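/- Let $M$ be a compact connected complex manifold of dimension $n$ with complex structure $J$, let $\omega_0$ be a Kähler form on $M$, let $\chi$ be a closed positive $(1,1)$-form on $M$, and let $t\in[0,1]$. Write $\alpha^{[k]}=\alpha^k/k!$, $\mathcal H=\{\varphi\in C^\infty(M,\mathbb R):\omega_\varphi=\omega_0+\sqrt{-1}\,\partial\bar\partial\varphi>0\}$, $\mathrm{tr}_\varphi\chi=g_\varphi^{a\bar b}\chi_{a\bar b}$ and $R_\varphi=\mathrm{tr}_\varphi\mathrm{Ric}(\omega_\varphi)$, where $\omega_\varphi=\sqrt{-1}\,(g_\varphi)_{a\bar b}\,dz^a\wedge d\bar z^b$ and $\mathrm{Ric}(\omega_\varphi)=-\sqrt{-1}\,\partial\bar\partial\log\det (g_\varphi)_{a\bar b}$. Put $$C_t=(1-t)\frac{\int_M\chi\wedge\omega_0^{[n-1]}}{\int_M\omega_0^{[n]}}-t\,\frac{\int_M\mathrm{Ric}(\omega_0)\wedge\omega_0^{[n-1]}}{\int_M\omega_0^{[n]}} .$$ Let $\mathcal G$ be the group of exact symplectic (Hamiltonian) diffeomorphisms of the symplectic manifold $(M,\omega_0)$. Its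 Lie algebra is $C^\infty(M)/\mathbb R$, where $h$ corresponds to the vector field $X_h$ with $\omega_0(X_h,\cdot)=dh$; a smooth function $\mu$ with $\int_M\mu\,\omega_0^{[n]}=0$ is an element of its dual by $\langle\mu,h\rangle=\int_M\mu h\,\omega_0^{[n]}$. Let $$\mathcal D=\{f\in\mathrm{Diff}(M): f_*\omega_0=\omega_\varphi\text{ for some }\varphi\in\mathcal H\},$$ on which $\mathcal G$ acts by $g\cdot f=f\circ g^{-1}$. Equivalently, $f\in\mathcal D$ is the complex structure $f^*J$ on $M$, compatible with $\omega_0$, together with its biholomorphism $f$ to $(M,J)$. Tangent vectors to $\mathcal D$ at $f$ are written as $V\circ f$, where $V$ is a smooth vector field on $M$ such that the variation $L_VJ$ preserves the compatibility of $J$ with $f_*\omega_0$; the velocities of smooth families in $\mathcal D$ are such vectors. For $f\in\mathcal D$ with $f_*\omega_0=\omega_\varphi$ let $$\Omega_t(V,W)=(1-t)\int_M\chi(V,W)\,\omega_\varphi^{[n]}+\frac t4\int_M\mathrm{tr}\,(J\circ L_VJ\circ L_WJ)\,\omega_\varphi^{[n]} .$$ Then $\omega_\varphi\mapsto(1-t)\,\mathrm{tr}_\varphi\chi-t\,R_\varphi-C_t$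 is a moment map for the action of $\mathcal G$ on $(\mathcal D,\Omega_t)$, in the following sense. 1. $\mathcal G$ preserves $\mathcal D$. The infinitesimal action of $h\in C^\infty(M)$ at $f$ is the vector $\xi_h(f)=-df(X_h)$, and it is tangent to $\mathcal D$. The 2-form $\Omega_t$ on $\mathcal D$ is closed (on smooth finite-dimensional families) and $\mathcal G$-invariant. 2. The tangent spaces of $\mathcal D$ are invariant under $V\mapsto JV$, and $\Omega_t(V,JV)\ge0$ for every tangent vector $V$. If $t<1$, equality holds only for $V=0$. If $t=1$, equality holds exactly when $L_VJ=0$. 3. For $f\in\mathcal D$ with $f_*\omega_0=\omega_\varphi$, the function $$\mu_t(f)=\big((1-t)\,\mathrm{tr}_\varphi\chi-t\,R_\varphi-C_t\big)\circ f$$ is smooth with $\int_M\mu_t(f)\,\omega_0^{[n]}=0$, and $\mu_t(f\circ g^{-1})=\mu_t(f)\circ g^{-1}$ for all $g\in\mathcal G$. 4. For every $h\in C^\infty(M)$ and every smooth path $f_s$ in $\mathcal D$, with velocity $\dot f_s=V_s\circ f_s$, $$\frac{d}{ds}\int_M\mu_t(f_s)\,h\,\omega_0^{[n]}=\Omega_t\big(\xi_h(f_s),V_s\big).$$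 -/

import Mathlib

open scoped Manifold ContDiff
open MeasureTheory

noncomputable section

namespace TwistedKahler

/-! ## The model space and tensors

A complex manifold `M` of dimension `n` is a manifold modelled on `ℂⁿ` with holomorphic changes of
charts.  As everywhere in Mathlib, the tangent space `TangentSpace 𝓘(ℝ, ℂⁿ) x` *is* the model space
`ℂⁿ`, a vector being represented by its coordinates in the preferred chart `chartAt _ x`.  Since the
changes of charts are holomorphic, the complex structure of `M` at `x` is multiplication by `i`. -/

/-- The model space `ℂⁿ`. -/
abbrev Cn (n : ℕ) : Type := Fin n → ℂ

/-- Multiplication by `i`, as a real linear map: the complex structure on each tangent space. -/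
def J (n : ℕ) : Cn n →L[ℝ] Cn n :=
  (Complex.I • ContinuousLinearMap.id ℂ (Cn n)).restrictScalars ℝ

/-- Real bilinear forms on the tangent spaces of `M` (covariant 2-tensor fields, no regularity). -/
abbrev Tensor2 (n : ℕ) (M : Type*) : Type _ := M → Cn n →L[ℝ] Cn n →L[ℝ] ℝ

/-- Vector fields on `M` (no regularity). -/
abbrev Field (n : ℕ) (M : Type*) : Type _ := M → Cn n

section Local

variable {n : ℕ}

/-- For a real function `u` on an open subset of `ℂⁿ`, the real `(1,1)`-form
`√-1 ∂∂̄u (v, w) = (D²u (iv, w) - D²u (v, iw)) / 2`. -/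
def ddbarAt (u : Cn n → ℝ) (y : Cn n) : Cn n →L[ℝ] Cn n →L[ℝ] ℝ :=
  (1 / 2 : ℝ) •
    ((fderiv ℝ (fderiv ℝ u) y).bilinearComp (J n) (ContinuousLinearMap.id ℝ (Cn n)) -
      (fderiv ℝ (fderiv ℝ u) y).bilinearComp (ContinuousLinearMap.id ℝ (Cn n)) (J n))

/-- The coefficients `β_{a b̄}` of a real `(1,1)`-form `β = √-1 ∑ β_{a b̄} dzᵃ ∧ dz̄ᵇ`. -/
def coeff (β : Cn n →L[ℝ] Cn n →L[ℝ] ℝ) : Matrix (Fin n) (Fin n) ℂ :=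
  Matrix.of fun a b =>
    (1 / 2 : ℂ) * ((β (Pi.single a 1) (J n (Pi.single b 1)) : ℝ) -
      Complex.I * (β (Pi.single a 1) (Pi.single b 1) : ℝ))

/-- `tr_α β = α^{a b̄} β_{a b̄}`, for real `(1,1)`-forms `α > 0` and `β` on a tangent space;
equivalently `β ∧ α^{n-1} / (n-1)! = (tr_α β) α^n / n!`. -/
def trAt (α β : Cn n →L[ℝ] Cn n →L[ℝ] ℝ) : ℝ :=
  ((coeff α)⁻¹ * coeff β).trace.re

end Local

variable {n : ℕ} {M : Type*} [TopologicalSpace M] [ChartedSpace (Cn n) M]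

/-! ## Calculus in charts -/

/-- The differential at `x` of a real function, as a covector on `T_x M`. -/
def dAt (u : M → ℝ) (x : M) : Cn n →L[ℝ] ℝ :=
  fderiv ℝ (u ∘ (chartAt (Cn n) x).symm) (chartAt (Cn n) x x)

/-- The tensor `α` written in the chart `chartAt x₀`, at a point `y` of the target of that chart. -/
def inChart (α : Tensor2 n M) (x₀ : M) (y : Cn n) : Cn n →L[ℝ] Cn n →L[ℝ] ℝ :=
  let D : Cn n →L[ℝ] Cn n := mfderiv 𝓘(ℝ, Cn n) 𝓘(ℝ, Cn n) (chartAt (Cn n) x₀).symm y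
  (α ((chartAt (Cn n) x₀).symm y)).bilinearComp D D

/-- The vector field `V` written in the chart `chartAt x₀`. -/
def fieldInChart (V : Field n M) (x₀ : M) (y : Cn n) : Cn n :=
  mfderiv 𝓘(ℝ, Cn n) 𝓘(ℝ, Cn n) (chartAt (Cn n) x₀) ((chartAt (Cn n) x₀).symm y)
    (V ((chartAt (Cn n) x₀).symm y))

/-- Smooth vector fields. -/
def IsSmoothField (V : Field n M) : Prop :=
  ∀ x₀ : M, ContDiffOn ℝ ∞ (fieldInChart V x₀) (chartAt (Cn n) x₀).target

/-- `J V`, for a vector field `V`. -/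
def mulI (V : Field n M) : Field n M := fun x => J n (V x)

/-- `(L_V J)_x`, the Lie derivative of the complex structure.  In a holomorphic chart `J` is constant,
so that `L_V J = J ∘ DV - DV ∘ J`. -/
def lieJ (V : Field n M) (x : M) : Cn n →L[ℝ] Cn n :=
  (J n).comp (fderiv ℝ (fieldInChart V x) (chartAt (Cn n) x x)) -
    (fderiv ℝ (fieldInChart V x) (chartAt (Cn n) x x)).comp (J n)

/-- Smooth, closed, positive `(1,1)`-forms; that is, Kähler forms. -/
structure IsKahlerForm (α : Tensor2 n M) : Prop where
  smooth : ∀ x₀ : M, ContDiffOn ℝ ∞ (inChart α x₀) (chartAt (Cn n) x₀).target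
  alt : ∀ x v, α x v v = 0
  closed : ∀ x₀ : M, ∀ y ∈ (chartAt (Cn n) x₀).target, ∀ u v w,
    fderiv ℝ (inChart α x₀) y u v w + fderiv ℝ (inChart α x₀) y v w u +
      fderiv ℝ (inChart α x₀) y w u v = 0
  type_one_one : ∀ x v w, α x (J n v) (J n w) = α x v w
  pos : ∀ x v, v ≠ 0 → 0 < α x v (J n v)

/-! ## Kähler geometry -/

/-- `α_φ = α + √-1 ∂∂̄φ`. -/
def shift (α : Tensor2 n M) (φ : M → ℝ) : Tensor2 n M := fun x =>
  α x + ddbarAt (φ ∘ (chartAt (Cn n) x).symm) (chartAt (Cn n) x x)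

/-- The space of Kähler potentials `{φ ∈ C^∞(M) : α + √-1 ∂∂̄φ > 0}`. -/
def potentials (α : Tensor2 n M) : Set (M → ℝ) :=
  {φ | ContMDiff 𝓘(ℝ, Cn n) 𝓘(ℝ, ℝ) ∞ φ ∧ ∀ x v, v ≠ 0 → 0 < shift α φ x v (J n v)}

/-- `tr_α χ`, as a function on `M`. -/
def tr (α χ : Tensor2 n M) (x : M) : ℝ := trAt (α x) (χ x)

/-- The Ricci form `-√-1 ∂∂̄ log det (α_{a b̄})`. -/
def ricci (α : Tensor2 n M) : Tensor2 n M := fun x =>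
  -ddbarAt (fun y => Real.log (coeff (inChart α x y)).det.re) (chartAt (Cn n) x x)

/-- The scalar curvature `R = tr_α Ric(α)` of a Kähler metric. -/
def scal (α : Tensor2 n M) : M → ℝ := tr α (ricci α)

/-- The part in the domain of the chart at `x₀` of the measure given by the volume form
`α^[n] = α^n / n!`.  In that chart `α^[n] = 2^n det (α_{a b̄})` times Lebesgue measure on `ℂⁿ`. -/
def chartVolume [MeasurableSpace M] (α : Tensor2 n M) (x₀ : M) : Measure M :=
  (((volume : Measure (Cn n)).restrict (chartAt (Cn n) x₀).target).withDensity
    fun y => ENNReal.ofReal (2 ^ n * (coeff (inChart α x₀ y)).det.re)).map (chartAt (Cn n) x₀).symm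

/-- The measure on `M` given by the volume form `α^[n] = α^n / n!`.  The measures `chartVolume α x₀`
are the restrictions of one measure to the chart domains, and that measure is their supremum. -/
def vol [MeasurableSpace M] (α : Tensor2 n M) : Measure M := ⨆ x₀ : M, chartVolume α x₀

/-- `[β]·[α]^[n-1] / [α]^[n] = ∫ β ∧ α^[n-1] / ∫ α^[n]`, where `β ∧ α^[n-1] = (tr_α β) α^[n]`. -/
def average [MeasurableSpace M] (α β : Tensor2 n M) : ℝ :=
  (∫ x, tr α β x ∂(vol α)) / (vol α).real Set.univ

/-- The constant `C_t = (1 - t) χ̲ - t R̲` of the Kähler class of `ω₀` and the class of `χ`. -/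
def constC [MeasurableSpace M] (ω₀ χ : Tensor2 n M) (t : ℝ) : ℝ :=
  (1 - t) * average ω₀ χ - t * average ω₀ (ricci ω₀)

/-! ## Diffeomorphisms and smooth families -/

/-- Smooth diffeomorphisms of `M`. -/
abbrev Diff (n : ℕ) (M : Type*) [TopologicalSpace M] [ChartedSpace (Cn n) M] : Type _ :=
  M ≃ₘ^∞⟮𝓘(ℝ, Cn n), 𝓘(ℝ, Cn n)⟯ M

/-- The group structure on diffeomorphisms: `f * g = f ∘ g`. -/
instance instGroupDiff : Group (Diff n M) where
  mul f g := g.trans f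
  one := Diffeomorph.refl 𝓘(ℝ, Cn n) M ∞
  inv f := f.symm
  mul_assoc _ _ _ := rfl
  one_mul f := Diffeomorph.trans_refl f
  mul_one f := Diffeomorph.refl_trans f
  inv_mul_cancel f := Diffeomorph.self_trans_symm f

theorem mul_apply (f g : Diff n M) (x : M) : (f * g) x = f (g x) := rfl

theorem inv_apply (f : Diff n M) (x : M) : (f⁻¹ : Diff n M) x = f.symm x := rfl

/-- `f_* α = (f⁻¹)^* α`. -/
def pushforward (f : Diff n M) (α : Tensor2 n M) : Tensor2 n M := fun x =>
  let D : Cn n →L[ℝ] Cn n := mfderiv 𝓘(ℝ, Cn n) 𝓘(ℝ, Cn n) f.symm x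
  (α (f.symm x)).bilinearComp D D

/-- `P`-parameter families of diffeomorphisms `F` with `(p, x) ↦ F p x` smooth. -/
def IsSmoothFamily {P : Type*} [NormedAddCommGroup P] [NormedSpace ℝ P] (F : P → Diff n M) : Prop :=
  ContMDiff (𝓘(ℝ, P).prod 𝓘(ℝ, Cn n)) 𝓘(ℝ, Cn n) ∞ (fun q : P × M => F q.1 q.2)

/-- The velocity at the parameter `p`, in the direction `u`, of a family of diffeomorphisms.  A tangent
vector at `f` to the space of diffeomorphisms is a vector field along `f`; here it is written as a vector
field `V` on `M`, the vector field along `f` being `V ∘ f`.  So `V (x) = (∂_u F)(F_p⁻¹ x)`. -/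
def velocity {P : Type*} [NormedAddCommGroup P] [NormedSpace ℝ P] (F : P → Diff n M) (p u : P) :
    Field n M := fun x =>
  fderiv ℝ (fun q => chartAt (Cn n) x (F q ((F p).symm x))) p u

/-- `g` is the end point of a Hamiltonian isotopy of `(M, ω₀)`: `g = G 1` where `G 0 = id` and
`ω₀ (∂_s G_s ∘ G_s⁻¹, ·) = d(H_s)` for a smooth time-dependent Hamiltonian `H`. -/
def IsHamiltonian (ω₀ : Tensor2 n M) (g : Diff n M) : Prop :=
  ∃ (G : ℝ → Diff n M) (H : ℝ → M → ℝ),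
    IsSmoothFamily G ∧
    ContMDiff (𝓘(ℝ, ℝ).prod 𝓘(ℝ, Cn n)) 𝓘(ℝ, ℝ) ∞ (fun q : ℝ × M => H q.1 q.2) ∧
    (∀ s x, ω₀ x (velocity G s 1 x) = dAt (H s) x) ∧ G 0 = 1 ∧ G 1 = g

/-- The group of exact symplectic (that is, Hamiltonian) diffeomorphisms of `(M, ω₀)`. -/
def hamGroup (ω₀ : Tensor2 n M) : Subgroup (Diff n M) :=
  Subgroup.closure {g | IsHamiltonian ω₀ g}

/-- The Hamiltonian vector field `X_h` of `(M, ω₀)`: `ω₀ (X_h, ·) = dh`. -/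
def hamField (ω₀ : Tensor2 n M) (h : M → ℝ) : Field n M := fun x =>
  Function.invFun (fun v : Cn n => ω₀ x v) (dAt h x)

/-! ## The space acted upon

The symplectic manifold `(M, ω₀)` is fixed.  A Kähler metric `ω_φ` in the class of `ω₀` on the complex
manifold `M` is presented by a diffeomorphism `f` with `f_* ω₀ = ω_φ`; equivalently, by the complex
structure `f^* J` on the symplectic manifold, compatible with `ω₀`, with its biholomorphism `f` to `M`.
The group acts by `g • f = f ∘ g⁻¹`. -/

/-- The diffeomorphisms `f` such that `f_* ω₀ = ω₀ + √-1 ∂∂̄φ` for a Kähler potential `φ`. -/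
def kahlerSpace (ω₀ : Tensor2 n M) : Set (Diff n M) :=
  {f | ∃ φ ∈ potentials ω₀, pushforward f ω₀ = shift ω₀ φ}

/-- The tangent vectors to `kahlerSpace ω₀` at `f`: the smooth vector fields `V` such that the
infinitesimal variation `A = L_V J` of the complex structure preserves its compatibility with the
symplectic form `α = f_* ω₀`, that is, `α (A v, J w) + α (J v, A w) = 0`. -/
def IsTangent (ω₀ : Tensor2 n M) (f : Diff n M) (V : Field n M) : Prop :=
  IsSmoothField V ∧ ∀ x v w,
    pushforward f ω₀ x (lieJ V x v) (J n w) + pushforward f ω₀ x (J n v) (lieJ V x w) = 0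

/-- The infinitesimal action of `h`: the derivative at `s = 0` of `f ∘ (exp s X_h)⁻¹`, which is
`-df (X_h)`. -/
def infAction (ω₀ : Tensor2 n M) (h : M → ℝ) (f : Diff n M) : Field n M := fun x =>
  -(mfderiv 𝓘(ℝ, Cn n) 𝓘(ℝ, Cn n) f (f.symm x) (hamField ω₀ h (f.symm x)) : Cn n)

/-- A map `m` from Kähler forms to functions induces the map `f ↦ m (f_* ω₀) ∘ f`: the function
`m (ω_φ)`, transported to the symplectic manifold `(M, ω₀)` by `f`. -/
def onSymplectic (ω₀ : Tensor2 n M) (m : Tensor2 n M → M → ℝ) (f : Diff n M) : M → ℝ :=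
  fun x => m (pushforward f ω₀) (f x)

/-- The 2-form on the space `kahlerSpace ω₀`
`Ω_t (V, W) = (1 - t) ∫ χ (V, W) ω_φ^[n] + (t / 4) ∫ tr (J ∘ L_V J ∘ L_W J) ω_φ^[n]`,
where `ω_φ = f_* ω₀`.  The first integral is the natural form on maps into `(M, χ)`; the second is
pulled back by `f ↦ f^* J` from the natural form on complex structures compatible with `ω₀`. -/
def twistedForm [MeasurableSpace M] (ω₀ χ : Tensor2 n M) (t : ℝ)
    (f : Diff n M) (V W : Field n M) : ℝ :=
  (1 - t) * ∫ x, χ x (V x) (W x) ∂(vol (pushforward f ω₀)) +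
    t / 4 * ∫ x, LinearMap.trace ℝ (Cn n)
      (((J n).comp ((lieJ V x).comp (lieJ W x)) : Cn n →L[ℝ] Cn n) : Cn n →ₗ[ℝ] Cn n)
        ∂(vol (pushforward f ω₀))

/-! ## Moment maps -/

/-- `Ω` is a closed 2-form on `kahlerSpace ω₀`, invariant under the action of the group of exact
symplectic diffeomorphisms.  Differentiability and closedness are those of the pull-backs of `Ω` by
smooth finite-dimensional families. -/
structure IsInvariantClosedForm (ω₀ : Tensor2 n M) (Ω : Diff n M → Field n M → Field n M → ℝ) :
    Prop where
  antisymm : ∀ f ∈ kahlerSpace ω₀, ∀ V W, IsTangent ω₀ f V → IsTangent ω₀ f W →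
    Ω f V W = -Ω f W V
  add_left : ∀ f ∈ kahlerSpace ω₀, ∀ V V' W, IsTangent ω₀ f V → IsTangent ω₀ f V' →
    IsTangent ω₀ f W → Ω f (V + V') W = Ω f V W + Ω f V' W
  smul_left : ∀ f ∈ kahlerSpace ω₀, ∀ (c : ℝ) (V W), IsTangent ω₀ f V → IsTangent ω₀ f W →
    Ω f (c • V) W = c * Ω f V W
  differentiable : ∀ (k : ℕ) (F : (Fin k → ℝ) → Diff n M), IsSmoothFamily F →
    (∀ p, F p ∈ kahlerSpace ω₀) → ∀ u v,
      Differentiable ℝ (fun p => Ω (F p) (velocity F p u) (velocity F p v))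
  closed : ∀ (k : ℕ) (F : (Fin k → ℝ) → Diff n M), IsSmoothFamily F →
    (∀ p, F p ∈ kahlerSpace ω₀) → ∀ p u v w,
      fderiv ℝ (fun q => Ω (F q) (velocity F q v) (velocity F q w)) p u +
      fderiv ℝ (fun q => Ω (F q) (velocity F q w) (velocity F q u)) p v +
      fderiv ℝ (fun q => Ω (F q) (velocity F q u) (velocity F q v)) p w = 0
  invariant : ∀ g ∈ hamGroup ω₀, ∀ (k : ℕ) (F : (Fin k → ℝ) → Diff n M), IsSmoothFamily F →
    (∀ p, F p ∈ kahlerSpace ω₀) → ∀ p u v,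
      Ω (F p * g⁻¹) (velocity (fun q => F q * g⁻¹) p u) (velocity (fun q => F q * g⁻¹) p v) =
        Ω (F p) (velocity F p u) (velocity F p v)

/-- `α ↦ m α` is a moment map for the action `g • f = f ∘ g⁻¹` of the group of exact symplectic
diffeomorphisms of `(M, ω₀)` on `kahlerSpace ω₀` with the 2-form `Ω`.  The Lie algebra of the group is
`C^∞(M) / ℝ`, the function `h` acting through `X_h`, and functions of mean value zero are elements of
its dual by `⟨μ, h⟩ = ∫ μ h ω₀^[n]`. -/
structure IsMomentMap [MeasurableSpace M] (ω₀ : Tensor2 n M)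
    (Ω : Diff n M → Field n M → Field n M → ℝ) (m : Tensor2 n M → M → ℝ) : Prop where
  /-- The group acts on the space. -/
  stable : ∀ g ∈ hamGroup ω₀, ∀ f ∈ kahlerSpace ω₀, f * g⁻¹ ∈ kahlerSpace ω₀
  /-- Velocities of families in the space are tangent vectors. -/
  velocity_tangent : ∀ (k : ℕ) (F : (Fin k → ℝ) → Diff n M), IsSmoothFamily F →
    (∀ p, F p ∈ kahlerSpace ω₀) → ∀ p u, IsTangent ω₀ (F p) (velocity F p u)
  /-- `infAction` is the infinitesimal action of the Lie algebra of the group, and it is tangent. -/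
  infinitesimal : ∀ f ∈ kahlerSpace ω₀, ∀ h : M → ℝ, ContMDiff 𝓘(ℝ, Cn n) 𝓘(ℝ, ℝ) ∞ h →
    (∀ x, ω₀ x (hamField ω₀ h x) = dAt h x) ∧ IsTangent ω₀ f (infAction ω₀ h f) ∧
    ∀ G : ℝ → Diff n M, IsSmoothFamily G → (∀ s, G s ∈ hamGroup ω₀) → G 0 = 1 →
      velocity G 0 1 = hamField ω₀ h →
        velocity (fun s => f * (G s)⁻¹) 0 1 = infAction ω₀ h f
  form : IsInvariantClosedForm ω₀ Ω
  /-- The map takes values in the dual of the Lie algebra. -/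
  smooth : ∀ f ∈ kahlerSpace ω₀, ContMDiff 𝓘(ℝ, Cn n) 𝓘(ℝ, ℝ) ∞ (onSymplectic ω₀ m f)
  mean_zero : ∀ f ∈ kahlerSpace ω₀, ∫ x, onSymplectic ω₀ m f x ∂(vol ω₀) = 0
  /-- The map is equivariant. -/
  equivariant : ∀ g ∈ hamGroup ω₀, ∀ f ∈ kahlerSpace ω₀, ∀ x,
    onSymplectic ω₀ m (f * g⁻¹) x = onSymplectic ω₀ m f (g.symm x)
  /-- `d⟨μ, h⟩ = Ω (ξ_h, ·)`, where `ξ_h` is the infinitesimal action of `h`. -/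
  moment : ∀ h : M → ℝ, ContMDiff 𝓘(ℝ, Cn n) 𝓘(ℝ, ℝ) ∞ h →
    ∀ F : ℝ → Diff n M, IsSmoothFamily F → (∀ s, F s ∈ kahlerSpace ω₀) → ∀ s,
      HasDerivAt (fun r => ∫ x, onSymplectic ω₀ m (F r) x * h x ∂(vol ω₀))
        (Ω (F s) (infAction ω₀ h (F s)) (velocity F s 1)) s

end TwistedKahler

end

open scoped Manifold ContDiff
open MeasureTheory

noncomputable section

set_option maxSynthPendingDepth 3
set_option linter.unusedSectionVars false

/-! Write `η` for the fixed form `ω₀`, `α = f_* η` for the metric presented by `f`, and `X_h` for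
Hamiltonian fields. The maps `f` are symplectic for these forms but not holomorphic, so the complex
formulas are first replaced by real ones that behave well under arbitrary real maps. The trace `tr_α
β` is half the real trace of `α⁻¹ β` (`trAt_eq_trR`), and the square of the density `ρ` of `α^[n]`
is a real Gram determinant (`gram_det`). So traces are invariant under pull-back (`trR_pull`) and
densities are multiplied by `|det|` (`rho_pull`). Hence everything can be transported by `f` to the
fixed manifold `(M, η)` with its fixed measure, where only `f^* χ` and `f^* J` move.

The analytic tool is Stokes' theorem in divergence form. As `dα = 0`, the divergence of `Z` with
respect to `α^[n]` is `tr_α d(α(Z, ·))` (`LocalKahler.div_eq`), whence `∫ h tr_α(dζ) α^[n] = ∫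
ζ(X_h) α^[n]` for compactly supported `h` (`LocalKahler.integral_mul_trR_extd`). Identities additive
in `h` reduce to this case by a partition of unity.

Moment identity. It is enough to differentiate at a parameter where the family is the identity: near
`s`, replace `F_r` by `F_r F_s⁻¹` and `η` by `(F_s)_* η`; the infinitesimal action of `h` is then
minus the Hamiltonian field of `h ∘ F_s⁻¹` (`infAction_eq`). Let `V` be the velocity. The variation
of `F^* χ` is `d(χ(V, ·))` by Cartan's formula, so Stokes gives `∫ χ(V, X_h)`. For the scalar
curvature, the Ricci form pulled back by `F` is `½ d(dμ ∘ F^* J)`, where `μ` is the transported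
logarithm of the coordinate density of `F_* η`. Its variation at the identity is `½ d(d log ρ ∘ L_V
J - d(tr DV) ∘ J)`. Stokes and a second integration by parts (`LocalKahler.integral_variation`) give
`¼ ∫ tr(J L_{X_h}J L_V J)`. The combination with weights `1 - t` and `-t` is `Ω_t(-X_h, V)`.

Closedness. After transport to `η^[n]` the integrand of `Ω_t` is closed pointwise in the parameters.
The first part is a pull-back of the closed form `χ`. For the second, the matrices `B_u = ∂_u(DF)
(DF)⁻¹` satisfy `∂_u B_v - ∂_v B_u = [B_u, B_v]`, and a cyclic trace identity finishes
(`trc_cyclic`). Invariance holds because Hamiltonian diffeomorphisms preserve `η` and right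
translation does not change velocities written on the target.

Positivity. For a tangent vector `V`, `A = L_V J` is self-adjoint for the metric `α(·, J·)`, and
`L_{JV} J = J A`, so the trace term of `Ω_t(V, JV)` is `tr(A²)`, a sum of nonnegative terms that
vanishes only for `A = 0`.

Mean value. The volume of `η + s √-1∂∂̄φ + ε χ` does not depend on `s`, by Stokes; its derivative in
`ε` at `0` is `∫ tr χ`, which is therefore the same for `η` and `ω_φ`. The scalar curvature reduces
to this because `Ric(ω_φ) - Ric(η)` is `√-1∂∂̄` of a function and `C η + Ric(η)` is Kähler for large
`C`. -/

namespace TwistedKahler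

/-! ## Linear algebra of `(1,1)`-forms -/

section LinearAlgebra

variable {n : ℕ}

/-- Real bilinear forms on `ℂⁿ`. -/
abbrev Bil (n : ℕ) : Type := Cn n →L[ℝ] Cn n →L[ℝ] ℝ

/-- The pull-back of a bilinear form by a linear map. -/
def pull (α : Bil n) (D : Cn n →L[ℝ] Cn n) : Bil n := α.bilinearComp D D

@[simp] theorem pull_apply (α : Bil n) (D : Cn n →L[ℝ] Cn n) (v w : Cn n) :
    pull α D v w = α (D v) (D w) := rfl

theorem pull_pull (α : Bil n) (D E : Cn n →L[ℝ] Cn n) :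
    pull (pull α D) E = pull α (D.comp E) := rfl

theorem pull_id (α : Bil n) : pull α (ContinuousLinearMap.id ℝ (Cn n)) = α := rfl

theorem J_apply (v : Cn n) : J n v = Complex.I • v := rfl

@[simp] theorem J_J (v : Cn n) : J n (J n v) = -v := by
  simp [J_apply, smul_smul]

/-- Forms of type `(1,1)`: alternating and invariant under `J`. -/
structure IsHerm (α : Bil n) : Prop where
  alt : ∀ v, α v v = 0
  inv : ∀ v w, α (J n v) (J n w) = α v w

/-- Positive forms of type `(1,1)`. -/
structure IsPos (α : Bil n) : Prop extends IsHerm α where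
  pos : ∀ v, v ≠ 0 → 0 < α v (J n v)

theorem IsHerm.antisymm {α : Bil n} (h : IsHerm α) (v w : Cn n) : α v w = -α w v := by
  have := h.alt (v + w)
  simp only [map_add, add_apply, h.alt] at this
  linarith

theorem IsHerm.J_left {α : Bil n} (h : IsHerm α) (v w : Cn n) : α (J n v) w = -α v (J n w) := by
  have := h.inv v (J n w)
  rw [J_J, map_neg] at this
  linarith

theorem IsHerm.J_symm {α : Bil n} (h : IsHerm α) (v w : Cn n) : α v (J n w) = α w (J n v) := by
  rw [h.antisymm v, h.J_left, neg_neg]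

theorem IsHerm.add {α β : Bil n} (hα : IsHerm α) (hβ : IsHerm β) : IsHerm (α + β) :=
  ⟨fun v => by simp [hα.alt, hβ.alt], fun v w => by simp [hα.inv, hβ.inv]⟩

theorem IsHerm.smul {α : Bil n} (hα : IsHerm α) (c : ℝ) : IsHerm (c • α) :=
  ⟨fun v => by simp [hα.alt], fun v w => by simp [hα.inv]⟩

theorem IsHerm.neg {α : Bil n} (hα : IsHerm α) : IsHerm (-α) :=
  ⟨fun v => by simp [hα.alt], fun v w => by simp [hα.inv]⟩

theorem IsHerm.pull {α : Bil n} (hα : IsHerm α) {D : Cn n →L[ℝ] Cn n}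
    (hD : ∀ v, D (J n v) = J n (D v)) : IsHerm (pull α D) :=
  ⟨fun v => by simp [hα.alt], fun v w => by simp [hD, hα.inv]⟩

theorem IsPos.pull {α : Bil n} (hα : IsPos α) {D : Cn n →L[ℝ] Cn n}
    (hD : ∀ v, D (J n v) = J n (D v)) (hi : D.IsInvertible) : IsPos (pull α D) :=
  ⟨hα.toIsHerm.pull hD, fun v hv => by
    rw [pull_apply, hD]
    exact hα.pos _ fun h => hv (hi.injective (by rw [h, map_zero]))⟩

theorem IsPos.isInvertible {α : Bil n} (h : IsPos α) : α.IsInvertible := by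
  have hinj : Function.Injective α := by
    rw [injective_iff_map_eq_zero]
    intro v hv
    by_contra h0
    have := h.pos v h0
    simp [hv] at this
  let e₁ : Cn n →ₗ[ℝ] (Cn n →L[ℝ] ℝ) := α
  have hfr : Module.finrank ℝ (Cn n) = Module.finrank ℝ (Cn n →L[ℝ] ℝ) := by
    rw [← (LinearMap.toContinuousLinearMap : (Cn n →ₗ[ℝ] ℝ) ≃ₗ[ℝ] _).finrank_eq]
    exact (Subspace.dual_finrank_eq).symm
  let e := LinearEquiv.ofInjectiveOfFinrankEq e₁ hinj hfr
  exact ⟨e.toContinuousLinearEquiv, by ext v w; rfl⟩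

theorem apply_inverse {α : Bil n} (h : α.IsInvertible) (ℓ : Cn n →L[ℝ] ℝ) :
    α (α.inverse ℓ) = ℓ := by
  obtain ⟨e, rfl⟩ := h
  simp

theorem inverse_apply {α : Bil n} (h : α.IsInvertible) (v : Cn n) : α.inverse (α v) = v := by
  obtain ⟨e, rfl⟩ := h
  simp

/-! ### Traces -/

/-- The real trace of an endomorphism of `ℂⁿ`. -/
def trc : (Cn n →L[ℝ] Cn n) →L[ℝ] ℝ :=
  LinearMap.toContinuousLinearMap
    ((LinearMap.trace ℝ (Cn n)).comp (ContinuousLinearMap.coeLM ℝ))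

theorem trc_apply (A : Cn n →L[ℝ] Cn n) :
    trc A = LinearMap.trace ℝ (Cn n) (A : Cn n →ₗ[ℝ] Cn n) := rfl

theorem trc_comm (A B : Cn n →L[ℝ] Cn n) : trc (A.comp B) = trc (B.comp A) := by
  simp only [trc_apply]
  exact LinearMap.trace_comp_comm' _ _

theorem trc_conj (A D E : Cn n →L[ℝ] Cn n) (h : E.comp D = ContinuousLinearMap.id ℝ (Cn n)) :
    trc (D.comp (A.comp E)) = trc A := by
  rw [trc_comm, ContinuousLinearMap.comp_assoc, h, ContinuousLinearMap.comp_id]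

/-- The standard real basis of `ℂⁿ`. -/
def realBasis (n : ℕ) : Module.Basis (Fin 2 × Fin n) ℝ (Cn n) :=
  Complex.basisOneI.smulTower (Pi.basisFun ℂ (Fin n))

theorem realBasis_zero (a : Fin n) : realBasis n (0, a) = Pi.single a 1 := by
  simp [realBasis, Module.Basis.smulTower_apply]

theorem realBasis_one (a : Fin n) : realBasis n (1, a) = J n (Pi.single a 1) := by
  simp [realBasis, Module.Basis.smulTower_apply, J_apply]

theorem realBasis_repr_zero (v : Cn n) (a : Fin n) : (realBasis n).repr v (0, a) = (v a).re := by
  simp [realBasis]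

theorem realBasis_repr_one (v : Cn n) (a : Fin n) : (realBasis n).repr v (1, a) = (v a).im := by
  simp [realBasis]

theorem trc_eq_sum (A : Cn n →L[ℝ] Cn n) :
    trc A = ∑ a, ((A (Pi.single a 1) a).re + (A (J n (Pi.single a 1)) a).im) := by
  rw [trc_apply, LinearMap.trace_eq_matrix_trace ℝ (realBasis n), Matrix.trace,
    Fintype.sum_prod_type, Fin.sum_univ_two, ← Finset.sum_add_distrib]
  refine Finset.sum_congr rfl fun a _ => ?_
  simp [Matrix.diag_apply, LinearMap.toMatrix_apply, realBasis_zero, realBasis_one,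
    realBasis_repr_zero, realBasis_repr_one]

/-- The trace of `β` with respect to a nondegenerate form `α`, in real terms. -/
def trR (α β : Bil n) : ℝ := (1 / 2) * trc (α.inverse.comp β)

theorem trR_add (α β γ : Bil n) : trR α (β + γ) = trR α β + trR α γ := by
  simp only [trR, ContinuousLinearMap.comp_add, map_add]; ring

/-- Pulling back conjugates the endomorphism `α⁻¹ β` by `D`, which leaves its trace alone. `D` need
not be complex linear, and this is what allows traces to be transported by non-holomorphic
diffeomorphisms. -/
theorem trR_pull {α β : Bil n} (hα : α.IsInvertible) {D : Cn n →L[ℝ] Cn n}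
    (hD : D.IsInvertible) : trR (pull α D) (pull β D) = trR α β := by
  obtain ⟨e, rfl⟩ := hD
  set D : Cn n →L[ℝ] Cn n := (e : Cn n →L[ℝ] Cn n)
  set E : Cn n →L[ℝ] Cn n := (e.symm : Cn n →L[ℝ] Cn n)
  have hDE : ∀ v, D (E v) = v := e.apply_symm_apply
  have hED : ∀ v, E (D v) = v := e.symm_apply_apply
  let A := α.inverse.comp β
  have hA : ∀ v, α (A v) = β v := fun v => apply_inverse hα _
  have hinv : (pull α D).IsInvertible := by
    obtain ⟨a, rfl⟩ := hα
    refine ⟨(e.trans a).trans (e.symm.arrowCongr (ContinuousLinearEquiv.refl ℝ ℝ)), ?_⟩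
    ext v w
    simp [pull, D]
  have key : (pull α D).inverse.comp (pull β D) = E.comp (A.comp D) := by
    ext1 v
    have h1 : pull β D v = pull α D (E (A (D v))) := by
      ext w
      simp [hDE, hA]
    simp only [ContinuousLinearMap.comp_apply, h1, inverse_apply hinv]
  rw [trR, trR, key, trc_conj]
  ext1 v; simp [hDE]

/-- `trR` of the infinitesimal action of an endomorphism on `α`. -/
theorem trR_lie {α : Bil n} (hα : α.IsInvertible)
    (B : Cn n →L[ℝ] Cn n) {β : Bil n} (hβ : ∀ v w, β v w = α (B v) w + α v (B w)) :
    trR α β = trc B := by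
  let e := α.inverse
  let B' : Bil n := ContinuousLinearMap.bilinearComp α (ContinuousLinearMap.id ℝ (Cn n)) B
  have h1 : β = α.comp B + B' := by ext v w; simp [hβ, B']
  have h2 : trc (α.inverse.comp (α.comp B)) = trc B := by
    congr 1; ext1 v; simp [inverse_apply hα]
  -- The second term is the `α`-transpose of `B`.
  have h3 : trc (α.inverse.comp B') = trc B := by
    let α' : (Cn n) ≃ₗ[ℝ] Module.Dual ℝ (Cn n) :=
      (LinearEquiv.ofBijective (α : Cn n →ₗ[ℝ] Cn n →L[ℝ] ℝ)
        (by obtain ⟨a, rfl⟩ := hα; exact a.bijective)).trans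
        (LinearMap.toContinuousLinearMap : (Cn n →ₗ[ℝ] ℝ) ≃ₗ[ℝ] _).symm
    have : ((α.inverse.comp B' : Cn n →L[ℝ] Cn n) : Cn n →ₗ[ℝ] Cn n) =
        α'.symm.conj (Module.Dual.transpose (R := ℝ) (B : Cn n →ₗ[ℝ] Cn n)) := by
      refine LinearMap.ext fun v => α'.injective ?_
      rw [LinearEquiv.conj_apply]
      simp only [LinearMap.comp_apply, LinearEquiv.coe_coe, LinearEquiv.apply_symm_apply,
        LinearEquiv.symm_symm]
      refine LinearMap.ext fun w => ?_
      change α (α.inverse (B' v)) w = α v (B w)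
      rw [apply_inverse hα]
      rfl
    rw [trc_apply, this, LinearMap.trace_conj', LinearMap.trace_transpose', trc_apply]
  rw [trR, h1, ContinuousLinearMap.comp_add, map_add, h2, h3]; ring

/-! ### Coefficients and the density of the volume form -/

theorem coeff_apply (β : Bil n) (a b : Fin n) : coeff β a b =
    (1 / 2 : ℂ) * ((β (Pi.single a 1) (J n (Pi.single b 1)) : ℝ) -
      Complex.I * (β (Pi.single a 1) (Pi.single b 1) : ℝ)) := rfl

/-- The sesquilinear form of a real bilinear form. -/
def herm (β : Bil n) (v w : Cn n) : ℂ :=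
  (1 / 2 : ℂ) * ((β v (J n w) : ℝ) - Complex.I * (β v w : ℝ))

theorem coeff_eq_herm (β : Bil n) (a b : Fin n) :
    coeff β a b = herm β (Pi.single a 1) (Pi.single b 1) := rfl

theorem herm_add_left (β : Bil n) (v v' w : Cn n) :
    herm β (v + v') w = herm β v w + herm β v' w := by
  simp [herm]; ring

/-- Invariance under `J` is what makes `β(v, Jw) - i β(v, w)` complex linear in `v`, so that a
`(1,1)`-form is determined by its coefficient matrix. -/
theorem herm_smul_left {β : Bil n} (hβ : IsHerm β) (c : ℂ) (v w : Cn n) :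
    herm β (c • v) w = c * herm β v w := by
  have h1 : c • v = c.re • v + c.im • J n v := by
    rw [J_apply]
    ext i
    simp only [Pi.smul_apply, Pi.add_apply, smul_eq_mul, Complex.real_smul]
    conv_lhs => rw [← Complex.re_add_im c]
    ring
  rw [h1]
  simp only [herm, map_add, map_smul, add_apply, smul_apply, smul_eq_mul, hβ.inv, hβ.J_left v w,
    Complex.ofReal_add, Complex.ofReal_mul, Complex.ofReal_neg]
  conv_rhs => rw [← Complex.re_add_im c]
  linear_combination ((c.im : ℂ) * (β v w : ℝ) / 2) * Complex.I_sq

theorem herm_conj {β : Bil n} (hβ : IsHerm β) (v w : Cn n) :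
    star (herm β v w) = herm β w v := by
  simp only [herm, star_mul', star_sub, Complex.star_def, Complex.conj_ofReal, Complex.conj_I,
    hβ.J_symm v w, hβ.antisymm w v, Complex.ofReal_neg]
  simp [map_ofNat]

theorem herm_sum_left {β : Bil n} (hβ : IsHerm β) (v w : Cn n) :
    herm β v w = ∑ a, v a * herm β (Pi.single a 1) w := by
  let L : Cn n →ₗ[ℂ] ℂ :=
    { toFun := fun v => herm β v w
      map_add' := fun v v' => herm_add_left β v v' w
      map_smul' := fun c v => herm_smul_left hβ c v w }
  have := LinearMap.pi_apply_eq_sum_univ L v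
  simp only [smul_eq_mul] at this
  rw [show herm β v w = L v from rfl, this]
  refine Finset.sum_congr rfl fun a _ => ?_
  rw [show (fun j => if a = j then (1 : ℂ) else 0) = Pi.single a 1 by
    ext i; simp [Pi.single_apply, eq_comm]]
  rfl

theorem herm_sum {β : Bil n} (hβ : IsHerm β) (v w : Cn n) :
    herm β v w = ∑ a, ∑ b, v a * star (w b) * coeff β a b := by
  rw [herm_sum_left hβ]
  refine Finset.sum_congr rfl fun a _ => ?_
  rw [← herm_conj hβ, herm_sum_left hβ, star_sum, Finset.mul_sum]
  refine Finset.sum_congr rfl fun b _ => ?_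
  rw [star_mul', herm_conj hβ, coeff_eq_herm, mul_assoc]

theorem IsHerm.coeff_isHermitian {β : Bil n} (hβ : IsHerm β) : (coeff β).IsHermitian := by
  ext a b
  rw [Matrix.conjTranspose_apply, coeff_eq_herm, herm_conj hβ, coeff_eq_herm]

open scoped ComplexOrder in
theorem IsPos.coeff_posDef {α : Bil n} (h : IsPos α) : (coeff α).PosDef := by
  rw [Matrix.posDef_iff_dotProduct_mulVec]
  refine ⟨h.coeff_isHermitian, fun x hx => ?_⟩
  -- `herm` is linear in its first argument, whereas the quadratic form of a matrix is conjugate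
  -- linear there; this is why the vector is `star x` rather than `x`.
  have h1 : dotProduct (star x) (Matrix.mulVec (coeff α) x) = herm α (star x) (star x) := by
    rw [herm_sum h.toIsHerm]
    simp only [dotProduct, Matrix.mulVec, Finset.mul_sum, Pi.star_apply, star_star]
    refine Finset.sum_congr rfl fun a _ => Finset.sum_congr rfl fun b _ => by ring
  have hx' : star x ≠ 0 := by simpa using hx
  have h2 := h.pos _ hx'
  rw [h1, herm, h.alt]
  simp only [Complex.ofReal_zero, mul_zero, sub_zero]
  rw [show (1 / 2 : ℂ) = ((1 / 2 : ℝ) : ℂ) by norm_num, ← Complex.ofReal_mul]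
  exact_mod_cast by positivity

open scoped ComplexOrder in
theorem IsPos.coeff_det_pos {α : Bil n} (h : IsPos α) : 0 < (coeff α).det.re :=
  (Complex.lt_def.1 h.coeff_posDef.det_pos).1

theorem IsHerm.coeff_det_im {α : Bil n} (h : IsHerm α) : (coeff α).det.im = 0 := by
  have h1 : star (coeff α).det = (coeff α).det := by
    rw [← Matrix.det_conjTranspose, h.coeff_isHermitian]
  exact Complex.conj_eq_iff_im.1 h1

theorem IsPos.coeff_det_ne {α : Bil n} (h : IsPos α) : (coeff α).det ≠ 0 := fun h0 => by
  simpa [h0] using h.coeff_det_pos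

/-- The density of the volume form `α^[n]` with respect to Lebesgue measure. -/
def rho (α : Bil n) : ℝ := 2 ^ n * (coeff α).det.re

theorem IsPos.rho_pos {α : Bil n} (h : IsPos α) : 0 < rho α :=
  mul_pos (by positivity) h.coeff_det_pos

theorem coeff_add (α β : Bil n) : coeff (α + β) = coeff α + coeff β := by
  ext a b
  simp only [coeff_apply, Matrix.add_apply, add_apply, Complex.ofReal_add]; ring

theorem coeff_smul (c : ℝ) (β : Bil n) : coeff (c • β) = c • coeff β := by
  ext a b
  simp only [coeff_apply, Matrix.smul_apply, smul_apply, smul_eq_mul, Complex.ofReal_mul,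
    Complex.real_smul]
  ring

theorem trAt_add (α β γ : Bil n) : trAt α (β + γ) = trAt α β + trAt α γ := by
  simp [trAt, coeff_add, Matrix.mul_add]

theorem trAt_smul (α β : Bil n) (c : ℝ) : trAt α (c • β) = c * trAt α β := by
  simp [trAt, coeff_smul]

/-- The endomorphism `α⁻¹ β` commutes with `J`, and its complex matrix is, up to order, `(coeff α)⁻¹
* coeff β`. The real trace of a complex linear map is twice the real part of its complex trace,
which explains the `1 / 2` in `trR`. -/
theorem trAt_eq_trR {α β : Bil n} (hα : IsPos α) (hβ : IsHerm β) : trAt α β = trR α β := by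
  let A := α.inverse.comp β
  have hA : ∀ v, α (A v) = β v := fun v => apply_inverse hα.isInvertible _
  have hAJ : ∀ v, A (J n v) = J n (A v) := fun v => by
    apply hα.isInvertible.injective
    ext w
    have h1 : α (A v) (J n w) = β v (J n w) := by rw [hA]
    rw [hA, hα.J_left, h1, hβ.J_left]
  let m : Matrix (Fin n) (Fin n) ℂ := Matrix.of fun a c => A (Pi.single a 1) c
  have hm : coeff β = m * coeff α := by
    ext a b
    rw [coeff_eq_herm, Matrix.mul_apply]
    have h1 : herm β (Pi.single a 1) (Pi.single b 1) = herm α (A (Pi.single a 1)) (Pi.single b 1) := by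
      simp only [herm, hA]
    rw [h1, herm_sum_left hα.toIsHerm]
    rfl
  have hu : IsUnit (coeff α).det := hα.coeff_det_ne.isUnit
  rw [trAt, trR, hm, Matrix.trace_mul_comm, Matrix.mul_assoc, Matrix.mul_nonsing_inv _ hu,
    Matrix.mul_one, trc_eq_sum, Matrix.trace, Complex.re_sum, Finset.mul_sum]
  refine Finset.sum_congr rfl fun a _ => ?_
  have h2 : (A (J n (Pi.single a 1)) a).im = (A (Pi.single a 1) a).re := by
    rw [hAJ, J_apply]; simp
  have h3 : (Matrix.diag m a).re = (A (Pi.single a 1) a).re := rfl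
  change _ = (1 / 2) * ((A (Pi.single a 1) a).re + (A (J n (Pi.single a 1)) a).im)
  rw [h2, h3]; ring

/-- The real Gram matrix of a `(1,1)`-form. -/
theorem gram_det {β : Bil n} (hβ : IsHerm β) :
    (Matrix.of fun i j => β (realBasis n i) (realBasis n j)).det = rho β ^ 2 := by
  let S : Matrix (Fin n) (Fin n) ℝ := Matrix.of fun a b => β (Pi.single a 1) (Pi.single b 1)
  let T : Matrix (Fin n) (Fin n) ℝ := Matrix.of fun a b => β (Pi.single a 1) (J n (Pi.single b 1))
  let e : Fin 2 × Fin n ≃ Fin n ⊕ Fin n :=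
    (finTwoEquiv.prodCongr (Equiv.refl _)).trans (Equiv.boolProdEquivSum _)
  have h1 : Matrix.of (fun i j => β (realBasis n i) (realBasis n j)) =
      (Matrix.fromBlocks S T (-T) S).submatrix e e := by
    ext ⟨i, a⟩ ⟨j, b⟩
    fin_cases i <;> fin_cases j <;>
      simp [e, S, T, realBasis_zero, realBasis_one, hβ.inv, hβ.J_left, finTwoEquiv,
        Equiv.boolProdEquivSum]
  rw [h1, Matrix.det_submatrix_equiv_self]
  let S' : Matrix (Fin n) (Fin n) ℂ := S.map Complex.ofRealHom
  let T' : Matrix (Fin n) (Fin n) ℂ := T.map Complex.ofRealHom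
  have h2 : ((Matrix.fromBlocks S T (-T) S).det : ℂ) = (Matrix.fromBlocks S' T' (-T') S').det := by
    change Complex.ofRealHom _ = _
    rw [RingHom.map_det]
    congr 1
    simp [Matrix.fromBlocks_map, S', T', Matrix.map_neg]
  have h3 : (Matrix.fromBlocks S' T' (-T') S').det =
      (S' - Complex.I • T').det * (S' + Complex.I • T').det := by
    -- Block row and column operations by `±i` make the real block matrix triangular over `ℂ`, with
    -- diagonal blocks `S ∓ iT`.
    have h4 : Matrix.fromBlocks 1 (Complex.I • (1 : Matrix (Fin n) (Fin n) ℂ)) 0 1 *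
        Matrix.fromBlocks S' T' (-T') S' *
        Matrix.fromBlocks 1 (-Complex.I • (1 : Matrix (Fin n) (Fin n) ℂ)) 0 1 =
        Matrix.fromBlocks (S' - Complex.I • T') 0 (-T') (S' + Complex.I • T') := by
      rw [Matrix.fromBlocks_multiply, Matrix.fromBlocks_multiply]
      congr 1
      · simp [sub_eq_add_neg]
      · simp [smul_smul]; abel
      · simp
      · simp [add_comm]
    have h5 := congrArg Matrix.det h4
    rwa [Matrix.det_mul, Matrix.det_mul, Matrix.det_fromBlocks_zero₂₁,
      Matrix.det_fromBlocks_zero₂₁, Matrix.det_fromBlocks_zero₁₂, Matrix.det_one, one_mul,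
      one_mul, mul_one] at h5
  -- The coefficient matrix and its conjugate are `∓i/2` times `S ± iT`; the resulting constant
  -- `(1/4)^n` is absorbed by the two factors `2^n` in `rho β ^ 2`.
  have hc : coeff β = (-Complex.I / 2) • (S' + Complex.I • T') := by
    ext a b
    simp only [coeff_apply, Matrix.smul_apply, Matrix.add_apply, smul_eq_mul, S', T', S, T,
      Matrix.map_apply, Matrix.of_apply, Complex.ofRealHom_eq_coe]
    linear_combination (((β (Pi.single a 1) (J n (Pi.single b 1)) : ℝ) : ℂ) / 2) * Complex.I_sq
  have hc' : (coeff β).map star = (Complex.I / 2) • (S' - Complex.I • T') := by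
    rw [hc]
    ext a b
    simp [S', T', Complex.ext_iff, map_ofNat]
  have h6 : (2 ^ n * (coeff β).det) * (2 ^ n * star (coeff β).det) =
      (S' - Complex.I • T').det * (S' + Complex.I • T').det := by
    have h7 : star (coeff β).det = ((coeff β).map star).det := by
      have := RingHom.map_det (starRingEnd ℂ) (coeff β)
      exact this
    rw [h7, hc', hc, Matrix.det_smul, Matrix.det_smul, Fintype.card_fin]
    have h8 : ((-Complex.I / 2) ^ n * (Complex.I / 2) ^ n * 2 ^ n * 2 ^ n : ℂ) = 1 := by
      rw [← mul_pow, ← mul_pow, ← mul_pow]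
      have : (-Complex.I / 2 * (Complex.I / 2) * 2 * 2 : ℂ) = 1 := by
        linear_combination (-1 : ℂ) * Complex.I_sq
      rw [this, one_pow]
    linear_combination ((S' - Complex.I • T').det * (S' + Complex.I • T').det) * h8
  have hre : (coeff β).det = ((coeff β).det.re : ℂ) := by
    rw [Complex.ext_iff]; simp [hβ.coeff_det_im]
  have h9 : (((Matrix.fromBlocks S T (-T) S).det : ℝ) : ℂ) = ((rho β ^ 2 : ℝ) : ℂ) := by
    rw [h2, h3, ← h6, hre, rho]
    simp [Complex.conj_ofReal]
    ring
  exact_mod_cast h9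

/-- By `gram_det` the square of the density is a real Gram determinant, which is multiplied by `(det
D)²` under any real linear change of variables. Both forms are positive, so the square roots agree
as well. -/
theorem rho_pull {α : Bil n} {D : Cn n →L[ℝ] Cn n} (hα : IsPos α) (hβ : IsPos (pull α D)) :
    rho (pull α D) = |D.det| * rho α := by
  have h1 : rho (pull α D) ^ 2 = (|D.det| * rho α) ^ 2 := by
    let B : LinearMap.BilinForm ℝ (Cn n) :=
      (ContinuousLinearMap.coeLM ℝ).comp (α : Cn n →ₗ[ℝ] Cn n →L[ℝ] ℝ)
    have h2 := LinearMap.BilinForm.toMatrix_comp (realBasis n) (realBasis n) B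
      (D : Cn n →ₗ[ℝ] Cn n) (D : Cn n →ₗ[ℝ] Cn n)
    have h3 := congrArg Matrix.det h2
    rw [Matrix.det_mul, Matrix.det_mul, Matrix.det_transpose, LinearMap.det_toMatrix] at h3
    have h4 := gram_det hα.toIsHerm
    have h5 := gram_det hβ.toIsHerm
    have h6 : LinearMap.BilinForm.toMatrix (realBasis n) B =
        Matrix.of fun i j => α (realBasis n i) (realBasis n j) := by
      ext i j; simp [LinearMap.BilinForm.toMatrix_apply, B]
    have h7 : LinearMap.BilinForm.toMatrix (realBasis n)
        (B.comp (D : Cn n →ₗ[ℝ] Cn n) (D : Cn n →ₗ[ℝ] Cn n)) =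
        Matrix.of fun i j => pull α D (realBasis n i) (realBasis n j) := by
      ext i j; simp [LinearMap.BilinForm.toMatrix_apply, B]
    rw [h6, h7, h4, h5] at h3
    rw [h3, mul_pow, sq_abs]
    change _ = (LinearMap.det (D : Cn n →ₗ[ℝ] Cn n)) ^ 2 * _
    ring
  rwa [sq_eq_sq₀ hβ.rho_pos.le (mul_nonneg (abs_nonneg _) hα.rho_pos.le)] at h1

end LinearAlgebra

/-! ### Endomorphisms anticommuting with `J`, and positivity of `tr(A²)` -/

section Traces

variable {n : ℕ}

/-- An endomorphism which anticommutes with `J`. -/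
def AntiJ (A : Cn n →L[ℝ] Cn n) : Prop := ∀ v, A (J n v) = -J n (A v)

theorem AntiJ.comp_J {A : Cn n →L[ℝ] Cn n} (h : AntiJ A) : A.comp (J n) = -(J n).comp A := by
  ext1 v; simp [h v]

theorem antiJ_comm (D : Cn n →L[ℝ] Cn n) : AntiJ ((J n).comp D - D.comp (J n)) := fun v => by
  simp

/-- For endomorphisms anticommuting with `J`, `tr (J A B) = -tr (J B A)`. -/
theorem trc_J_antisymm {A B : Cn n →L[ℝ] Cn n} (hB : AntiJ B) :
    trc ((J n).comp (A.comp B)) = -trc ((J n).comp (B.comp A)) := by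
  rw [trc_comm, ContinuousLinearMap.comp_assoc, hB.comp_J, ContinuousLinearMap.comp_neg, map_neg,
    trc_comm, ContinuousLinearMap.comp_assoc]

/-- The hypothesis says exactly that `A` is self-adjoint for the metric `α(·, J·)`. In an orthogonal
basis the diagonal entries of `A²` are then the quotients `|A b_i|² / |b_i|²`. -/
theorem trc_sq_eq_sum {α : Bil n} (hα : IsPos α) {A : Cn n →L[ℝ] Cn n}
    (hA : ∀ v w, α (A v) (J n w) + α (J n v) (A w) = 0) :
    ∃ (k : ℕ) (b : Module.Basis (Fin k) ℝ (Cn n)), trc (A.comp A) =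
      ∑ i, α (A (b i)) (J n (A (b i))) / α (b i) (J n (b i)) := by
  let B : LinearMap.BilinForm ℝ (Cn n) :=
    (ContinuousLinearMap.coeLM ℝ).comp
      ((α.bilinearComp (ContinuousLinearMap.id ℝ (Cn n)) (J n) : Bil n) :
        Cn n →ₗ[ℝ] Cn n →L[ℝ] ℝ)
  have hB : ∀ v w, B v w = α v (J n w) := fun v w => rfl
  have hsymm : LinearMap.IsSymm B := ⟨fun v w => by simpa [hB] using hα.J_symm v w⟩
  have : Invertible (2 : ℝ) := invertibleOfNonzero two_ne_zero
  obtain ⟨b, hb⟩ := LinearMap.BilinForm.exists_orthogonal_basis hsymm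
  refine ⟨_, b, ?_⟩
  have hself : ∀ v w, B (A v) w = B v (A w) := fun v w => by
    have := hA v w
    rw [hB, hB]
    have h2 := hα.J_left v (A w)
    linarith
  have hbpos : ∀ i, 0 < B (b i) (b i) := fun i => hα.pos _ (b.ne_zero i)
  have hrepr : ∀ v i, b.repr v i = B v (b i) / B (b i) (b i) := fun v i => by
    rw [eq_div_iff (hbpos i).ne']
    conv_rhs => rw [← b.sum_repr v]
    rw [map_sum, LinearMap.sum_apply, Finset.sum_eq_single i]
    · simp
    · intro j _ hj
      have : B (b j) (b i) = 0 := hb hj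
      simp [this]
    · simp
  rw [trc_apply, LinearMap.trace_eq_matrix_trace ℝ b, Matrix.trace]
  refine Finset.sum_congr rfl fun i _ => ?_
  rw [Matrix.diag_apply, LinearMap.toMatrix_apply, hrepr]
  change B (A (A (b i))) (b i) / _ = _
  rw [hself]; rfl

theorem trc_sq_nonneg {α : Bil n} (hα : IsPos α) {A : Cn n →L[ℝ] Cn n}
    (hA : ∀ v w, α (A v) (J n w) + α (J n v) (A w) = 0) : 0 ≤ trc (A.comp A) := by
  obtain ⟨k, b, h⟩ := trc_sq_eq_sum hα hA
  rw [h]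
  refine Finset.sum_nonneg fun i _ => div_nonneg ?_ (hα.pos _ (b.ne_zero i)).le
  by_cases h0 : A (b i) = 0
  · simp [h0]
  · exact (hα.pos _ h0).le

theorem eq_zero_of_trc_sq {α : Bil n} (hα : IsPos α) {A : Cn n →L[ℝ] Cn n}
    (hA : ∀ v w, α (A v) (J n w) + α (J n v) (A w) = 0) (h0 : trc (A.comp A) = 0) : A = 0 := by
  obtain ⟨k, b, h⟩ := trc_sq_eq_sum hα hA
  rw [h] at h0
  have hnn : ∀ i, 0 ≤ α (A (b i)) (J n (A (b i))) := fun i => by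
    by_cases h0 : A (b i) = 0
    · simp [h0]
    · exact (hα.pos _ h0).le
  rw [Finset.sum_eq_zero_iff_of_nonneg
    (fun i _ => div_nonneg (hnn i) (hα.pos _ (b.ne_zero i)).le)] at h0
  have h1 : ∀ i, A (b i) = 0 := fun i => by
    by_contra hi
    exact (div_pos (hα.pos _ hi) (hα.pos _ (b.ne_zero i))).ne' (h0 i (Finset.mem_univ i))
  have h2 : (A : Cn n →ₗ[ℝ] Cn n) = 0 := b.ext fun i => by simpa using h1 i
  ext1 v
  exact LinearMap.congr_fun h2 v

/-- `-tr (A D) = tr (J (J D - D J) A) / 2` for `A` anticommuting with `J`. -/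
theorem trc_comm_J {A : Cn n →L[ℝ] Cn n} (hA : AntiJ A) (D : Cn n →L[ℝ] Cn n) :
    trc ((J n).comp (((J n).comp D - D.comp (J n)).comp A)) = -2 * trc (A.comp D) := by
  have h1 : (J n).comp (((J n).comp D - D.comp (J n)).comp A) =
      -(D.comp A) - (J n).comp (D.comp ((J n).comp A)) := by
    ext1 v; simp
  have h2 : trc ((J n).comp (D.comp ((J n).comp A))) = trc (D.comp A) := by
    rw [trc_comm]
    congr 1
    ext1 v; simp [hA v]
  rw [h1, map_sub, map_neg, h2, trc_comm D]; ring

end Traces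

/-! ### Derivative of the volume density (Jacobi's formula) -/

section Jacobi

variable {n : ℕ}

theorem contDiff_rho : ContDiff ℝ ∞ (rho : Bil n → ℝ) := by
  have hc : ∀ a b, ContDiff ℝ ∞ fun α : Bil n => coeff α a b := fun a b => by
    simp only [coeff_apply]
    refine contDiff_const.mul (ContDiff.sub ?_ (contDiff_const.mul ?_))
    · exact Complex.ofRealCLM.contDiff.comp ((contDiff_id.clm_apply contDiff_const).clm_apply contDiff_const)
    · exact Complex.ofRealCLM.contDiff.comp ((contDiff_id.clm_apply contDiff_const).clm_apply contDiff_const)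
  have hd : ContDiff ℝ ∞ fun α : Bil n => (coeff α).det := by
    simp only [Matrix.det_apply]
    refine ContDiff.sum fun σ _ => ContDiff.const_smul _ ?_
    exact contDiff_prod fun i _ => hc _ _
  exact contDiff_const.mul (Complex.reCLM.contDiff.comp hd)

/-- Factor out `coeff α` and expand `det (1 + s m)` to first order, with `m = (coeff α)⁻¹ * coeff
β`. Since `det (coeff α)` is real, taking real parts splits the product `det * trace`. -/
theorem hasDerivAt_rho_line {α : Bil n} (hα : (coeff α).det ≠ 0) (him : (coeff α).det.im = 0)
    (β : Bil n) : HasDerivAt (fun s : ℝ => rho (α + s • β)) (rho α * trAt α β) 0 := by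
  let m := (coeff α)⁻¹ * coeff β
  obtain ⟨q, hq⟩ : ∃ q : Polynomial ℂ, ∀ s : ℂ,
      (1 + s • m).det = 1 + m.trace * s + q.eval s * s ^ 2 := ⟨_, fun s => Matrix.det_one_add_smul s m⟩
  have h1 : ∀ s : ℝ, (coeff (α + s • β)).det =
      (coeff α).det * (1 + m.trace * s + q.eval (s : ℂ) * (s : ℂ) ^ 2) := fun s => by
    rw [← hq, ← Matrix.det_mul, coeff_add, coeff_smul, mul_add, mul_one, Matrix.mul_smul,
      ← Matrix.mul_assoc, Matrix.mul_nonsing_inv _ hα.isUnit, one_mul]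
    rfl
  have h2 : HasDerivAt (fun s : ℂ => (coeff α).det * (1 + m.trace * s + q.eval s * s ^ 2))
      ((coeff α).det * m.trace) 0 := by
    have h3 := ((((hasDerivAt_id (0 : ℂ)).const_mul m.trace).const_add 1).add
      ((q.hasDerivAt 0).mul (hasDerivAt_pow 2 (0 : ℂ)))).const_mul (coeff α).det
    refine h3.congr_deriv ?_
    simp
  have h4 : HasDerivAt (fun s : ℝ => ((coeff α).det *
      (1 + m.trace * s + q.eval (s : ℂ) * (s : ℂ) ^ 2)).re) ((coeff α).det * m.trace).re 0 := by
    have h5 : HasDerivAt (fun s : ℂ => (coeff α).det * (1 + m.trace * s + q.eval s * s ^ 2))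
      ((coeff α).det * m.trace) ((0 : ℝ) : ℂ) := by simpa using h2
    exact h5.real_of_complex
  have h6 := h4.const_mul ((2 : ℝ) ^ n)
  refine (h6.congr_of_eventuallyEq (Filter.Eventually.of_forall fun s => ?_)).congr_deriv ?_
  · simp only [rho, h1]
  · rw [rho, trAt, Complex.mul_re, him]; ring

/-- Jacobi's formula. -/
theorem fderiv_rho {α : Bil n} (hα : IsPos α) (β : Bil n) :
    fderiv ℝ rho α β = rho α * trAt α β := by
  have h1 : HasDerivAt (fun s : ℝ => rho (α + s • β)) (fderiv ℝ rho α β) 0 := by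
    have h2 : HasFDerivAt rho (fderiv ℝ rho α) (α + (0 : ℝ) • β) := by
      rw [zero_smul, add_zero]
      exact (contDiff_rho.differentiable (by simp) α).hasFDerivAt
    have h3 : HasDerivAt (fun s : ℝ => α + s • β) β 0 := by
      simpa using ((hasDerivAt_id (0 : ℝ)).smul_const β).const_add α
    exact h2.comp_hasDerivAt 0 h3
  exact h1.unique (hasDerivAt_rho_line hα.coeff_det_ne hα.coeff_det_im β)

theorem HasFDerivAt.rho_comp {E : Type*} [NormedAddCommGroup E] [NormedSpace ℝ E]
    {γ : E → Bil n} {γ' : E →L[ℝ] Bil n} {s : E} (h : HasFDerivAt γ γ' s)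
    (hp : IsPos (γ s)) (v : E) :
    fderiv ℝ (fun r => rho (γ r)) s v = rho (γ s) * trAt (γ s) (γ' v) := by
  rw [← fderiv_rho hp]
  have := ((contDiff_rho.differentiable (by simp) (γ s)).hasFDerivAt).comp s h
  rw [show (fun r => rho (γ r)) = rho ∘ γ from rfl, this.fderiv]; rfl

end Jacobi

/-! ### Stokes' theorem for Kähler forms on open subsets of `ℂⁿ` -/

section LocalCalculus

open Filter Topology

variable {n : ℕ}

theorem _root_.ContDiffAt.fderiv_infty {E F : Type*} [NormedAddCommGroup E] [NormedSpace ℝ E]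
    [NormedAddCommGroup F] [NormedSpace ℝ F] {f : E → F} {x : E} (h : ContDiffAt ℝ ∞ f x) :
    ContDiffAt ℝ ∞ (fderiv ℝ f) x :=
  h.fderiv_right (by simp)

theorem _root_.ContDiffAt.hasFDerivAt_infty {E F : Type*} [NormedAddCommGroup E] [NormedSpace ℝ E]
    [NormedAddCommGroup F] [NormedSpace ℝ F] {f : E → F} {x : E} (h : ContDiffAt ℝ ∞ f x) :
    HasFDerivAt f (fderiv ℝ f x) x :=
  (h.differentiableAt (by simp)).hasFDerivAt

theorem _root_.ContDiffAt.symm_infty {E F : Type*} [NormedAddCommGroup E] [NormedSpace ℝ E]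
    [NormedAddCommGroup F] [NormedSpace ℝ F] {f : E → F} {x : E} (h : ContDiffAt ℝ ∞ f x)
    (v w : E) : fderiv ℝ (fderiv ℝ f) x v w = fderiv ℝ (fderiv ℝ f) x w v :=
  (h.isSymmSndFDerivAt (by
    rw [minSmoothness_of_isRCLikeNormedField]
    exact WithTop.coe_le_coe.2 (le_top : (2 : ℕ∞) ≤ ⊤))).eq v w

theorem fderiv_clm_apply_const {E F G : Type*} [NormedAddCommGroup E] [NormedSpace ℝ E]
    [NormedAddCommGroup F] [NormedSpace ℝ F] [NormedAddCommGroup G] [NormedSpace ℝ G]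
    {f : E → F →L[ℝ] G} {x : E} (h : DifferentiableAt ℝ f x) (v : E) (w : F) :
    fderiv ℝ (fun y => f y w) x v = fderiv ℝ f x v w := by
  rw [fderiv_clm_apply h (differentiableAt_const w)]
  simp

/-! ### The divergence theorem -/

theorem integral_fderiv_eq_zero {u : Cn n → ℝ} (hu : ContDiff ℝ 1 u) (hs : HasCompactSupport u)
    (v : Cn n) : ∫ y, fderiv ℝ u y v = 0 := by
  have hc : Continuous fun y => fderiv ℝ u y v :=
    (hu.continuous_fderiv one_ne_zero).clm_apply continuous_const
  have hi : Integrable fun y => fderiv ℝ u y v :=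
    hc.integrable_of_hasCompactSupport (hs.fderiv_apply ℝ v)
  -- Integration by parts against the constant function `1`.
  have h := integral_mul_fderiv_eq_neg_fderiv_mul_of_integrable (μ := (volume : Measure (Cn n)))
    (f := fun _ => (1 : ℝ)) (g := u) (v := v) (by simp) (by simpa using hi)
    (by simpa using hu.continuous.integrable_of_hasCompactSupport hs)
    (fun _ _ => differentiableAt_const _)
    (fun x _ => (hu.differentiable one_ne_zero) x)
  simpa using h

theorem trc_eq_sum_coord (A : Cn n →L[ℝ] Cn n) :
    trc A = ∑ i, (realBasis n).coord i (A (realBasis n i)) := by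
  rw [trc_apply, LinearMap.trace_eq_matrix_trace ℝ (realBasis n), Matrix.trace]
  refine Finset.sum_congr rfl fun i _ => ?_
  simp [Matrix.diag_apply, LinearMap.toMatrix_apply]

theorem integral_trc_fderiv_eq_zero {Y : Cn n → Cn n} (hY : ContDiff ℝ 1 Y)
    (hs : HasCompactSupport Y) : ∫ y, trc (fderiv ℝ Y y) = 0 := by
  let c : Fin 2 × Fin n → (Cn n →L[ℝ] ℝ) := fun i =>
    LinearMap.toContinuousLinearMap ((realBasis n).coord i)
  have hsc : ∀ i, HasCompactSupport fun y => c i (Y y) := fun i =>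
    hs.comp_left (g := c i) (map_zero _)
  have hYc : ∀ i, ContDiff ℝ 1 fun y => c i (Y y) := fun i => (c i).contDiff.comp hY
  have h1 : ∀ y, trc (fderiv ℝ Y y) =
      ∑ i, fderiv ℝ (fun z => c i (Y z)) y (realBasis n i) := fun y => by
    rw [trc_eq_sum_coord]
    refine Finset.sum_congr rfl fun i _ => ?_
    have := ((c i).hasFDerivAt.comp y ((hY.differentiable one_ne_zero) y).hasFDerivAt).fderiv
    rw [show (fun z => c i (Y z)) = c i ∘ Y from rfl, this]
    rfl
  simp only [h1]
  rw [integral_finsetSum]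
  · exact Finset.sum_eq_zero fun i _ => integral_fderiv_eq_zero (hYc i) (hsc i) _
  · intro i _
    have hc : Continuous fun y => fderiv ℝ (fun z => c i (Y z)) y (realBasis n i) :=
      ((hYc i).continuous_fderiv one_ne_zero).clm_apply continuous_const
    exact hc.integrable_of_hasCompactSupport ((hsc i).fderiv_apply ℝ _)

/-! ### Exterior derivatives of 1-forms and the divergence formula -/

/-- The exterior derivative of a 1-form. -/
def extd (ζ : Cn n → Cn n →L[ℝ] ℝ) (y : Cn n) : Bil n :=
  fderiv ℝ ζ y - (fderiv ℝ ζ y).flip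

theorem extd_apply (ζ : Cn n → Cn n →L[ℝ] ℝ) (y v w : Cn n) :
    extd ζ y v w = fderiv ℝ ζ y v w - fderiv ℝ ζ y w v := rfl

theorem extd_closed {ζ : Cn n → Cn n →L[ℝ] ℝ} {y : Cn n} (h : ContDiffAt ℝ ∞ ζ y) (u v w : Cn n) :
    fderiv ℝ (extd ζ) y u v w + fderiv ℝ (extd ζ) y v w u + fderiv ℝ (extd ζ) y w u v = 0 := by
  have hd := h.fderiv_infty.hasFDerivAt_infty
  have h1 : ∀ a b c, fderiv ℝ (extd ζ) y a b c =
      fderiv ℝ (fderiv ℝ ζ) y a b c - fderiv ℝ (fderiv ℝ ζ) y a c b := fun a b c => by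
    let F := (ContinuousLinearMap.flipₗᵢ ℝ (Cn n) (Cn n) ℝ).toContinuousLinearEquiv
    have h2 : HasFDerivAt (extd ζ) (fderiv ℝ (fderiv ℝ ζ) y -
        (F : Bil n →L[ℝ] Bil n).comp (fderiv ℝ (fderiv ℝ ζ) y)) y :=
      hd.sub ((F : Bil n →L[ℝ] Bil n).hasFDerivAt.comp y hd)
    rw [h2.fderiv]; rfl
  simp only [h1, h.symm_infty v u, h.symm_infty w u, h.symm_infty w v]
  ring

/-- Kähler forms on open subsets of `ℂⁿ`. -/
structure LocalKahler (α : Cn n → Bil n) (U : Set (Cn n)) : Prop where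
  isOpen : IsOpen U
  smooth : ContDiffOn ℝ ∞ α U
  pos : ∀ y ∈ U, IsPos (α y)
  closed : ∀ y ∈ U, ∀ u v w, fderiv ℝ α y u v w + fderiv ℝ α y v w u + fderiv ℝ α y w u v = 0

theorem LocalKahler.smoothAt {α : Cn n → Bil n} {U : Set (Cn n)} (h : LocalKahler α U) {y : Cn n}
    (hy : y ∈ U) : ContDiffAt ℝ ∞ α y :=
  h.smooth.contDiffAt (h.isOpen.mem_nhds hy)

theorem isHerm_fderiv {E : Type*} [NormedAddCommGroup E] [NormedSpace ℝ E]
    {α : E → Bil n} {y : E} (hd : DifferentiableAt ℝ α y)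
    (h : ∀ᶠ z in 𝓝 y, IsHerm (α z)) (u : E) : IsHerm (fderiv ℝ α y u) := by
  have key : ∀ v w, HasFDerivAt (fun z => α z v w)
      (((ContinuousLinearMap.apply ℝ ℝ w).comp
        (ContinuousLinearMap.apply ℝ (Cn n →L[ℝ] ℝ) v)).comp (fderiv ℝ α y)) y := fun v w =>
    ((ContinuousLinearMap.apply ℝ ℝ w).comp
        (ContinuousLinearMap.apply ℝ (Cn n →L[ℝ] ℝ) v)).hasFDerivAt.comp y hd.hasFDerivAt
  constructor
  · intro v
    have h1 : HasFDerivAt (fun z => α z v v) (0 : E →L[ℝ] ℝ) y :=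
      (hasFDerivAt_const (0 : ℝ) y).congr_of_eventuallyEq (h.mono fun z hz => hz.alt v)
    exact DFunLike.congr_fun ((key v v).unique h1) u
  · intro v w
    have h1 := (key v w).congr_of_eventuallyEq
      (h.mono fun z hz => (hz.inv v w : (fun z => α z (J n v) (J n w)) z = _))
    exact DFunLike.congr_fun ((key (J n v) (J n w)).unique h1) u

theorem LocalKahler.isHerm_fderiv {α : Cn n → Bil n} {U : Set (Cn n)} (h : LocalKahler α U)
    {y : Cn n} (hy : y ∈ U) (u : Cn n) : IsHerm (fderiv ℝ α y u) :=
  TwistedKahler.isHerm_fderiv ((h.smoothAt hy).differentiableAt (by simp))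
    (Filter.eventually_of_mem (h.isOpen.mem_nhds hy) fun z hz => (h.pos z hz).toIsHerm) u

theorem trc_smulRight (c : Cn n →L[ℝ] ℝ) (v : Cn n) : trc (c.smulRight v) = c v := by
  rw [trc_eq_sum_coord]
  conv_rhs => rw [← (realBasis n).sum_repr v]
  simp only [map_sum, map_smul, ContinuousLinearMap.smulRight_apply, Module.Basis.coord_apply,
    smul_eq_mul]
  exact Finset.sum_congr rfl fun i _ => mul_comm _ _

theorem trc_fderiv_smul {f : Cn n → ℝ} {Z : Cn n → Cn n} {y : Cn n}
    (hf : DifferentiableAt ℝ f y) (hZ : DifferentiableAt ℝ Z y) :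
    trc (fderiv ℝ (fun z => f z • Z z) y) = f y * trc (fderiv ℝ Z y) + fderiv ℝ f y (Z y) := by
  rw [fderiv_fun_smul hf hZ, map_add, trc_smulRight, map_smul, smul_eq_mul]

/-- The divergence of a field `Z` with respect to the volume form `α^[n]` is the trace of the
exterior derivative of `α (Z, ·)`. -/
theorem LocalKahler.div_eq {α : Cn n → Bil n} {U : Set (Cn n)} (h : LocalKahler α U)
    {y : Cn n} (hy : y ∈ U) {Z : Cn n → Cn n} (hZ : DifferentiableAt ℝ Z y) :
    trc (fderiv ℝ (fun z => rho (α z) • Z z) y) =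
      rho (α y) * trR (α y) (extd (fun z => α z (Z z)) y) := by
  have hα := (h.smoothAt hy).hasFDerivAt_infty
  have hρ : DifferentiableAt ℝ (fun z => rho (α z)) y :=
    (contDiff_rho.differentiable (by simp) _).comp y hα.differentiableAt
  have hp := h.pos y hy
  have hext : extd (fun z => α z (Z z)) y = fderiv ℝ α y (Z y) +
      ((α y).bilinearComp (fderiv ℝ Z y) (ContinuousLinearMap.id ℝ (Cn n)) +
        (α y).bilinearComp (ContinuousLinearMap.id ℝ (Cn n)) (fderiv ℝ Z y)) := by
    ext v w
    have h1 : ∀ a b, fderiv ℝ (fun z => α z (Z z)) y a b =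
        fderiv ℝ α y a (Z y) b + α y (fderiv ℝ Z y a) b := fun a b => by
      rw [fderiv_clm_apply hα.differentiableAt hZ]
      simp [add_comm]
    rw [extd_apply, h1, h1]
    -- Cartan's formula: closedness trades `D_v α(Z, w) - D_w α(Z, v)` for the derivative of `α`
    -- along `Z`.
    have h2 := h.closed y hy (Z y) v w
    have h3 := (h.isHerm_fderiv hy v).antisymm w (Z y)
    have h4 := hp.antisymm (fderiv ℝ Z y w) v
    simp only [add_apply, ContinuousLinearMap.bilinearComp_apply, ContinuousLinearMap.id_apply]
    linarith
  -- The Lie derivative of `α` splits into `D_Z α`, whose trace is `dρ(Z) / ρ` by Jacobi's formula,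
  -- and the infinitesimal action of `DZ`, whose trace is `tr DZ`.
  have hlie := trR_lie hp.isInvertible (fderiv ℝ Z y)
    (β := (α y).bilinearComp (fderiv ℝ Z y) (ContinuousLinearMap.id ℝ (Cn n)) +
      (α y).bilinearComp (ContinuousLinearMap.id ℝ (Cn n)) (fderiv ℝ Z y)) (fun v w => rfl)
  rw [trc_fderiv_smul hρ hZ, HasFDerivAt.rho_comp hα hp, hext, trR_add, hlie,
    trAt_eq_trR hp (h.isHerm_fderiv hy _)]
  ring

theorem IsPos.contDiffAt_inverse {α : Bil n} (h : IsPos α) :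
    ContDiffAt ℝ ∞ (ContinuousLinearMap.inverse : Bil n → _) α :=
  h.isInvertible.contDiffAt_map_inverse

/-- The Hamiltonian field of a function. -/
def locHam (α : Cn n → Bil n) (h : Cn n → ℝ) (y : Cn n) : Cn n := (α y).inverse (fderiv ℝ h y)

theorem locHam_spec {α : Cn n → Bil n} {h : Cn n → ℝ} {y : Cn n} (hp : IsPos (α y)) :
    α y (locHam α h y) = fderiv ℝ h y := apply_inverse hp.isInvertible _

/-- Used with `K` the support of a cutoff: the charts, forms and fields involved are smooth only
near `K`, and their values elsewhere are irrelevant. -/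
theorem contDiff_of_tsupport {E F : Type*} [NormedAddCommGroup E] [NormedSpace ℝ E]
    [NormedAddCommGroup F] [NormedSpace ℝ F] {f : E → F} {K : Set E} (hK : IsClosed K)
    (h0 : ∀ x ∉ K, f x = 0) (h : ∀ x ∈ K, ContDiffAt ℝ ∞ f x) : ContDiff ℝ ∞ f := by
  rw [contDiff_iff_contDiffAt]
  intro x
  by_cases hx : x ∈ K
  · exact h x hx
  · exact (contDiffAt_const (c := (0 : F))).congr_of_eventuallyEq
      (Filter.eventually_of_mem (hK.isOpen_compl.mem_nhds hx) fun z hz => h0 z hz)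

theorem LocalKahler.contDiffAt_rho {α : Cn n → Bil n} {U : Set (Cn n)} (h : LocalKahler α U)
    {y : Cn n} (hy : y ∈ U) : ContDiffAt ℝ ∞ (fun z => rho (α z)) y :=
  contDiff_rho.contDiffAt.comp y (h.smoothAt hy)

theorem LocalKahler.contDiffAt_inverse {α : Cn n → Bil n} {U : Set (Cn n)} (h : LocalKahler α U)
    {y : Cn n} (hy : y ∈ U) : ContDiffAt ℝ ∞ (fun z => (α z).inverse) y :=
  (h.pos y hy).contDiffAt_inverse.comp y (h.smoothAt hy)

/-- Stokes' theorem, in the form `∫ h (tr_α dζ) α^[n] = ∫ ζ (X_h) α^[n]`. -/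
theorem LocalKahler.integral_mul_trR_extd {α : Cn n → Bil n} {U : Set (Cn n)} (hα : LocalKahler α U)
    {ζ : Cn n → Cn n →L[ℝ] ℝ} {h : Cn n → ℝ} (hh : ContDiff ℝ ∞ h) (hc : HasCompactSupport h)
    (hU : tsupport h ⊆ U) (hζ : ∀ y ∈ tsupport h, ContDiffAt ℝ ∞ ζ y) :
    ∫ y, rho (α y) * (h y * trR (α y) (extd ζ y)) =
      ∫ y, rho (α y) * ζ y (locHam α h y) := by
  let Z : Cn n → Cn n := fun y => (α y).inverse (ζ y)
  have hZ : ∀ y ∈ tsupport h, ContDiffAt ℝ ∞ Z y := fun y hy =>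
    (hα.contDiffAt_inverse (hU hy)).clm_apply (hζ y hy)
  have hαZ : ∀ y ∈ U, α y (Z y) = ζ y := fun y hy => apply_inverse (hα.pos y hy).isInvertible _
  -- With `Z` dual to `ζ`, the divergence of `h ρ Z` is `h ρ tr_α(dζ) + ρ dh(Z)`, and `dh(Z) =
  -- α(X_h, Z) = -ζ(X_h)`.
  let Y : Cn n → Cn n := fun y => h y • (rho (α y) • Z y)
  have hYs : ContDiff ℝ ∞ Y := contDiff_of_tsupport (isClosed_tsupport h)
    (fun y hy => by simp [Y, image_eq_zero_of_notMem_tsupport hy]) fun y hy =>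
      hh.contDiffAt.smul ((hα.contDiffAt_rho (hU hy)).smul (hZ y hy))
  have hYc : HasCompactSupport Y := hc.smul_right
  have h0 := integral_trc_fderiv_eq_zero (hYs.of_le (by simp)) hYc
  have key : ∀ y, trc (fderiv ℝ Y y) = rho (α y) * (h y * trR (α y) (extd ζ y)) -
      rho (α y) * ζ y (locHam α h y) := fun y => by
    by_cases hy : y ∈ tsupport h
    · have h1 : DifferentiableAt ℝ (fun z => rho (α z) • Z z) y :=
        ((hα.contDiffAt_rho (hU hy)).smul (hZ y hy)).differentiableAt (by simp)
      have h2 : extd (fun z => α z (Z z)) y = extd ζ y := by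
        have : (fun z => α z (Z z)) =ᶠ[𝓝 y] ζ :=
          Filter.eventually_of_mem (hα.isOpen.mem_nhds (hU hy)) hαZ
        rw [extd, this.fderiv_eq]; rfl
      have hp := hα.pos y (hU hy)
      rw [trc_fderiv_smul (hh.differentiable (by simp) y) h1,
        hα.div_eq (hU hy) ((hZ y hy).differentiableAt (by simp)), h2, map_smul, smul_eq_mul,
        ← locHam_spec hp, hp.antisymm, hαZ y (hU hy)]
      ring
    · have h1 : fderiv ℝ Y y = 0 := by
        have : Y =ᶠ[𝓝 y] fun _ => 0 :=
          Filter.eventually_of_mem ((isClosed_tsupport h).isOpen_compl.mem_nhds hy) fun z hz => by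
            simp [Y, image_eq_zero_of_notMem_tsupport hz]
        rw [this.fderiv_eq]; simp
      have h2 : fderiv ℝ h y = 0 := by
        have : h =ᶠ[𝓝 y] fun _ => 0 := notMem_tsupport_iff_eventuallyEq.1 hy
        rw [this.fderiv_eq]; simp
      simp [h1, locHam, h2, image_eq_zero_of_notMem_tsupport hy]
  have hi1 : Integrable fun y => rho (α y) * (h y * trR (α y) (extd ζ y)) := by
    refine Continuous.integrable_of_hasCompactSupport (ContDiff.continuous (𝕜 := ℝ) (n := ∞)
      (contDiff_of_tsupport (isClosed_tsupport h)
      (fun y hy => by simp [image_eq_zero_of_notMem_tsupport hy]) fun y hy => ?_))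
      (hc.mono' fun y hy => ?_)
    · refine (hα.contDiffAt_rho (hU hy)).mul (hh.contDiffAt.mul (contDiffAt_const.mul
        (trc.contDiff.contDiffAt.comp y ((hα.contDiffAt_inverse (hU hy)).clm_comp ?_))))
      exact (hζ y hy).fderiv_infty.sub ((ContinuousLinearMap.flipₗᵢ ℝ (Cn n) (Cn n)
        ℝ).toContinuousLinearEquiv.contDiff.contDiffAt.comp y (hζ y hy).fderiv_infty)
    · by_contra hy'
      exact hy (by simp [image_eq_zero_of_notMem_tsupport hy'])
  have hi2 : Integrable fun y => rho (α y) * ζ y (locHam α h y) := by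
    have hz : ∀ y ∉ tsupport h, rho (α y) * ζ y (locHam α h y) = 0 := fun y hy => by
      have : h =ᶠ[𝓝 y] fun _ => 0 := notMem_tsupport_iff_eventuallyEq.1 hy
      simp [locHam, this.fderiv_eq]
    refine Continuous.integrable_of_hasCompactSupport (ContDiff.continuous (𝕜 := ℝ) (n := ∞)
      (contDiff_of_tsupport (isClosed_tsupport h) hz fun y hy => ?_))
      (hc.mono' fun y hy => ?_)
    · exact (hα.contDiffAt_rho (hU hy)).mul ((hζ y hy).clm_apply
        ((hα.contDiffAt_inverse (hU hy)).clm_apply hh.contDiffAt.fderiv_infty))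
    · by_contra hy'
      exact hy (hz y hy')
  rw [integral_congr_ae (Eventually.of_forall key), integral_sub hi1 hi2, sub_eq_zero] at h0
  exact h0

end LocalCalculus

/-! ### The operator `∂∂̄`, the local Ricci form, and its variation -/

section Ddbar

open Filter Topology

variable {n : ℕ}

theorem ddbarAt_apply (u : Cn n → ℝ) (y v w : Cn n) : ddbarAt u y v w =
    (1 / 2) * (fderiv ℝ (fderiv ℝ u) y (J n v) w - fderiv ℝ (fderiv ℝ u) y v (J n w)) := rfl

theorem _root_.Filter.EventuallyEq.ddbarAt_eq {u v : Cn n → ℝ} {y : Cn n} (h : u =ᶠ[𝓝 y] v) :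
    ddbarAt u y = ddbarAt v y := by
  rw [ddbarAt, ddbarAt, h.fderiv.fderiv_eq]

theorem isHerm_ddbarAt {u : Cn n → ℝ} {y : Cn n} (h : ContDiffAt ℝ ∞ u y) :
    IsHerm (ddbarAt u y) :=
  ⟨fun v => by rw [ddbarAt_apply, h.symm_infty (J n v) v]; ring,
    fun v w => by simp only [ddbarAt_apply, J_J, map_neg, neg_apply]; ring⟩

/-- The 1-form `du ∘ J`. -/
def dJ (u : Cn n → ℝ) (y : Cn n) : Cn n →L[ℝ] ℝ := (fderiv ℝ u y).comp (J n)

theorem contDiffAt_dJ {u : Cn n → ℝ} {y : Cn n} (h : ContDiffAt ℝ ∞ u y) :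
    ContDiffAt ℝ ∞ (dJ u) y :=
  h.fderiv_infty.clm_comp contDiffAt_const

theorem extd_dJ {u : Cn n → ℝ} {y : Cn n} (h : ContDiffAt ℝ ∞ u y) :
    extd (dJ u) y = (-2 : ℝ) • ddbarAt u y := by
  have h1 : ∀ a b, fderiv ℝ (dJ u) y a b = fderiv ℝ (fderiv ℝ u) y a (J n b) := fun a b => by
    have h2 : HasFDerivAt (dJ u) (((ContinuousLinearMap.compL ℝ (Cn n) (Cn n) ℝ).flip (J n)).comp
        (fderiv ℝ (fderiv ℝ u) y)) y :=
      ((ContinuousLinearMap.compL ℝ (Cn n) (Cn n) ℝ).flip (J n)).hasFDerivAt.comp y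
        h.fderiv_infty.hasFDerivAt_infty
    rw [h2.fderiv]; rfl
  ext v w
  rw [extd_apply, h1, h1, h.symm_infty w (J n v)]
  simp only [smul_apply, smul_eq_mul, ddbarAt_apply]
  ring

theorem ddbarAt_eq_extd {u : Cn n → ℝ} {y : Cn n} (h : ContDiffAt ℝ ∞ u y) :
    ddbarAt u y = (-1 / 2 : ℝ) • extd (dJ u) y := by
  rw [extd_dJ h, smul_smul]; norm_num

theorem contDiffAt_extd {ζ : Cn n → Cn n →L[ℝ] ℝ} {y : Cn n} (h : ContDiffAt ℝ ∞ ζ y) :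
    ContDiffAt ℝ ∞ (extd ζ) y :=
  h.fderiv_infty.sub ((ContinuousLinearMap.flipₗᵢ ℝ (Cn n) (Cn n)
    ℝ).toContinuousLinearEquiv.contDiff.contDiffAt.comp y h.fderiv_infty)

theorem ddbar_eventuallyEq {u : Cn n → ℝ} {U : Set (Cn n)} (hU : IsOpen U)
    (h : ContDiffOn ℝ ∞ u U) {y : Cn n} (hy : y ∈ U) :
    ddbarAt u =ᶠ[𝓝 y] fun z => (-1 / 2 : ℝ) • extd (dJ u) z :=
  Filter.eventually_of_mem (hU.mem_nhds hy) fun _ hz =>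
    ddbarAt_eq_extd (h.contDiffAt (hU.mem_nhds hz))

theorem contDiffOn_ddbarAt {u : Cn n → ℝ} {U : Set (Cn n)} (hU : IsOpen U)
    (h : ContDiffOn ℝ ∞ u U) : ContDiffOn ℝ ∞ (ddbarAt u) U := fun y hy => by
  refine ContDiffAt.contDiffWithinAt (ContDiffAt.congr_of_eventuallyEq ?_
    (ddbar_eventuallyEq hU h hy))
  exact ContDiffAt.const_smul (-1 / 2 : ℝ)
    (contDiffAt_extd (contDiffAt_dJ (h.contDiffAt (hU.mem_nhds hy))))

theorem ddbarAt_closed {u : Cn n → ℝ} {U : Set (Cn n)} (hU : IsOpen U)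
    (h : ContDiffOn ℝ ∞ u U) {y : Cn n} (hy : y ∈ U) (a b c : Cn n) :
    fderiv ℝ (ddbarAt u) y a b c + fderiv ℝ (ddbarAt u) y b c a +
      fderiv ℝ (ddbarAt u) y c a b = 0 := by
  have hd := contDiffAt_dJ (h.contDiffAt (hU.mem_nhds hy))
  have h2 := extd_closed hd a b c
  have h3 := (contDiffAt_extd hd).hasFDerivAt_infty.const_smul (-1 / 2 : ℝ)
  have h4 : HasFDerivAt (fun z => (-1 / 2 : ℝ) • extd (dJ u) z) _ y := h3
  rw [(ddbar_eventuallyEq hU h hy).fderiv_eq, h4.fderiv]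
  simp only [smul_apply, smul_eq_mul]
  linear_combination (-1 / 2 : ℝ) * h2

/-- `∂∂̄` commutes with pull-back by maps whose differential commutes with `J`. -/
theorem ddbarAt_comp {u : Cn n → ℝ} {g : Cn n → Cn n} {y : Cn n} (hg : ContDiffAt ℝ ∞ g y)
    (hJ : ∀ᶠ z in 𝓝 y, ∀ v, fderiv ℝ g z (J n v) = J n (fderiv ℝ g z v))
    (hu : ContDiffAt ℝ ∞ u (g y)) :
    ddbarAt (u ∘ g) y = pull (ddbarAt u (g y)) (fderiv ℝ g y) := by
  have hg2 := hg.fderiv_infty.hasFDerivAt_infty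
  have hev : fderiv ℝ (u ∘ g) =ᶠ[𝓝 y] fun z => (fderiv ℝ u (g z)).comp (fderiv ℝ g z) := by
    have h1 : ∀ᶠ z in 𝓝 y, DifferentiableAt ℝ g z :=
      ((hg.of_le (m := 1) (by simp)).eventually (by simp)).mono fun z hz =>
        hz.differentiableAt one_ne_zero
    have h2 : ∀ᶠ z in 𝓝 y, DifferentiableAt ℝ u (g z) :=
      hg.continuousAt.eventually (((hu.of_le (m := 1) (by simp)).eventually (by simp)).mono
        fun z hz => hz.differentiableAt one_ne_zero)
    filter_upwards [h1, h2] with z hz1 hz2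
    exact fderiv_comp z hz2 hz1
  have hD : ∀ a b, fderiv ℝ (fderiv ℝ (u ∘ g)) y a b =
      fderiv ℝ (fderiv ℝ u) (g y) (fderiv ℝ g y a) (fderiv ℝ g y b) +
        fderiv ℝ u (g y) (fderiv ℝ (fderiv ℝ g) y a b) := fun a b => by
    have h3 := (hu.fderiv_infty.hasFDerivAt_infty.comp y hg.hasFDerivAt_infty).clm_comp hg2
    rw [hev.fderiv_eq]
    have h4 : HasFDerivAt (fun z => (fderiv ℝ u (g z)).comp (fderiv ℝ g z)) _ y := h3
    rw [h4.fderiv]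
    simp [add_comm]
  have hJ2 : ∀ a b, fderiv ℝ (fderiv ℝ g) y a (J n b) = J n (fderiv ℝ (fderiv ℝ g) y a b) := by
    intro a b
    have h5 : (fun z => fderiv ℝ g z (J n b)) =ᶠ[𝓝 y] fun z => J n (fderiv ℝ g z b) :=
      hJ.mono fun z hz => hz b
    rw [← fderiv_clm_apply_const hg2.differentiableAt, h5.fderiv_eq]
    have h6 : HasFDerivAt (fun z => fderiv ℝ g z b)
        ((ContinuousLinearMap.apply ℝ (Cn n) b).comp (fderiv ℝ (fderiv ℝ g) y)) y :=
      (ContinuousLinearMap.apply ℝ (Cn n) b).hasFDerivAt.comp y hg2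
    have h7 : HasFDerivAt (fun z => J n (fderiv ℝ g z b)) _ y := (J n).hasFDerivAt.comp y h6
    rw [h7.fderiv]; rfl
  ext v w
  rw [ddbarAt_apply, pull_apply, ddbarAt_apply, hD, hD, hJ2, hg.symm_infty (J n v) w, hJ2,
    hg.symm_infty w v, hJ.self_of_nhds, hJ.self_of_nhds]
  ring

/-- The real part of a function whose differential is complex linear is pluriharmonic. -/
theorem ddbarAt_re {f : Cn n → ℂ} {y : Cn n} (hf : ContDiffAt ℝ ∞ f y)
    (hJ : ∀ᶠ z in 𝓝 y, ∀ v, fderiv ℝ f z (J n v) = Complex.I * fderiv ℝ f z v) :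
    ddbarAt (fun z => (f z).re) y = 0 := by
  have hf2 := hf.fderiv_infty.hasFDerivAt_infty
  have hev : fderiv ℝ (fun z => (f z).re) =ᶠ[𝓝 y] fun z => Complex.reCLM.comp (fderiv ℝ f z) := by
    have h1 : ∀ᶠ z in 𝓝 y, DifferentiableAt ℝ f z :=
      ((hf.of_le (m := 1) (by simp)).eventually (by simp)).mono fun z hz =>
        hz.differentiableAt one_ne_zero
    filter_upwards [h1] with z hz
    exact (Complex.reCLM.hasFDerivAt.comp z hz.hasFDerivAt).fderiv
  have hD : ∀ a b, fderiv ℝ (fderiv ℝ (fun z => (f z).re)) y a b =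
      (fderiv ℝ (fderiv ℝ f) y a b).re := fun a b => by
    rw [hev.fderiv_eq]
    have h4 : HasFDerivAt (fun z => Complex.reCLM.comp (fderiv ℝ f z)) _ y :=
      (ContinuousLinearMap.compL ℝ (Cn n) ℂ ℝ Complex.reCLM).hasFDerivAt.comp y hf2
    rw [h4.fderiv]; rfl
  have hJ2 : ∀ a b, fderiv ℝ (fderiv ℝ f) y a (J n b) =
      Complex.I * fderiv ℝ (fderiv ℝ f) y a b := by
    intro a b
    have h5 : (fun z => fderiv ℝ f z (J n b)) =ᶠ[𝓝 y] fun z => Complex.I * fderiv ℝ f z b :=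
      hJ.mono fun z hz => hz b
    rw [← fderiv_clm_apply_const hf2.differentiableAt, h5.fderiv_eq]
    have h6 : HasFDerivAt (fun z => fderiv ℝ f z b)
        ((ContinuousLinearMap.apply ℝ ℂ b).comp (fderiv ℝ (fderiv ℝ f) y)) y :=
      (ContinuousLinearMap.apply ℝ ℂ b).hasFDerivAt.comp y hf2
    rw [(h6.const_mul Complex.I).fderiv]; rfl
  ext v w
  rw [ddbarAt_apply, hD, hD, hJ2, hf.symm_infty (J n v) w, hJ2, hf.symm_infty w v]
  simp

theorem fderiv_J_of_complex {F : Type*} [NormedAddCommGroup F] [NormedSpace ℂ F]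
    {f : Cn n → F} {z : Cn n} (h : DifferentiableAt ℂ f z) (v : Cn n) :
    fderiv ℝ f z (J n v) = Complex.I • fderiv ℝ f z v := by
  rw [h.fderiv_restrictScalars ℝ, J_apply]
  simp

theorem ddbarAt_add {u v : Cn n → ℝ} {y : Cn n} (hu : ContDiffAt ℝ ∞ u y)
    (hv : ContDiffAt ℝ ∞ v y) :
    ddbarAt (fun z => u z + v z) y = ddbarAt u y + ddbarAt v y := by
  have hev : fderiv ℝ (fun z => u z + v z) =ᶠ[𝓝 y] fun z => fderiv ℝ u z + fderiv ℝ v z := by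
    filter_upwards [(hu.of_le (m := 1) (by simp)).eventually (by simp),
      (hv.of_le (m := 1) (by simp)).eventually (by simp)] with z hz1 hz2
    exact fderiv_fun_add (hz1.differentiableAt one_ne_zero) (hz2.differentiableAt one_ne_zero)
  ext a b
  simp only [ddbarAt_apply, hev.fderiv_eq, fderiv_fun_add
    hu.fderiv_infty.hasFDerivAt_infty.differentiableAt
    hv.fderiv_infty.hasFDerivAt_infty.differentiableAt, add_apply]
  ring

theorem ddbarAt_const_add {u : Cn n → ℝ} {y : Cn n} (c : ℝ) :
    ddbarAt (fun z => c + u z) y = ddbarAt u y := by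
  have : fderiv ℝ (fun z => c + u z) = fderiv ℝ u := by ext1 z; exact fderiv_const_add c
  rw [ddbarAt, ddbarAt, this]

/-- `log |f|²` is pluriharmonic for `f` holomorphic without zeros. -/
theorem ddbarAt_log_normSq {f : Cn n → ℂ} {y : Cn n} {s : Set (Cn n)} (hs : IsOpen s)
    (hf : ContDiffOn ℂ ∞ f s) (hy : y ∈ s) (h0 : f y ≠ 0) :
    ddbarAt (fun z => Real.log (Complex.normSq (f z))) y = 0 := by
  -- Dividing by `f y` brings the value at `y` to `1`, where the principal logarithm is holomorphic;
  -- the constant `log |f y|²` does not affect `∂∂̄`.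
  let g : Cn n → ℂ := fun z => f z / f y
  have hg : ∀ z ∈ s, ContDiffAt ℂ ∞ g z := fun z hz =>
    (hf.contDiffAt (hs.mem_nhds hz)).div_const _
  have hslit : ∀ᶠ z in 𝓝 y, g z ∈ Complex.slitPlane := by
    have : g y ∈ Complex.slitPlane := by simp [g, h0]
    exact (hg y hy).continuousAt.eventually (Complex.isOpen_slitPlane.mem_nhds this)
  let l : Cn n → ℂ := fun z => 2 * Complex.log (g z)
  have hl : ∀ z ∈ s, g z ∈ Complex.slitPlane → ContDiffAt ℂ ∞ l z := fun z hz hz' =>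
    contDiffAt_const.mul ((Complex.contDiffAt_log hz').comp z (hg z hz))
  have h1 : (fun z => Real.log (Complex.normSq (f z))) =ᶠ[𝓝 y]
      fun z => Real.log (Complex.normSq (f y)) + (l z).re := by
    filter_upwards [hslit] with z hz
    have hgz : g z ≠ 0 := Complex.slitPlane_ne_zero hz
    have h2 : f z = f y * g z := by simp only [g]; field_simp
    have h3 : (l z).re = Real.log (Complex.normSq (g z)) := by
      simp only [l, Complex.mul_re, Complex.re_ofNat, Complex.im_ofNat, zero_mul, sub_zero,
        Complex.log_re, Complex.normSq_eq_norm_sq, Real.log_pow]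
      norm_num
    rw [h3, h2, Complex.normSq_mul, Real.log_mul]
    · simpa using h0
    · simpa using hgz
  rw [h1.ddbarAt_eq, ddbarAt_const_add]
  refine ddbarAt_re ((hl y hy hslit.self_of_nhds).restrict_scalars ℝ) ?_
  filter_upwards [hslit, hs.mem_nhds hy] with z hz hz' v
  exact fderiv_J_of_complex ((hl z hz' hz).differentiableAt (by simp)) v

/-- The complex determinant of a real endomorphism of `ℂⁿ`. -/
def cdet (D : Cn n →L[ℝ] Cn n) : ℂ :=
  (Matrix.of fun a c => D (Pi.single a 1) c : Matrix (Fin n) (Fin n) ℂ).det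

/-- For complex linear maps the factor is `|det_ℂ|²`. Unlike `rho_pull` this needs no positivity,
and for holomorphic maps it exhibits the factor as the squared modulus of a holomorphic function,
whose logarithm is pluriharmonic. -/
theorem rho_pull_of_commJ {α : Bil n} (hα : IsHerm α) {D : Cn n →L[ℝ] Cn n}
    (hD : ∀ v, D (J n v) = J n (D v)) : rho (pull α D) = Complex.normSq (cdet D) * rho α := by
  let m : Matrix (Fin n) (Fin n) ℂ := Matrix.of fun a c => D (Pi.single a 1) c
  have h1 : coeff (pull α D) = m * coeff α * m.conjTranspose := by
    ext a b
    have h2 : coeff (pull α D) a b = herm α (D (Pi.single a 1)) (D (Pi.single b 1)) := by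
      rw [coeff_eq_herm]; simp only [herm, pull_apply, hD]
    rw [h2, herm_sum hα, Matrix.mul_apply]
    simp only [Matrix.mul_apply, Matrix.conjTranspose_apply, Finset.sum_mul]
    rw [Finset.sum_comm]
    refine Finset.sum_congr rfl fun c _ => Finset.sum_congr rfl fun d _ => ?_
    simp only [m, Matrix.of_apply]; ring
  have h3 : (coeff (pull α D)).det = (Complex.normSq (cdet D) : ℂ) * (coeff α).det := by
    rw [h1, Matrix.det_mul, Matrix.det_mul, Matrix.det_conjTranspose, Complex.normSq_eq_conj_mul_self]
    change cdet D * _ * (starRingEnd ℂ) (cdet D) = _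
    ring
  rw [rho, rho, h3, Complex.re_ofReal_mul]; ring

theorem contDiffOn_cdet {g : Cn n → Cn n} {s : Set (Cn n)} (hs : IsOpen s)
    (hg : ContDiffOn ℂ ∞ g s) : ContDiffOn ℂ ∞ (fun y => cdet (fderiv ℝ g y)) s := by
  have h1 : ContDiffOn ℂ ∞ (fderiv ℂ g) s := hg.fderiv_of_isOpen hs (by simp)
  have h2 : ∀ a c, ContDiffOn ℂ ∞ (fun y => fderiv ℂ g y (Pi.single a 1) c) s := fun a c =>
    (contDiff_apply ℂ ℂ c).comp_contDiffOn (h1.clm_apply contDiffOn_const)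
  have h3 : ContDiffOn ℂ ∞ (fun y =>
      (Matrix.of fun a c => fderiv ℂ g y (Pi.single a 1) c : Matrix (Fin n) (Fin n) ℂ).det) s := by
    simp only [Matrix.det_apply, Matrix.of_apply]
    refine ContDiffOn.sum fun σ _ => ContDiffOn.const_smul _ ?_
    exact contDiffOn_prod fun i _ => h2 _ _
  refine h3.congr fun y hy => ?_
  have h4 : DifferentiableAt ℂ g y := (hg.contDiffAt (hs.mem_nhds hy)).differentiableAt (by simp)
  rw [cdet, h4.fderiv_restrictScalars ℝ]
  rfl

theorem commJ_of_complex {g : Cn n → Cn n} {s : Set (Cn n)} (hs : IsOpen s)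
    (hg : ContDiffOn ℂ ∞ g s) {y : Cn n} (hy : y ∈ s) (v : Cn n) :
    fderiv ℝ g y (J n v) = J n (fderiv ℝ g y v) :=
  fderiv_J_of_complex ((hg.contDiffAt (hs.mem_nhds hy)).differentiableAt (by simp)) v

/-- The Ricci form of a Kähler form on an open subset of `ℂⁿ`. -/
def locRicci (α : Cn n → Bil n) (y : Cn n) : Bil n := -ddbarAt (fun z => Real.log (rho (α z))) y

theorem LocalKahler.contDiffAt_log_rho {α : Cn n → Bil n} {U : Set (Cn n)} (h : LocalKahler α U)
    {y : Cn n} (hy : y ∈ U) : ContDiffAt ℝ ∞ (fun z => Real.log (rho (α z))) y :=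
  (h.contDiffAt_rho hy).log (h.pos y hy).rho_pos.ne'

theorem LocalKahler.isHerm_locRicci {α : Cn n → Bil n} {U : Set (Cn n)} (h : LocalKahler α U)
    {y : Cn n} (hy : y ∈ U) : IsHerm (locRicci α y) :=
  (isHerm_ddbarAt (h.contDiffAt_log_rho hy)).neg

/-- The Ricci form is compatible with pull-back by biholomorphisms. -/
theorem LocalKahler.locRicci_pull {α : Cn n → Bil n} {U : Set (Cn n)} (h : LocalKahler α U)
    {β : Cn n → Bil n} {g : Cn n → Cn n} {s : Set (Cn n)} (hs : IsOpen s)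
    (hg : ContDiffOn ℂ ∞ g s) (hgU : ∀ z ∈ s, g z ∈ U)
    (hβ : ∀ z ∈ s, β z = pull (α (g z)) (fderiv ℝ g z)) (hp : ∀ z ∈ s, IsPos (β z))
    {y : Cn n} (hy : y ∈ s) : locRicci β y = pull (locRicci α (g y)) (fderiv ℝ g y) := by
  have hρ : ∀ z ∈ s, rho (β z) =
      Complex.normSq (cdet (fderiv ℝ g z)) * rho (α (g z)) := fun z hz => by
    rw [hβ z hz, rho_pull_of_commJ (h.pos _ (hgU z hz)).toIsHerm (commJ_of_complex hs hg hz)]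
  have hne : ∀ z ∈ s, cdet (fderiv ℝ g z) ≠ 0 := fun z hz h0 => by
    have := (hp z hz).rho_pos
    rw [hρ z hz, h0] at this
    simp at this
  have hgR : ContDiffAt ℝ ∞ g y := (hg.contDiffAt (hs.mem_nhds hy)).restrict_scalars ℝ
  have h1 : (fun z => Real.log (rho (β z))) =ᶠ[𝓝 y] fun z =>
      Real.log (Complex.normSq (cdet (fderiv ℝ g z))) + Real.log (rho (α (g z))) := by
    filter_upwards [hs.mem_nhds hy] with z hz
    rw [hρ z hz, Real.log_mul (by simpa using hne z hz) (h.pos _ (hgU z hz)).rho_pos.ne']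
  have hc := (contDiffOn_cdet hs hg).contDiffAt (hs.mem_nhds hy)
  have hns : ContDiffAt ℝ ∞ (fun z => Complex.normSq (cdet (fderiv ℝ g z))) y := by
    have h2 := hc.restrict_scalars ℝ
    simp only [Complex.normSq_apply]
    exact ((Complex.reCLM.contDiff.contDiffAt.comp y h2).mul
      (Complex.reCLM.contDiff.contDiffAt.comp y h2)).add
      ((Complex.imCLM.contDiff.contDiffAt.comp y h2).mul
      (Complex.imCLM.contDiff.contDiffAt.comp y h2))
  have h3 := h.contDiffAt_log_rho (hgU y hy)
  rw [locRicci, h1.ddbarAt_eq, ddbarAt_add (v := fun z => Real.log (rho (α (g z))))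
      (hns.log (by simpa using hne y hy)) (h3.comp y hgR),
    ddbarAt_log_normSq hs (contDiffOn_cdet hs hg) hy (hne y hy), zero_add]
  have h4 := ddbarAt_comp (u := fun z => Real.log (rho (α z))) hgR
    (Filter.eventually_of_mem (hs.mem_nhds hy) fun z hz v => commJ_of_complex hs hg hz v) h3
  rw [show (fun z => Real.log (rho (α (g z)))) = (fun z => Real.log (rho (α z))) ∘ g from rfl, h4]
  ext v w
  simp [locRicci]

/-! ### The first variation of the scalar curvature, after integration by parts -/

/-- The Lie derivative of the complex structure of `ℂⁿ`. -/
def locLieJ (V : Cn n → Cn n) (y : Cn n) : Cn n →L[ℝ] Cn n :=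
  (J n).comp (fderiv ℝ V y) - (fderiv ℝ V y).comp (J n)

theorem contDiffAt_locLieJ {V : Cn n → Cn n} {y : Cn n} (h : ContDiffAt ℝ ∞ V y) :
    ContDiffAt ℝ ∞ (locLieJ V) y :=
  (contDiffAt_const.clm_comp h.fderiv_infty).sub (h.fderiv_infty.clm_comp contDiffAt_const)

/-- Leibniz' rule. In the term where `L_V J` is differentiated, symmetry of the second derivative of
`V` moves the traced direction into the slot of `DV`, so that the trace becomes the derivative of
`tr(J DV)` along `X` minus that of `tr(DV)` along `J X`. -/
theorem trc_fderiv_locLieJ_apply {V X : Cn n → Cn n} {y : Cn n} (hV : ContDiffAt ℝ ∞ V y)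
    (hX : DifferentiableAt ℝ X y) :
    trc (fderiv ℝ (fun z => locLieJ V z (X z)) y) = trc ((locLieJ V y).comp (fderiv ℝ X y)) +
      fderiv ℝ (fun z => trc ((J n).comp (fderiv ℝ V z))) y (X y) -
      fderiv ℝ (fun z => trc (fderiv ℝ V z)) y (J n (X y)) := by
  have hV2 := hV.fderiv_infty.hasFDerivAt_infty
  let L1 := ContinuousLinearMap.compL ℝ (Cn n) (Cn n) (Cn n) (J n)
  let L2 := (ContinuousLinearMap.compL ℝ (Cn n) (Cn n) (Cn n)).flip (J n)
  have hA : HasFDerivAt (locLieJ V) ((L1 - L2).comp (fderiv ℝ (fderiv ℝ V) y)) y :=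
    (L1 - L2).hasFDerivAt.comp y hV2
  have h1 : HasFDerivAt (fun z => trc ((J n).comp (fderiv ℝ V z)))
      ((trc.comp L1).comp (fderiv ℝ (fderiv ℝ V) y)) y := (trc.comp L1).hasFDerivAt.comp y hV2
  have h2 : HasFDerivAt (fun z => trc (fderiv ℝ V z))
      (trc.comp (fderiv ℝ (fderiv ℝ V) y)) y := trc.hasFDerivAt.comp y hV2
  rw [(hA.clm_apply hX.hasFDerivAt).fderiv, h1.fderiv, h2.fderiv, map_add, add_sub_assoc]
  congr 1
  simp only [ContinuousLinearMap.comp_apply]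
  rw [← map_sub]
  congr 1
  ext1 v
  simp [L1, L2, hV.symm_infty v]

/-- The second integration by parts in the variation of scalar curvature: the difference of the two
sides is the integral of the divergence of a compactly supported field, using that `X_h` preserves
`α^[n]`. -/
theorem LocalKahler.integral_variation {α : Cn n → Bil n} {U : Set (Cn n)} (hα : LocalKahler α U)
    {V : Cn n → Cn n} {h : Cn n → ℝ} (hh : ContDiff ℝ ∞ h) (hc : HasCompactSupport h)
    (hU : tsupport h ⊆ U) (hV : ∀ y ∈ tsupport h, ContDiffAt ℝ ∞ V y) :
    ∫ y, rho (α y) * (fderiv ℝ (fun z => Real.log (rho (α z))) y (locLieJ V y (locHam α h y)) -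
        fderiv ℝ (fun z => trc (fderiv ℝ V z)) y (J n (locHam α h y))) =
      -∫ y, rho (α y) * trc ((locLieJ V y).comp (fderiv ℝ (locHam α h) y)) := by
  let X := locHam α h
  have hX : ∀ y ∈ tsupport h, ContDiffAt ℝ ∞ X y := fun y hy =>
    (hα.contDiffAt_inverse (hU hy)).clm_apply hh.contDiffAt.fderiv_infty
  have hX0 : ∀ y ∉ tsupport h, X =ᶠ[𝓝 y] fun _ => 0 := fun y hy =>
    Filter.eventually_of_mem ((isClosed_tsupport h).isOpen_compl.mem_nhds hy) fun z hz => by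
      have : h =ᶠ[𝓝 z] fun _ => 0 := notMem_tsupport_iff_eventuallyEq.1 hz
      simp [X, locHam, this.fderiv_eq]
  let u : Cn n → ℝ := fun z => trc ((J n).comp (fderiv ℝ V z))
  have hu : ∀ y ∈ tsupport h, ContDiffAt ℝ ∞ u y := fun y hy =>
    trc.contDiff.contDiffAt.comp y (contDiffAt_const.clm_comp (hV y hy).fderiv_infty)
  let Z : Cn n → Cn n := fun z => locLieJ V z (X z) - u z • X z
  have hZ1 : ∀ y ∈ tsupport h, ContDiffAt ℝ ∞ (fun z => locLieJ V z (X z)) y := fun y hy =>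
    (contDiffAt_locLieJ (hV y hy)).clm_apply (hX y hy)
  have hZ : ∀ y ∈ tsupport h, ContDiffAt ℝ ∞ Z y := fun y hy =>
    (hZ1 y hy).sub ((hu y hy).smul (hX y hy))
  let Y : Cn n → Cn n := fun z => rho (α z) • Z z
  have hY0 : ∀ y ∉ tsupport h, Y y = 0 := fun y hy => by simp [Y, Z, (hX0 y hy).self_of_nhds]
  have hYs : ContDiff ℝ ∞ Y := contDiff_of_tsupport (isClosed_tsupport h) hY0 fun y hy =>
    (hα.contDiffAt_rho (hU hy)).smul (hZ y hy)
  have hYc : HasCompactSupport Y := hc.mono' fun y hy => by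
    by_contra hy'
    exact hy (hY0 y hy')
  have h0 := integral_trc_fderiv_eq_zero (hYs.of_le (by simp)) hYc
  -- `X` is divergence free for `α^[n]`, since `α(X, ·) = dh` is closed.
  have hdivX : ∀ y ∈ tsupport h, rho (α y) * trc (fderiv ℝ X y) +
      fderiv ℝ (fun z => rho (α z)) y (X y) = 0 := fun y hy => by
    have h1 := hα.div_eq (hU hy) ((hX y hy).differentiableAt (by simp))
    have h2 : (fun z => α z (X z)) =ᶠ[𝓝 y] fderiv ℝ h :=
      Filter.eventually_of_mem (hα.isOpen.mem_nhds (hU hy)) fun z hz => locHam_spec (hα.pos z hz)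
    have h3 : extd (fun z => α z (X z)) y = 0 := by
      ext v w
      rw [extd_apply, h2.fderiv_eq, hh.contDiffAt.symm_infty]; simp
    rw [h3, trc_fderiv_smul ((hα.contDiffAt_rho (hU hy)).differentiableAt (by simp))
      ((hX y hy).differentiableAt (by simp))] at h1
    rw [h1]; simp [trR]
  have key : ∀ y, trc (fderiv ℝ Y y) = rho (α y) *
      (fderiv ℝ (fun z => Real.log (rho (α z))) y (locLieJ V y (X y)) -
        fderiv ℝ (fun z => trc (fderiv ℝ V z)) y (J n (X y))) +
      rho (α y) * trc ((locLieJ V y).comp (fderiv ℝ X y)) := fun y => by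
    by_cases hy : y ∈ tsupport h
    · have hρ := (hα.contDiffAt_rho (hU hy)).differentiableAt (by simp)
      have hp := (hα.pos y (hU hy)).rho_pos
      have e1 : fderiv ℝ Z y = fderiv ℝ (fun z => locLieJ V z (X z)) y -
          fderiv ℝ (fun z => u z • X z) y :=
        fderiv_fun_sub ((hZ1 y hy).differentiableAt (by simp))
          (((hu y hy).smul (hX y hy)).differentiableAt (by simp))
      have e2 : fderiv ℝ (fun z => Real.log (rho (α z))) y =
          (rho (α y))⁻¹ • fderiv ℝ (fun z => rho (α z)) y := fderiv.log hρ hp.ne'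
      rw [trc_fderiv_smul hρ ((hZ y hy).differentiableAt (by simp)), e1, map_sub,
        trc_fderiv_locLieJ_apply (hV y hy) ((hX y hy).differentiableAt (by simp)),
        trc_fderiv_smul ((hu y hy).differentiableAt (by simp))
          ((hX y hy).differentiableAt (by simp)), e2]
      simp only [Z, map_sub, map_smul, smul_eq_mul, smul_apply]
      have h4 := hdivX y hy
      field_simp
      linear_combination (-u y) * h4
    · have h1 : fderiv ℝ Y y = 0 := by
        have : Y =ᶠ[𝓝 y] fun _ => 0 :=
          Filter.eventually_of_mem ((isClosed_tsupport h).isOpen_compl.mem_nhds hy) hY0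
        rw [this.fderiv_eq]; simp
      rw [h1, (hX0 y hy).fderiv_eq, (hX0 y hy).self_of_nhds]
      simp
  have hint : ∀ f : Cn n → ℝ, (∀ y ∉ tsupport h, f y = 0) →
      (∀ y ∈ tsupport h, ContDiffAt ℝ ∞ f y) → Integrable f := fun f hf0 hf => by
    refine Continuous.integrable_of_hasCompactSupport (ContDiff.continuous (𝕜 := ℝ) (n := ∞)
      (contDiff_of_tsupport (isClosed_tsupport h) hf0 hf)) (hc.mono' fun y hy => ?_)
    by_contra hy'
    exact hy (hf0 y hy')
  have hi1 : Integrable fun y => rho (α y) *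
      (fderiv ℝ (fun z => Real.log (rho (α z))) y (locLieJ V y (X y)) -
        fderiv ℝ (fun z => trc (fderiv ℝ V z)) y (J n (X y))) := by
    refine hint _ (fun y hy => by simp [(hX0 y hy).self_of_nhds]) fun y hy => ?_
    refine (hα.contDiffAt_rho (hU hy)).mul (ContDiffAt.sub ?_ ?_)
    · exact (hα.contDiffAt_log_rho (hU hy)).fderiv_infty.clm_apply (hZ1 y hy)
    · refine ContDiffAt.clm_apply ?_ (contDiffAt_const.clm_apply (hX y hy))
      exact (trc.contDiff.contDiffAt.comp y (hV y hy).fderiv_infty).fderiv_infty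
  have hi2 : Integrable fun y => rho (α y) * trc ((locLieJ V y).comp (fderiv ℝ X y)) := by
    refine hint _ (fun y hy => by simp [(hX0 y hy).fderiv_eq]) fun y hy => ?_
    exact (hα.contDiffAt_rho (hU hy)).mul (trc.contDiff.contDiffAt.comp y
      ((contDiffAt_locLieJ (hV y hy)).clm_comp (hX y hy).fderiv_infty))
  rw [integral_congr_ae (Eventually.of_forall key), integral_add hi1 hi2] at h0
  linarith

/-! ### Differentiation under the integral sign -/

theorem hasFDerivAt_integral_of_compact {X P : Type*} [TopologicalSpace X] [MeasurableSpace X]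
    [OpensMeasurableSpace X] {μ : Measure X} [NormedAddCommGroup P] [NormedSpace ℝ P]
    [FiniteDimensional ℝ P] {K : Set X} (hK : IsCompact K) (hKm : MeasurableSet K) (hμ : μ K < ⊤)
    {k : P → X → ℝ} {k' : P → X → P →L[ℝ] ℝ} {p₀ : P}
    (h0 : ∀ᶠ p in 𝓝 p₀, ∀ x ∉ K, k p x = 0)
    (hc : ∀ᶠ p in 𝓝 p₀, ContinuousOn (k p) K)
    (hd : ∀ᶠ p in 𝓝 p₀, ∀ x ∈ K, HasFDerivAt (fun q => k q x) (k' p x) p)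
    (hk' : ∀ x ∈ K, ContinuousAt (fun q : P × X => k' q.1 q.2) (p₀, x)) :
    HasFDerivAt (fun p => ∫ x, k p x ∂μ) (∫ x in K, k' p₀ x ∂μ) p₀ := by
  have : IsFiniteMeasure (μ.restrict K) := ⟨by simpa using hμ⟩
  -- Compactness of `K` turns pointwise continuity in `(p, x)` into a bound valid on all of `K` for
  -- `p` in one neighbourhood; this constant is the dominating function.
  obtain ⟨C, hC⟩ : ∃ C : ℝ, ∀ᶠ p in 𝓝 p₀, ∀ x ∈ K, ‖k' p x‖ ≤ C := by
    have hcomp : IsCompact ((fun x => k' p₀ x) '' K) :=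
      hK.image_of_continuousOn fun x hx =>
        ((hk' x hx).comp (f := fun x => (p₀, x)) (by fun_prop)).continuousWithinAt
    obtain ⟨C, hC⟩ := hcomp.isBounded.exists_norm_le
    refine ⟨C + 1, ?_⟩
    refine hK.eventually_forall_of_forall_eventually fun x hx => ?_
    have h1 : ‖k' p₀ x‖ < C + 1 := (hC _ ⟨x, hx, rfl⟩).trans_lt (by linarith)
    exact ((hk' x hx).norm.eventually (gt_mem_nhds h1)).mono fun q hq => hq.le
  have hs : {p | (∀ x ∈ K, HasFDerivAt (fun q => k q x) (k' p x) p) ∧ ∀ x ∈ K, ‖k' p x‖ ≤ C} ∈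
      𝓝 p₀ := hd.and hC
  have h1 : HasFDerivAt (fun p => ∫ x in K, k p x ∂μ) (∫ x in K, k' p₀ x ∂μ) p₀ := by
    refine hasFDerivAt_integral_of_dominated_of_fderiv_le (bound := fun _ => C) hs
      (hc.mono fun p hp => hp.aestronglyMeasurable hKm) ?_ ?_ ?_ (integrable_const C) ?_
    · obtain ⟨B, hB⟩ := (hK.image_of_continuousOn hc.self_of_nhds).isBounded.exists_norm_le
      exact Integrable.of_bound (hc.self_of_nhds.aestronglyMeasurable hKm) B
        ((ae_restrict_iff' hKm).2 (Eventually.of_forall fun x hx => hB _ ⟨x, hx, rfl⟩))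
    · refine ContinuousOn.aestronglyMeasurable (fun x hx => ?_) hKm
      exact ((hk' x hx).comp (f := fun x => (p₀, x)) (by fun_prop)).continuousWithinAt
    · exact (ae_restrict_iff' hKm).2 (Eventually.of_forall fun x hx p hp => hp.2 x hx)
    · exact (ae_restrict_iff' hKm).2 (Eventually.of_forall fun x hx p hp => hp.1 x hx)
  refine h1.congr_of_eventuallyEq (h0.mono fun p hp => ?_)
  exact (setIntegral_eq_integral_of_forall_compl_eq_zero hp).symm

end Ddbar

/-! ### Naturality of `L_V J` -/

section LocalLie

open Filter Topology

variable {n : ℕ}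

/-- Differentiating `Dg (V) = W ∘ g` produces the extra term `D²g(·, V)`. It commutes with `J`
because `Dg` does at every nearby point, so it drops out of the commutator with `J`. -/
theorem locLieJ_conj {g V W : Cn n → Cn n} {y : Cn n} (hg : ContDiffAt ℝ ∞ g y)
    (hJ : ∀ᶠ z in 𝓝 y, ∀ v, fderiv ℝ g z (J n v) = J n (fderiv ℝ g z v))
    (hV : DifferentiableAt ℝ V y) (hW : DifferentiableAt ℝ W (g y))
    (hVW : ∀ᶠ z in 𝓝 y, fderiv ℝ g z (V z) = W (g z)) :
    (fderiv ℝ g y).comp (locLieJ V y) = (locLieJ W (g y)).comp (fderiv ℝ g y) := by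
  have hg2 := hg.fderiv_infty.hasFDerivAt_infty
  have hJ2 : ∀ a b, fderiv ℝ (fderiv ℝ g) y a (J n b) = J n (fderiv ℝ (fderiv ℝ g) y a b) := by
    intro a b
    have h5 : (fun z => fderiv ℝ g z (J n b)) =ᶠ[𝓝 y] fun z => J n (fderiv ℝ g z b) :=
      hJ.mono fun z hz => hz b
    rw [← fderiv_clm_apply_const hg2.differentiableAt, h5.fderiv_eq]
    have h6 : HasFDerivAt (fun z => fderiv ℝ g z b)
        ((ContinuousLinearMap.apply ℝ (Cn n) b).comp (fderiv ℝ (fderiv ℝ g) y)) y :=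
      (ContinuousLinearMap.apply ℝ (Cn n) b).hasFDerivAt.comp y hg2
    have h7 : HasFDerivAt (fun z => J n (fderiv ℝ g z b)) _ y := (J n).hasFDerivAt.comp y h6
    rw [h7.fderiv]; rfl
  have key : ∀ v, fderiv ℝ W (g y) (fderiv ℝ g y v) =
      fderiv ℝ (fderiv ℝ g) y v (V y) + fderiv ℝ g y (fderiv ℝ V y v) := fun v => by
    have h1 : HasFDerivAt (fun z => fderiv ℝ g z (V z)) _ y := hg2.clm_apply hV.hasFDerivAt
    have h2 : HasFDerivAt (fun z => W (g z)) _ y :=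
      hW.hasFDerivAt.comp y hg.hasFDerivAt_infty
    have h3 := DFunLike.congr_fun ((h1.congr_of_eventuallyEq
      (hVW.mono fun z hz => hz.symm)).unique h2) v
    simp only [add_apply, ContinuousLinearMap.comp_apply,
      ContinuousLinearMap.flip_apply] at h3
    rw [← h3]; abel
  ext1 v
  simp only [ContinuousLinearMap.comp_apply, locLieJ, sub_apply, map_sub, key, map_add,
    ← hJ.self_of_nhds v, hJ.self_of_nhds (fderiv ℝ V y v)]
  rw [hg.symm_infty (J n v), hJ2, hg.symm_infty (V y)]
  abel

end LocalLie

/-! ### Passage between the manifold and its charts -/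

section Charts

open Filter Topology

variable {n : ℕ} {M : Type*} [TopologicalSpace M] [ChartedSpace (Cn n) M]

instance instIsManifoldReal [h : IsManifold 𝓘(ℂ, Cn n) ∞ M] : IsManifold 𝓘(ℝ, Cn n) ∞ M := by
  refine isManifold_of_contDiffOn _ _ _ fun e e' he he' => ?_
  have h1 := (contDiffGroupoid ∞ 𝓘(ℂ, Cn n)).compatible he he'
  have h2 := (mem_groupoid_of_pregroupoid.1 h1).1
  simp only [contDiffPregroupoid] at h2
  simpa using (ContDiffOn.restrict_scalars ℝ h2)

variable [IsManifold 𝓘(ℂ, Cn n) ∞ M]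

/-- The domain of the change of charts `κ_b ∘ κ_a⁻¹`. -/
def transSet (a b : M) : Set (Cn n) :=
  ((chartAt (Cn n) a).symm.trans (chartAt (Cn n) b)).source

theorem isOpen_transSet (a b : M) : IsOpen (transSet (n := n) a b) :=
  ((chartAt (Cn n) a).symm.trans (chartAt (Cn n) b)).open_source

theorem mem_transSet {a b : M} {y : Cn n} : y ∈ transSet a b ↔
    y ∈ (chartAt (Cn n) a).target ∧ (chartAt (Cn n) a).symm y ∈ (chartAt (Cn n) b).source := by
  simp [transSet]

theorem chart_mem_transSet {a b x : M} (ha : x ∈ (chartAt (Cn n) a).source)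
    (hb : x ∈ (chartAt (Cn n) b).source) : chartAt (Cn n) a x ∈ transSet a b := by
  rw [mem_transSet, (chartAt (Cn n) a).left_inv ha]
  exact ⟨(chartAt (Cn n) a).map_source ha, hb⟩

/-- The change of charts `κ_b ∘ κ_a⁻¹`. -/
def trans (a b : M) : Cn n → Cn n := chartAt (Cn n) b ∘ (chartAt (Cn n) a).symm

theorem trans_chart {a b x : M} (ha : x ∈ (chartAt (Cn n) a).source) :
    trans a b (chartAt (Cn n) a x) = chartAt (Cn n) b x := by
  simp [trans, (chartAt (Cn n) a).left_inv ha]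

theorem trans_mem {a b : M} {y : Cn n} (hy : y ∈ transSet a b) :
    trans a b y ∈ (chartAt (Cn n) b).target :=
  (chartAt (Cn n) b).map_source (mem_transSet.1 hy).2

theorem contDiffOn_trans (a b : M) : ContDiffOn ℂ ∞ (trans (n := n) a b) (transSet a b) := by
  have h1 := (contDiffGroupoid ∞ 𝓘(ℂ, Cn n)).compatible (chart_mem_atlas (Cn n) a)
    (chart_mem_atlas (Cn n) b)
  have h2 := (mem_groupoid_of_pregroupoid.1 h1).1
  simp only [contDiffPregroupoid] at h2
  refine (ContDiffOn.congr_mono (by simpa using h2) (fun _ _ => rfl) ?_ : ContDiffOn ℂ ∞ _ _)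
  intro y hy
  exact mem_transSet.1 hy

theorem contDiffAt_trans {a b : M} {y : Cn n} (hy : y ∈ transSet a b) :
    ContDiffAt ℝ ∞ (trans a b) y :=
  ((contDiffOn_trans a b).contDiffAt ((isOpen_transSet a b).mem_nhds hy)).restrict_scalars ℝ

/-- The differential of a chart. -/
def dchart (a x : M) : Cn n →L[ℝ] Cn n :=
  mfderiv 𝓘(ℝ, Cn n) 𝓘(ℝ, Cn n) (chartAt (Cn n) a) x

/-- The differential of a map between manifolds, as an endomorphism of `ℂⁿ`. -/
def mder (f : M → M) (x : M) : Cn n →L[ℝ] Cn n := mfderiv 𝓘(ℝ, Cn n) 𝓘(ℝ, Cn n) f x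

/-- The differential of a function, as a covector on `ℂⁿ`. -/
def mderFun (u : M → ℝ) (x : M) : Cn n →L[ℝ] ℝ := mfderiv 𝓘(ℝ, Cn n) 𝓘(ℝ, ℝ) u x

theorem mdiffAt_chart {a x : M} (ha : x ∈ (chartAt (Cn n) a).source) :
    MDifferentiableAt 𝓘(ℝ, Cn n) 𝓘(ℝ, Cn n) (chartAt (Cn n) a) x :=
  mdifferentiableAt_atlas (chart_mem_atlas _ _) ha

theorem mdiffAt_chart_symm {a : M} {y : Cn n} (hy : y ∈ (chartAt (Cn n) a).target) :
    MDifferentiableAt 𝓘(ℝ, Cn n) 𝓘(ℝ, Cn n) (chartAt (Cn n) a).symm y :=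
  mdifferentiableAt_atlas_symm (chart_mem_atlas _ _) hy

/-- The differential of an inverse chart. -/
def dchartSymm (a : M) (y : Cn n) : Cn n →L[ℝ] Cn n :=
  mfderiv 𝓘(ℝ, Cn n) 𝓘(ℝ, Cn n) (chartAt (Cn n) a).symm y

theorem dchartSymm_comp {a x : M} (ha : x ∈ (chartAt (Cn n) a).source) :
    (dchartSymm a (chartAt (Cn n) a x)).comp (dchart a x) = ContinuousLinearMap.id ℝ (Cn n) :=
  (mdifferentiable_chart (I := 𝓘(ℝ, Cn n)) a).symm_comp_deriv ha

theorem dchart_comp {a x : M} (ha : x ∈ (chartAt (Cn n) a).source) :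
    (dchart a x).comp (dchartSymm a (chartAt (Cn n) a x)) = ContinuousLinearMap.id ℝ (Cn n) := by
  have h := (mdifferentiable_chart (I := 𝓘(ℝ, Cn n)) a).comp_symm_deriv
    ((chartAt (Cn n) a).map_source ha)
  rw [(chartAt (Cn n) a).left_inv ha] at h
  exact h

theorem dchart_isInvertible {a x : M} (ha : x ∈ (chartAt (Cn n) a).source) :
    (dchart a x : Cn n →L[ℝ] Cn n).IsInvertible :=
  .of_inverse (dchart_comp ha) (dchartSymm_comp ha)

theorem dchartSymm_dchart {a x : M} (ha : x ∈ (chartAt (Cn n) a).source) (v : Cn n) :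
    dchartSymm a (chartAt (Cn n) a x) (dchart a x v) = v :=
  DFunLike.congr_fun (dchartSymm_comp ha) v

theorem dchart_dchartSymm {a x : M} (ha : x ∈ (chartAt (Cn n) a).source) (v : Cn n) :
    dchart a x (dchartSymm a (chartAt (Cn n) a x) v) = v :=
  DFunLike.congr_fun (dchart_comp ha) v

/-- The differential of a map between manifolds in charts. -/
theorem fderiv_in_charts {f : M → M} {a b x : M} (ha : x ∈ (chartAt (Cn n) a).source)
    (hb : f x ∈ (chartAt (Cn n) b).source)
    (hf : MDifferentiableAt 𝓘(ℝ, Cn n) 𝓘(ℝ, Cn n) f x) :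
    fderiv ℝ (chartAt (Cn n) b ∘ f ∘ (chartAt (Cn n) a).symm) (chartAt (Cn n) a x) =
      (dchart b (f x)).comp ((mder f x).comp (dchartSymm a (chartAt (Cn n) a x))) := by
  have hx := (chartAt (Cn n) a).left_inv ha
  have hy := (chartAt (Cn n) a).map_source ha
  rw [← mfderiv_eq_fderiv]
  have h1 : MDifferentiableAt 𝓘(ℝ, Cn n) 𝓘(ℝ, Cn n) f
      ((chartAt (Cn n) a).symm (chartAt (Cn n) a x)) := by rwa [hx]
  have h2 : MDifferentiableAt 𝓘(ℝ, Cn n) 𝓘(ℝ, Cn n) (f ∘ (chartAt (Cn n) a).symm)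
      (chartAt (Cn n) a x) := h1.comp _ (mdiffAt_chart_symm hy)
  have h3 : MDifferentiableAt 𝓘(ℝ, Cn n) 𝓘(ℝ, Cn n) (chartAt (Cn n) b)
      ((f ∘ (chartAt (Cn n) a).symm) (chartAt (Cn n) a x)) := by
    simp only [Function.comp_apply, hx]
    exact mdiffAt_chart hb
  rw [mfderiv_comp _ h3 h2, mfderiv_comp _ h1 (mdiffAt_chart_symm hy)]
  -- The types of the differentials depend on the base point, so the equality of base points is used
  -- by substitution.
  have key : ∀ x' y, x' = x → ((mfderiv 𝓘(ℝ, Cn n) 𝓘(ℝ, Cn n) (chartAt (Cn n) b) (f x')).comp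
      ((mfderiv 𝓘(ℝ, Cn n) 𝓘(ℝ, Cn n) f x').comp (dchartSymm a y)) : Cn n →L[ℝ] Cn n) =
      (dchart b (f x)).comp ((mder f x).comp (dchartSymm a y)) := by
    rintro _ y rfl; rfl
  exact key _ _ hx

theorem fderiv_trans {a b x : M} (ha : x ∈ (chartAt (Cn n) a).source)
    (hb : x ∈ (chartAt (Cn n) b).source) :
    fderiv ℝ (trans a b) (chartAt (Cn n) a x) =
      (dchart b x).comp (dchartSymm a (chartAt (Cn n) a x)) := by
  have h := fderiv_in_charts (f := id) ha hb mdifferentiableAt_id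
  rw [show mder (id : M → M) x = ContinuousLinearMap.id ℝ (Cn n) from mfderiv_id,
    ContinuousLinearMap.id_comp] at h
  exact h

theorem dchart_self (x : M) : dchart x x = ContinuousLinearMap.id ℝ (Cn n) := by
  have h : mfderiv 𝓘(ℝ, Cn n) 𝓘(ℝ, Cn n) (extChartAt 𝓘(ℝ, Cn n) x) x = _ := mfderiv_extChartAt_self
  exact h

theorem dchartSymm_self (x : M) :
    dchartSymm x (chartAt (Cn n) x x) = ContinuousLinearMap.id ℝ (Cn n) := by
  have h := dchartSymm_comp (n := n) (mem_chart_source (Cn n) x)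
  rwa [dchart_self, ContinuousLinearMap.comp_id] at h

theorem dchart_eq_fderiv {a x : M} (ha : x ∈ (chartAt (Cn n) a).source) :
    dchart a x = fderiv ℝ (trans x a) (chartAt (Cn n) x x) := by
  rw [fderiv_trans (mem_chart_source (Cn n) x) ha, dchartSymm_self, ContinuousLinearMap.comp_id]

/-- Tangent vectors at `x` are coordinate vectors in the preferred chart, so the differential of
another chart at `x` is that of a holomorphic change of charts. -/
theorem dchart_J {a x : M} (ha : x ∈ (chartAt (Cn n) a).source) (v : Cn n) :
    dchart a x (J n v) = J n (dchart a x v) := by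
  rw [dchart_eq_fderiv ha]
  exact commJ_of_complex (isOpen_transSet x a) (contDiffOn_trans x a)
    (chart_mem_transSet (mem_chart_source (Cn n) x) ha) v

theorem dchartSymm_J {a : M} {y : Cn n} (hy : y ∈ (chartAt (Cn n) a).target) (v : Cn n) :
    dchartSymm a y (J n v) = J n (dchartSymm a y v) := by
  have hx := (chartAt (Cn n) a).map_target hy
  have hy' := (chartAt (Cn n) a).right_inv hy
  have h1 := dchart_dchartSymm hx
  have h2 := dchartSymm_dchart hx
  rw [hy'] at h1 h2
  rw [← h2 (J n (dchartSymm a y v)), dchart_J hx, h1]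

/-! ### Tensors in charts -/

theorem inChart_eq_pull (α : Tensor2 n M) (a : M) (y : Cn n) :
    inChart α a y = pull (α ((chartAt (Cn n) a).symm y)) (dchartSymm a y) := rfl

theorem inChart_chart (α : Tensor2 n M) {a x : M} (ha : x ∈ (chartAt (Cn n) a).source) :
    inChart α a (chartAt (Cn n) a x) = pull (α x) (dchartSymm a (chartAt (Cn n) a x)) := by
  rw [inChart_eq_pull, (chartAt (Cn n) a).left_inv ha]

theorem pull_inChart (α : Tensor2 n M) {a x : M} (ha : x ∈ (chartAt (Cn n) a).source) :
    pull (inChart α a (chartAt (Cn n) a x)) (dchart a x) = α x := by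
  rw [inChart_chart α ha, pull_pull, dchartSymm_comp ha, pull_id]

theorem inChart_self (α : Tensor2 n M) (x : M) : inChart α x (chartAt (Cn n) x x) = α x := by
  rw [inChart_chart α (mem_chart_source (Cn n) x), dchartSymm_self, pull_id]

theorem inChart_of_eq_pull {α : Tensor2 n M} {β : Bil n} {a x : M}
    (ha : x ∈ (chartAt (Cn n) a).source) (h : α x = pull β (dchart a x)) :
    inChart α a (chartAt (Cn n) a x) = β := by
  rw [inChart_chart α ha, h, pull_pull, dchart_comp ha, pull_id]

theorem inChart_trans (α : Tensor2 n M) {a b : M} {y : Cn n} (hy : y ∈ transSet a b) :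
    inChart α a y = pull (inChart α b (trans a b y)) (fderiv ℝ (trans a b) y) := by
  obtain ⟨h1, h2⟩ := mem_transSet.1 hy
  have hx := (chartAt (Cn n) a).map_target h1
  obtain ⟨x, rfl⟩ : ∃ x, (chartAt (Cn n) a).symm y = x := ⟨_, rfl⟩
  have hy' := (chartAt (Cn n) a).right_inv h1
  have h3 := fderiv_trans hx h2
  rw [hy'] at h3
  rw [h3, trans, Function.comp_apply, ← pull_pull, pull_inChart α h2]
  rfl

theorem IsKahlerForm.isPos {α : Tensor2 n M} (h : IsKahlerForm α) (x : M) : IsPos (α x) :=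
  ⟨⟨h.alt x, h.type_one_one x⟩, h.pos x⟩

theorem dchartSymm_isInvertible {a : M} {y : Cn n} (hy : y ∈ (chartAt (Cn n) a).target) :
    (dchartSymm a y : Cn n →L[ℝ] Cn n).IsInvertible := by
  have h1 := dchart_comp ((chartAt (Cn n) a).map_target hy)
  have h2 := dchartSymm_comp ((chartAt (Cn n) a).map_target hy)
  rw [(chartAt (Cn n) a).right_inv hy] at h1 h2
  exact .of_inverse h2 h1

theorem isPos_inChart {α : Tensor2 n M} (h : ∀ x, IsPos (α x)) {a : M} {y : Cn n}
    (hy : y ∈ (chartAt (Cn n) a).target) : IsPos (inChart α a y) :=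
  (h _).pull (dchartSymm_J hy) (dchartSymm_isInvertible hy)

theorem IsKahlerForm.localKahler {α : Tensor2 n M} (h : IsKahlerForm α) (a : M) :
    LocalKahler (inChart α a) (chartAt (Cn n) a).target :=
  ⟨(chartAt (Cn n) a).open_target, h.smooth a, fun _ hy => isPos_inChart h.isPos hy, h.closed a⟩

theorem tr_eq_trR {α χ : Tensor2 n M} {x : M} (hα : IsPos (α x)) (hχ : IsHerm (χ x)) {a : M}
    (ha : x ∈ (chartAt (Cn n) a).source) :
    tr α χ x = trR (inChart α a (chartAt (Cn n) a x)) (inChart χ a (chartAt (Cn n) a x)) := by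
  rw [tr, trAt_eq_trR hα hχ, inChart_chart α ha, inChart_chart χ ha,
    trR_pull hα.isInvertible (dchartSymm_isInvertible ((chartAt (Cn n) a).map_source ha))]

/-- The factor `2^n` separating `rho` from the determinant contributes a constant to the logarithm,
which `∂∂̄` annihilates. -/
theorem ricci_eq_locRicci {α : Tensor2 n M} (hα : IsKahlerForm α) (x : M) :
    ricci α x = locRicci (inChart α x) (chartAt (Cn n) x x) := by
  have hk := hα.localKahler x
  have h1 : (fun z => Real.log (rho (inChart α x z))) =ᶠ[𝓝 (chartAt (Cn n) x x)]
      fun z => Real.log (2 ^ n) + Real.log (coeff (inChart α x z)).det.re := by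
    filter_upwards [hk.isOpen.mem_nhds ((chartAt (Cn n) x).map_source (mem_chart_source _ x))]
      with z hz
    rw [rho, Real.log_mul (by positivity) (hk.pos z hz).coeff_det_pos.ne']
  rw [locRicci, h1.ddbarAt_eq, ddbarAt_const_add, ricci]

theorem ricci_eq_pull {α : Tensor2 n M} (hα : IsKahlerForm α) {a x : M}
    (ha : x ∈ (chartAt (Cn n) a).source) :
    ricci α x = pull (locRicci (inChart α a) (chartAt (Cn n) a x)) (dchart a x) := by
  have hx := mem_chart_source (Cn n) x
  rw [ricci_eq_locRicci hα, (hα.localKahler a).locRicci_pull (isOpen_transSet x a)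
    (contDiffOn_trans x a) (fun z hz => trans_mem hz) (fun z hz => inChart_trans α hz)
    (fun z hz => isPos_inChart hα.isPos (mem_transSet.1 hz).1) (chart_mem_transSet hx ha),
    trans_chart hx, ← dchart_eq_fderiv ha]

theorem inChart_ricci {α : Tensor2 n M} (hα : IsKahlerForm α) {a : M} {y : Cn n}
    (hy : y ∈ (chartAt (Cn n) a).target) : inChart (ricci α) a y = locRicci (inChart α a) y := by
  have hx := (chartAt (Cn n) a).map_target hy
  have h := inChart_of_eq_pull hx (ricci_eq_pull hα hx)
  rwa [(chartAt (Cn n) a).right_inv hy] at h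

theorem isHerm_ricci {α : Tensor2 n M} (hα : IsKahlerForm α) (x : M) : IsHerm (ricci α x) := by
  rw [ricci_eq_locRicci hα]
  exact (hα.localKahler x).isHerm_locRicci ((chartAt (Cn n) x).map_source (mem_chart_source _ x))

/-- A function on `M` in a chart. -/
def funInChart (u : M → ℝ) (a : M) : Cn n → ℝ := u ∘ (chartAt (Cn n) a).symm

theorem contDiffOn_funInChart {u : M → ℝ} (hu : ContMDiff 𝓘(ℝ, Cn n) 𝓘(ℝ, ℝ) ∞ u) (a : M) :
    ContDiffOn ℝ ∞ (funInChart u a) (chartAt (Cn n) a).target :=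
  contMDiffOn_iff_contDiffOn.1 (hu.comp_contMDiffOn contMDiffOn_chart_symm)

theorem contDiffAt_funInChart {u : M → ℝ} (hu : ContMDiff 𝓘(ℝ, Cn n) 𝓘(ℝ, ℝ) ∞ u) {a : M}
    {y : Cn n} (hy : y ∈ (chartAt (Cn n) a).target) : ContDiffAt ℝ ∞ (funInChart u a) y :=
  (contDiffOn_funInChart hu a).contDiffAt ((chartAt (Cn n) a).open_target.mem_nhds hy)

/-- Every point is the centre of its own preferred chart, so smoothness need only be checked at
centres; this keeps the local verifications free of changes of charts. -/
theorem contMDiff_of_funInChart {u : M → ℝ}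
    (h : ∀ a : M, ContDiffAt ℝ ∞ (funInChart u a) (chartAt (Cn n) a a)) :
    ContMDiff 𝓘(ℝ, Cn n) 𝓘(ℝ, ℝ) ∞ u := fun a => by
  have h1 : ContMDiffAt 𝓘(ℝ, Cn n) 𝓘(ℝ, ℝ) ∞ (funInChart u a ∘ chartAt (Cn n) a) a :=
    (h a).contMDiffAt.comp a ((contMDiffOn_chart (I := 𝓘(ℝ, Cn n)) (n := ∞) (H := Cn n)
      (x := a)).contMDiffAt ((chartAt (Cn n) a).open_source.mem_nhds (mem_chart_source _ a)))
  refine h1.congr_of_eventuallyEq ?_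
  filter_upwards [(chartAt (Cn n) a).open_source.mem_nhds (mem_chart_source _ a)] with x hx
  simp [funInChart, (chartAt (Cn n) a).left_inv hx]

theorem funInChart_trans (u : M → ℝ) {a b : M} {y : Cn n} (hy : y ∈ transSet a b) :
    funInChart u a y = funInChart u b (trans a b y) := by
  simp [funInChart, trans, (chartAt (Cn n) b).left_inv (mem_transSet.1 hy).2]

theorem fderiv_funInChart {u : M → ℝ} {a x : M} (ha : x ∈ (chartAt (Cn n) a).source)
    (hu : MDifferentiableAt 𝓘(ℝ, Cn n) 𝓘(ℝ, ℝ) u x) :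
    fderiv ℝ (funInChart u a) (chartAt (Cn n) a x) =
      (mderFun u x).comp (dchartSymm a (chartAt (Cn n) a x)) := by
  have hx := (chartAt (Cn n) a).left_inv ha
  have hy := (chartAt (Cn n) a).map_source ha
  rw [← mfderiv_eq_fderiv, funInChart]
  have h1 : MDifferentiableAt 𝓘(ℝ, Cn n) 𝓘(ℝ, ℝ) u
      ((chartAt (Cn n) a).symm (chartAt (Cn n) a x)) := by rwa [hx]
  rw [mfderiv_comp _ h1 (mdiffAt_chart_symm hy)]
  have key : ∀ x' y, x' = x → ((mfderiv 𝓘(ℝ, Cn n) 𝓘(ℝ, ℝ) u x').comp (dchartSymm a y) :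
      Cn n →L[ℝ] ℝ) = (mderFun u x).comp (dchartSymm a y) := by
    rintro _ y rfl; rfl
  exact key _ _ hx

theorem dAt_eq_mfderiv {u : M → ℝ} {x : M} (hu : MDifferentiableAt 𝓘(ℝ, Cn n) 𝓘(ℝ, ℝ) u x) :
    (dAt u x : Cn n →L[ℝ] ℝ) = mderFun u x := by
  have h := fderiv_funInChart (mem_chart_source (Cn n) x) hu
  rwa [dchartSymm_self, ContinuousLinearMap.comp_id] at h

theorem inChart_shift (α : Tensor2 n M) {φ : M → ℝ} (hφ : ContMDiff 𝓘(ℝ, Cn n) 𝓘(ℝ, ℝ) ∞ φ)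
    {a : M} {y : Cn n} (hy : y ∈ (chartAt (Cn n) a).target) :
    inChart (shift α φ) a y = inChart α a y + ddbarAt (funInChart φ a) y := by
  have ha := (chartAt (Cn n) a).map_target hy
  obtain ⟨x, rfl, hxa⟩ : ∃ x, chartAt (Cn n) a x = y ∧ x ∈ (chartAt (Cn n) a).source :=
    ⟨_, (chartAt (Cn n) a).right_inv hy, ha⟩
  refine inChart_of_eq_pull hxa ?_
  have hx := mem_chart_source (Cn n) x
  have hm := chart_mem_transSet hx hxa
  have h1 : funInChart φ x =ᶠ[𝓝 (chartAt (Cn n) x x)] funInChart φ a ∘ trans x a :=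
    Filter.eventually_of_mem ((isOpen_transSet x a).mem_nhds hm) fun z hz => funInChart_trans φ hz
  have h2 : ddbarAt (funInChart φ x) (chartAt (Cn n) x x) =
      pull (ddbarAt (funInChart φ a) (chartAt (Cn n) a x)) (dchart a x) := by
    rw [h1.ddbarAt_eq, ddbarAt_comp (contDiffAt_trans hm)
      (Filter.eventually_of_mem ((isOpen_transSet x a).mem_nhds hm) fun z hz v =>
        commJ_of_complex (isOpen_transSet x a) (contDiffOn_trans x a) hz v)
      (by rw [trans_chart hx]; exact contDiffAt_funInChart hφ hy), trans_chart hx,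
      dchart_eq_fderiv hxa]
  rw [shift]
  change α x + ddbarAt (funInChart φ x) _ = _
  rw [h2, ← pull_inChart α hxa]
  rfl

theorem IsKahlerForm.shift {α : Tensor2 n M} (hα : IsKahlerForm α) {φ : M → ℝ}
    (hφ : φ ∈ potentials α) : IsKahlerForm (shift α φ) := by
  obtain ⟨hφ, hpos⟩ := hφ
  have hev : ∀ a : M, ∀ y ∈ (chartAt (Cn n) a).target, inChart (TwistedKahler.shift α φ) a =ᶠ[𝓝 y]
      fun z => inChart α a z + ddbarAt (funInChart φ a) z := fun a y hy =>
    Filter.eventually_of_mem ((chartAt (Cn n) a).open_target.mem_nhds hy) fun z hz =>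
      inChart_shift α hφ hz
  have hH : ∀ x, IsHerm (TwistedKahler.shift α φ x) := fun x =>
    (hα.isPos x).toIsHerm.add (isHerm_ddbarAt (contDiffAt_funInChart hφ
      ((chartAt (Cn n) x).map_source (mem_chart_source _ x))))
  have hs : ∀ a : M, ContDiffOn ℝ ∞ (ddbarAt (funInChart φ a)) (chartAt (Cn n) a).target :=
    fun a => contDiffOn_ddbarAt (chartAt (Cn n) a).open_target (contDiffOn_funInChart hφ a)
  refine ⟨fun a => ((hα.smooth a).add (hs a)).congr fun y hy => inChart_shift α hφ hy,
    fun x => (hH x).alt, fun a y hy u v w => ?_, fun x => (hH x).inv, hpos⟩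
  have hn := (chartAt (Cn n) a).open_target.mem_nhds hy
  rw [(hev a y hy).fderiv_eq, fderiv_fun_add
    (((hα.smooth a).contDiffAt hn).differentiableAt (by simp))
    (((hs a).contDiffAt hn).differentiableAt (by simp))]
  have h1 := hα.closed a y hy u v w
  have h2 := ddbarAt_closed (chartAt (Cn n) a).open_target (contDiffOn_funInChart hφ a) hy u v w
  simp only [add_apply]
  linarith

/-! ### Vector fields in charts -/

theorem fieldInChart_chart (V : Field n M) {a x : M} (ha : x ∈ (chartAt (Cn n) a).source) :
    fieldInChart V a (chartAt (Cn n) a x) = dchart a x (V x) := by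
  rw [fieldInChart, (chartAt (Cn n) a).left_inv ha]; rfl

theorem fieldInChart_self (V : Field n M) (x : M) :
    fieldInChart V x (chartAt (Cn n) x x) = V x := by
  rw [fieldInChart_chart V (mem_chart_source _ x), dchart_self]; rfl

theorem fieldInChart_trans (V : Field n M) {a b : M} {y : Cn n} (hy : y ∈ transSet a b) :
    fderiv ℝ (trans a b) y (fieldInChart V a y) = fieldInChart V b (trans a b y) := by
  obtain ⟨h1, h2⟩ := mem_transSet.1 hy
  have hx := (chartAt (Cn n) a).map_target h1
  obtain ⟨x, rfl, hxa⟩ : ∃ x, chartAt (Cn n) a x = y ∧ x ∈ (chartAt (Cn n) a).source :=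
    ⟨_, (chartAt (Cn n) a).right_inv h1, hx⟩
  rw [(chartAt (Cn n) a).left_inv hxa] at h2
  rw [fderiv_trans hxa h2, trans_chart hxa, fieldInChart_chart V hxa, fieldInChart_chart V h2,
    ContinuousLinearMap.comp_apply, dchartSymm_dchart hxa]

theorem IsSmoothField.contDiffAt {V : Field n M} (h : IsSmoothField V) {a : M} {y : Cn n}
    (hy : y ∈ (chartAt (Cn n) a).target) : ContDiffAt ℝ ∞ (fieldInChart V a) y :=
  (h a).contDiffAt ((chartAt (Cn n) a).open_target.mem_nhds hy)

theorem dchart_comp_lieJ {V : Field n M} (hV : IsSmoothField V) {a x : M}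
    (ha : x ∈ (chartAt (Cn n) a).source) : (dchart a x).comp (lieJ V x) =
      (locLieJ (fieldInChart V a) (chartAt (Cn n) a x)).comp (dchart a x) := by
  have hx := mem_chart_source (Cn n) x
  have hm := chart_mem_transSet hx ha
  have hn := (isOpen_transSet x a).mem_nhds hm
  have h1 : DifferentiableAt ℝ (fieldInChart V a) (trans x a (chartAt (Cn n) x x)) := by
    rw [trans_chart hx]
    exact (hV.contDiffAt ((chartAt (Cn n) a).map_source ha)).differentiableAt (by simp)
  have h := locLieJ_conj (contDiffAt_trans hm)
    (Filter.eventually_of_mem hn fun z hz v =>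
        commJ_of_complex (isOpen_transSet x a) (contDiffOn_trans x a) hz v)
    ((hV.contDiffAt ((chartAt (Cn n) x).map_source hx)).differentiableAt (by simp)) h1
    (Filter.eventually_of_mem hn fun z hz => fieldInChart_trans V hz)
  rw [trans_chart hx, ← dchart_eq_fderiv ha] at h
  exact h

theorem antiJ_lieJ (V : Field n M) (x : M) : AntiJ (lieJ V x) := antiJ_comm _

/-- A vector field is smooth if it is smooth near the centre of each chart. -/
theorem isSmoothField_of_contDiffAt {V : Field n M}
    (h : ∀ a : M, ContDiffAt ℝ ∞ (fieldInChart V a) (chartAt (Cn n) a a)) : IsSmoothField V := by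
  intro a y hy
  have hx := (chartAt (Cn n) a).map_target hy
  obtain ⟨x, rfl, hxa⟩ : ∃ x, chartAt (Cn n) a x = y ∧ x ∈ (chartAt (Cn n) a).source :=
    ⟨_, (chartAt (Cn n) a).right_inv hy, hx⟩
  have hxs := mem_chart_source (Cn n) x
  have hm := chart_mem_transSet hxa hxs
  have h1 : fieldInChart V a =ᶠ[𝓝 (chartAt (Cn n) a x)] fun z =>
      fderiv ℝ (trans x a) (trans a x z) (fieldInChart V x (trans a x z)) := by
    filter_upwards [(isOpen_transSet a x).mem_nhds hm] with z hz
    have hz1 := (mem_transSet.1 hz)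
    have hz2 : trans a x z ∈ transSet x a := by
      rw [trans, Function.comp_apply]
      exact chart_mem_transSet hz1.2 ((chartAt (Cn n) a).map_target hz1.1)
    rw [fieldInChart_trans V hz2]
    congr 1
    simp [trans, (chartAt (Cn n) x).left_inv hz1.2, (chartAt (Cn n) a).right_inv hz1.1]
  refine ContDiffAt.contDiffWithinAt (ContDiffAt.congr_of_eventuallyEq ?_ h1)
  have h2 := contDiffAt_trans hm
  refine ContDiffAt.clm_apply (ContDiffAt.comp (g := fderiv ℝ (trans x a)) _ ?_ h2)
    (ContDiffAt.comp (g := fieldInChart V x) _ ?_ h2)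
  · rw [trans_chart hxa]
    exact (contDiffAt_trans (chart_mem_transSet hxs hxa)).fderiv_infty
  · rw [trans_chart hxa]; exact h x

end Charts

/-! ### Diffeomorphisms and push-forward of forms -/

section Pushforward

open Filter Topology

variable {n : ℕ} {M : Type*} [TopologicalSpace M] [ChartedSpace (Cn n) M]
  [IsManifold 𝓘(ℂ, Cn n) ∞ M]

theorem mdiffAt_diff (f : Diff n M) (x : M) :
    MDifferentiableAt 𝓘(ℝ, Cn n) 𝓘(ℝ, Cn n) f x := f.mdifferentiable (by simp) x

theorem mder_comp {f g : M → M} {x : M} (hf : MDifferentiableAt 𝓘(ℝ, Cn n) 𝓘(ℝ, Cn n) f (g x))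
    (hg : MDifferentiableAt 𝓘(ℝ, Cn n) 𝓘(ℝ, Cn n) g x) :
    mder (n := n) (f ∘ g) x = (mder f (g x)).comp (mder g x) :=
  mfderiv_comp x hf hg

theorem mder_id (x : M) : mder (n := n) (id : M → M) x = ContinuousLinearMap.id ℝ (Cn n) :=
  mfderiv_id

theorem mder_symm_comp (f : Diff n M) (x : M) :
    (mder (n := n) f.symm (f x)).comp (mder f x) = ContinuousLinearMap.id ℝ (Cn n) := by
  rw [← mder_comp (mdiffAt_diff f.symm (f x)) (mdiffAt_diff f x), ← mder_id x]
  congr 1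
  ext z; simp

theorem mder_comp_symm (f : Diff n M) (x : M) :
    (mder (n := n) f x).comp (mder f.symm (f x)) = ContinuousLinearMap.id ℝ (Cn n) := by
  have h := mder_symm_comp f.symm (f x)
  rw [f.symm_apply_apply] at h
  exact h

theorem mder_isInvertible (f : Diff n M) (x : M) : (mder (n := n) f x).IsInvertible :=
  .of_inverse (mder_comp_symm f x) (mder_symm_comp f x)

theorem pushforward_apply (f : Diff n M) (η : Tensor2 n M) (x : M) :
    pushforward f η x = pull (η (f.symm x)) (mder f.symm x) := rfl

theorem pull_pushforward (f : Diff n M) (η : Tensor2 n M) (x : M) :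
    pull (pushforward f η (f x)) (mder f x) = η x := by
  rw [pushforward_apply, pull_pull, mder_symm_comp, pull_id, f.symm_apply_apply]

theorem pushforward_one (η : Tensor2 n M) : pushforward (1 : Diff n M) η = η := by
  ext1 x
  change pull (η x) (mder id x) = η x
  rw [mder_id, pull_id]

theorem pushforward_mul (f g : Diff n M) (η : Tensor2 n M) :
    pushforward (f * g) η = pushforward f (pushforward g η) := by
  ext1 x
  rw [pushforward_apply, pushforward_apply, pushforward_apply, pull_pull,
    ← mder_comp (mdiffAt_diff g.symm _) (mdiffAt_diff f.symm x)]
  rfl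

/-- A map between manifolds in charts. -/
def mapInCharts (f : M → M) (a b : M) : Cn n → Cn n :=
  chartAt (Cn n) b ∘ f ∘ (chartAt (Cn n) a).symm

theorem mapInCharts_chart (f : M → M) {a x : M} (b : M) (ha : x ∈ (chartAt (Cn n) a).source) :
    mapInCharts f a b (chartAt (Cn n) a x) = chartAt (Cn n) b (f x) := by
  simp [mapInCharts, (chartAt (Cn n) a).left_inv ha]

theorem fderiv_mapInCharts {f : M → M} {a b x : M} (ha : x ∈ (chartAt (Cn n) a).source)
    (hb : f x ∈ (chartAt (Cn n) b).source)
    (hf : MDifferentiableAt 𝓘(ℝ, Cn n) 𝓘(ℝ, Cn n) f x) :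
    fderiv ℝ (mapInCharts f a b) (chartAt (Cn n) a x) =
      (dchart b (f x)).comp ((mder f x).comp (dchartSymm a (chartAt (Cn n) a x))) :=
  fderiv_in_charts ha hb hf

theorem contDiffAt_mapInCharts (f : Diff n M) {a b x : M} (ha : x ∈ (chartAt (Cn n) a).source)
    (hb : f x ∈ (chartAt (Cn n) b).source) :
    ContDiffAt ℝ ∞ (mapInCharts f a b) (chartAt (Cn n) a x) := by
  rw [← contMDiffAt_iff_contDiffAt]
  have hx := (chartAt (Cn n) a).left_inv ha
  have hy := (chartAt (Cn n) a).map_source ha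
  have h1 : ContMDiffAt 𝓘(ℝ, Cn n) 𝓘(ℝ, Cn n) ∞ (chartAt (Cn n) a).symm (chartAt (Cn n) a x) :=
    (contMDiffOn_chart_symm (I := 𝓘(ℝ, Cn n)) (n := ∞) (H := Cn n) (x := a)).contMDiffAt
      ((chartAt (Cn n) a).open_target.mem_nhds hy)
  have h2 : ContMDiffAt 𝓘(ℝ, Cn n) 𝓘(ℝ, Cn n) ∞ (chartAt (Cn n) b)
      (f ((chartAt (Cn n) a).symm (chartAt (Cn n) a x))) := by
    rw [hx]
    exact (contMDiffOn_chart (I := 𝓘(ℝ, Cn n)) (n := ∞) (H := Cn n) (x := b)).contMDiffAt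
      ((chartAt (Cn n) b).open_source.mem_nhds hb)
  exact ContMDiffAt.comp _ h2 (ContMDiffAt.comp _ f.contMDiff.contMDiffAt h1)

theorem fderiv_mapInCharts_isInvertible (f : Diff n M) {a b x : M}
    (ha : x ∈ (chartAt (Cn n) a).source) (hb : f x ∈ (chartAt (Cn n) b).source) :
    (fderiv ℝ (mapInCharts f a b) (chartAt (Cn n) a x)).IsInvertible := by
  rw [fderiv_mapInCharts ha hb (mdiffAt_diff f x)]
  exact (dchart_isInvertible hb).comp ((mder_isInvertible f x).comp
    (dchartSymm_isInvertible ((chartAt (Cn n) a).map_source ha)))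

/-- In charts, `η` is the pull-back of `f_* η` by the coordinate expression of `f`: the form in
which transport to the fixed form `η` is used below. -/
theorem inChart_pushforward (f : Diff n M) (η : Tensor2 n M) {a b x : M}
    (ha : x ∈ (chartAt (Cn n) a).source) (hb : f x ∈ (chartAt (Cn n) b).source) :
    inChart η a (chartAt (Cn n) a x) =
      pull (inChart (pushforward f η) b (chartAt (Cn n) b (f x)))
        (fderiv ℝ (mapInCharts f a b) (chartAt (Cn n) a x)) := by
  rw [fderiv_mapInCharts ha hb (mdiffAt_diff f x), ← pull_pull, pull_inChart _ hb, ← pull_pull,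
    pull_pushforward, inChart_chart _ ha]

theorem IsKahlerForm.pushforward {η : Tensor2 n M} (hη : IsKahlerForm η) {f : Diff n M}
    (hf : f ∈ kahlerSpace η) : IsKahlerForm (pushforward f η) := by
  obtain ⟨φ, hφ, h⟩ := hf
  rw [h]
  exact hη.shift hφ

end Pushforward

/-! ### The measure of the volume form and its transport by diffeomorphisms -/

section Volume

open Filter Topology

variable {n : ℕ} {M : Type*} [TopologicalSpace M] [ChartedSpace (Cn n) M]
  [IsManifold 𝓘(ℂ, Cn n) ∞ M] [MeasurableSpace M] [BorelSpace M]

/-- The image of a set in a chart. -/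
def chartSet (a : M) (E : Set M) : Set (Cn n) :=
  (chartAt (Cn n) a).target ∩ (chartAt (Cn n) a).symm ⁻¹' E

theorem measurableSet_chartSet (a : M) {E : Set M} (hE : MeasurableSet E) :
    MeasurableSet (chartSet (n := n) a E) := by
  have h1 : Measurable fun y : (chartAt (Cn n) a).target => (chartAt (Cn n) a).symm y :=
    (continuousOn_iff_continuous_domRestrict.1 (chartAt (Cn n) a).continuousOn_symm).measurable
  have h2 := ((chartAt (Cn n) a).open_target.measurableSet).subtype_image (h1 hE)
  convert h2 using 1
  ext y
  simp [chartSet, and_comm]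

theorem aemeasurable_chart_symm (a : M) :
    AEMeasurable (chartAt (Cn n) a).symm
      ((volume : Measure (Cn n)).restrict (chartAt (Cn n) a).target) :=
  (chartAt (Cn n) a).continuousOn_symm.aemeasurable (chartAt (Cn n) a).open_target.measurableSet

theorem chartVolume_apply (α : Tensor2 n M) (a : M) {E : Set M} (hE : MeasurableSet E) :
    chartVolume α a E =
      ∫⁻ y in chartSet a E, ENNReal.ofReal (rho (inChart α a y)) := by
  have hT := (chartAt (Cn n) a).open_target.measurableSet
  rw [chartVolume, Measure.map_apply_of_aemeasurable
    ((aemeasurable_chart_symm a).mono_ac (withDensity_absolutelyContinuous _ _)) hE,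
    withDensity_apply', Measure.restrict_restrict' hT, Set.inter_comm]
  rfl

theorem chartVolume_inter_source (α : Tensor2 n M) (a : M) {E : Set M} (hE : MeasurableSet E) :
    chartVolume α a (E ∩ (chartAt (Cn n) a).source) = chartVolume α a E := by
  rw [chartVolume_apply α a hE,
    chartVolume_apply α a (hE.inter (chartAt (Cn n) a).open_source.measurableSet)]
  congr 2
  ext y
  simp only [chartSet, Set.mem_inter_iff, Set.mem_preimage]
  exact ⟨fun h => ⟨h.1, h.2.1⟩, fun h => ⟨h.1, h.2, (chartAt (Cn n) a).map_target h.1⟩⟩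

/-- Change of variables in `ℂⁿ`: the Jacobian `|det DF|` of the coordinate map is the factor by
which `rho_pull` says the density changes. The case `f = 1` shows that different charts define the
same measure on overlaps. -/
theorem chartVolume_pushforward {η : Tensor2 n M} (hη : ∀ x, IsPos (η x)) {f : Diff n M}
    (hf : ∀ x, IsPos (pushforward f η x)) {a b : M} {E : Set M} (hE : MeasurableSet E)
    (hb : E ⊆ (chartAt (Cn n) b).source) (ha : f ⁻¹' E ⊆ (chartAt (Cn n) a).source) :
    chartVolume (pushforward f η) b E = chartVolume η a (f ⁻¹' E) := by
  have hfE : MeasurableSet (f ⁻¹' E) := f.continuous.measurable hE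
  rw [chartVolume_apply _ b hE, chartVolume_apply _ a hfE]
  let F := mapInCharts (n := n) f a b
  have hpt : ∀ y ∈ chartSet a (f ⁻¹' E), ∃ x, x ∈ (chartAt (Cn n) a).source ∧
      chartAt (Cn n) a x = y ∧ f x ∈ E := fun y hy =>
    ⟨(chartAt (Cn n) a).symm y, (chartAt (Cn n) a).map_target hy.1,
      (chartAt (Cn n) a).right_inv hy.1, hy.2⟩
  have himg : chartSet b E = F '' chartSet a (f ⁻¹' E) := by
    ext z
    constructor
    · rintro ⟨hz1, hz2⟩
      have h1 : f (f.symm ((chartAt (Cn n) b).symm z)) = (chartAt (Cn n) b).symm z := by simp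
      have hz3 : f.symm ((chartAt (Cn n) b).symm z) ∈ f ⁻¹' E := by
        rw [Set.mem_preimage, h1]; exact hz2
      refine ⟨chartAt (Cn n) a (f.symm ((chartAt (Cn n) b).symm z)), ⟨?_, ?_⟩, ?_⟩
      · exact (chartAt (Cn n) a).map_source (ha hz3)
      · rw [Set.mem_preimage, (chartAt (Cn n) a).left_inv (ha hz3)]; exact hz3
      · simp only [F]
        rw [mapInCharts_chart _ _ (ha hz3), h1, (chartAt (Cn n) b).right_inv hz1]
    · rintro ⟨y, hy, rfl⟩
      obtain ⟨x, hx, rfl, hxE⟩ := hpt y hy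
      simp only [F]
      rw [mapInCharts_chart _ _ hx]
      refine ⟨(chartAt (Cn n) b).map_source (hb hxE), ?_⟩
      rw [Set.mem_preimage, (chartAt (Cn n) b).left_inv (hb hxE)]
      exact hxE
  have hinj : Set.InjOn F (chartSet a (f ⁻¹' E)) := by
    intro y hy z hz hyz
    obtain ⟨x, hx, rfl, hxE⟩ := hpt y hy
    obtain ⟨x', hx', rfl, hxE'⟩ := hpt z hz
    simp only [F] at hyz
    rw [mapInCharts_chart _ _ hx, mapInCharts_chart _ _ hx'] at hyz
    have := (chartAt (Cn n) b).injOn (hb hxE) (hb hxE') hyz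
    rw [f.injective this]
  rw [himg, lintegral_image_eq_lintegral_abs_det_fderiv_mul volume
    (measurableSet_chartSet a hfE) (f' := fderiv ℝ F) (fun y hy => ?_) hinj]
  · refine setLIntegral_congr_fun (measurableSet_chartSet a hfE) fun y hy => ?_
    obtain ⟨x, hx, rfl, hxE⟩ := hpt y hy
    have h1 := inChart_pushforward f η hx (hb hxE)
    have hp := isPos_inChart hη ((chartAt (Cn n) a).map_source hx)
    have h2 := rho_pull (isPos_inChart hf ((chartAt (Cn n) b).map_source (hb hxE)))
      (by rw [← h1]; exact hp)
    simp only [F]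
    rw [mapInCharts_chart _ _ hx, h1, h2, ENNReal.ofReal_mul (abs_nonneg _)]
  · obtain ⟨x, hx, rfl, hxE⟩ := hpt y hy
    exact (contDiffAt_mapInCharts f hx (hb hxE)).hasFDerivAt_infty.hasFDerivWithinAt

theorem chartVolume_compat {α : Tensor2 n M} (hα : ∀ x, IsPos (α x)) {a b : M} {E : Set M}
    (hE : MeasurableSet E) (hb : E ⊆ (chartAt (Cn n) b).source)
    (ha : E ⊆ (chartAt (Cn n) a).source) : chartVolume α b E = chartVolume α a E := by
  have h := chartVolume_pushforward (f := 1) hα (by rw [pushforward_one]; exact hα) hE hb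
    (a := a) ha
  rw [pushforward_one] at h
  exact h

/-- Measures which agree locally are equal. -/
theorem measure_ext_of_local {X : Type*} [TopologicalSpace X] [CompactSpace X] [MeasurableSpace X]
    [BorelSpace X] {μ ν : Measure X} {U : X → Set X} (hU : ∀ x, IsOpen (U x)) (hx : ∀ x, x ∈ U x)
    (h : ∀ x, ∀ E, MeasurableSet E → E ⊆ U x → μ E = ν E) : μ = ν := by
  obtain ⟨s, hs, hcov⟩ := countable_cover_nhds_of_sigmaCompact
    (f := U) fun x => (hU x).mem_nhds (hx x)
  refine Measure.ext_of_biUnion_eq_univ hs hcov fun x _ => ?_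
  ext E hE
  rw [Measure.restrict_apply hE, Measure.restrict_apply hE]
  exact h x _ (hE.inter (hU x).measurableSet) Set.inter_subset_right

variable [CompactSpace M]

/-- The supremum of measures is awkward to evaluate. It is identified with a measure `μ` glued from
a countable disjoint partition subordinate to chart domains: `μ` dominates each chart measure by
compatibility on overlaps, and is dominated by the supremum piece by piece. -/
theorem vol_apply_of_subset {α : Tensor2 n M} (hα : ∀ x, IsPos (α x)) {a : M} {E : Set M}
    (hE : MeasurableSet E) (ha : E ⊆ (chartAt (Cn n) a).source) :
    vol α E = chartVolume α a E := by
  obtain ⟨s, hs, hcov⟩ := countable_cover_nhds_of_sigmaCompact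
    (f := fun x : M => (chartAt (Cn n) x).source) fun x => chart_source_mem_nhds _ x
  have : Nonempty M := ⟨a⟩
  have hsn : s.Nonempty := by
    by_contra h
    rw [Set.not_nonempty_iff_eq_empty] at h
    simp only [h, Set.mem_empty_iff_false, Set.iUnion_of_empty, Set.iUnion_empty] at hcov
    exact Set.empty_ne_univ hcov
  obtain ⟨p, rfl⟩ := hs.exists_eq_range hsn
  let U : ℕ → Set M := fun i => (chartAt (Cn n) (p i)).source
  have hU : ⋃ i, U i = Set.univ := by simpa [U] using hcov
  -- Making the chart domains disjoint ensures that no piece of `M` is counted twice in `μ`.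
  let B : ℕ → Set M := disjointed U
  have hB : ∀ i, MeasurableSet (B i) :=
    MeasurableSet.disjointed fun i => (chartAt (Cn n) (p i)).open_source.measurableSet
  have hBU : ∀ i, B i ⊆ U i := fun i => disjointed_subset U i
  have hBd : Pairwise (Function.onFun Disjoint B) := disjoint_disjointed U
  have hBc : ⋃ i, B i = Set.univ := by rw [← hU]; exact iUnion_disjointed
  have hsplit : ∀ (ν : Measure M) {E : Set M}, MeasurableSet E → ν E = ∑' i, ν (E ∩ B i) :=
    fun ν E hE => by
      rw [← measure_iUnion (fun i j hij => (hBd hij).mono Set.inter_subset_right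
        Set.inter_subset_right) fun i => hE.inter (hB i), ← Set.inter_iUnion, hBc, Set.inter_univ]
  let μ : Measure M := Measure.sum fun i => (chartVolume α (p i)).restrict (B i)
  have hμ : ∀ {E : Set M}, MeasurableSet E → μ E = ∑' i, chartVolume α (p i) (E ∩ B i) :=
    fun {E} hE => by
      rw [Measure.sum_apply _ hE]
      exact tsum_congr fun i => Measure.restrict_apply hE
  have hμa : ∀ (b : M) {E : Set M}, MeasurableSet E → E ⊆ (chartAt (Cn n) b).source →
      μ E = chartVolume α b E := fun b E hE hb => by
    rw [hμ hE, hsplit (chartVolume α b) hE]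
    refine tsum_congr fun i => chartVolume_compat hα (hE.inter (hB i)) ?_ ?_
    · exact Set.inter_subset_right.trans (hBU i)
    · exact Set.inter_subset_left.trans hb
  have hle : ∀ b : M, chartVolume α b ≤ μ := fun b => Measure.le_iff.2 fun E hE => by
    rw [← chartVolume_inter_source α b hE, ← hμa b
      (hE.inter (chartAt (Cn n) b).open_source.measurableSet) Set.inter_subset_right]
    exact measure_mono Set.inter_subset_left
  have heq : vol α = μ := by
    refine le_antisymm (iSup_le hle) (Measure.le_iff.2 fun E hE => ?_)
    rw [hμ hE, hsplit (vol α) hE]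
    refine ENNReal.tsum_le_tsum fun i => ?_
    exact (le_iSup (fun x => chartVolume α x) (p i) : _ ≤ vol α) _
  rw [heq, hμa a hE ha]

theorem vol_restrict {α : Tensor2 n M} (hα : ∀ x, IsPos (α x)) (a : M) :
    (vol α).restrict (chartAt (Cn n) a).source = chartVolume α a := by
  ext E hE
  rw [Measure.restrict_apply hE, vol_apply_of_subset hα
    (hE.inter (chartAt (Cn n) a).open_source.measurableSet) Set.inter_subset_right,
    chartVolume_inter_source α a hE]

theorem vol_pushforward {η : Tensor2 n M} (hη : ∀ x, IsPos (η x)) {f : Diff n M}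
    (hf : ∀ x, IsPos (pushforward f η x)) : vol (pushforward f η) = (vol η).map f := by
  -- The neighbourhoods are chosen so that the set lies in a chart at `x` and its preimage in a
  -- chart at `f⁻¹ x`, as the change of variables requires.
  refine measure_ext_of_local (U := fun x : M => (chartAt (Cn n) x).source ∩
    f.symm ⁻¹' (chartAt (Cn n) (f.symm x)).source) (fun x => ?_) (fun x => ?_) fun x E hE h => ?_
  · exact (chartAt (Cn n) x).open_source.inter
      ((chartAt (Cn n) (f.symm x)).open_source.preimage f.symm.continuous)
  · exact ⟨mem_chart_source _ x, mem_chart_source _ (f.symm x)⟩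
  · have h1 : f ⁻¹' E ⊆ (chartAt (Cn n) (f.symm x)).source := fun z hz => by
      have := (h hz).2
      rwa [Set.mem_preimage, f.symm_apply_apply] at this
    have hm : Measurable f := f.continuous.measurable
    rw [Measure.map_apply hm hE, vol_apply_of_subset hf hE (h.trans Set.inter_subset_left),
      vol_apply_of_subset hη (hm hE) h1, chartVolume_pushforward hη hf hE
        (h.trans Set.inter_subset_left) h1]

theorem integral_vol_pushforward {η : Tensor2 n M} (hη : ∀ x, IsPos (η x)) {f : Diff n M}
    (hf : ∀ x, IsPos (pushforward f η x)) (g : M → ℝ) :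
    ∫ x, g x ∂(vol (pushforward f η)) = ∫ x, g (f x) ∂(vol η) := by
  rw [vol_pushforward hη hf]
  exact f.toHomeomorph.measurableEmbedding.integral_map g

theorem IsKahlerForm.continuousOn_rho {α : Tensor2 n M} (hα : IsKahlerForm α) (a : M) :
    ContinuousOn (fun y => rho (inChart α a y)) (chartAt (Cn n) a).target :=
  fun _ hy => ((hα.localKahler a).contDiffAt_rho hy).continuousAt.continuousWithinAt

theorem IsKahlerForm.isFiniteMeasure {α : Tensor2 n M} (hα : IsKahlerForm α) :
    IsFiniteMeasure (vol α) := by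
  have hloc : IsLocallyFiniteMeasure (vol α) := by
    refine ⟨fun x => ?_⟩
    let e := chartAt (Cn n) x
    have hy : e x ∈ e.target := e.map_source (mem_chart_source _ x)
    have hc := ((hα.localKahler x).contDiffAt_rho hy).continuousAt
    obtain ⟨ε, hε, hball⟩ := Metric.mem_nhds_iff.1 (Filter.inter_mem (e.open_target.mem_nhds hy)
      (hc.eventually (gt_mem_nhds (lt_add_one _))))
    have hopen : IsOpen (e.source ∩ e ⁻¹' Metric.ball (e x) ε) :=
      e.isOpen_inter_preimage Metric.isOpen_ball
    refine ⟨_, hopen.mem_nhds ⟨mem_chart_source _ x, Metric.mem_ball_self hε⟩, ?_⟩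
    rw [vol_apply_of_subset hα.isPos hopen.measurableSet Set.inter_subset_left,
      chartVolume_apply _ _ hopen.measurableSet]
    have hsub : chartSet x (e.source ∩ e ⁻¹' Metric.ball (e x) ε) ⊆ Metric.ball (e x) ε := by
      rintro y ⟨hy1, hy2⟩
      have := hy2.2
      rwa [Set.mem_preimage, e.right_inv hy1] at this
    refine (lintegral_mono_set hsub).trans_lt ?_
    refine (setLIntegral_mono' (g := fun _ => ENNReal.ofReal (rho (inChart α x (e x)) + 1))
      Metric.isOpen_ball.measurableSet fun y hy => ENNReal.ofReal_le_ofReal (hball hy).2.le).trans_lt ?_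
    rw [setLIntegral_const]
    exact ENNReal.mul_lt_top ENNReal.ofReal_lt_top Metric.isBounded_ball.measure_lt_top
  exact ⟨isCompact_univ.measure_lt_top⟩

theorem IsKahlerForm.isOpenPosMeasure {α : Tensor2 n M} (hα : IsKahlerForm α) :
    (vol α).IsOpenPosMeasure := by
  refine ⟨fun U hU hne h0 => ?_⟩
  obtain ⟨x, hx⟩ := hne
  let e := chartAt (Cn n) x
  have hopen : IsOpen (U ∩ e.source) := hU.inter e.open_source
  have h1 : vol α (U ∩ e.source) = 0 := measure_mono_null Set.inter_subset_left h0
  rw [vol_apply_of_subset hα.isPos hopen.measurableSet Set.inter_subset_right,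
    chartVolume_apply _ _ hopen.measurableSet] at h1
  have hset : chartSet x (U ∩ e.source) = e.target ∩ e.symm ⁻¹' U := by
    ext y
    exact ⟨fun h => ⟨h.1, h.2.1⟩, fun h => ⟨h.1, h.2, e.map_target h.1⟩⟩
  have hO : IsOpen (e.target ∩ e.symm ⁻¹' U) := e.isOpen_inter_preimage_symm hU
  rw [hset] at h1
  have hm : AEMeasurable (fun y => ENNReal.ofReal (rho (inChart α x y)))
      (volume.restrict (e.target ∩ e.symm ⁻¹' U)) :=
    (((hα.continuousOn_rho x).mono Set.inter_subset_left).aemeasurable hO.measurableSet).ennreal_ofReal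
  rw [lintegral_eq_zero_iff' hm] at h1
  have h2 : ∀ᵐ y ∂(volume.restrict (e.target ∩ e.symm ⁻¹' U)), False := by
    filter_upwards [h1, ae_restrict_mem hO.measurableSet] with y hy hy2
    have := (isPos_inChart hα.isPos hy2.1).rho_pos
    simp only [Pi.zero_apply, ENNReal.ofReal_eq_zero] at hy
    linarith
  rw [ae_restrict_iff' hO.measurableSet] at h2
  have h3 : volume (e.target ∩ e.symm ⁻¹' U) = 0 := by
    rw [← nonpos_iff_eq_zero, ← (ae_iff.1 h2)]
    exact measure_mono fun y hy => by simpa using hy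
  have h4 : (e.target ∩ e.symm ⁻¹' U).Nonempty :=
    ⟨e x, e.map_source (mem_chart_source _ x), by
      rw [Set.mem_preimage, e.left_inv (mem_chart_source _ x)]; exact hx⟩
  exact (hO.measure_pos volume h4).ne' h3

/-- Integrals of functions supported in the domain of a chart. -/
theorem IsKahlerForm.integral_eq_chart {α : Tensor2 n M} (hα : IsKahlerForm α) {a : M} {g : M → ℝ}
    (hg : Continuous g) (h0 : ∀ x ∉ (chartAt (Cn n) a).source, g x = 0) :
    ∫ x, g x ∂(vol α) =
      ∫ y in (chartAt (Cn n) a).target, rho (inChart α a y) * g ((chartAt (Cn n) a).symm y) := by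
  have hT := (chartAt (Cn n) a).open_target.measurableSet
  have hv : chartVolume α a = ((volume.restrict (chartAt (Cn n) a).target).withDensity
      fun y => ENNReal.ofReal (rho (inChart α a y))).map (chartAt (Cn n) a).symm := rfl
  rw [← setIntegral_eq_integral_of_forall_compl_eq_zero h0, vol_restrict hα.isPos, hv,
    integral_map ((aemeasurable_chart_symm a).mono_ac (withDensity_absolutelyContinuous _ _))
      hg.aestronglyMeasurable,
    integral_withDensity_eq_integral_toReal_smul₀
      (((hα.continuousOn_rho a).aemeasurable hT).ennreal_ofReal)
      (Filter.Eventually.of_forall fun _ => ENNReal.ofReal_lt_top)]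
  refine setIntegral_congr_fun hT fun y hy => ?_
  simp only [smul_eq_mul]
  rw [ENNReal.toReal_ofReal (isPos_inChart hα.isPos hy).rho_pos.le]

end Volume

/-! ### Hamiltonian vector fields -/

section HamiltonianFields

open Filter Topology

variable {n : ℕ} {M : Type*} [TopologicalSpace M] [ChartedSpace (Cn n) M]
  [IsManifold 𝓘(ℂ, Cn n) ∞ M]

/-- `v ↦ α x v` is bijective onto covectors by nondegeneracy, so the choice made by
`Function.invFun` is forced. -/
theorem hamField_eq_inverse {α : Tensor2 n M} {x : M} (hα : IsPos (α x)) (h : M → ℝ) :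
    hamField α h x = (α x).inverse (dAt h x) := by
  have hinj : Function.Injective fun v : Cn n => α x v := fun v w hvw => by
    rw [← inverse_apply hα.isInvertible v, ← inverse_apply hα.isInvertible w]
    exact congrArg _ hvw
  have h1 : Function.invFun (fun v : Cn n => α x v) (α x ((α x).inverse (dAt h x))) =
      (α x).inverse (dAt h x) := Function.leftInverse_invFun hinj _
  rwa [apply_inverse hα.isInvertible] at h1

theorem hamField_spec {α : Tensor2 n M} {x : M} (hα : IsPos (α x)) (h : M → ℝ) :
    α x (hamField α h x) = dAt h x := by
  rw [hamField_eq_inverse hα, apply_inverse hα.isInvertible]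

theorem eq_hamField {α : Tensor2 n M} {x : M} (hα : IsPos (α x)) {h : M → ℝ} {v : Cn n}
    (hv : α x v = dAt h x) : v = hamField α h x := by
  rw [hamField_eq_inverse hα, ← hv, inverse_apply hα.isInvertible]

theorem fieldInChart_hamField {α : Tensor2 n M} (hα : ∀ x, IsPos (α x)) {h : M → ℝ}
    (hh : ContMDiff 𝓘(ℝ, Cn n) 𝓘(ℝ, ℝ) ∞ h) {a : M} {y : Cn n}
    (hy : y ∈ (chartAt (Cn n) a).target) :
    fieldInChart (hamField α h) a y = locHam (inChart α a) (funInChart h a) y := by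
  have ha := (chartAt (Cn n) a).map_target hy
  obtain ⟨x, rfl, hxa⟩ : ∃ x, chartAt (Cn n) a x = y ∧ x ∈ (chartAt (Cn n) a).source :=
    ⟨_, (chartAt (Cn n) a).right_inv hy, ha⟩
  have hd : MDifferentiableAt 𝓘(ℝ, Cn n) 𝓘(ℝ, ℝ) h x := hh.mdifferentiableAt (by simp)
  have hp := isPos_inChart hα hy
  rw [fieldInChart_chart _ hxa, ← inverse_apply hp.isInvertible (dchart a x _), locHam]
  congr 1
  rw [fderiv_funInChart hxa hd, ← dAt_eq_mfderiv hd, ← hamField_spec (hα x), inChart_chart _ hxa]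
  ext1 v
  simp [dchartSymm_dchart hxa]

theorem contDiffAt_locHam {α : Cn n → Bil n} {U : Set (Cn n)} (hα : LocalKahler α U) {h : Cn n → ℝ}
    {y : Cn n} (hy : y ∈ U) (hh : ContDiffAt ℝ ∞ h y) : ContDiffAt ℝ ∞ (locHam α h) y :=
  (hα.contDiffAt_inverse hy).clm_apply hh.fderiv_infty

theorem IsKahlerForm.isSmoothField_hamField {α : Tensor2 n M} (hα : IsKahlerForm α) {h : M → ℝ}
    (hh : ContMDiff 𝓘(ℝ, Cn n) 𝓘(ℝ, ℝ) ∞ h) : IsSmoothField (hamField α h) := fun a y hy => by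
  refine ((contDiffAt_locHam (hα.localKahler a) hy
    (contDiffAt_funInChart hh hy)).congr_of_eventuallyEq ?_).contDiffWithinAt
  exact Filter.eventually_of_mem ((chartAt (Cn n) a).open_target.mem_nhds hy) fun z hz =>
    fieldInChart_hamField hα.isPos hh hz

theorem hamField_eq_zero {α : Tensor2 n M} (hα : ∀ x, IsPos (α x)) {h : M → ℝ} {x : M}
    (hx : x ∉ tsupport h) : hamField α h x = 0 := by
  rw [hamField_eq_inverse (hα x)]
  have h1 : (h ∘ (chartAt (Cn n) x).symm) =ᶠ[𝓝 (chartAt (Cn n) x x)] fun _ => 0 := by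
    have h2 := (chartAt (Cn n) x).continuousAt_symm
      ((chartAt (Cn n) x).map_source (mem_chart_source _ x))
    rw [ContinuousAt, (chartAt (Cn n) x).left_inv (mem_chart_source _ x)] at h2
    exact h2.eventually (notMem_tsupport_iff_eventuallyEq.1 hx)
  rw [dAt, h1.fderiv_eq]
  simp

theorem lieJ_eq_zero {V : Field n M} {x : M} (h : ∀ᶠ z in 𝓝 x, V z = 0) : lieJ V x = 0 := by
  have h1 : fieldInChart V x =ᶠ[𝓝 (chartAt (Cn n) x x)] fun _ => 0 := by
    have h2 := (chartAt (Cn n) x).continuousAt_symm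
      ((chartAt (Cn n) x).map_source (mem_chart_source _ x))
    rw [ContinuousAt, (chartAt (Cn n) x).left_inv (mem_chart_source _ x)] at h2
    filter_upwards [h2.eventually h] with z hz
    rw [fieldInChart, hz]
    exact map_zero _
  rw [lieJ, h1.fderiv_eq]
  simp

theorem lieJ_hamField_eq_zero {α : Tensor2 n M} (hα : ∀ x, IsPos (α x)) {h : M → ℝ} {x : M}
    (hx : x ∉ tsupport h) : lieJ (hamField α h) x = 0 :=
  lieJ_eq_zero (Filter.eventually_of_mem ((isClosed_tsupport h).isOpen_compl.mem_nhds hx)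
    fun _ hz => hamField_eq_zero hα hz)

end HamiltonianFields

/-! ### Partitions of unity and Stokes' theorem on `M` -/

section Localization

open Filter Topology

variable {n : ℕ} {M : Type*} [TopologicalSpace M] [ChartedSpace (Cn n) M]
  [IsManifold 𝓘(ℂ, Cn n) ∞ M] [CompactSpace M]

/-- A function supported in the domain of a chart, as a function on `ℂⁿ`. -/
def chartExt (h : M → ℝ) (a : M) : Cn n → ℝ :=
  (chartAt (Cn n) a).target.indicator (funInChart h a)

theorem chartExt_of_mem (h : M → ℝ) {a : M} {y : Cn n} (hy : y ∈ (chartAt (Cn n) a).target) :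
    chartExt h a y = funInChart h a y := Set.indicator_of_mem hy _

theorem chartExt_chart (h : M → ℝ) {a x : M} (ha : x ∈ (chartAt (Cn n) a).source) :
    chartExt h a (chartAt (Cn n) a x) = h x := by
  rw [chartExt_of_mem h ((chartAt (Cn n) a).map_source ha), funInChart, Function.comp_apply,
    (chartAt (Cn n) a).left_inv ha]

theorem chartExt_eventuallyEq (h : M → ℝ) {a : M} {y : Cn n}
    (hy : y ∈ (chartAt (Cn n) a).target) : chartExt h a =ᶠ[𝓝 y] funInChart h a :=
  Filter.eventually_of_mem ((chartAt (Cn n) a).open_target.mem_nhds hy) fun _ hz =>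
    chartExt_of_mem h hz

theorem isCompact_image_tsupport {h : M → ℝ} {a : M} (hs : tsupport h ⊆ (chartAt (Cn n) a).source) :
    IsCompact (chartAt (Cn n) a '' tsupport h) :=
  (isClosed_tsupport h).isCompact.image_of_continuousOn
    ((chartAt (Cn n) a).continuousOn.mono hs)

theorem tsupport_chartExt_subset {h : M → ℝ} {a : M} (hs : tsupport h ⊆ (chartAt (Cn n) a).source) :
    tsupport (chartExt (n := n) h a) ⊆ chartAt (Cn n) a '' tsupport h := by
  refine closure_minimal (fun y hy => ?_) (isCompact_image_tsupport hs).isClosed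
  have hyt : y ∈ (chartAt (Cn n) a).target := by
    by_contra h0
    exact hy (Set.indicator_of_notMem h0 _)
  refine ⟨(chartAt (Cn n) a).symm y, subset_tsupport h ?_, (chartAt (Cn n) a).right_inv hyt⟩
  rw [Function.mem_support, chartExt_of_mem h hyt] at hy
  exact hy

theorem hasCompactSupport_chartExt {h : M → ℝ} {a : M}
    (hs : tsupport h ⊆ (chartAt (Cn n) a).source) : HasCompactSupport (chartExt (n := n) h a) :=
  (isCompact_image_tsupport hs).of_isClosed_subset (isClosed_tsupport _)
    (tsupport_chartExt_subset hs)

theorem tsupport_chartExt_subset_target {h : M → ℝ} {a : M}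
    (hs : tsupport h ⊆ (chartAt (Cn n) a).source) :
    tsupport (chartExt (n := n) h a) ⊆ (chartAt (Cn n) a).target :=
  (tsupport_chartExt_subset hs).trans (by
    rintro _ ⟨x, hx, rfl⟩; exact (chartAt (Cn n) a).map_source (hs hx))

theorem contDiff_chartExt {h : M → ℝ} (hh : ContMDiff 𝓘(ℝ, Cn n) 𝓘(ℝ, ℝ) ∞ h) {a : M}
    (hs : tsupport h ⊆ (chartAt (Cn n) a).source) : ContDiff ℝ ∞ (chartExt (n := n) h a) :=
  contDiff_of_tsupport (isClosed_tsupport (chartExt (n := n) h a))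
    (fun _ hx => image_eq_zero_of_notMem_tsupport hx) fun _ hy =>
      (contDiffAt_funInChart hh (tsupport_chartExt_subset_target hs hy)).congr_of_eventuallyEq
        (chartExt_eventuallyEq h (tsupport_chartExt_subset_target hs hy))

/-- An induction principle for smooth functions: additive statements are local. -/
theorem contMDiff_induction [T2Space M] {p : (M → ℝ) → Prop} {U : M → Set M}
    (hU : ∀ x, IsOpen (U x)) (hx : ∀ x, x ∈ U x)
    (hloc : ∀ x, ∀ h, ContMDiff 𝓘(ℝ, Cn n) 𝓘(ℝ, ℝ) ∞ h → tsupport h ⊆ U x → p h)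
    (hadd : ∀ h k, ContMDiff 𝓘(ℝ, Cn n) 𝓘(ℝ, ℝ) ∞ h → ContMDiff 𝓘(ℝ, Cn n) 𝓘(ℝ, ℝ) ∞ k →
      p h → p k → p (h + k)) (h0 : p 0) {h : M → ℝ} (hh : ContMDiff 𝓘(ℝ, Cn n) 𝓘(ℝ, ℝ) ∞ h) :
    p h := by
  obtain ⟨t, ht⟩ := isCompact_univ.elim_finite_subcover U hU fun x _ => Set.mem_iUnion.2 ⟨x, hx x⟩
  obtain ⟨ψ, hψ⟩ := SmoothPartitionOfUnity.exists_isSubordinate 𝓘(ℝ, Cn n) isClosed_univ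
    (fun i : t => U i) (fun i => hU i) (fun x _ => by
      obtain ⟨i, hi, hxi⟩ := Set.mem_iUnion₂.1 (ht (Set.mem_univ x))
      exact Set.mem_iUnion.2 ⟨⟨i, hi⟩, hxi⟩)
  have hsm : ∀ i, ContMDiff 𝓘(ℝ, Cn n) 𝓘(ℝ, ℝ) ∞ fun x => ψ i x * h x := fun i =>
    (ψ i).contMDiff.mul hh
  have hsum : h = ∑ i, fun x => ψ i x * h x := by
    ext x
    have := ψ.sum_eq_one (Set.mem_univ x)
    rw [finsum_eq_sum_of_fintype] at this
    rw [Finset.sum_apply, ← Finset.sum_mul, this, one_mul]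
  have key : ∀ s : Finset t, ContMDiff 𝓘(ℝ, Cn n) 𝓘(ℝ, ℝ) ∞ (∑ i ∈ s, fun x => ψ i x * h x) ∧
      p (∑ i ∈ s, fun x => ψ i x * h x) := fun s => by
    classical
    induction s using Finset.induction_on with
    | empty => exact ⟨contMDiff_const (c := (0 : ℝ)), h0⟩
    | insert i s hi ih =>
      rw [Finset.sum_insert hi]
      exact ⟨(hsm i).add ih.1, hadd _ _ (hsm i) ih.1 (hloc i _ (hsm i)
        ((tsupport_mul_subset_left).trans (hψ i))) ih.2⟩
  rw [hsum]
  exact (key _).2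

variable [MeasurableSpace M] [BorelSpace M]

theorem IsKahlerForm.integrable {α : Tensor2 n M} (hα : IsKahlerForm α) {g : M → ℝ}
    (hg : Continuous g) : Integrable g (vol α) := by
  have := hα.isFiniteMeasure
  obtain ⟨C, hC⟩ := (isCompact_range hg).isBounded.exists_norm_le
  exact Integrable.of_bound hg.aestronglyMeasurable C
    (Filter.Eventually.of_forall fun x => hC _ ⟨x, rfl⟩)

theorem IsKahlerForm.integral_add {α : Tensor2 n M} (hα : IsKahlerForm α) {f g : M → ℝ}
    (hf : Continuous fun x => f x) (hg : Continuous fun x => g x) :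
    ∫ x, (f x + g x) ∂(vol α) = (∫ x, f x ∂(vol α)) + ∫ x, g x ∂(vol α) :=
  MeasureTheory.integral_add (hα.integrable hf) (hα.integrable hg)

/-- Integrals of functions supported in the domain of a chart, as integrals over `ℂⁿ`. -/
theorem IsKahlerForm.integral_eq_integral {α : Tensor2 n M} (hα : IsKahlerForm α) {a : M}
    {g : M → ℝ} {k : Cn n → ℝ} (hg : Continuous g)
    (h0 : ∀ x ∉ (chartAt (Cn n) a).source, g x = 0)
    (hk : ∀ x ∈ (chartAt (Cn n) a).source, k (chartAt (Cn n) a x) = g x)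
    (hk0 : ∀ y ∉ (chartAt (Cn n) a).target, k y = 0) :
    ∫ x, g x ∂(vol α) = ∫ y, rho (inChart α a y) * k y := by
  rw [hα.integral_eq_chart hg h0, ← setIntegral_eq_integral_of_forall_compl_eq_zero
    (s := (chartAt (Cn n) a).target) (f := fun y => rho (inChart α a y) * k y)
    (fun y hy => by rw [hk0 y hy, mul_zero])]
  refine setIntegral_congr_fun (chartAt (Cn n) a).open_target.measurableSet fun y hy => ?_
  rw [← hk _ ((chartAt (Cn n) a).map_target hy), (chartAt (Cn n) a).right_inv hy]

/-- Stokes' theorem on `M`, for functions supported in the domain of a chart. -/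
theorem IsKahlerForm.integral_mul_eq_of_extd {α : Tensor2 n M} (hα : IsKahlerForm α) {a : M}
    {h k g : M → ℝ} (hh : ContMDiff 𝓘(ℝ, Cn n) 𝓘(ℝ, ℝ) ∞ h)
    (hs : tsupport h ⊆ (chartAt (Cn n) a).source) {ζ : Cn n → Cn n →L[ℝ] ℝ}
    (hζ : ∀ x ∈ tsupport h, ContDiffAt ℝ ∞ ζ (chartAt (Cn n) a x))
    (hk : Continuous k) (hg : Continuous g)
    (hkζ : ∀ x ∈ tsupport h, k x =
      trR (inChart α a (chartAt (Cn n) a x)) (extd ζ (chartAt (Cn n) a x)))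
    (hgζ : ∀ x ∈ tsupport h, g x =
      ζ (chartAt (Cn n) a x) (fieldInChart (hamField α h) a (chartAt (Cn n) a x)))
    (hg0 : ∀ x ∉ tsupport h, g x = 0) :
    ∫ x, k x * h x ∂(vol α) = ∫ x, g x ∂(vol α) := by
  have hts := tsupport_chartExt_subset hs
  have hloc := (hα.localKahler a).integral_mul_trR_extd (contDiff_chartExt hh hs)
    (hasCompactSupport_chartExt hs) (tsupport_chartExt_subset_target hs) (ζ := ζ) (fun _ hy => by
      obtain ⟨x, hx, rfl⟩ := hts hy
      exact hζ x hx)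
  rw [hα.integral_eq_integral (a := a) (g := fun x => k x * h x) (k := fun y => chartExt h a y *
    trR (inChart α a y) (extd ζ y)) (hk.mul hh.continuous), hloc, ← hα.integral_eq_integral hg]
  · exact fun x hx => hg0 x fun hx' => hx (hs hx')
  · intro x hx
    have hy := (chartAt (Cn n) a).map_source hx
    -- Extension by zero does not change the germ of `h` at a point of the open target, hence
    -- neither its Hamiltonian field.
    have h1 : locHam (inChart α a) (chartExt h a) (chartAt (Cn n) a x) =
        fieldInChart (hamField α h) a (chartAt (Cn n) a x) := by
      rw [fieldInChart_hamField hα.isPos hh hy, locHam, locHam,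
        (chartExt_eventuallyEq h hy).fderiv_eq]
    by_cases hxs : x ∈ tsupport h
    · rw [hgζ x hxs, h1]
    · rw [hg0 x hxs, h1, fieldInChart_chart _ hx, hamField_eq_zero hα.isPos hxs, map_zero, map_zero]
  · intro y hy
    have h1 : y ∉ tsupport (chartExt (n := n) h a) := fun h' =>
      hy (tsupport_chartExt_subset_target hs h')
    rw [locHam, fderiv_of_notMem_tsupport ℝ h1, map_zero, map_zero]
  · intro x hx
    rw [image_eq_zero_of_notMem_tsupport fun hx' => hx (hs hx'), mul_zero]
  · intro x hx
    rw [chartExt_chart h hx]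
    by_cases hxs : x ∈ tsupport h
    · rw [hkζ x hxs, mul_comm]
    · rw [image_eq_zero_of_notMem_tsupport hxs, zero_mul, mul_zero]
  · intro y hy
    rw [chartExt, Set.indicator_of_notMem hy, zero_mul]

/-- The density of the volume form `α^[n]` with respect to `η^[n]`. -/
def volRatio (η α : Tensor2 n M) (x : M) : ℝ := rho (α x) / rho (η x)

/-- Both densities are multiplied by the same `|det_ℂ|²` under a holomorphic change of coordinates,
so their quotient is a function on `M`. The numerator need not be positive, which matters for
pencils of forms. -/
theorem volRatio_symm {α η : Tensor2 n M} (hα : ∀ x, IsHerm (α x)) (hη : ∀ x, IsPos (η x)) {a : M}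
    {y : Cn n} (hy : y ∈ (chartAt (Cn n) a).target) :
    volRatio η α ((chartAt (Cn n) a).symm y) = rho (inChart α a y) / rho (inChart η a y) := by
  have hJ := dchartSymm_J (n := n) hy
  have h1 := (isPos_inChart hη hy).rho_pos.ne'
  rw [inChart_eq_pull, rho_pull_of_commJ (hη _).toIsHerm hJ] at h1
  rw [inChart_eq_pull, inChart_eq_pull, rho_pull_of_commJ (hα _) hJ,
    rho_pull_of_commJ (hη _).toIsHerm hJ, mul_div_mul_left _ _ (left_ne_zero_of_mul h1), volRatio]

theorem IsKahlerForm.contMDiff_volRatio {α η : Tensor2 n M} (hα : IsKahlerForm α)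
    (hη : IsKahlerForm η) : ContMDiff 𝓘(ℝ, Cn n) 𝓘(ℝ, ℝ) ∞ (volRatio η α) :=
  contMDiff_of_funInChart fun a => by
    have hy := (chartAt (Cn n) a).map_source (mem_chart_source _ a)
    refine (((hα.localKahler a).contDiffAt_rho hy).div ((hη.localKahler a).contDiffAt_rho hy)
      (isPos_inChart hη.isPos hy).rho_pos.ne').congr_of_eventuallyEq ?_
    exact Filter.eventually_of_mem ((chartAt (Cn n) a).open_target.mem_nhds hy) fun z hz =>
      volRatio_symm (fun x => (hα.isPos x).toIsHerm) hη.isPos hz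

theorem IsKahlerForm.integral_mul_volRatio [T2Space M] {α η : Tensor2 n M} (hα : IsKahlerForm α)
    (hη : IsKahlerForm η) {g : M → ℝ} (hg : Continuous g) :
    ∫ x, g x ∂(vol α) = ∫ x, g x * volRatio η α x ∂(vol η) := by
  have hr : Continuous (volRatio η α) := (hα.contMDiff_volRatio hη).continuous
  -- The induction runs over a smooth factor multiplying `g`, and is applied to the constant factor
  -- `1`; thus `g` itself need only be continuous.
  have key := contMDiff_induction (n := n)
    (p := fun h => ∫ x, h x * g x ∂(vol α) = ∫ x, h x * (g x * volRatio η α x) ∂(vol η))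
    (U := fun x : M => (chartAt (Cn n) x).source) (fun x => (chartAt (Cn n) x).open_source)
    (fun x => mem_chart_source _ x) (fun a h hh hs => ?_) (fun h k hh hk h1 h2 => ?_) (by simp)
    (contMDiff_const (c := (1 : ℝ)))
  · simpa using key
  · have h0 : ∀ x ∉ (chartAt (Cn n) a).source, h x = 0 := fun x hx =>
      image_eq_zero_of_notMem_tsupport fun hx' => hx (hs hx')
    rw [hα.integral_eq_chart (g := fun x => h x * g x) (hh.continuous.mul hg)
      (fun x hx => by rw [h0 x hx, zero_mul]),
      hη.integral_eq_chart (g := fun x => h x * (g x * volRatio η α x))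
      (hh.continuous.mul (hg.mul hr)) (fun x hx => by rw [h0 x hx, zero_mul])]
    refine setIntegral_congr_fun (chartAt (Cn n) a).open_target.measurableSet fun y hy => ?_
    have h1 := (isPos_inChart hη.isPos hy).rho_pos.ne'
    simp only [volRatio_symm (fun x => (hα.isPos x).toIsHerm) hη.isPos hy]
    field_simp
  · simp only [Pi.add_apply, add_mul]
    rw [hα.integral_add (f := fun x => h x * g x) (g := fun x => k x * g x)
      (hh.continuous.mul hg) (hk.continuous.mul hg),
      hη.integral_add (f := fun x => h x * (g x * volRatio η α x))
      (g := fun x => k x * (g x * volRatio η α x))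
      (hh.continuous.mul (hg.mul hr)) (hk.continuous.mul (hg.mul hr)), h1, h2]

end Localization

/-! ### Smooth dependence on parameters and differentiation under the integral -/

section Parameters

open Filter Topology

variable {n : ℕ} {M : Type*} [TopologicalSpace M] [ChartedSpace (Cn n) M]
  {P : Type*} [NormedAddCommGroup P] [NormedSpace ℝ P]

/-- Functions depending smoothly on a point of `M` and on parameters. -/
def SmoothParam (n : ℕ) {M : Type*} [TopologicalSpace M] [ChartedSpace (Cn n) M]
    {P : Type*} [NormedAddCommGroup P] [NormedSpace ℝ P] (K : P → M → ℝ) : Prop :=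
  ∀ p (a : M), ContDiffAt ℝ ∞ (fun q : P × Cn n => K q.1 ((chartAt (Cn n) a).symm q.2))
    (p, chartAt (Cn n) a a)

theorem SmoothParam.hasFDerivAt {K : P → M → ℝ} (h : SmoothParam n K) (p : P) (x : M) :
    HasFDerivAt (fun q => K q x) (fderiv ℝ (fun q => K q x) p) p := by
  have h1 := (h p x).comp p (f := fun q => (q, chartAt (Cn n) x x))
    (contDiffAt_id.prodMk contDiffAt_const)
  have h2 : (fun q : P × Cn n => K q.1 ((chartAt (Cn n) x).symm q.2)) ∘
      (fun q => (q, chartAt (Cn n) x x)) = fun q => K q x := by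
    ext q
    simp [(chartAt (Cn n) x).left_inv (mem_chart_source _ x)]
  rw [h2] at h1
  exact h1.hasFDerivAt_infty

theorem continuousAt_of_chart {X Y : Type*} [TopologicalSpace X] [TopologicalSpace Y]
    {g : X × M → Y} {p : X} {a : M}
    (h : ContinuousAt (fun q : X × Cn n => g (q.1, (chartAt (Cn n) a).symm q.2))
      (p, chartAt (Cn n) a a)) : ContinuousAt g (p, a) := by
  have h1 : ContinuousAt (fun q : X × M => (q.1, chartAt (Cn n) a q.2)) (p, a) :=
    continuousAt_fst.prodMk (((chartAt (Cn n) a).continuousAt (mem_chart_source _ a)).comp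
      continuousAt_snd)
  refine (h.comp (f := fun q : X × M => (q.1, chartAt (Cn n) a q.2)) h1).congr ?_
  have h2 : ∀ᶠ q : X × M in 𝓝 (p, a), q.2 ∈ (chartAt (Cn n) a).source :=
    continuousAt_snd.eventually ((chartAt (Cn n) a).open_source.mem_nhds (mem_chart_source _ a))
  filter_upwards [h2] with q hq
  simp [(chartAt (Cn n) a).left_inv hq]

theorem SmoothParam.continuous {K : P → M → ℝ} (h : SmoothParam n K) (p : P) : Continuous (K p) := by
  have h1 : Continuous fun q : P × M => K q.1 q.2 :=
    continuous_iff_continuousAt.2 fun q => continuousAt_of_chart (n := n) (h q.1 q.2).continuousAt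
  exact h1.comp (Continuous.prodMk_right p)

theorem SmoothParam.continuousAt_fderiv [IsManifold 𝓘(ℂ, Cn n) ∞ M] {K : P → M → ℝ}
    (h : SmoothParam n K) (p : P) (x : M) :
    ContinuousAt (fun q : P × M => fderiv ℝ (fun r => K r q.2) q.1) (p, x) := by
  refine continuousAt_of_chart (n := n) ?_
  let f : P × Cn n → ℝ := fun q => K q.1 ((chartAt (Cn n) x).symm q.2)
  have hf : ContDiffAt ℝ ∞ f (p, chartAt (Cn n) x x) := h p x
  have h1 : ∀ᶠ q in 𝓝 (p, chartAt (Cn n) x x), fderiv ℝ (fun r => K r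
      ((chartAt (Cn n) x).symm q.2)) q.1 = (fderiv ℝ f q).comp (ContinuousLinearMap.inl ℝ P (Cn n)) := by
    filter_upwards [(hf.of_le (m := 1) (by simp)).eventually (by simp)] with q hq
    have h2 := (hq.differentiableAt (by simp)).hasFDerivAt.comp q.1 (f := fun r => (r, q.2))
      (hasFDerivAt_prodMk_left q.1 q.2)
    exact h2.fderiv
  refine (ContinuousAt.congr ?_ (h1.mono fun q hq => hq.symm))
  exact (hf.fderiv_infty.clm_comp contDiffAt_const).continuousAt

theorem SmoothParam.mul_const {K : P → M → ℝ} (h : SmoothParam n K) {g : M → ℝ}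
    (hg : ∀ a : M, ContDiffAt ℝ ∞ (funInChart g a) (chartAt (Cn n) a a)) :
    SmoothParam n fun p x => K p x * g x := fun p a =>
  (h p a).mul ((hg a).comp (p, chartAt (Cn n) a a) (f := fun q : P × Cn n => q.2) contDiffAt_snd)

/-- Differentiation under the integral sign. -/
theorem SmoothParam.hasFDerivAt_integral [IsManifold 𝓘(ℂ, Cn n) ∞ M] [CompactSpace M]
    [MeasurableSpace M] [BorelSpace M] [FiniteDimensional ℝ P] {μ : Measure M} [IsFiniteMeasure μ]
    {K : P → M → ℝ} (h : SmoothParam n K) (p : P) :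
    HasFDerivAt (fun q => ∫ x, K q x ∂μ) (∫ x, fderiv ℝ (fun q => K q x) p ∂μ) p := by
  have h1 := hasFDerivAt_integral_of_compact (μ := μ) (isCompact_univ (X := M)) MeasurableSet.univ
    (measure_lt_top _ _) (k := K) (k' := fun q x => fderiv ℝ (fun r => K r x) q) (p₀ := p)
    (Eventually.of_forall fun q x hx => absurd (Set.mem_univ x) hx)
    (Eventually.of_forall fun q => (h.continuous q).continuousOn)
    (Eventually.of_forall fun q x _ => h.hasFDerivAt q x)
    fun x _ => h.continuousAt_fderiv p x
  rwa [Measure.restrict_univ] at h1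

theorem SmoothParam.continuous_fderiv [IsManifold 𝓘(ℂ, Cn n) ∞ M] {K : P → M → ℝ}
    (h : SmoothParam n K) (p : P) : Continuous fun x => fderiv ℝ (fun r => K r x) p :=
  continuous_iff_continuousAt.2 fun x =>
    (h.continuousAt_fderiv p x).comp (f := fun x => (p, x)) (Continuous.prodMk_right p).continuousAt

theorem SmoothParam.fderiv_integral_apply [IsManifold 𝓘(ℂ, Cn n) ∞ M] [CompactSpace M]
    [MeasurableSpace M] [BorelSpace M] [FiniteDimensional ℝ P] {μ : Measure M} [IsFiniteMeasure μ]
    {K : P → M → ℝ} (h : SmoothParam n K) (p u : P) :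
    fderiv ℝ (fun q => ∫ x, K q x ∂μ) p u = ∫ x, fderiv ℝ (fun q => K q x) p u ∂μ := by
  rw [(h.hasFDerivAt_integral p).fderiv]
  refine ContinuousLinearMap.integral_apply ?_ u
  obtain ⟨C, hC⟩ := (isCompact_range (h.continuous_fderiv p)).isBounded.exists_norm_le
  exact Integrable.of_bound (h.continuous_fderiv p).aestronglyMeasurable C
    (Filter.Eventually.of_forall fun x => hC _ ⟨x, rfl⟩)

end Parameters

/-! ### Derivatives of pull-backs and inverses -/

section PullCalculus

variable {n : ℕ} {E : Type*} [NormedAddCommGroup E] [NormedSpace ℝ E]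

theorem pull_eq_comp (α : Bil n) (D : Cn n →L[ℝ] Cn n) : pull α D =
    ((ContinuousLinearMap.compL ℝ (Cn n) (Cn n) ℝ).flip D).comp (α.comp D) := rfl

theorem contDiffAt_pull {α : E → Bil n} {D : E → Cn n →L[ℝ] Cn n} {q : E}
    (hα : ContDiffAt ℝ ∞ α q) (hD : ContDiffAt ℝ ∞ D q) :
    ContDiffAt ℝ ∞ (fun r => pull (α r) (D r)) q := by
  simp only [pull_eq_comp]
  refine ContDiffAt.clm_comp ?_ (hα.clm_comp hD)
  exact ((ContinuousLinearMap.compL ℝ (Cn n) (Cn n) ℝ).flip).contDiff.contDiffAt.comp q hD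

theorem fderiv_apply_apply {α : E → Bil n} {V W : E → Cn n} {q : E} (hα : DifferentiableAt ℝ α q)
    (hV : DifferentiableAt ℝ V q) (hW : DifferentiableAt ℝ W q) (u : E) :
    fderiv ℝ (fun r => α r (V r) (W r)) q u = fderiv ℝ α q u (V q) (W q) +
      α q (fderiv ℝ V q u) (W q) + α q (V q) (fderiv ℝ W q u) := by
  rw [((hα.hasFDerivAt.clm_apply hV.hasFDerivAt).clm_apply hW.hasFDerivAt).fderiv]
  simp
  ring

theorem fderiv_bil_const {α : E → Bil n} {q : E} (hα : DifferentiableAt ℝ α q) (u : E)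
    (v w : Cn n) : fderiv ℝ (fun r => α r v w) q u = fderiv ℝ α q u v w := by
  rw [fderiv_apply_apply hα (differentiableAt_const v) (differentiableAt_const w)]
  simp

theorem fderiv_pull_apply {α : E → Bil n} {D : E → Cn n →L[ℝ] Cn n} {q : E}
    (hα : ContDiffAt ℝ ∞ α q) (hD : ContDiffAt ℝ ∞ D q) (u : E) (v w : Cn n) :
    fderiv ℝ (fun r => pull (α r) (D r)) q u v w = fderiv ℝ α q u (D q v) (D q w) +
      α q (fderiv ℝ D q u v) (D q w) + α q (D q v) (fderiv ℝ D q u w) := by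
  have hd : DifferentiableAt ℝ D q := hD.differentiableAt (by simp)
  rw [← fderiv_bil_const ((contDiffAt_pull hα hD).differentiableAt (by simp))]
  simp only [pull_apply]
  rw [fderiv_apply_apply (hα.differentiableAt (by simp)) (hd.clm_apply (differentiableAt_const v))
    (hd.clm_apply (differentiableAt_const w)), fderiv_clm_apply_const hd, fderiv_clm_apply_const hd]

theorem contDiffAt_inverse_comp {D : E → Cn n →L[ℝ] Cn n} {q : E} (hD : ContDiffAt ℝ ∞ D q)
    (hi : (D q).IsInvertible) : ContDiffAt ℝ ∞ (fun r => (D r).inverse) q :=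
  hi.contDiffAt_map_inverse.comp q hD

/-- Differentiate `D⁻¹ D = id`, which holds near `q` because invertibility is an open condition. -/
theorem fderiv_inverse {D : E → Cn n →L[ℝ] Cn n} {q : E} (hD : ContDiffAt ℝ ∞ D q)
    (hi : (D q).IsInvertible) (u : E) : fderiv ℝ (fun r => (D r).inverse) q u =
      -(D q).inverse.comp ((fderiv ℝ D q u).comp (D q).inverse) := by
  have h1 : (fun r => (D r).inverse.comp (D r)) =ᶠ[nhds q]
      fun _ => ContinuousLinearMap.id ℝ (Cn n) := by
    obtain ⟨e, he⟩ := hi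
    have h2 := ContinuousLinearEquiv.nhds e
    rw [he] at h2
    filter_upwards [hD.continuousAt.preimage_mem_nhds h2] with r hr
    obtain ⟨e', he'⟩ := hr
    exact ContinuousLinearMap.IsInvertible.inverse_comp_self ⟨e', he'⟩
  have h3 := ((contDiffAt_inverse_comp hD hi).hasFDerivAt_infty.clm_comp
    hD.hasFDerivAt_infty).unique ((hasFDerivAt_const _ _).congr_of_eventuallyEq h1)
  ext1 z
  have h4 := DFunLike.congr_fun (DFunLike.congr_fun h3 u) ((D q).inverse z)
  simp [hi.self_apply_inverse] at h4
  simp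
  exact eq_neg_of_add_eq_zero_right h4

/-- The infinitesimal form of the invariance of `α` under `J` and a family of diffeomorphisms. -/
theorem compat_of_invariant {α : Bil n} (hα : IsHerm α) {B : Cn n →L[ℝ] Cn n}
    (h : ∀ v w, α (B (J n v)) (J n w) + α (J n v) (B (J n w)) = α (B v) w + α v (B w)) (v w : Cn n) :
    α (((J n).comp B - B.comp (J n)) v) (J n w) +
      α (J n v) (((J n).comp B - B.comp (J n)) w) = 0 := by
  have h1 := h v w
  have h2 := hα.inv (B v) w
  have h3 := hα.inv v (B w)
  simp only [sub_apply, ContinuousLinearMap.comp_apply, map_sub]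
  linarith

/-- Pull-back commutes with the exterior derivative. -/
theorem extd_comp {ζ : Cn n → Cn n →L[ℝ] ℝ} {g : Cn n → Cn n} {y : Cn n}
    (hg : ContDiffAt ℝ ∞ g y) (hζ : ContDiffAt ℝ ∞ ζ (g y)) :
    extd (fun z => (ζ (g z)).comp (fderiv ℝ g z)) y = pull (extd ζ (g y)) (fderiv ℝ g y) := by
  ext v w
  have h1 : HasFDerivAt (fun z => ζ (g z)) ((fderiv ℝ ζ (g y)).comp (fderiv ℝ g y)) y :=
    hζ.hasFDerivAt_infty.comp y hg.hasFDerivAt_infty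
  have h2 := (h1.clm_comp hg.fderiv_infty.hasFDerivAt_infty).fderiv
  rw [extd_apply, h2, pull_apply, extd_apply]
  simp [hg.symm_infty v w]

end PullCalculus

/-! ### Families of diffeomorphisms and their velocities in charts -/

section Families

open Filter Topology

variable {n : ℕ} {M : Type*} [TopologicalSpace M] [ChartedSpace (Cn n) M]
  [IsManifold 𝓘(ℂ, Cn n) ∞ M] {P : Type*} [NormedAddCommGroup P] [NormedSpace ℝ P]

/-- A family of diffeomorphisms in charts. -/
def famChart (F : P → Diff n M) (a b : M) (q : P × Cn n) : Cn n :=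
  chartAt (Cn n) b (F q.1 ((chartAt (Cn n) a).symm q.2))

/-- The domain of `famChart`. -/
def famSet (F : P → Diff n M) (a b : M) : Set (P × Cn n) :=
  {q | q.2 ∈ (chartAt (Cn n) a).target ∧
    F q.1 ((chartAt (Cn n) a).symm q.2) ∈ (chartAt (Cn n) b).source}

/-- The differentials of a family of diffeomorphisms in charts. -/
def famD (F : P → Diff n M) (a b : M) (q : P × Cn n) : Cn n →L[ℝ] Cn n :=
  (fderiv ℝ (famChart F a b) q).comp (ContinuousLinearMap.inr ℝ P (Cn n))

theorem mem_famSet {F : P → Diff n M} {p : P} {a b x : M} (ha : x ∈ (chartAt (Cn n) a).source)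
    (hb : F p x ∈ (chartAt (Cn n) b).source) : (p, chartAt (Cn n) a x) ∈ famSet F a b :=
  ⟨(chartAt (Cn n) a).map_source ha, by simpa [(chartAt (Cn n) a).left_inv ha] using hb⟩

theorem exists_of_mem_famSet {F : P → Diff n M} {a b : M} {q : P × Cn n} (hq : q ∈ famSet F a b) :
    ∃ x, q = (q.1, chartAt (Cn n) a x) ∧ x ∈ (chartAt (Cn n) a).source ∧
      F q.1 x ∈ (chartAt (Cn n) b).source :=
  ⟨(chartAt (Cn n) a).symm q.2, by ext1 <;> simp [(chartAt (Cn n) a).right_inv hq.1],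
    (chartAt (Cn n) a).map_target hq.1, hq.2⟩

theorem famChart_chart (F : P → Diff n M) (p : P) {a x : M} (b : M)
    (ha : x ∈ (chartAt (Cn n) a).source) :
    famChart F a b (p, chartAt (Cn n) a x) = chartAt (Cn n) b (F p x) := by
  simp [famChart, (chartAt (Cn n) a).left_inv ha]

theorem contMDiffAt_prod_chart_symm {a : M} {q : P × Cn n} (hq : q.2 ∈ (chartAt (Cn n) a).target) :
    ContMDiffAt 𝓘(ℝ, P × Cn n) (𝓘(ℝ, P).prod 𝓘(ℝ, Cn n)) ∞
      (fun q : P × Cn n => (q.1, (chartAt (Cn n) a).symm q.2)) q := by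
  have h1 : ContMDiffAt 𝓘(ℝ, Cn n) 𝓘(ℝ, Cn n) ∞ (chartAt (Cn n) a).symm q.2 :=
    (contMDiffOn_chart_symm (I := 𝓘(ℝ, Cn n)) (n := ∞) (H := Cn n) (x := a)).contMDiffAt
      ((chartAt (Cn n) a).open_target.mem_nhds hq)
  exact (contDiff_fst.contMDiff.contMDiffAt).prodMk
    (h1.comp (g := (chartAt (Cn n) a).symm) q contDiff_snd.contMDiff.contMDiffAt)

variable {F : P → Diff n M}

theorem IsSmoothFamily.contMDiffAt (hF : IsSmoothFamily F) {a : M} {q : P × Cn n}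
    (hq : q.2 ∈ (chartAt (Cn n) a).target) : ContMDiffAt 𝓘(ℝ, P × Cn n) 𝓘(ℝ, Cn n) ∞
      (fun q : P × Cn n => F q.1 ((chartAt (Cn n) a).symm q.2)) q :=
  ContMDiffAt.comp q (g := fun q : P × M => F q.1 q.2) (ContMDiff.contMDiffAt hF)
    (contMDiffAt_prod_chart_symm hq)

theorem IsSmoothFamily.famSet_mem_nhds (hF : IsSmoothFamily F) {a b : M} {q : P × Cn n}
    (hq : q ∈ famSet F a b) : famSet F a b ∈ 𝓝 q :=
  Filter.inter_mem (continuousAt_snd.preimage_mem_nhds ((chartAt (Cn n) a).open_target.mem_nhds hq.1))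
    ((hF.contMDiffAt hq.1).continuousAt.preimage_mem_nhds
      ((chartAt (Cn n) b).open_source.mem_nhds hq.2))

theorem IsSmoothFamily.contDiffAt (hF : IsSmoothFamily F) {a b : M} {q : P × Cn n}
    (hq : q ∈ famSet F a b) : ContDiffAt ℝ ∞ (famChart F a b) q := by
  rw [← contMDiffAt_iff_contDiffAt]
  exact ContMDiffAt.comp q ((contMDiffOn_chart (I := 𝓘(ℝ, Cn n)) (n := ∞) (H := Cn n)
    (x := b)).contMDiffAt ((chartAt (Cn n) b).open_source.mem_nhds hq.2)) (hF.contMDiffAt hq.1)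

theorem IsSmoothFamily.contDiffAt_famD (hF : IsSmoothFamily F) {a b : M} {q : P × Cn n}
    (hq : q ∈ famSet F a b) : ContDiffAt ℝ ∞ (famD F a b) q :=
  (hF.contDiffAt hq).fderiv_infty.clm_comp contDiffAt_const

theorem IsSmoothFamily.famD_eq (hF : IsSmoothFamily F) {a b : M} {q : P × Cn n}
    (hq : q ∈ famSet F a b) : famD F a b q = fderiv ℝ (mapInCharts (F q.1) a b) q.2 :=
  ((hF.contDiffAt hq).hasFDerivAt_infty.comp q.2 (f := fun y => (q.1, y))
    (hasFDerivAt_prodMk_right q.1 q.2)).fderiv.symm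

theorem IsSmoothFamily.famD_isInvertible (hF : IsSmoothFamily F) {a b : M} {q : P × Cn n}
    (hq : q ∈ famSet F a b) : (famD F a b q).IsInvertible := by
  obtain ⟨x, hx, ha, hb⟩ := exists_of_mem_famSet hq
  rw [hF.famD_eq hq, hx]
  exact fderiv_mapInCharts_isInvertible (F q.1) ha hb

theorem IsSmoothFamily.inChart_eq (hF : IsSmoothFamily F) (η : Tensor2 n M) {a b : M} {q : P × Cn n}
    (hq : q ∈ famSet F a b) : inChart η a q.2 =
      pull (inChart (pushforward (F q.1) η) b (famChart F a b q)) (famD F a b q) := by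
  obtain ⟨x, hx, ha, hb⟩ := exists_of_mem_famSet hq
  rw [hF.famD_eq hq, hx]
  simp only
  rw [famChart_chart F _ b ha]
  exact inChart_pushforward (F q.1) η ha hb

/-- `velocity` is computed in the preferred chart at the image point; the chain rule for the change
of charts gives the same answer in any chart `b` around that point. -/
theorem IsSmoothFamily.fieldInChart_velocity (hF : IsSmoothFamily F) {a b : M} {q : P × Cn n}
    (hq : q ∈ famSet F a b) (u : P) : fieldInChart (velocity F q.1 u) b (famChart F a b q) =
      fderiv ℝ (famChart F a b) q (u, 0) := by
  obtain ⟨x, hx, ha, hb⟩ := exists_of_mem_famSet hq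
  obtain ⟨p, y⟩ := q
  obtain rfl : y = chartAt (Cn n) a x := congrArg Prod.snd hx
  simp only at hb ⊢
  have hz := mem_chart_source (Cn n) (F p x)
  have hq' : (p, chartAt (Cn n) a x) ∈ famSet F a (F p x) := mem_famSet ha hz
  rw [famChart_chart F p b ha, fieldInChart_chart _ hb, dchart_eq_fderiv hb, velocity,
    Diffeomorph.symm_apply_apply]
  have h1 : ∀ b, (p, chartAt (Cn n) a x) ∈ famSet F a b →
      HasFDerivAt (fun r => chartAt (Cn n) b (F r x))
        ((fderiv ℝ (famChart F a b) (p, chartAt (Cn n) a x)).comp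
          (ContinuousLinearMap.inl ℝ P (Cn n))) p := fun b hb' => by
    have h2 := (hF.contDiffAt hb').hasFDerivAt_infty.comp p (f := fun r => (r, chartAt (Cn n) a x))
      (hasFDerivAt_prodMk_left p _)
    refine h2.congr_of_eventuallyEq (Filter.Eventually.of_forall fun r => ?_)
    exact (famChart_chart F r b ha).symm
  have h3 := (contDiffAt_trans (chart_mem_transSet hz hb)).hasFDerivAt_infty.comp p
    (f := fun r => chartAt (Cn n) (F p x) (F r x)) (h1 _ hq')
  have h4 : (trans (F p x) b ∘ fun r => chartAt (Cn n) (F p x) (F r x)) =ᶠ[𝓝 p]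
      fun r => chartAt (Cn n) b (F r x) := by
    have h5 : ContinuousAt (fun r => (r, chartAt (Cn n) a x)) p :=
      (Continuous.prodMk_left _).continuousAt
    filter_upwards [h5.preimage_mem_nhds (hF.famSet_mem_nhds hq')] with r hr
    have h6 := hr.2
    simp only [(chartAt (Cn n) a).left_inv ha] at h6
    exact trans_chart h6
  have h7 := (h3.congr_of_eventuallyEq h4.symm).unique (h1 b hq)
  rw [(h1 _ hq').fderiv]
  exact DFunLike.congr_fun h7 u

/-- Locally the velocity is the parameter derivative of the family evaluated at `F_p⁻¹`, a
composition of smooth maps. -/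
theorem IsSmoothFamily.isSmoothField_velocity (hF : IsSmoothFamily F) (p u : P) :
    IsSmoothField (velocity F p u) := by
  refine isSmoothField_of_contDiffAt fun b => ?_
  let a : M := (F p).symm b
  have hb := mem_chart_source (Cn n) b
  have ha : (F p).symm b ∈ (chartAt (Cn n) a).source := mem_chart_source (Cn n) a
  let g := mapInCharts (n := n) (F p).symm b a
  have hg : ContDiffAt ℝ ∞ g (chartAt (Cn n) b b) := contDiffAt_mapInCharts _ hb ha
  have hgb : g (chartAt (Cn n) b b) = chartAt (Cn n) a a := mapInCharts_chart _ _ hb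
  have hq : (p, chartAt (Cn n) a a) ∈ famSet F a b := mem_famSet ha (by simp [a])
  have hc : ContinuousAt (fun w => (p, g w)) (chartAt (Cn n) b b) :=
    continuousAt_const.prodMk hg.continuousAt
  have hmem : ∀ᶠ w in 𝓝 (chartAt (Cn n) b b), (p, g w) ∈ famSet F a b :=
    hc.preimage_mem_nhds (by rw [hgb]; exact hF.famSet_mem_nhds hq)
  have hsrc : ∀ᶠ w in 𝓝 (chartAt (Cn n) b b), w ∈ (chartAt (Cn n) b).target ∧
      (F p).symm ((chartAt (Cn n) b).symm w) ∈ (chartAt (Cn n) a).source := by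
    have h1 := (chartAt (Cn n) b).continuousAt_symm ((chartAt (Cn n) b).map_source hb)
    have h2 := (F p).symm.continuous.continuousAt.comp
      (f := (chartAt (Cn n) b).symm) h1
    refine Filter.Eventually.and ((chartAt (Cn n) b).open_target.mem_nhds
      ((chartAt (Cn n) b).map_source hb)) ?_
    refine h2.preimage_mem_nhds ((chartAt (Cn n) a).open_source.mem_nhds ?_)
    simp [(chartAt (Cn n) b).left_inv hb, a]
  have hev : fieldInChart (velocity F p u) b =ᶠ[𝓝 (chartAt (Cn n) b b)]
      fun w => fderiv ℝ (famChart F a b) (p, g w) (u, 0) := by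
    filter_upwards [hmem, hsrc] with w hw hw2
    rw [← hF.fieldInChart_velocity hw]
    congr 1
    simp [famChart, g, mapInCharts, (chartAt (Cn n) a).left_inv hw2.2,
      (chartAt (Cn n) b).right_inv hw2.1]
  refine ContDiffAt.congr_of_eventuallyEq ?_ hev
  have h1 : ContDiffAt ℝ ∞ (fun w => (p, g w)) (chartAt (Cn n) b b) := contDiffAt_const.prodMk hg
  refine ContDiffAt.clm_apply (ContDiffAt.comp (g := fderiv ℝ (famChart F a b)) _ ?_ h1)
    contDiffAt_const
  rw [hgb]
  exact (hF.contDiffAt hq).fderiv_infty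

theorem famChart_mem_target {a b : M} {q : P × Cn n}
    (hq : q ∈ famSet F a b) : famChart F a b q ∈ (chartAt (Cn n) b).target :=
  (chartAt (Cn n) b).map_source hq.2

/-- Differentiate `V ∘ F = ∂_u F` in the space variable and interchange the two derivatives: `DV ·
DF = ∂_u (DF)`. -/
theorem IsSmoothFamily.fderiv_velocity (hF : IsSmoothFamily F) {a b : M} {q : P × Cn n}
    (hq : q ∈ famSet F a b) (u : P) :
    (fderiv ℝ (fieldInChart (velocity F q.1 u) b) (famChart F a b q)).comp (famD F a b q) =
      fderiv ℝ (famD F a b) q (u, 0) := by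
  have hf := hF.contDiffAt hq
  have hV := (hF.isSmoothField_velocity q.1 u).contDiffAt (famChart_mem_target hq)
  have hr : HasFDerivAt (fun y : Cn n => (q.1, y)) (ContinuousLinearMap.inr ℝ P (Cn n)) q.2 :=
    hasFDerivAt_prodMk_right q.1 q.2
  have h0 : HasFDerivAt (fun y => famChart F a b (q.1, y)) (famD F a b q) q.2 :=
    HasFDerivAt.comp (g := famChart F a b) q.2 hf.hasFDerivAt_infty hr
  have h1 : HasFDerivAt (fun y => fieldInChart (velocity F q.1 u) b (famChart F a b (q.1, y)))
      ((fderiv ℝ (fieldInChart (velocity F q.1 u) b) (famChart F a b q)).comp (famD F a b q)) q.2 :=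
    HasFDerivAt.comp (g := fieldInChart (velocity F q.1 u) b) q.2 hV.hasFDerivAt_infty h0
  have h2 : HasFDerivAt (fun y => fderiv ℝ (famChart F a b) (q.1, y) (u, 0))
      (((ContinuousLinearMap.apply ℝ (Cn n) ((u, 0) : P × Cn n)).comp
        (fderiv ℝ (fderiv ℝ (famChart F a b)) q)).comp (ContinuousLinearMap.inr ℝ P (Cn n))) q.2 :=
    HasFDerivAt.comp (g := fun q => fderiv ℝ (famChart F a b) q (u, 0)) q.2
      ((ContinuousLinearMap.apply ℝ (Cn n) ((u, 0) : P × Cn n)).hasFDerivAt.comp q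
        hf.fderiv_infty.hasFDerivAt_infty) hr
  have h3 : (fun y => fieldInChart (velocity F q.1 u) b (famChart F a b (q.1, y))) =ᶠ[𝓝 q.2]
      fun y => fderiv ℝ (famChart F a b) (q.1, y) (u, 0) := by
    filter_upwards [hr.continuousAt.preimage_mem_nhds (hF.famSet_mem_nhds hq)] with y hy
    exact hF.fieldInChart_velocity hy u
  rw [h1.unique (h2.congr_of_eventuallyEq h3)]
  ext1 v
  have h4 : fderiv ℝ (famD F a b) q (u, 0) v =
      fderiv ℝ (fderiv ℝ (famChart F a b)) q (u, 0) (0, v) := by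
    rw [← fderiv_clm_apply_const ((hF.contDiffAt_famD hq).differentiableAt (by simp))]
    exact fderiv_clm_apply_const (hf.fderiv_infty.differentiableAt (by simp)) (u, (0 : Cn n)) (0, v)
  rw [h4, ← hf.symm_infty]
  rfl

/-- The invariance of the complex structure, differentiated along a family: the forms
`(F_p)_* η` are all of type `(1,1)`. -/
theorem IsSmoothFamily.velocity_compat (hF : IsSmoothFamily F) {η : Tensor2 n M}
    (hFη : ∀ p, IsKahlerForm (pushforward (F p) η)) {a b : M} {q : P × Cn n}
    (hq : q ∈ famSet F a b) (u : P) (v w : Cn n) :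
    let α := inChart (pushforward (F q.1) η) b (famChart F a b q)
    let B := fderiv ℝ (fieldInChart (velocity F q.1 u) b) (famChart F a b q)
    α (B (J n v)) (J n w) + α (J n v) (B (J n w)) = α (B v) w + α v (B w) := by
  intro α B
  have hP := hF.contDiffAt_famD hq
  have hi := hF.famD_isInvertible hq
  have hl : HasFDerivAt (fun r : P => (r, q.2)) (ContinuousLinearMap.inl ℝ P (Cn n)) q.1 :=
    hasFDerivAt_prodMk_left q.1 q.2
  have hPl : ContDiffAt ℝ ∞ (fun r => famD F a b (r, q.2)) q.1 :=
    ContDiffAt.comp (g := famD F a b) q.1 hP (contDiffAt_id.prodMk contDiffAt_const)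
  -- Following a fixed source point, the form `(F_r)_* η` at the moving image point is the pull-back
  -- of one constant form by `Q r = (DF_r)⁻¹`, and `∂_u Q = -Q B`. Being of type `(1,1)` is a linear
  -- condition, so it passes to the derivative in `r`.
  obtain ⟨Q, hQd⟩ : ∃ Q : P → Cn n →L[ℝ] Cn n, Q = fun r => (famD F a b (r, q.2)).inverse :=
    ⟨_, rfl⟩
  have hQ : ContDiffAt ℝ ∞ Q q.1 := by rw [hQd]; exact contDiffAt_inverse_comp hPl hi
  have hmem : ∀ᶠ r in 𝓝 q.1, (r, q.2) ∈ famSet F a b :=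
    hl.continuousAt.preimage_mem_nhds (hF.famSet_mem_nhds hq)
  have hQ' : fderiv ℝ Q q.1 u = -(Q q.1).comp B := by
    have h2 : fderiv ℝ (fun r => famD F a b (r, q.2)) q.1 u = fderiv ℝ (famD F a b) q (u, 0) :=
      DFunLike.congr_fun (HasFDerivAt.comp (g := famD F a b) q.1 hP.hasFDerivAt_infty hl).fderiv u
    rw [hQd, fderiv_inverse hPl hi, h2, ← hF.fderiv_velocity hq u]
    ext1 z
    simp [hi.self_apply_inverse, B]
  have hherm : ∀ᶠ r in 𝓝 q.1, IsHerm (pull (inChart η a q.2) (Q r)) := by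
    filter_upwards [hmem] with r hr
    rw [hF.inChart_eq η hr]
    have : pull (pull (inChart (pushforward (F r) η) b (famChart F a b (r, q.2)))
        (famD F a b (r, q.2))) (Q r) =
        inChart (pushforward (F r) η) b (famChart F a b (r, q.2)) := by
      rw [pull_pull, hQd, (hF.famD_isInvertible hr).self_comp_inverse, pull_id]
    rw [this]
    exact (isPos_inChart (hFη r).isPos (famChart_mem_target hr)).toIsHerm
  have h1 := isHerm_fderiv ((contDiffAt_pull contDiffAt_const hQ).differentiableAt (by simp)) hherm u
  have h2 : ∀ v w, fderiv ℝ (fun r => pull (inChart η a q.2) (Q r)) q.1 u v w =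
      -(α (B v) w + α v (B w)) := fun v w => by
    have hα : ∀ v w, inChart η a q.2 (Q q.1 v) (Q q.1 w) = α v w := fun v w => by
      rw [hF.inChart_eq η hq, pull_apply]
      congr 1
      · congr 1
        rw [hQd]
        exact hi.self_apply_inverse v
      · rw [hQd]
        exact hi.self_apply_inverse w
    rw [fderiv_pull_apply contDiffAt_const hQ, hQ']
    simp [hα]
    ring
  have h3 := h1.inv v w
  rw [h2, h2] at h3
  linarith

end Families

/-! ### Linearity of `L_V J` in `V` -/

section FieldAlgebra

open Filter Topology

variable {n : ℕ} {M : Type*} [TopologicalSpace M] [ChartedSpace (Cn n) M]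
  [IsManifold 𝓘(ℂ, Cn n) ∞ M]

theorem fieldInChart_add (V W : Field n M) (a : M) :
    fieldInChart (V + W) a = fieldInChart V a + fieldInChart W a := by
  ext1 y
  exact map_add _ _ _

theorem fieldInChart_smul (c : ℝ) (V : Field n M) (a : M) :
    fieldInChart (c • V) a = c • fieldInChart V a := by
  ext1 y
  exact (show Cn n →L[ℝ] Cn n from mfderiv 𝓘(ℝ, Cn n) 𝓘(ℝ, Cn n) (chartAt (Cn n) a)
    ((chartAt (Cn n) a).symm y)).map_smul c (V ((chartAt (Cn n) a).symm y))

theorem fieldInChart_neg (V : Field n M) (a : M) : fieldInChart (-V) a = -fieldInChart V a := by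
  ext1 y
  exact map_neg _ _

theorem fieldInChart_mulI (V : Field n M) {a : M} {y : Cn n} (hy : y ∈ (chartAt (Cn n) a).target) :
    fieldInChart (mulI V) a y = J n (fieldInChart V a y) := by
  have hx := (chartAt (Cn n) a).map_target hy
  rw [← (chartAt (Cn n) a).right_inv hy, fieldInChart_chart _ hx, fieldInChart_chart _ hx, mulI,
    dchart_J hx]

theorem IsSmoothField.neg {V : Field n M} (hV : IsSmoothField V) : IsSmoothField (-V) := fun a => by
  rw [fieldInChart_neg]; exact (hV a).neg

theorem IsSmoothField.mulI {V : Field n M} (hV : IsSmoothField V) : IsSmoothField (mulI V) :=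
  fun a => ((J n).contDiff.comp_contDiffOn (hV a)).congr fun _ hy => fieldInChart_mulI V hy

theorem IsSmoothField.differentiableAt_self {V : Field n M} (hV : IsSmoothField V) (x : M) :
    DifferentiableAt ℝ (fieldInChart V x) (chartAt (Cn n) x x) :=
  (hV.contDiffAt ((chartAt (Cn n) x).map_source (mem_chart_source _ x))).differentiableAt (by simp)

theorem lieJ_add {V W : Field n M} (hV : IsSmoothField V) (hW : IsSmoothField W) (x : M) :
    lieJ (V + W) x = lieJ V x + lieJ W x := by
  rw [lieJ, fieldInChart_add, fderiv_add (hV.differentiableAt_self x) (hW.differentiableAt_self x),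
    lieJ, lieJ, ContinuousLinearMap.comp_add, ContinuousLinearMap.add_comp]
  abel

theorem lieJ_smul (c : ℝ) {V : Field n M} (hV : IsSmoothField V) (x : M) :
    lieJ (c • V) x = c • lieJ V x := by
  rw [lieJ, fieldInChart_smul, fderiv_const_smul (hV.differentiableAt_self x), lieJ,
    ContinuousLinearMap.comp_smul, ContinuousLinearMap.smul_comp, smul_sub]

theorem lieJ_neg (V : Field n M) (x : M) : lieJ (-V) x = -lieJ V x := by
  rw [lieJ, fieldInChart_neg, fderiv_neg, lieJ, ContinuousLinearMap.comp_neg,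
    ContinuousLinearMap.neg_comp]
  abel

/-- `J` is constant in holomorphic charts, so it can be taken out of the derivative of `J V`; this
is the integrability of the complex structure. -/
theorem lieJ_mulI {V : Field n M} (hV : IsSmoothField V) (x : M) :
    lieJ (mulI V) x = (J n).comp (lieJ V x) := by
  have h1 : fieldInChart (mulI V) x =ᶠ[𝓝 (chartAt (Cn n) x x)] fun y => J n (fieldInChart V x y) :=
    Filter.eventually_of_mem ((chartAt (Cn n) x).open_target.mem_nhds
      ((chartAt (Cn n) x).map_source (mem_chart_source _ x))) fun y hy => fieldInChart_mulI V hy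
  have h2 : fderiv ℝ (fun y => J n (fieldInChart V x y)) (chartAt (Cn n) x x) =
      (J n).comp (fderiv ℝ (fieldInChart V x) (chartAt (Cn n) x x)) :=
    ((J n).hasFDerivAt.comp _ (hV.differentiableAt_self x).hasFDerivAt).fderiv
  rw [lieJ, h1.fderiv_eq, h2, lieJ, ContinuousLinearMap.comp_sub]
  rfl

end FieldAlgebra

/-! ### Velocities and infinitesimal actions are tangent vectors -/

section Tangent

open Filter Topology

variable {n : ℕ} {M : Type*} [TopologicalSpace M] [ChartedSpace (Cn n) M]
  [IsManifold 𝓘(ℂ, Cn n) ∞ M] {P : Type*} [NormedAddCommGroup P] [NormedSpace ℝ P]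

/-- The forms `(F_p)_* η` stay of type `(1,1)` along the family; differentiating this, as
`velocity_compat` does, is equivalent to the tangency condition by `compat_of_invariant`. -/
theorem IsSmoothFamily.isTangent {F : P → Diff n M} (hF : IsSmoothFamily F) {η : Tensor2 n M}
    (hFη : ∀ p, IsKahlerForm (pushforward (F p) η)) (p u : P) :
    IsTangent η (F p) (velocity F p u) := by
  refine ⟨hF.isSmoothField_velocity p u, fun x => ?_⟩
  have ha : (F p).symm x ∈ (chartAt (Cn n) ((F p).symm x)).source := mem_chart_source _ _
  have hq : (p, chartAt (Cn n) ((F p).symm x) ((F p).symm x)) ∈ famSet F ((F p).symm x) x :=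
    mem_famSet ha (by simp)
  have h1 := hF.velocity_compat hFη hq u
  simp only at h1
  rw [famChart_chart F p x ha, Diffeomorph.apply_symm_apply, inChart_self] at h1
  exact compat_of_invariant ((hFη p).isPos x).toIsHerm h1

/-- Hamiltonian fields preserve the symplectic form. -/
theorem LocalKahler.locHam_invariant {α : Cn n → Bil n} {U : Set (Cn n)} (hα : LocalKahler α U)
    {h : Cn n → ℝ} {y : Cn n} (hy : y ∈ U) (hh : ContDiffAt ℝ ∞ h y) (v w : Cn n) :
    α y (fderiv ℝ (locHam α h) y (J n v)) (J n w) + α y (J n v) (fderiv ℝ (locHam α h) y (J n w)) =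
      α y (fderiv ℝ (locHam α h) y v) w + α y v (fderiv ℝ (locHam α h) y w) := by
  let X := locHam α h
  have hX : DifferentiableAt ℝ X y := (contDiffAt_locHam hα hy hh).differentiableAt (by simp)
  have hd : DifferentiableAt ℝ α y := (hα.smoothAt hy).differentiableAt (by simp)
  have h1 : ∀ v w, fderiv ℝ α y v (X y) w + α y (fderiv ℝ X y v) w =
      fderiv ℝ (fderiv ℝ h) y v w := fun v w => by
    have h2 : (fun z => α z (X z) w) =ᶠ[𝓝 y] fun z => fderiv ℝ h z w :=
      Filter.eventually_of_mem (hα.isOpen.mem_nhds hy) fun z hz => by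
        simp only [X]; rw [locHam_spec (hα.pos z hz)]
    have h3 := fderiv_apply_apply hd hX (differentiableAt_const w) v
    rw [h2.fderiv_eq, fderiv_clm_apply_const (hh.fderiv_infty.differentiableAt (by simp))] at h3
    simp at h3
    linarith
  have h2 : ∀ v w, fderiv ℝ α y (X y) v w + (α y (fderiv ℝ X y v) w + α y v (fderiv ℝ X y w)) = 0 :=
    fun v w => by
    have e1 := h1 v w
    have e2 := h1 w v
    have e3 := hh.symm_infty v w
    have e4 := hα.closed y hy (X y) v w
    have e5 := (hα.isHerm_fderiv hy v).antisymm (X y) w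
    have e6 := (hα.pos y hy).toIsHerm.antisymm v (fderiv ℝ X y w)
    linarith
  -- `L_X α = 0` is used at `(v, w)` and at `(Jv, Jw)`. The term `D_X α` is of type `(1,1)`, hence
  -- the same in both, and cancels.
  have h3 := h2 v w
  have h4 := h2 (J n v) (J n w)
  rw [(hα.isHerm_fderiv hy (X y)).inv] at h4
  simp only [X] at h3 h4
  linarith

theorem IsKahlerForm.lieJ_hamField_compat {α : Tensor2 n M} (hα : IsKahlerForm α) {h : M → ℝ}
    (hh : ContMDiff 𝓘(ℝ, Cn n) 𝓘(ℝ, ℝ) ∞ h) (x : M) (v w : Cn n) :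
    α x (lieJ (hamField α h) x v) (J n w) + α x (J n v) (lieJ (hamField α h) x w) = 0 := by
  have hy := (chartAt (Cn n) x).map_source (mem_chart_source _ x)
  have h1 : fieldInChart (hamField α h) x =ᶠ[𝓝 (chartAt (Cn n) x x)]
      locHam (inChart α x) (funInChart h x) :=
    Filter.eventually_of_mem ((chartAt (Cn n) x).open_target.mem_nhds hy) fun z hz =>
      fieldInChart_hamField hα.isPos hh hz
  have h2 := (hα.localKahler x).locHam_invariant hy (contDiffAt_funInChart hh hy)
  rw [← h1.fderiv_eq, inChart_self] at h2
  exact compat_of_invariant (hα.isPos x).toIsHerm h2 v w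

theorem mderFun_comp {f : M → M} {u : M → ℝ} {x : M}
    (hu : MDifferentiableAt 𝓘(ℝ, Cn n) 𝓘(ℝ, ℝ) u (f x))
    (hf : MDifferentiableAt 𝓘(ℝ, Cn n) 𝓘(ℝ, Cn n) f x) :
    mderFun (n := n) (u ∘ f) x = (mderFun u (f x)).comp (mder f x) :=
  mfderiv_comp x hu hf

/-- A symplectomorphism carries Hamiltonian fields to Hamiltonian fields; here `f` maps `(M, η)` to
`(M, f_* η)` and `h` to `h ∘ f⁻¹`. -/
theorem infAction_eq {η : Tensor2 n M} (hη : IsKahlerForm η) {f : Diff n M}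
    (hf : IsKahlerForm (pushforward f η)) {h : M → ℝ} (hh : ContMDiff 𝓘(ℝ, Cn n) 𝓘(ℝ, ℝ) ∞ h) :
    infAction η h f = -hamField (pushforward f η) (h ∘ f.symm) := by
  ext1 x
  change -(mder f (f.symm x) (hamField η h (f.symm x))) = -_
  congr 1
  refine eq_hamField (hf.isPos x) ?_
  have hd : MDifferentiableAt 𝓘(ℝ, Cn n) 𝓘(ℝ, ℝ) h (f.symm x) := hh.mdifferentiableAt (by simp)
  have hs := mdiffAt_diff f.symm x
  have h1 := mder_symm_comp f (f.symm x)
  rw [f.apply_symm_apply] at h1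
  rw [dAt_eq_mfderiv (hd.comp x hs), mderFun_comp hd hs, ← dAt_eq_mfderiv hd,
    ← hamField_spec (hη.isPos _)]
  ext1 w
  rw [pushforward_apply, pull_apply]
  have h2 := DFunLike.congr_fun h1 (hamField η h (f.symm x))
  simp only [ContinuousLinearMap.comp_apply, ContinuousLinearMap.id_apply] at h2
  rw [h2]
  rfl

theorem isTangent_infAction {η : Tensor2 n M} (hη : IsKahlerForm η) {f : Diff n M}
    (hf : IsKahlerForm (pushforward f η)) {h : M → ℝ} (hh : ContMDiff 𝓘(ℝ, Cn n) 𝓘(ℝ, ℝ) ∞ h) :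
    IsTangent η f (infAction η h f) := by
  have hl : ContMDiff 𝓘(ℝ, Cn n) 𝓘(ℝ, ℝ) ∞ (h ∘ f.symm) := hh.comp f.symm.contMDiff
  rw [infAction_eq hη hf hh]
  refine ⟨(hf.isSmoothField_hamField hl).neg, fun x v w => ?_⟩
  have := hf.lieJ_hamField_compat hl x v w
  rw [lieJ_neg]
  simp only [neg_apply, map_neg]
  linarith

end Tangent

/-! ### Cartan's formula and invariance under Hamiltonian diffeomorphisms -/

section Cartan

open Filter Topology

variable {n : ℕ} {M : Type*} [TopologicalSpace M] [ChartedSpace (Cn n) M]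
  [IsManifold 𝓘(ℂ, Cn n) ∞ M] {P : Type*} [NormedAddCommGroup P] [NormedSpace ℝ P]

/-- Cartan's formula for the variation of the pull-backs of a closed form by a family of
diffeomorphisms. -/
theorem IsSmoothFamily.fderiv_pull_closed {F : P → Diff n M} (hF : IsSmoothFamily F)
    {χ : Tensor2 n M} (hχ : IsKahlerForm χ) {a b : M} {q : P × Cn n} (hq : q ∈ famSet F a b)
    (u : P) :
    fderiv ℝ (fun r => pull (inChart χ b (famChart F a b r)) (famD F a b r)) q (u, 0) =
      extd (fun y => (inChart χ b (famChart F a b (q.1, y))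
        (fderiv ℝ (famChart F a b) (q.1, y) (u, 0))).comp (famD F a b (q.1, y))) q.2 := by
  have hf := hF.contDiffAt hq
  have hχb := (hχ.localKahler b).smoothAt (famChart_mem_target hq)
  have hχf : ContDiffAt ℝ ∞ (fun r => inChart χ b (famChart F a b r)) q := hχb.comp q hf
  have hD := hF.contDiffAt_famD hq
  have hu : ContDiffAt ℝ ∞ (fun r => fderiv ℝ (famChart F a b) r (u, 0)) q :=
    hf.fderiv_infty.clm_apply contDiffAt_const
  have hDw : ∀ w, DifferentiableAt ℝ (fun r => famD F a b r w) q := fun w =>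
    (hD.clm_apply contDiffAt_const).differentiableAt (by simp)
  have hr : HasFDerivAt (fun y : Cn n => (q.1, y)) (ContinuousLinearMap.inr ℝ P (Cn n)) q.2 :=
    hasFDerivAt_prodMk_right q.1 q.2
  have hζ : ContDiffAt ℝ ∞ (fun r => (inChart χ b (famChart F a b r)
        (fderiv ℝ (famChart F a b) r (u, 0))).comp (famD F a b r)) q :=
    (hχf.clm_apply hu).clm_comp hD
  have h1 : ∀ v w, fderiv ℝ (fun y => (inChart χ b (famChart F a b (q.1, y))
        (fderiv ℝ (famChart F a b) (q.1, y) (u, 0))).comp (famD F a b (q.1, y))) q.2 v w =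
      fderiv ℝ (fun r => inChart χ b (famChart F a b r) (fderiv ℝ (famChart F a b) r (u, 0))
        (famD F a b r w)) q (0, v) := fun v w => by
    have e : HasFDerivAt (fun y => (inChart χ b (famChart F a b (q.1, y))
        (fderiv ℝ (famChart F a b) (q.1, y) (u, 0))).comp (famD F a b (q.1, y))) _ q.2 :=
      HasFDerivAt.comp (g := fun r => (inChart χ b (famChart F a b r)
        (fderiv ℝ (famChart F a b) r (u, 0))).comp (famD F a b r)) q.2 hζ.hasFDerivAt_infty hr
    rw [e.fderiv]
    exact (fderiv_clm_apply_const (hζ.differentiableAt (by simp)) (0, v) w).symm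
  have h2 : ∀ z, fderiv ℝ (fun r => inChart χ b (famChart F a b r)) q z =
      fderiv ℝ (inChart χ b) (famChart F a b q) (fderiv ℝ (famChart F a b) q z) := fun z =>
    DFunLike.congr_fun (hχb.hasFDerivAt_infty.comp q hf.hasFDerivAt_infty).fderiv z
  have h3 : ∀ z w, fderiv ℝ (fun r => famD F a b r w) q z =
      fderiv ℝ (fderiv ℝ (famChart F a b)) q z (0, w) := fun z w =>
    fderiv_clm_apply_const (hf.fderiv_infty.differentiableAt (by simp)) z (0, w)
  have h4 : ∀ z, fderiv ℝ (fun r => fderiv ℝ (famChart F a b) r (u, 0)) q z =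
      fderiv ℝ (fderiv ℝ (famChart F a b)) q z (u, 0) := fun z =>
    fderiv_clm_apply_const (hf.fderiv_infty.differentiableAt (by simp)) z (u, 0)
  have h5 : ∀ z w, fderiv ℝ (famD F a b) q z w =
      fderiv ℝ (fderiv ℝ (famChart F a b)) q z (0, w) := fun z w => by
    rw [← h3, fderiv_clm_apply_const (hD.differentiableAt (by simp))]
  have h6 : ∀ v, fderiv ℝ (famChart F a b) q (0, v) = famD F a b q v := fun v => rfl
  ext v w
  rw [extd_apply, h1, h1, fderiv_pull_apply hχf hD,
    fderiv_apply_apply (hχf.differentiableAt (by simp)) (hu.differentiableAt (by simp)) (hDw w),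
    fderiv_apply_apply (hχf.differentiableAt (by simp)) (hu.differentiableAt (by simp)) (hDw v)]
  simp only [h2, h3, h4, h5, h6]
  have hH := (hχ.localKahler b).pos _ (famChart_mem_target hq)
  -- After expansion both sides contain first derivatives of `χ`, matched by `dχ = 0`, and second
  -- derivatives of the family, matched by their symmetry.
  have e1 := (hχ.localKahler b).closed _ (famChart_mem_target hq)
    (fderiv ℝ (famChart F a b) q (u, 0)) (famD F a b q v) (famD F a b q w)
  have e2 := ((hχ.localKahler b).isHerm_fderiv (famChart_mem_target hq) (famD F a b q v)).antisymm
    (fderiv ℝ (famChart F a b) q (u, 0)) (famD F a b q w)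
  have e3 := hH.toIsHerm.antisymm (famD F a b q v)
    (fderiv ℝ (fderiv ℝ (famChart F a b)) q (u, 0) (0, w))
  rw [hf.symm_infty (0, v) (0, w), hf.symm_infty (0, v) (u, 0), hf.symm_infty (0, w) (u, 0)]
  linarith

theorem extd_fderiv {u : Cn n → ℝ} {y : Cn n} (hu : ContDiffAt ℝ ∞ u y) :
    extd (fderiv ℝ u) y = 0 := by
  ext v w
  rw [extd_apply, hu.symm_infty v w]
  simp

theorem _root_.Filter.EventuallyEq.extd_eq {ζ ξ : Cn n → Cn n →L[ℝ] ℝ} {y : Cn n}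
    (h : ζ =ᶠ[𝓝 y] ξ) : extd ζ y = extd ξ y := by
  rw [extd, extd, h.fderiv_eq]

theorem IsSmoothFamily.pull_eq {F : P → Diff n M} (hF : IsSmoothFamily F) (χ : Tensor2 n M)
    {a b : M} {q : P × Cn n} (hq : q ∈ famSet F a b) :
    pull (inChart χ b (famChart F a b q)) (famD F a b q) =
      pull (pull (χ (F q.1 ((chartAt (Cn n) a).symm q.2)))
        (mder (F q.1) ((chartAt (Cn n) a).symm q.2))) (dchartSymm a q.2) := by
  obtain ⟨x, hx, ha, hb⟩ := exists_of_mem_famSet hq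
  obtain ⟨p, y⟩ := q
  obtain rfl : y = chartAt (Cn n) a x := congrArg Prod.snd hx
  rw [hF.famD_eq hq]
  simp only [(chartAt (Cn n) a).left_inv ha]
  rw [famChart_chart F p b ha, fderiv_mapInCharts ha hb (mdiffAt_diff (F p) x), ← pull_pull,
    pull_inChart _ hb, pull_pull]

/-- Hamiltonian isotopies preserve the symplectic form. -/
theorem IsHamiltonian.pull_eq {η : Tensor2 n M} (hη : IsKahlerForm η) {g : Diff n M}
    (hg : IsHamiltonian η g) (x : M) : pull (η (g x)) (mder g x) = η x := by
  obtain ⟨G, H, hG, hH, hGH, h0, rfl⟩ := hg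
  -- The value of `G_s^* η` at `x`, all taken in the same space of bilinear forms, so that constancy
  -- in `s` makes sense. Its derivative is the exterior derivative of a pulled-back contraction.
  let c : ℝ → Bil n := fun s => pull (η (G s x)) (mder (G s) x)
  have hx := mem_chart_source (Cn n) x
  have hc : ∀ s, HasDerivAt c 0 s := fun s => by
    let b := G s x
    have hb : G s x ∈ (chartAt (Cn n) b).source := mem_chart_source _ _
    have hq : (s, chartAt (Cn n) x x) ∈ famSet G x b := mem_famSet hx hb
    have hl : HasFDerivAt (fun r : ℝ => (r, chartAt (Cn n) x x))
        (ContinuousLinearMap.inl ℝ ℝ (Cn n)) s := hasFDerivAt_prodMk_left s _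
    have hr : HasFDerivAt (fun y : Cn n => (s, y)) (ContinuousLinearMap.inr ℝ ℝ (Cn n))
        (chartAt (Cn n) x x) := hasFDerivAt_prodMk_right s _
    have h1 : c =ᶠ[𝓝 s] fun r => pull (inChart η b (famChart G x b (r, chartAt (Cn n) x x)))
        (famD G x b (r, chartAt (Cn n) x x)) := by
      filter_upwards [hl.continuousAt.preimage_mem_nhds (hG.famSet_mem_nhds hq)] with r hr
      rw [hG.pull_eq η hr]
      simp only [(chartAt (Cn n) x).left_inv hx]
      rw [dchartSymm_self, pull_id]
    have hs : ContDiffAt ℝ ∞ (fun r => pull (inChart η b (famChart G x b r)) (famD G x b r))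
        (s, chartAt (Cn n) x x) :=
      contDiffAt_pull (ContDiffAt.comp (g := inChart η b) _
        ((hη.localKahler b).smoothAt (famChart_mem_target hq)) (hG.contDiffAt hq))
        (hG.contDiffAt_famD hq)
    have h2 := (HasFDerivAt.comp (g := fun r => pull (inChart η b (famChart G x b r))
      (famD G x b r)) s hs.hasFDerivAt_infty hl).hasDerivAt
    have h3 := hG.fderiv_pull_closed hη hq 1
    have hHs : ContMDiff 𝓘(ℝ, Cn n) 𝓘(ℝ, ℝ) ∞ (H s) :=
      hH.comp (contMDiff_const.prodMk contMDiff_id)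
    have hHb := contDiffAt_funInChart hHs (famChart_mem_target hq)
    have hfs : ContDiffAt ℝ ∞ (fun y => famChart G x b (s, y)) (chartAt (Cn n) x x) :=
      ContDiffAt.comp (g := famChart G x b) _ (hG.contDiffAt hq)
        (contDiffAt_const.prodMk contDiffAt_id)
    -- The Hamiltonian condition makes the contracted 1-form equal to `d(H_s ∘ G_s)`, so its
    -- exterior derivative vanishes.
    have h4 : (fun y => (inChart η b (famChart G x b (s, y))
        (fderiv ℝ (famChart G x b) (s, y) (1, 0))).comp (famD G x b (s, y)))
        =ᶠ[𝓝 (chartAt (Cn n) x x)] fderiv ℝ (fun y => funInChart (H s) b (famChart G x b (s, y))) := by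
      filter_upwards [hr.continuousAt.preimage_mem_nhds (hG.famSet_mem_nhds hq)] with y hy
      have hy' := famChart_mem_target hy
      have hz := (chartAt (Cn n) b).map_target hy'
      have e1 : HasFDerivAt (fun y => famChart G x b (s, y)) (famD G x b (s, y)) y :=
        HasFDerivAt.comp (g := famChart G x b) y (hG.contDiffAt hy).hasFDerivAt_infty
          (hasFDerivAt_prodMk_right s y)
      have e2 : HasFDerivAt (fun y => funInChart (H s) b (famChart G x b (s, y))) _ y :=
        HasFDerivAt.comp (g := funInChart (H s) b) y
          (contDiffAt_funInChart hHs hy').hasFDerivAt_infty e1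
      rw [e2.fderiv]
      congr 1
      rw [← hG.fieldInChart_velocity hy 1]
      obtain ⟨z, hz1, hz2⟩ : ∃ z, famChart G x b (s, y) = chartAt (Cn n) b z ∧
          z ∈ (chartAt (Cn n) b).source := ⟨_, ((chartAt (Cn n) b).right_inv hy').symm, hz⟩
      have hd : MDifferentiableAt 𝓘(ℝ, Cn n) 𝓘(ℝ, ℝ) (H s) z := hHs.mdifferentiableAt (by simp)
      simp only [hz1]
      rw [fieldInChart_chart _ hz2, inChart_chart _ hz2, fderiv_funInChart hz2 hd,
        ← dAt_eq_mfderiv hd, ← hGH]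
      ext1 w
      simp [dchartSymm_dchart hz2]
    have h5 := h4.extd_eq
    have hHf : ContDiffAt ℝ ∞ (fun y => funInChart (H s) b (famChart G x b (s, y)))
        (chartAt (Cn n) x x) := ContDiffAt.comp (g := funInChart (H s) b) _ hHb hfs
    rw [extd_fderiv hHf] at h5
    have h6 : ((fderiv ℝ (fun r => pull (inChart η b (famChart G x b r)) (famD G x b r))
        (s, chartAt (Cn n) x x)).comp (ContinuousLinearMap.inl ℝ ℝ (Cn n))) 1 = 0 := by
      rw [← h5, ← h3]; rfl
    rw [h6] at h2
    exact h2.congr_of_eventuallyEq h1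
  have h1 := is_const_of_deriv_eq_zero (fun s => (hc s).differentiableAt) (fun s => (hc s).deriv) 1 0
  simp only [c, h0] at h1
  rw [h1]
  change pull (η x) (mder id x) = η x
  rw [mder_id, pull_id]

theorem pushforward_eq_of_pull {η : Tensor2 n M} {g : Diff n M}
    (h : ∀ x, pull (η (g x)) (mder g x) = η x) : pushforward g η = η := by
  ext1 x
  rw [pushforward_apply, ← h, pull_pull, g.apply_symm_apply]
  have h1 := mder_comp_symm g (g.symm x)
  rw [g.apply_symm_apply] at h1
  rw [h1, pull_id]

/-- Preserving `η` is closed under composition and inversion, so it passes from end points of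
Hamiltonian isotopies to the group they generate. -/
theorem pushforward_hamGroup {η : Tensor2 n M} (hη : IsKahlerForm η) {g : Diff n M}
    (hg : g ∈ hamGroup η) : pushforward g η = η := by
  induction hg using Subgroup.closure_induction with
  | mem g hg => exact pushforward_eq_of_pull (IsHamiltonian.pull_eq hη hg)
  | one => exact pushforward_one η
  | mul f g _ _ hf hg => rw [pushforward_mul, hg, hf]
  | inv g _ hg =>
    conv_lhs => rw [← hg]
    rw [← pushforward_mul, inv_mul_cancel, pushforward_one]

theorem pushforward_mul_inv {η : Tensor2 n M} (hη : IsKahlerForm η) {g : Diff n M}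
    (hg : g ∈ hamGroup η) (f : Diff n M) : pushforward (f * g⁻¹) η = pushforward f η := by
  rw [pushforward_mul, pushforward_hamGroup hη (inv_mem hg)]

theorem mul_inv_mem_kahlerSpace {η : Tensor2 n M} (hη : IsKahlerForm η) {g f : Diff n M}
    (hg : g ∈ hamGroup η) (hf : f ∈ kahlerSpace η) : f * g⁻¹ ∈ kahlerSpace η := by
  obtain ⟨φ, hφ, h⟩ := hf
  exact ⟨φ, hφ, by rw [pushforward_mul_inv hη hg, h]⟩

/-- The velocity is recorded on the target, at the point `F_p(F_p⁻¹ x)`, and a fixed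
reparametrisation of the source cancels. -/
theorem velocity_mul_right (F : P → Diff n M) (g : Diff n M) (p u : P) :
    velocity (fun q => F q * g) p u = velocity F p u := by
  ext1 x
  have h1 : (F p * g).symm x = g.symm ((F p).symm x) := rfl
  have h2 : ∀ q, (F q * g) (g.symm ((F p).symm x)) = F q ((F p).symm x) := fun q => by
    rw [mul_apply, g.apply_symm_apply]
  rw [velocity, h1]
  simp only [h2]
  rfl

end Cartan

/-! ### The infinitesimal action of Hamiltonian functions -/

section InfinitesimalAction

open Filter Topology

variable {n : ℕ} {M : Type*} [TopologicalSpace M] [ChartedSpace (Cn n) M]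
  [IsManifold 𝓘(ℂ, Cn n) ∞ M]

/-- The derivative of the inverses of a family of diffeomorphisms starting at the identity. -/
theorem IsSmoothFamily.hasFDerivAt_symm {G : ℝ → Diff n M} (hG : IsSmoothFamily G) (h0 : G 0 = 1)
    (z : M) : (∀ᶠ s in 𝓝 0, (G s).symm z ∈ (chartAt (Cn n) z).source) ∧
      HasDerivAt (fun s => chartAt (Cn n) z ((G s).symm z)) (-velocity G 0 1 z) 0 := by
  have hz := mem_chart_source (Cn n) z
  let y₀ := chartAt (Cn n) z z
  have h0z : G 0 z = z := by rw [h0]; rfl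
  have hq : ((0 : ℝ), y₀) ∈ famSet G z z := mem_famSet hz (by rw [h0z]; exact hz)
  have hf := hG.contDiffAt hq
  have hf0 : famChart G z z (0, y₀) = y₀ := by
    rw [famChart_chart G 0 z hz, h0z]
  let V := fderiv ℝ (famChart G z z) (0, y₀) (1, 0)
  have hV : V = velocity G 0 1 z := by
    have h1 := hG.fieldInChart_velocity hq 1
    rw [hf0, fieldInChart_self] at h1
    exact h1.symm
  have hD : famD G z z (0, y₀) = ContinuousLinearMap.id ℝ (Cn n) := by
    rw [hG.famD_eq hq, fderiv_mapInCharts hz (by rw [h0z]; exact hz) (mdiffAt_diff _ _)]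
    simp only [h0]
    change (dchart z z).comp ((mder id z).comp (dchartSymm z y₀)) = _
    rw [mder_id, dchart_self, dchartSymm_self]
    rfl
  have hfd : ∀ σ v, fderiv ℝ (famChart G z z) (0, y₀) (σ, v) = σ • V + v := fun σ v => by
    have h1 : ((σ, v) : ℝ × Cn n) = σ • ((1, 0) : ℝ × Cn n) + (0, v) := by ext1 <;> simp
    rw [h1, map_add, map_smul]
    congr 1
    exact DFunLike.congr_fun hD v
  -- The inverses `G_s⁻¹` are read off from the inverse of `(s, y) ↦ (s, G_s y)`, to which the
  -- inverse function theorem applies. Its differential at the base point is `(σ, v) ↦ (σ, σV + v)`,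
  -- with inverse `(σ, v) ↦ (σ, v - σV)`; hence the sign of the velocity.
  let Φ : ℝ × Cn n → ℝ × Cn n := fun q => (q.1, famChart G z z q)
  let e : (ℝ × Cn n) ≃L[ℝ] (ℝ × Cn n) := ContinuousLinearEquiv.equivOfInverse
    ((ContinuousLinearMap.fst ℝ ℝ (Cn n)).prod
      ((ContinuousLinearMap.fst ℝ ℝ (Cn n)).smulRight V + ContinuousLinearMap.snd ℝ ℝ (Cn n)))
    ((ContinuousLinearMap.fst ℝ ℝ (Cn n)).prod
      (ContinuousLinearMap.snd ℝ ℝ (Cn n) - (ContinuousLinearMap.fst ℝ ℝ (Cn n)).smulRight V))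
    (fun q => by ext1 <;> simp) (fun q => by ext1 <;> simp)
  have hΦc : ContDiffAt ℝ ∞ Φ (0, y₀) := contDiffAt_fst.prodMk hf
  have hΦ : HasFDerivAt Φ (e : (ℝ × Cn n) →L[ℝ] (ℝ × Cn n)) (0, y₀) := by
    have h1 : HasFDerivAt Φ ((ContinuousLinearMap.fst ℝ ℝ (Cn n)).prod
        (fderiv ℝ (famChart G z z) (0, y₀))) (0, y₀) :=
      hasFDerivAt_fst.prodMk hf.hasFDerivAt_infty
    convert h1 using 1
    exact ContinuousLinearMap.ext fun q => Prod.ext rfl (hfd q.1 q.2).symm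
  have hst : HasStrictFDerivAt Φ (e : (ℝ × Cn n) →L[ℝ] (ℝ × Cn n)) (0, y₀) :=
    hΦc.hasStrictFDerivAt' hΦ (by simp)
  let Ψ := hst.localInverse Φ e (0, y₀)
  have hΦ0 : Φ (0, y₀) = (0, y₀) := by simp only [Φ, hf0]
  have hΨ0 : Ψ (0, y₀) = (0, y₀) := by
    have := hst.localInverse_apply_image
    rwa [hΦ0] at this
  have hΨ := hst.to_localInverse.hasFDerivAt
  rw [hΦ0] at hΨ
  have hright := hst.eventually_right_inverse
  rw [hΦ0] at hright
  have hl : HasFDerivAt (fun s : ℝ => (s, y₀)) (ContinuousLinearMap.inl ℝ ℝ (Cn n)) 0 :=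
    hasFDerivAt_prodMk_left 0 _
  have hcomp : HasFDerivAt (fun s => Ψ (s, y₀)) _ 0 := HasFDerivAt.comp (g := Ψ) 0 hΨ hl
  have hev : ∀ᶠ s in 𝓝 (0 : ℝ), (Ψ (s, y₀)).1 = s ∧
      (G s).symm z = (chartAt (Cn n) z).symm (Ψ (s, y₀)).2 ∧
      (Ψ (s, y₀)).2 ∈ (chartAt (Cn n) z).target := by
    have h1 := hcomp.continuousAt
    rw [ContinuousAt, hΨ0] at h1
    filter_upwards [hl.continuousAt.eventually hright, h1 (hG.famSet_mem_nhds hq)] with s hs1 hs2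
    have h2 : (Ψ (s, y₀)).1 = s := congrArg Prod.fst hs1
    have h3 : famChart G z z (Ψ (s, y₀)) = y₀ := congrArg Prod.snd hs1
    have hs2' : Ψ (s, y₀) ∈ famSet G z z := hs2
    refine ⟨h2, ?_, hs2'.1⟩
    have h4 : G s ((chartAt (Cn n) z).symm (Ψ (s, y₀)).2) = z := by
      have h5 := hs2'.2
      rw [h2] at h5
      refine (chartAt (Cn n) z).injOn h5 hz ?_
      rw [famChart, h2] at h3
      exact h3
    rw [← h4, Diffeomorph.symm_apply_apply, h4]
  refine ⟨hev.mono fun s hs => ?_, ?_⟩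
  · rw [hs.2.1]; exact (chartAt (Cn n) z).map_target hs.2.2
  · have h1 : HasDerivAt (fun s => (Ψ (s, y₀)).2) _ 0 :=
      (ContinuousLinearMap.snd ℝ ℝ (Cn n)).hasFDerivAt.comp_hasDerivAt 0 hcomp.hasDerivAt
    have h2 : (fun s => chartAt (Cn n) z ((G s).symm z)) =ᶠ[𝓝 0] fun s => (Ψ (s, y₀)).2 :=
      hev.mono fun s hs => by
        simp only
        rw [hs.2.1, (chartAt (Cn n) z).right_inv hs.2.2]
    refine (h1.congr_of_eventuallyEq h2).congr_deriv ?_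
    rw [← hV]
    simp [e]

theorem velocity_mul_inv {G : ℝ → Diff n M} (hG : IsSmoothFamily G) (h0 : G 0 = 1) (f : Diff n M)
    (x : M) : velocity (fun s => f * (G s)⁻¹) 0 1 x = -(mder f (f.symm x) (velocity G 0 1 (f.symm x))) := by
  let z := f.symm x
  have hz := mem_chart_source (Cn n) z
  obtain ⟨h1, h2⟩ := hG.hasFDerivAt_symm h0 z
  have hsymm : (f * (G 0)⁻¹).symm x = z := by rw [h0]; rfl
  have hfz : f z = x := f.apply_symm_apply x
  have hb : f z ∈ (chartAt (Cn n) x).source := by rw [hfz]; exact mem_chart_source _ _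
  have hgz : (G 0).symm z = z := by rw [h0]; rfl
  have h3 := (contDiffAt_mapInCharts f hz hb).hasFDerivAt_infty
  have h4 : HasDerivAt (fun s => mapInCharts f z x (chartAt (Cn n) z ((G s).symm z)))
      (fderiv ℝ (mapInCharts f z x) (chartAt (Cn n) z z) (-velocity G 0 1 z)) 0 :=
    HasFDerivAt.comp_hasDerivAt (l := mapInCharts f z x) 0 (by rw [hgz]; exact h3) h2
  have h5 : (fun s => chartAt (Cn n) x ((f * (G s)⁻¹) z)) =ᶠ[𝓝 0]
      fun s => mapInCharts f z x (chartAt (Cn n) z ((G s).symm z)) := by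
    filter_upwards [h1] with s hs
    rw [mapInCharts_chart _ _ hs]
    rfl
  rw [velocity, hsymm, h5.fderiv_eq, h4.hasFDerivAt.fderiv,
    fderiv_mapInCharts hz hb (mdiffAt_diff f z), hfz, dchart_self, dchartSymm_self]
  simp [z]

end InfinitesimalAction

/-! ### The algebraic identity behind closedness -/

section TraceIdentity

variable {n : ℕ}

/-- The linear algebra behind the closedness of `tr (J ∘ A ∘ B)`. -/
theorem trc_cyclic (B : Fin 3 → Cn n →L[ℝ] Cn n) (T : Fin 3 → Fin 3 → Cn n →L[ℝ] Cn n)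
    (hT : ∀ i j, T i j + (B j).comp (B i) = T j i + (B i).comp (B j)) :
    let com : (Cn n →L[ℝ] Cn n) → (Cn n →L[ℝ] Cn n) := fun D => (J n).comp D - D.comp (J n)
    let d : Fin 3 → Fin 3 → Fin 3 → ℝ := fun i j k =>
      trc ((J n).comp ((com (T i j)).comp (com (B k)))) +
        trc ((J n).comp ((com (B j)).comp (com (T i k))))
    d 0 1 2 + d 1 2 0 + d 2 0 1 = 0 := by
  intro com d
  -- Both trace terms are brought to the form `tr(com(B) T)`, linear in the undifferentiated
  -- commutator. In the cyclic sum only the antisymmetrisations `T i j - T j i` then occur.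
  have hd : ∀ i j k, d i j k = -2 * trc ((com (B k)).comp (T i j)) +
      2 * trc ((com (B j)).comp (T i k)) := fun i j k => by
    simp only [d]
    rw [trc_J_antisymm (A := com (B j)) (antiJ_comm (T i k)), trc_comm_J (antiJ_comm (B k)),
      trc_comm_J (antiJ_comm (B j))]
    simp only [com]
    ring
  -- `hT` replaces each antisymmetrisation of `T` by a commutator of the `B`'s.
  have hS : ∀ i j k, trc ((com (B k)).comp (T i j)) = trc ((com (B k)).comp (T j i)) +
      trc ((com (B k)).comp ((B i).comp (B j))) - trc ((com (B k)).comp ((B j).comp (B i))) :=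
    fun i j k => by
    rw [eq_sub_of_add_eq (hT i j), ContinuousLinearMap.comp_sub, map_sub,
      ContinuousLinearMap.comp_add, map_add]
  -- Every remaining term is expanded into traces `tr(J X Y Z)`; those with the same cyclic order of
  -- indices cancel in the cyclic sum.
  have hτ : ∀ X Y Z : Cn n →L[ℝ] Cn n, trc ((com X).comp (Y.comp Z)) =
      trc ((J n).comp (X.comp (Y.comp Z))) - trc ((J n).comp (Y.comp (Z.comp X))) :=
    fun X Y Z => by
    simp only [com]
    rw [ContinuousLinearMap.sub_comp, map_sub, ContinuousLinearMap.comp_assoc,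
      ContinuousLinearMap.comp_assoc X, trc_comm X]
    rfl
  rw [hd, hd, hd, hS 0 1 2, hS 1 2 0, hS 2 0 1]
  simp only [hτ]
  ring

end TraceIdentity

/-! ### The integrand of `Ω_t` along a family -/

section Density

open Filter Topology

variable {n : ℕ} {M : Type*} [TopologicalSpace M] [ChartedSpace (Cn n) M]
  [IsManifold 𝓘(ℂ, Cn n) ∞ M]

/-- The trace pairing of the variations `L_V J` and `L_W J`. -/
def lieTrace (V W : Field n M) (x : M) : ℝ := trc ((J n).comp ((lieJ V x).comp (lieJ W x)))

/-- The integrand of the 2-form `twistedForm`. -/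
def formDensity (χ : Tensor2 n M) (t : ℝ) (V W : Field n M) (x : M) : ℝ :=
  (1 - t) * χ x (V x) (W x) + t / 4 * lieTrace V W x

theorem apply_eq_inChart (χ : Tensor2 n M) (V W : Field n M) {a x : M}
    (ha : x ∈ (chartAt (Cn n) a).source) : χ x (V x) (W x) =
      inChart χ a (chartAt (Cn n) a x) (fieldInChart V a (chartAt (Cn n) a x))
        (fieldInChart W a (chartAt (Cn n) a x)) := by
  conv_lhs => rw [← pull_inChart χ ha]
  rw [fieldInChart_chart V ha, fieldInChart_chart W ha, pull_apply]

/-- Passing to another chart conjugates `L_V J`, `L_W J` and `J` simultaneously by the differential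
of the chart, and the trace is invariant under conjugation. -/
theorem lieTrace_eq_inChart {V W : Field n M} (hV : IsSmoothField V) (hW : IsSmoothField W) {a x : M}
    (ha : x ∈ (chartAt (Cn n) a).source) : lieTrace V W x =
      trc ((J n).comp ((locLieJ (fieldInChart V a) (chartAt (Cn n) a x)).comp
        (locLieJ (fieldInChart W a) (chartAt (Cn n) a x)))) := by
  have h1 := dchart_comp_lieJ hV ha
  have h2 := dchart_comp_lieJ hW ha
  have h3 : ∀ v, lieJ V x v = dchartSymm a (chartAt (Cn n) a x)
      (locLieJ (fieldInChart V a) (chartAt (Cn n) a x) (dchart a x v)) := fun v => by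
    have := DFunLike.congr_fun h1 v
    simp only [ContinuousLinearMap.comp_apply] at this
    rw [← this, dchartSymm_dchart ha]
  have h4 : ∀ v, dchart a x (lieJ W x v) =
      locLieJ (fieldInChart W a) (chartAt (Cn n) a x) (dchart a x v) := fun v =>
    DFunLike.congr_fun h2 v
  have h5 : (J n).comp ((lieJ V x).comp (lieJ W x)) =
      (dchartSymm a (chartAt (Cn n) a x)).comp (((J n).comp
        ((locLieJ (fieldInChart V a) (chartAt (Cn n) a x)).comp
        (locLieJ (fieldInChart W a) (chartAt (Cn n) a x)))).comp (dchart a x)) := by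
    ext1 v
    simp only [ContinuousLinearMap.comp_apply]
    rw [h3, h4, dchartSymm_J ((chartAt (Cn n) a).map_source ha)]
  rw [lieTrace, h5, trc_conj _ _ _ (dchart_comp ha)]

theorem contMDiff_apply {χ : Tensor2 n M} (hχ : IsKahlerForm χ) {V W : Field n M}
    (hV : IsSmoothField V) (hW : IsSmoothField W) :
    ContMDiff 𝓘(ℝ, Cn n) 𝓘(ℝ, ℝ) ∞ fun x => χ x (V x) (W x) :=
  contMDiff_of_funInChart fun a => by
    have hy := (chartAt (Cn n) a).map_source (mem_chart_source _ a)
    refine ((((hχ.localKahler a).smoothAt hy).clm_apply (hV.contDiffAt hy)).clm_apply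
      (hW.contDiffAt hy)).congr_of_eventuallyEq ?_
    filter_upwards [(chartAt (Cn n) a).open_target.mem_nhds hy] with z hz
    simp only [funInChart, Function.comp_apply]
    rw [apply_eq_inChart χ V W ((chartAt (Cn n) a).map_target hz), (chartAt (Cn n) a).right_inv hz]

theorem contMDiff_lieTrace {V W : Field n M} (hV : IsSmoothField V) (hW : IsSmoothField W) :
    ContMDiff 𝓘(ℝ, Cn n) 𝓘(ℝ, ℝ) ∞ (lieTrace V W) :=
  contMDiff_of_funInChart fun a => by
    have hy := (chartAt (Cn n) a).map_source (mem_chart_source _ a)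
    have h1 := contDiffAt_locLieJ (hV.contDiffAt hy)
    have h2 := contDiffAt_locLieJ (hW.contDiffAt hy)
    refine (trc.contDiff.contDiffAt.comp _ (contDiffAt_const.clm_comp
      (h1.clm_comp h2))).congr_of_eventuallyEq ?_ (f := fun z => trc ((J n).comp
        ((locLieJ (fieldInChart V a) z).comp (locLieJ (fieldInChart W a) z))))
    filter_upwards [(chartAt (Cn n) a).open_target.mem_nhds hy] with z hz
    simp only [funInChart, Function.comp_apply]
    rw [lieTrace_eq_inChart hV hW ((chartAt (Cn n) a).map_target hz),
      (chartAt (Cn n) a).right_inv hz]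

theorem continuous_formDensity {χ : Tensor2 n M} (hχ : IsKahlerForm χ) (t : ℝ) {V W : Field n M}
    (hV : IsSmoothField V) (hW : IsSmoothField W) : Continuous (formDensity χ t V W) :=
  (continuous_const.mul (contMDiff_apply hχ hV hW).continuous).add
    (continuous_const.mul (contMDiff_lieTrace hV hW).continuous)

theorem twistedForm_eq [CompactSpace M] [MeasurableSpace M] [BorelSpace M] {η χ : Tensor2 n M}
    (hχ : IsKahlerForm χ) (t : ℝ) {f : Diff n M} (hf : IsKahlerForm (pushforward f η))
    {V W : Field n M} (hV : IsSmoothField V) (hW : IsSmoothField W) :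
    twistedForm η χ t f V W = ∫ x, formDensity χ t V W x ∂(vol (pushforward f η)) := by
  have h1 : Continuous fun x => (1 - t) * χ x (V x) (W x) :=
    continuous_const.mul (contMDiff_apply hχ hV hW).continuous
  have h2 : Continuous fun x => t / 4 * lieTrace V W x :=
    continuous_const.mul (contMDiff_lieTrace hV hW).continuous
  simp only [formDensity]
  rw [hf.integral_add h1 h2, integral_const_mul, integral_const_mul]
  rfl

variable {P : Type*} [NormedAddCommGroup P] [NormedSpace ℝ P]

/-- The derivative `∂_u (D f) ∘ (D f)⁻¹` of a family of diffeomorphisms in charts. -/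
def famB (F : P → Diff n M) (a b : M) (u : P) (q : P × Cn n) : Cn n →L[ℝ] Cn n :=
  (fderiv ℝ (famD F a b) q (u, 0)).comp (famD F a b q).inverse

theorem IsSmoothFamily.famB_eq {F : P → Diff n M} (hF : IsSmoothFamily F) {a b : M} {q : P × Cn n}
    (hq : q ∈ famSet F a b) (u : P) :
    famB F a b u q = fderiv ℝ (fieldInChart (velocity F q.1 u) b) (famChart F a b q) := by
  rw [famB, ← hF.fderiv_velocity hq u, ContinuousLinearMap.comp_assoc,
    (hF.famD_isInvertible hq).self_comp_inverse, ContinuousLinearMap.comp_id]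

theorem IsSmoothFamily.contDiffAt_famB {F : P → Diff n M} (hF : IsSmoothFamily F) {a b : M}
    {q : P × Cn n} (hq : q ∈ famSet F a b) (u : P) : ContDiffAt ℝ ∞ (famB F a b u) q :=
  ((hF.contDiffAt_famD hq).fderiv_infty.clm_apply contDiffAt_const).clm_comp
    (contDiffAt_inverse_comp (hF.contDiffAt_famD hq) (hF.famD_isInvertible hq))

/-- The right-hand side is symmetric in `u` and `v`, so this contains the zero-curvature equation
`∂_u B_v - ∂_v B_u = [B_u, B_v]` required by `trc_cyclic`. -/
theorem IsSmoothFamily.fderiv_famB {F : P → Diff n M} (hF : IsSmoothFamily F) {a b : M}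
    {q : P × Cn n} (hq : q ∈ famSet F a b) (u v : P) :
    fderiv ℝ (famB F a b v) q (u, 0) + (famB F a b v q).comp (famB F a b u q) =
      (fderiv ℝ (fderiv ℝ (famD F a b)) q (u, 0) (v, 0)).comp (famD F a b q).inverse := by
  have hD := hF.contDiffAt_famD hq
  have hi := hF.famD_isInvertible hq
  have h1 : HasFDerivAt (fun r => fderiv ℝ (famD F a b) r (v, 0)) _ q :=
    hD.fderiv_infty.hasFDerivAt_infty.clm_apply (hasFDerivAt_const _ _)
  have h2 := h1.clm_comp (contDiffAt_inverse_comp hD hi).hasFDerivAt_infty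
  have h3 : fderiv ℝ (famB F a b v) q = _ := h2.fderiv
  rw [h3]
  ext1 z
  simp [fderiv_inverse hD hi, famB]

/-- The integrand of `twistedForm` along a family, in charts. -/
def famDensity (F : P → Diff n M) (χ : Tensor2 n M) (t : ℝ) (a b : M) (u v : P) (q : P × Cn n) : ℝ :=
  (1 - t) * inChart χ b (famChart F a b q) (fderiv ℝ (famChart F a b) q (u, 0))
    (fderiv ℝ (famChart F a b) q (v, 0)) +
  t / 4 * trc ((J n).comp (((J n).comp (famB F a b u q) - (famB F a b u q).comp (J n)).comp
    ((J n).comp (famB F a b v q) - (famB F a b v q).comp (J n))))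

theorem IsSmoothFamily.formDensity_eq {F : P → Diff n M} (hF : IsSmoothFamily F) (χ : Tensor2 n M)
    (t : ℝ) {a b : M} {q : P × Cn n} (hq : q ∈ famSet F a b) (u v : P) :
    formDensity χ t (velocity F q.1 u) (velocity F q.1 v) (F q.1 ((chartAt (Cn n) a).symm q.2)) =
      famDensity F χ t a b u v q := by
  have h1 : chartAt (Cn n) b (F q.1 ((chartAt (Cn n) a).symm q.2)) = famChart F a b q := rfl
  rw [formDensity, famDensity, apply_eq_inChart χ _ _ hq.2, lieTrace_eq_inChart
    (hF.isSmoothField_velocity _ _) (hF.isSmoothField_velocity _ _) hq.2, h1,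
    hF.fieldInChart_velocity hq, hF.fieldInChart_velocity hq, hF.famB_eq hq, hF.famB_eq hq]
  rfl

theorem IsSmoothFamily.contDiffAt_famDensity {F : P → Diff n M} (hF : IsSmoothFamily F)
    {χ : Tensor2 n M} (hχ : IsKahlerForm χ) (t : ℝ) {a b : M} {q : P × Cn n}
    (hq : q ∈ famSet F a b) (u v : P) : ContDiffAt ℝ ∞ (famDensity F χ t a b u v) q := by
  have hf := hF.contDiffAt hq
  have h1 : ∀ u, ContDiffAt ℝ ∞ (fun r => (J n).comp (famB F a b u r) -
      (famB F a b u r).comp (J n)) q := fun u =>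
    (contDiffAt_const.clm_comp (hF.contDiffAt_famB hq u)).sub
      ((hF.contDiffAt_famB hq u).clm_comp contDiffAt_const)
  have h2 : ContDiffAt ℝ ∞ (fun r => inChart χ b (famChart F a b r)) q :=
    ((hχ.localKahler b).smoothAt (famChart_mem_target hq)).comp q hf
  exact (contDiffAt_const.mul ((h2.clm_apply (hf.fderiv_infty.clm_apply contDiffAt_const)).clm_apply
    (hf.fderiv_infty.clm_apply contDiffAt_const))).add
    (contDiffAt_const.mul (trc.contDiff.contDiffAt.comp q
      (contDiffAt_const.clm_comp ((h1 u).clm_comp (h1 v)))))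

theorem IsSmoothFamily.smoothParam_formDensity {F : P → Diff n M} (hF : IsSmoothFamily F)
    {χ : Tensor2 n M} (hχ : IsKahlerForm χ) (t : ℝ) (u v : P) :
    SmoothParam n fun p x => formDensity χ t (velocity F p u) (velocity F p v) (F p x) :=
  fun p a => by
  have hq : (p, chartAt (Cn n) a a) ∈ famSet F a (F p a) :=
    mem_famSet (mem_chart_source _ a) (mem_chart_source _ _)
  refine (hF.contDiffAt_famDensity hχ t hq u v).congr_of_eventuallyEq ?_
  exact Filter.eventually_of_mem (hF.famSet_mem_nhds hq) fun r hr => hF.formDensity_eq χ t hr u v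

/-- The `χ` part is `χ` evaluated on derivatives of the map `F`: its cyclic sum is `dχ` plus terms
in mixed second derivatives that cancel by symmetry. The trace part is `trc_cyclic` with `T i j =
∂_i B_j`. -/
theorem IsSmoothFamily.famDensity_closed {F : P → Diff n M} (hF : IsSmoothFamily F)
    {χ : Tensor2 n M} (hχ : IsKahlerForm χ) (t : ℝ) {a b : M} {q : P × Cn n}
    (hq : q ∈ famSet F a b) (u : Fin 3 → P) :
    fderiv ℝ (famDensity F χ t a b (u 1) (u 2)) q (u 0, 0) +
      fderiv ℝ (famDensity F χ t a b (u 2) (u 0)) q (u 1, 0) +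
      fderiv ℝ (famDensity F χ t a b (u 0) (u 1)) q (u 2, 0) = 0 := by
  have hf := hF.contDiffAt hq
  have hχb := (hχ.localKahler b).smoothAt (famChart_mem_target hq)
  have h2 : ContDiffAt ℝ ∞ (fun r => inChart χ b (famChart F a b r)) q := hχb.comp q hf
  have h3 : ∀ z, fderiv ℝ (fun r => inChart χ b (famChart F a b r)) q z =
      fderiv ℝ (inChart χ b) (famChart F a b q) (fderiv ℝ (famChart F a b) q z) := fun z =>
    DFunLike.congr_fun (hχb.hasFDerivAt_infty.comp q hf.hasFDerivAt_infty).fderiv z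
  have h4 : ∀ v z, fderiv ℝ (fun r => fderiv ℝ (famChart F a b) r v) q z =
      fderiv ℝ (fderiv ℝ (famChart F a b)) q z v := fun v z =>
    fderiv_clm_apply_const (hf.fderiv_infty.differentiableAt (by simp)) z v
  have h5 : ∀ v, ContDiffAt ℝ ∞ (fun r => fderiv ℝ (famChart F a b) r v) q := fun v =>
    hf.fderiv_infty.clm_apply contDiffAt_const
  let com : (Cn n →L[ℝ] Cn n) → (Cn n →L[ℝ] Cn n) := fun D => (J n).comp D - D.comp (J n)
  let T : Fin 3 → Fin 3 → Cn n →L[ℝ] Cn n := fun i j => fderiv ℝ (famB F a b (u j)) q (u i, 0)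
  have h6 : ∀ j, HasFDerivAt (fun r => com (famB F a b (u j) r))
      (((ContinuousLinearMap.compL ℝ (Cn n) (Cn n) (Cn n) (J n)) -
        ((ContinuousLinearMap.compL ℝ (Cn n) (Cn n) (Cn n)).flip (J n))).comp
        (fderiv ℝ (famB F a b (u j)) q)) q := fun j =>
    ((ContinuousLinearMap.compL ℝ (Cn n) (Cn n) (Cn n) (J n)) -
        ((ContinuousLinearMap.compL ℝ (Cn n) (Cn n) (Cn n)).flip (J n))).hasFDerivAt.comp q
      (hF.contDiffAt_famB hq (u j)).hasFDerivAt_infty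
  have h7 : ∀ j k, HasFDerivAt (fun r => trc ((J n).comp ((com (famB F a b (u j) r)).comp
      (com (famB F a b (u k) r))))) _ q := fun j k =>
    (trc.comp (ContinuousLinearMap.compL ℝ (Cn n) (Cn n) (Cn n) (J n))).hasFDerivAt.comp q
      ((h6 j).clm_comp (h6 k))
  have h8 : ∀ i j k, fderiv ℝ (famDensity F χ t a b (u j) (u k)) q (u i, 0) =
      (1 - t) * (fderiv ℝ (inChart χ b) (famChart F a b q) (fderiv ℝ (famChart F a b) q (u i, 0))
        (fderiv ℝ (famChart F a b) q (u j, 0)) (fderiv ℝ (famChart F a b) q (u k, 0)) +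
        inChart χ b (famChart F a b q) (fderiv ℝ (fderiv ℝ (famChart F a b)) q (u i, 0) (u j, 0))
          (fderiv ℝ (famChart F a b) q (u k, 0)) +
        inChart χ b (famChart F a b q) (fderiv ℝ (famChart F a b) q (u j, 0))
          (fderiv ℝ (fderiv ℝ (famChart F a b)) q (u i, 0) (u k, 0))) +
      t / 4 * (trc ((J n).comp ((com (T i j)).comp (com (famB F a b (u k) q)))) +
        trc ((J n).comp ((com (famB F a b (u j) q)).comp (com (T i k))))) := fun i j k => by
    have e1 := (((h2.clm_apply (h5 (u j, 0))).clm_apply (h5 (u k, 0))).differentiableAt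
      (n := ∞) (by simp)).hasFDerivAt
    have e2 : HasFDerivAt (famDensity F χ t a b (u j) (u k)) _ q :=
      (e1.const_mul (1 - t)).add ((h7 j k).const_mul (t / 4))
    rw [e2.fderiv, add_apply, smul_apply, smul_apply,
      fderiv_apply_apply (h2.differentiableAt (by simp)) ((h5 _).differentiableAt (by simp))
        ((h5 _).differentiableAt (by simp)), h3, h4, h4]
    simp only [smul_eq_mul]
    congr 2
    simp only [ContinuousLinearMap.comp_apply, add_apply, map_add, com, T]
    rw [add_comm]
    rfl
  have h9 := trc_cyclic (fun j => famB F a b (u j) q) T (fun i j => by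
    simp only [T]
    rw [hF.fderiv_famB hq, hF.fderiv_famB hq,
      (hF.contDiffAt_famD hq).symm_infty (u i, 0) (u j, 0)])
  simp only at h9
  rw [h8 0 1 2, h8 1 2 0, h8 2 0 1]
  have hH := ((hχ.localKahler b).pos _ (famChart_mem_target hq)).toIsHerm
  have e1 := (hχ.localKahler b).closed _ (famChart_mem_target hq)
    (fderiv ℝ (famChart F a b) q (u 0, 0)) (fderiv ℝ (famChart F a b) q (u 1, 0))
    (fderiv ℝ (famChart F a b) q (u 2, 0))
  rw [hf.symm_infty (u 1, 0) (u 0, 0), hf.symm_infty (u 2, 0) (u 0, 0),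
    hf.symm_infty (u 2, 0) (u 1, 0),
    hH.antisymm (fderiv ℝ (famChart F a b) q (u 1, 0)),
    hH.antisymm (fderiv ℝ (famChart F a b) q (u 2, 0)),
    hH.antisymm (fderiv ℝ (famChart F a b) q (u 0, 0))]
  simp only [com]
  linear_combination (1 - t) * e1 + t / 4 * h9

end Density

/-! ### Closedness, invariance and positivity of `Ω_t` -/

section Form

open Filter Topology

variable {n : ℕ} {M : Type*} [TopologicalSpace M] [ChartedSpace (Cn n) M]
  [IsManifold 𝓘(ℂ, Cn n) ∞ M] [CompactSpace M] [MeasurableSpace M] [BorelSpace M]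
  {P : Type*} [NormedAddCommGroup P] [NormedSpace ℝ P]

/-- Transport by `F_p` replaces the varying measure `ω_φ^[n]` by the fixed `η^[n]`, so that
derivatives in the parameters fall on the integrand alone. -/
theorem IsSmoothFamily.twistedForm_velocity {F : P → Diff n M} (hF : IsSmoothFamily F)
    {η χ : Tensor2 n M} (hη : IsKahlerForm η) (hχ : IsKahlerForm χ)
    (hFη : ∀ p, IsKahlerForm (pushforward (F p) η)) (t : ℝ) (p u v : P) :
    twistedForm η χ t (F p) (velocity F p u) (velocity F p v) =
      ∫ x, formDensity χ t (velocity F p u) (velocity F p v) (F p x) ∂(vol η) := by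
  rw [twistedForm_eq hχ t (hFη p) (hF.isSmoothField_velocity p u) (hF.isSmoothField_velocity p v),
    integral_vol_pushforward hη.isPos (hFη p).isPos]

theorem isInvariantClosedForm_twistedForm {η χ : Tensor2 n M} (hη : IsKahlerForm η)
    (hχ : IsKahlerForm χ) (t : ℝ) : IsInvariantClosedForm η (twistedForm η χ t) := by
  have := hη.isFiniteMeasure
  have hK : ∀ f ∈ kahlerSpace η, IsKahlerForm (pushforward f η) := fun f hf => hη.pushforward hf
  constructor
  · intro f hf V W hV hW
    rw [twistedForm_eq hχ t (hK f hf) hV.1 hW.1, twistedForm_eq hχ t (hK f hf) hW.1 hV.1,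
      ← integral_neg]
    congr 1
    ext x
    rw [formDensity, formDensity, (hχ.isPos x).toIsHerm.antisymm, lieTrace,
      trc_J_antisymm (antiJ_lieJ W x), lieTrace]
    ring
  · intro f hf V V' W hV hV' hW
    have hs : IsSmoothField (V + V') := fun a => by
      rw [fieldInChart_add]; exact (hV.1 a).add (hV'.1 a)
    rw [twistedForm_eq hχ t (hK f hf) hs hW.1, twistedForm_eq hχ t (hK f hf) hV.1 hW.1,
      twistedForm_eq hχ t (hK f hf) hV'.1 hW.1,
      ← (hK f hf).integral_add (continuous_formDensity hχ t hV.1 hW.1)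
        (continuous_formDensity hχ t hV'.1 hW.1)]
    congr 1
    ext x
    simp only [formDensity, lieTrace, lieJ_add hV.1 hV'.1, Pi.add_apply, map_add, add_apply,
      ContinuousLinearMap.add_comp, ContinuousLinearMap.comp_add]
    ring
  · intro f hf c V W hV hW
    have hs : IsSmoothField (c • V) := fun a => by
      rw [fieldInChart_smul]; exact (hV.1 a).const_smul c
    rw [twistedForm_eq hχ t (hK f hf) hs hW.1, twistedForm_eq hχ t (hK f hf) hV.1 hW.1,
      ← integral_const_mul]
    congr 1
    ext x
    simp only [formDensity, lieTrace, lieJ_smul c hV.1, Pi.smul_apply, map_smul,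
      smul_apply, ContinuousLinearMap.smul_comp, ContinuousLinearMap.comp_smul,
      smul_eq_mul]
    ring
  · intro k F hF hFη u v p
    have hFη' := fun p => hK (F p) (hFη p)
    have h1 := (hF.smoothParam_formDensity hχ t u v).hasFDerivAt_integral (μ := vol η) p
    refine (h1.congr_of_eventuallyEq (Filter.Eventually.of_forall fun q => ?_)).differentiableAt
    exact hF.twistedForm_velocity hη hχ hFη' t q u v
  · intro k F hF hFη p u v w
    have hFη' := fun p => hK (F p) (hFη p)
    have h1 : ∀ u v w, fderiv ℝ (fun q => twistedForm η χ t (F q) (velocity F q v) (velocity F q w))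
        p u = ∫ x, fderiv ℝ (fun q => formDensity χ t (velocity F q v) (velocity F q w) (F q x)) p u
          ∂(vol η) := fun u v w => by
      rw [← (hF.smoothParam_formDensity hχ t v w).fderiv_integral_apply]
      congr 2
      ext q
      exact hF.twistedForm_velocity hη hχ hFη' t q v w
    have hc : ∀ u v w, Continuous fun x => fderiv ℝ (fun q => formDensity χ t (velocity F q v)
        (velocity F q w) (F q x)) p u := fun u v w =>
      ((hF.smoothParam_formDensity hχ t v w).continuous_fderiv p).clm_apply continuous_const
    have hc2 : Continuous fun x => fderiv ℝ (fun q => formDensity χ t (velocity F q v)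
        (velocity F q w) (F q x)) p u + fderiv ℝ (fun q => formDensity χ t (velocity F q w)
        (velocity F q u) (F q x)) p v := (hc u v w).add (hc v w u)
    rw [h1, h1, h1, ← hη.integral_add (hc u v w) (hc v w u), ← hη.integral_add hc2 (hc w u v)]
    refine integral_eq_zero_of_ae (Filter.Eventually.of_forall fun x => ?_)
    have hq : (p, chartAt (Cn n) x x) ∈ famSet F x (F p x) :=
      mem_famSet (mem_chart_source _ x) (mem_chart_source _ _)
    have hl : HasFDerivAt (fun r => (r, chartAt (Cn n) x x))
        (ContinuousLinearMap.inl ℝ (Fin k → ℝ) (Cn n)) p := hasFDerivAt_prodMk_left p _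
    have h2 : ∀ u v w, fderiv ℝ (fun q => formDensity χ t (velocity F q v) (velocity F q w) (F q x))
        p u = fderiv ℝ (famDensity F χ t x (F p x) v w) (p, chartAt (Cn n) x x) (u, 0) :=
      fun u v w => by
      have e1 : (fun q => formDensity χ t (velocity F q v) (velocity F q w) (F q x)) =ᶠ[𝓝 p]
          fun q => famDensity F χ t x (F p x) v w (q, chartAt (Cn n) x x) := by
        filter_upwards [hl.continuousAt.preimage_mem_nhds (hF.famSet_mem_nhds hq)] with r hr
        rw [← hF.formDensity_eq χ t hr v w]
        simp [(chartAt (Cn n) x).left_inv (mem_chart_source _ x)]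
      have e2 : HasFDerivAt (fun q => famDensity F χ t x (F p x) v w (q, chartAt (Cn n) x x)) _ p :=
        HasFDerivAt.comp (g := famDensity F χ t x (F p x) v w) p
          (hF.contDiffAt_famDensity hχ t hq v w).hasFDerivAt_infty hl
      rw [e1.fderiv_eq, e2.fderiv]
      rfl
    have h3 := hF.famDensity_closed hχ t hq ![u, v, w]
    simp only [h2]
    exact h3
  · intro g hg k F hF hFη p u v
    rw [velocity_mul_right, velocity_mul_right, twistedForm, pushforward_mul_inv hη hg]
    rfl

/-- The positivity of `twistedForm`. -/
theorem twistedForm_mulI {η χ : Tensor2 n M} (hη : IsKahlerForm η) (hχ : IsKahlerForm χ) {t : ℝ}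
    (ht : t ∈ Set.Icc (0 : ℝ) 1) {f : Diff n M} (hf : f ∈ kahlerSpace η) {V : Field n M}
    (hV : IsTangent η f V) :
    IsTangent η f (mulI V) ∧ 0 ≤ twistedForm η χ t f V (mulI V) ∧
      (twistedForm η χ t f V (mulI V) = 0 ↔ (t < 1 → V = 0) ∧ (t = 1 → ∀ x, lieJ V x = 0)) := by
  have hα := hη.pushforward hf
  have hVJ := hV.1.mulI
  have hform := twistedForm_eq hχ t hα hV.1 hVJ
  have hc := continuous_formDensity hχ t hV.1 hVJ
  -- With `A = L_V J` one has `L_{JV} J = J A`, and `J A J A = A²` because `A` anticommutes with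
  -- `J`.
  have hd : ∀ x, formDensity χ t V (mulI V) x =
      (1 - t) * χ x (V x) (J n (V x)) + t / 4 * trc ((lieJ V x).comp (lieJ V x)) := fun x => by
    rw [formDensity, lieTrace, lieJ_mulI hV.1]
    congr 3
    ext1 v
    simp [antiJ_lieJ V x _]
  have h1 : ∀ x, 0 ≤ χ x (V x) (J n (V x)) := fun x => by
    by_cases h : V x = 0
    · simp [h]
    · exact (hχ.pos x _ h).le
  have h2 : ∀ x, 0 ≤ trc ((lieJ V x).comp (lieJ V x)) := fun x =>
    trc_sq_nonneg (hα.isPos x) (hV.2 x)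
  have ht1 : 0 ≤ 1 - t := by linarith [ht.2]
  have ht0 : 0 ≤ t / 4 := by linarith [ht.1]
  have hnn : ∀ x, 0 ≤ formDensity χ t V (mulI V) x := fun x => by
    rw [hd]
    exact add_nonneg (mul_nonneg ht1 (h1 x)) (mul_nonneg ht0 (h2 x))
  refine ⟨⟨hVJ, fun x v w => ?_⟩, ?_, ?_⟩
  · have h3 := hV.2 x v (J n w)
    have h4 := (hα.isPos x).toIsHerm.inv
    rw [lieJ_mulI hV.1]
    rw [antiJ_lieJ V x w] at h3
    simp only [J_J, map_neg, ContinuousLinearMap.comp_apply] at h3 ⊢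
    rw [h4] at h3 ⊢
    rw [h4]
    linarith
  · rw [hform]; exact integral_nonneg hnn
  · have hopen := hα.isOpenPosMeasure
    -- The integrand is continuous and nonnegative and the measure charges every nonempty open set,
    -- so a vanishing integral forces pointwise vanishing.
    have hzero : twistedForm η χ t f V (mulI V) = 0 ↔ ∀ x, formDensity χ t V (mulI V) x = 0 := by
      rw [hform, integral_eq_zero_iff_of_nonneg hnn (hα.integrable hc),
        Continuous.ae_eq_iff_eq _ hc continuous_zero]
      exact funext_iff
    rw [hzero]
    constructor
    · refine fun h => ⟨fun hlt => ?_, fun h1' x => ?_⟩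
      · ext1 x
        by_contra hne
        have h3 := h x
        rw [hd] at h3
        have h4 := mul_pos (sub_pos.2 hlt) (hχ.pos x _ hne)
        have h5 := mul_nonneg ht0 (h2 x)
        linarith
      · have h3 := h x
        rw [hd, h1'] at h3
        exact eq_zero_of_trc_sq (hα.isPos x) (hV.2 x) (by linarith)
    · rintro ⟨h3, h4⟩ x
      rw [hd]
      rcases lt_or_eq_of_le ht.2 with hlt | heq
      · have h5 := h3 hlt
        have h6 : lieJ V x = 0 := lieJ_eq_zero (Filter.Eventually.of_forall fun z => by rw [h5]; rfl)
        rw [h6, h5]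
        simp
      · rw [h4 heq x, heq]
        simp

end Form

/-! ### Smoothness of traces and sums of `(1,1)`-forms -/

section Tensors

open Filter Topology

variable {n : ℕ} {M : Type*} [TopologicalSpace M] [ChartedSpace (Cn n) M]
  [IsManifold 𝓘(ℂ, Cn n) ∞ M]

theorem IsPos.contDiffAt_trR {E : Type*} [NormedAddCommGroup E] [NormedSpace ℝ E] {α β : E → Bil n}
    {q : E} (hp : IsPos (α q)) (hα : ContDiffAt ℝ ∞ α q) (hβ : ContDiffAt ℝ ∞ β q) :
    ContDiffAt ℝ ∞ (fun r => trR (α r) (β r)) q :=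
  contDiffAt_const.mul (trc.contDiff.contDiffAt.comp q
    ((hp.contDiffAt_inverse.comp q hα).clm_comp hβ))

theorem funInChart_tr {α β : Tensor2 n M} (hα : IsKahlerForm α) (hH : ∀ x, IsHerm (β x)) {a : M}
    {y : Cn n} (hy : y ∈ (chartAt (Cn n) a).target) :
    funInChart (tr α β) a y = trR (inChart α a y) (inChart β a y) := by
  rw [funInChart, Function.comp_apply, tr_eq_trR (hα.isPos _) (hH _)
    ((chartAt (Cn n) a).map_target hy), (chartAt (Cn n) a).right_inv hy]

theorem IsKahlerForm.contMDiff_tr {α β : Tensor2 n M} (hα : IsKahlerForm α)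
    (hH : ∀ x, IsHerm (β x)) (hβ : ∀ a : M, ContDiffOn ℝ ∞ (inChart β a) (chartAt (Cn n) a).target) :
    ContMDiff 𝓘(ℝ, Cn n) 𝓘(ℝ, ℝ) ∞ (tr α β) :=
  contMDiff_of_funInChart fun a => by
    have hy := (chartAt (Cn n) a).map_source (mem_chart_source _ a)
    have hn := (chartAt (Cn n) a).open_target.mem_nhds hy
    refine ((isPos_inChart hα.isPos hy).contDiffAt_trR ((hα.smooth a).contDiffAt hn)
      ((hβ a).contDiffAt hn)).congr_of_eventuallyEq ?_
    exact Filter.eventually_of_mem hn fun z hz => funInChart_tr hα hH hz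

theorem contDiffOn_inChart_ricci {α : Tensor2 n M} (hα : IsKahlerForm α) (a : M) :
    ContDiffOn ℝ ∞ (inChart (ricci α) a) (chartAt (Cn n) a).target :=
  ((contDiffOn_ddbarAt (chartAt (Cn n) a).open_target fun _ hy =>
    ((hα.localKahler a).contDiffAt_log_rho hy).contDiffWithinAt).neg).congr fun _ hy =>
      inChart_ricci hα hy

theorem IsKahlerForm.contMDiff_scal {α : Tensor2 n M} (hα : IsKahlerForm α) :
    ContMDiff 𝓘(ℝ, Cn n) 𝓘(ℝ, ℝ) ∞ (scal α) :=
  hα.contMDiff_tr (isHerm_ricci hα) (contDiffOn_inChart_ricci hα)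

theorem tr_add (α β γ : Tensor2 n M) (x : M) : tr α (β + γ) x = tr α β x + tr α γ x := trAt_add _ _ _

theorem tr_smul (α β : Tensor2 n M) (c : ℝ) (x : M) : tr α (c • β) x = c * tr α β x := trAt_smul _ _ _

theorem inChart_add (α β : Tensor2 n M) (a : M) :
    inChart (α + β) a = inChart α a + inChart β a := rfl

theorem inChart_smul (c : ℝ) (α : Tensor2 n M) (a : M) : inChart (c • α) a = c • inChart α a := rfl

theorem inChart_zero (a : M) : inChart (0 : Tensor2 n M) a = 0 := rfl

theorem shift_eq_add (α : Tensor2 n M) (φ : M → ℝ) : shift α φ = α + shift 0 φ := by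
  ext1 x
  simp [shift]

theorem inChart_ddbar {φ : M → ℝ} (hφ : ContMDiff 𝓘(ℝ, Cn n) 𝓘(ℝ, ℝ) ∞ φ) {a : M} {y : Cn n}
    (hy : y ∈ (chartAt (Cn n) a).target) :
    inChart (shift 0 φ) a y = ddbarAt (funInChart φ a) y := by
  rw [inChart_shift 0 hφ hy, inChart_zero, Pi.zero_apply, zero_add]

theorem contDiffOn_inChart_ddbar {φ : M → ℝ} (hφ : ContMDiff 𝓘(ℝ, Cn n) 𝓘(ℝ, ℝ) ∞ φ) (a : M) :
    ContDiffOn ℝ ∞ (inChart (shift 0 φ) a) (chartAt (Cn n) a).target :=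
  (contDiffOn_ddbarAt (chartAt (Cn n) a).open_target (contDiffOn_funInChart hφ a)).congr
    fun _ hy => inChart_ddbar hφ hy

theorem isHerm_ddbar {φ : M → ℝ} (hφ : ContMDiff 𝓘(ℝ, Cn n) 𝓘(ℝ, ℝ) ∞ φ) (x : M) :
    IsHerm (shift (0 : Tensor2 n M) φ x) := by
  have hy := (chartAt (Cn n) x).map_source (mem_chart_source _ x)
  rw [← inChart_self (shift 0 φ) x, inChart_ddbar hφ hy]
  exact isHerm_ddbarAt (contDiffAt_funInChart hφ hy)

/-- Smooth closed `(1,1)`-forms which are positive are Kähler forms. -/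
theorem IsKahlerForm.add_of_pos {α β : Tensor2 n M} (hα : IsKahlerForm α) (c : ℝ)
    (hβ : ∀ a : M, ContDiffOn ℝ ∞ (inChart β a) (chartAt (Cn n) a).target)
    (hH : ∀ x, IsHerm (β x))
    (hc : ∀ a : M, ∀ y ∈ (chartAt (Cn n) a).target, ∀ u v w,
      fderiv ℝ (inChart β a) y u v w + fderiv ℝ (inChart β a) y v w u +
        fderiv ℝ (inChart β a) y w u v = 0)
    (hpos : ∀ x v, v ≠ 0 → 0 < c * α x v (J n v) + β x v (J n v)) : IsKahlerForm (c • α + β) := by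
  have hH' : ∀ x, IsHerm ((c • α + β) x) := fun x =>
    ((hα.isPos x).toIsHerm.smul c).add (hH x)
  refine ⟨fun a => ?_, fun x => (hH' x).alt, fun a y hy u v w => ?_, fun x => (hH' x).inv,
    fun x v hv => hpos x v hv⟩
  · rw [inChart_add, inChart_smul]
    exact ((hα.smooth a).const_smul c).add (hβ a)
  · have hn := (chartAt (Cn n) a).open_target.mem_nhds hy
    have h1 : DifferentiableAt ℝ (inChart α a) y :=
      ((hα.smooth a).contDiffAt hn).differentiableAt (by simp)
    have h2 : DifferentiableAt ℝ (inChart β a) y := ((hβ a).contDiffAt hn).differentiableAt (by simp)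
    have h3 := hα.closed a y hy u v w
    have h4 := hc a y hy u v w
    rw [inChart_add, inChart_smul, fderiv_add (h1.const_smul c) h2, fderiv_const_smul h1]
    simp only [add_apply, smul_apply, smul_eq_mul]
    linear_combination c * h3 + h4

end Tensors

/-! ### Cohomological invariance of the averages -/

section MeanValues

open Filter Topology

variable {n : ℕ} {M : Type*} [TopologicalSpace M] [ChartedSpace (Cn n) M]
  [IsManifold 𝓘(ℂ, Cn n) ∞ M]

theorem extd_const_smul (c : ℝ) {ζ : Cn n → Cn n →L[ℝ] ℝ} {y : Cn n} (h : DifferentiableAt ℝ ζ y) :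
    extd (fun z => c • ζ z) y = c • extd ζ y := by
  ext v w
  rw [extd_apply, fderiv_fun_const_smul h]
  simp [extd_apply, mul_sub]

theorem hamField_add {α : Tensor2 n M} (hα : ∀ x, IsPos (α x)) {h k : M → ℝ}
    (hh : ContMDiff 𝓘(ℝ, Cn n) 𝓘(ℝ, ℝ) ∞ h) (hk : ContMDiff 𝓘(ℝ, Cn n) 𝓘(ℝ, ℝ) ∞ k) (x : M) :
    hamField α (h + k) x = hamField α h x + hamField α k x := by
  have hy := (chartAt (Cn n) x).map_source (mem_chart_source _ x)
  have h1 : DifferentiableAt ℝ (h ∘ (chartAt (Cn n) x).symm) (chartAt (Cn n) x x) :=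
    (contDiffAt_funInChart hh hy).differentiableAt (by simp)
  have h2 : DifferentiableAt ℝ (k ∘ (chartAt (Cn n) x).symm) (chartAt (Cn n) x x) :=
    (contDiffAt_funInChart hk hy).differentiableAt (by simp)
  rw [hamField_eq_inverse (hα x), hamField_eq_inverse (hα x), hamField_eq_inverse (hα x), ← map_add]
  congr 1
  exact fderiv_add h1 h2

theorem hamField_const {α : Tensor2 n M} (hα : ∀ x, IsPos (α x)) (c : ℝ) (x : M) :
    hamField α (fun _ => c) x = 0 := by
  rw [hamField_eq_inverse (hα x), dAt]
  have : ((fun _ => c) ∘ (chartAt (Cn n) x).symm) = fun _ => c := rfl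
  rw [this]
  simp

variable [CompactSpace M] [T2Space M] [MeasurableSpace M] [BorelSpace M]

/-- Stokes applied to `√-1∂∂̄φ = -½ d(dφ ∘ J)`. The right side is linear in `X_h`, so it is additive
in `h`, local, and zero when `h` is constant. -/
theorem IsKahlerForm.integral_tr_ddbar_mul {α : Tensor2 n M} (hα : IsKahlerForm α) {φ h : M → ℝ}
    (hφ : ContMDiff 𝓘(ℝ, Cn n) 𝓘(ℝ, ℝ) ∞ φ) (hh : ContMDiff 𝓘(ℝ, Cn n) 𝓘(ℝ, ℝ) ∞ h) :
    ∫ x, tr α (TwistedKahler.shift 0 φ) x * h x ∂(vol α) =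
      ∫ x, -1 / 2 * α x (hamField α φ x) (mulI (hamField α h) x) ∂(vol α) := by
  have htr : Continuous (tr α (TwistedKahler.shift 0 φ)) :=
    (hα.contMDiff_tr (isHerm_ddbar hφ) (contDiffOn_inChart_ddbar hφ)).continuous
  have hX : ∀ {h}, ContMDiff 𝓘(ℝ, Cn n) 𝓘(ℝ, ℝ) ∞ h →
      Continuous fun x => -1 / 2 * α x (hamField α φ x) (mulI (hamField α h) x) := fun hh =>
    continuous_const.mul (contMDiff_apply hα (hα.isSmoothField_hamField hφ)
      (hα.isSmoothField_hamField hh).mulI).continuous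
  refine contMDiff_induction (n := n)
    (p := fun h => ∫ x, tr α (TwistedKahler.shift 0 φ) x * h x ∂(vol α) =
      ∫ x, -1 / 2 * α x (hamField α φ x) (mulI (hamField α h) x) ∂(vol α))
    (U := fun x : M => (chartAt (Cn n) x).source) (fun x => (chartAt (Cn n) x).open_source)
    (fun x => mem_chart_source _ x) (fun a h hh hs => ?_) (fun h k hh hk h1 h2 => ?_) ?_ hh
  · have hsm : ∀ x ∈ tsupport h, ContDiffAt ℝ ∞ (funInChart φ a) (chartAt (Cn n) a x) :=
      fun x hx => contDiffAt_funInChart hφ ((chartAt (Cn n) a).map_source (hs hx))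
    refine hα.integral_mul_eq_of_extd hh hs (ζ := fun y => (-1 / 2 : ℝ) • dJ (funInChart φ a) y)
      (fun x hx => (contDiffAt_dJ (hsm x hx)).const_smul _) htr (hX hh) (fun x hx => ?_)
      (fun x hx => ?_) fun x hx => ?_
    · rw [extd_const_smul _ ((contDiffAt_dJ (hsm x hx)).differentiableAt (by simp)),
        ← ddbarAt_eq_extd (hsm x hx), tr_eq_trR (hα.isPos x) (isHerm_ddbar hφ x) (hs hx),
        inChart_ddbar hφ ((chartAt (Cn n) a).map_source (hs hx))]
    · have hy := (chartAt (Cn n) a).map_source (hs hx)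
      rw [apply_eq_inChart α _ _ (hs hx), fieldInChart_mulI _ hy, fieldInChart_hamField hα.isPos hφ hy,
        locHam_spec (isPos_inChart hα.isPos hy)]
      rfl
    · rw [mulI, hamField_eq_zero hα.isPos hx]; simp
  · have e1 : ∀ x, -1 / 2 * α x (hamField α φ x) (mulI (hamField α (h + k)) x) =
        -1 / 2 * α x (hamField α φ x) (mulI (hamField α h) x) +
        -1 / 2 * α x (hamField α φ x) (mulI (hamField α k) x) := fun x => by
      simp only [mulI, hamField_add hα.isPos hh hk, map_add]
      ring
    simp only [e1, Pi.add_apply, mul_add]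
    rw [hα.integral_add (f := fun x => tr α (TwistedKahler.shift 0 φ) x * h x)
      (g := fun x => tr α (TwistedKahler.shift 0 φ) x * k x) (htr.mul hh.continuous)
      (htr.mul hk.continuous), hα.integral_add (hX hh) (hX hk), h1, h2]
  · have e1 : ∀ x, hamField α (0 : M → ℝ) x = 0 := fun x => hamField_const hα.isPos 0 x
    simp [mulI, e1]

theorem IsKahlerForm.integral_tr_ddbar {α : Tensor2 n M} (hα : IsKahlerForm α) {φ : M → ℝ}
    (hφ : ContMDiff 𝓘(ℝ, Cn n) 𝓘(ℝ, ℝ) ∞ φ) : ∫ x, tr α (TwistedKahler.shift 0 φ) x ∂(vol α) = 0 := by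
  have h := hα.integral_tr_ddbar_mul hφ (h := fun _ => 1) contMDiff_const
  simpa [mulI, hamField_const hα.isPos] using h

/-- A two-parameter family of forms. -/
def formPencil (η β χ : Tensor2 n M) (p : ℝ × ℝ) : Tensor2 n M := η + p.1 • β + p.2 • χ

/-- The density is a polynomial in the form, so the quotient is smooth in all parameters, including
those for which the pencil is not positive. This permits two-sided derivatives at the edge of the
positive region. -/
theorem smoothParam_volRatio {η β χ : Tensor2 n M} (hη : IsKahlerForm η)
    (hβ : ∀ a : M, ContDiffOn ℝ ∞ (inChart β a) (chartAt (Cn n) a).target)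
    (hH : ∀ x, IsHerm (β x)) (hχ : IsKahlerForm χ) :
    SmoothParam n fun (p : ℝ × ℝ) x => volRatio η (formPencil η β χ p) x := fun p a => by
  have hy := (chartAt (Cn n) a).map_source (mem_chart_source _ a)
  have hn := (chartAt (Cn n) a).open_target.mem_nhds hy
  have hs : ∀ {γ : Tensor2 n M}, ContDiffOn ℝ ∞ (inChart γ a) (chartAt (Cn n) a).target →
      ContDiffAt ℝ ∞ (fun q : (ℝ × ℝ) × Cn n => inChart γ a q.2) (p, chartAt (Cn n) a a) := fun h =>
    (h.contDiffAt hn).comp (p, chartAt (Cn n) a a) (f := fun q : (ℝ × ℝ) × Cn n => q.2) contDiffAt_snd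
  have h1 : ContDiffAt ℝ ∞ (fun q : (ℝ × ℝ) × Cn n => inChart (formPencil η β χ q.1) a q.2)
      (p, chartAt (Cn n) a a) :=
    ((hs (hη.smooth a)).add (contDiffAt_fst.fst.smul (hs (hβ a)))).add
      (contDiffAt_fst.snd.smul (hs (hχ.smooth a)))
  have h2 := (contDiff_rho.contDiffAt.comp _ h1).div (contDiff_rho.contDiffAt.comp _ (hs (hη.smooth a)))
    (isPos_inChart hη.isPos hy).rho_pos.ne'
  refine h2.congr_of_eventuallyEq ?_
  filter_upwards [continuousAt_snd.preimage_mem_nhds hn] with q hq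
  exact volRatio_symm (fun x => (((hη.isPos x).toIsHerm.add ((hH x).smul _)).add
    ((hχ.isPos x).toIsHerm.smul _))) hη.isPos hq

theorem fderiv_volRatio {η β χ : Tensor2 n M} {p : ℝ × ℝ} {x : M}
    (hp : IsPos (formPencil η β χ p x)) (c d : ℝ) :
    fderiv ℝ (fun q => volRatio η (formPencil η β χ q) x) p (c, d) =
      tr (formPencil η β χ p) (c • β + d • χ) x * volRatio η (formPencil η β χ p) x := by
  have h1 : HasFDerivAt (fun q : ℝ × ℝ => formPencil η β χ q x)
      ((ContinuousLinearMap.fst ℝ ℝ ℝ).smulRight (β x) +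
        (ContinuousLinearMap.snd ℝ ℝ ℝ).smulRight (χ x)) p := by
    have h2 : (fun q : ℝ × ℝ => formPencil η β χ q x) = fun q => η x +
        ((ContinuousLinearMap.fst ℝ ℝ ℝ).smulRight (β x) +
        (ContinuousLinearMap.snd ℝ ℝ ℝ).smulRight (χ x)) q := by
      ext1 q
      simp [formPencil, add_assoc]
    rw [h2]
    exact (ContinuousLinearMap.hasFDerivAt _).const_add _
  have h3 := HasFDerivAt.rho_comp h1 hp (c, d)
  have h4 : DifferentiableAt ℝ (fun q : ℝ × ℝ => rho (formPencil η β χ q x)) p :=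
    (contDiff_rho.differentiable (by simp) _).comp p h1.differentiableAt
  have h5 : fderiv ℝ (fun q => volRatio η (formPencil η β χ q) x) p =
      (rho (η x))⁻¹ • fderiv ℝ (fun q : ℝ × ℝ => rho (formPencil η β χ q x)) p := by
    rw [← fderiv_const_mul h4]
    congr 1
    ext q
    rw [volRatio, div_eq_inv_mul]
  rw [h5, smul_apply, h3, volRatio, tr]
  simp only [add_apply, ContinuousLinearMap.smulRight_apply, ContinuousLinearMap.coe_fst',
    ContinuousLinearMap.coe_snd', smul_eq_mul, Pi.add_apply, Pi.smul_apply]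
  ring

/-- The integral of the trace of a Kähler form is an invariant of the Kähler class. -/
theorem IsKahlerForm.integral_tr_shift {η χ : Tensor2 n M} (hη : IsKahlerForm η)
    (hχ : IsKahlerForm χ) {φ : M → ℝ} (hφ : φ ∈ potentials η) :
    ∫ x, tr (TwistedKahler.shift η φ) χ x ∂(vol (TwistedKahler.shift η φ)) = ∫ x, tr η χ x ∂(vol η) := by
  have hfin := hη.isFiniteMeasure
  have hφs := hφ.1
  have hα := hη.shift hφ
  let β : Tensor2 n M := TwistedKahler.shift 0 φ
  have hβs := contDiffOn_inChart_ddbar hφs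
  have hβH := isHerm_ddbar hφs
  have hβc : ∀ a : M, ∀ y ∈ (chartAt (Cn n) a).target, ∀ u v w,
      fderiv ℝ (inChart β a) y u v w + fderiv ℝ (inChart β a) y v w u +
        fderiv ℝ (inChart β a) y w u v = 0 := fun a y hy u v w => by
    have h1 := hα.closed a y hy u v w
    have h2 := hη.closed a y hy u v w
    have hn := (chartAt (Cn n) a).open_target.mem_nhds hy
    rw [shift_eq_add, inChart_add, fderiv_add (((hη.smooth a).contDiffAt hn).differentiableAt (by simp))
      (((hβs a).contDiffAt hn).differentiableAt (by simp))] at h1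
    simp only [add_apply] at h1
    linarith
  -- Convexity: `η + sβ = (1 - s) η + s (η + β)` is positive for `0 ≤ s ≤ 1`, and adding a
  -- nonnegative multiple of `χ` keeps it so.
  have hK : ∀ p : ℝ × ℝ, 0 ≤ p.1 → p.1 ≤ 1 → 0 ≤ p.2 → IsKahlerForm (formPencil η β χ p) := by
    rintro ⟨s, ε⟩ hs0 hs1 hε
    have h1 : IsKahlerForm ((1 : ℝ) • η + s • β) := by
      refine hη.add_of_pos (β := s • β) 1 (fun a => ?_) (fun x => (hβH x).smul s) (fun a y hy u v w => ?_)
        fun x v hv => ?_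
      · rw [inChart_smul]; exact (hβs a).const_smul s
      · have hn := (chartAt (Cn n) a).open_target.mem_nhds hy
        rw [inChart_smul, fderiv_const_smul (((hβs a).contDiffAt hn).differentiableAt (by simp))]
        have := hβc a y hy u v w
        simp only [smul_apply, smul_eq_mul]
        linear_combination s * this
      · have h2 := hη.pos x v hv
        have h3 := hα.pos x v hv
        rw [shift_eq_add] at h3
        have h4 : (η + TwistedKahler.shift 0 φ : Tensor2 n M) x v (J n v) = η x v (J n v) + β x v (J n v) := rfl
        rw [h4] at h3
        change 0 < 1 * η x v (J n v) + s * β x v (J n v)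
        rcases hs1.lt_or_eq with h | h
        · nlinarith
        · simp only at h
          rw [h]; linarith
    have h2 : formPencil η β χ (s, ε) = (1 : ℝ) • ((1 : ℝ) • η + s • β) + ε • χ := by
      simp [formPencil]
    rw [h2]
    have h1' : IsKahlerForm ((1 : ℝ) • η + s • β) := by simpa using h1
    have := h1'.add_of_pos (β := ε • χ) 1 (fun a => by
      rw [inChart_smul]; exact (hχ.smooth a).const_smul ε) (fun x => (hχ.isPos x).toIsHerm.smul ε)
      (fun a y hy u v w => by
        have hn := (chartAt (Cn n) a).open_target.mem_nhds hy
        rw [inChart_smul, fderiv_const_smul (((hχ.smooth a).contDiffAt hn).differentiableAt (by simp))]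
        have := hχ.closed a y hy u v w
        simp only [smul_apply, smul_eq_mul]
        linear_combination ε * this) fun x v hv => by
        have h2 := h1'.pos x v hv
        have h3 := hχ.pos x v hv
        change 0 < 1 * (((1 : ℝ) • η + s • β) x) v (J n v) + ε * χ x v (J n v)
        have := mul_nonneg hε h3.le
        linarith
    simpa using this
  have hS := smoothParam_volRatio hη hβs hβH hχ
  -- On the positive region this is the total volume of the form in the pencil; its differential is
  -- the integral of a trace.
  let G : ℝ × ℝ → ℝ := fun p => ∫ x, volRatio η (formPencil η β χ p) x ∂(vol η)
  have hG : ∀ p, HasFDerivAt G (fderiv ℝ G p) p := fun p =>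
    (hS.hasFDerivAt_integral p).differentiableAt.hasFDerivAt
  have hG' : ∀ p : ℝ × ℝ, 0 ≤ p.1 → p.1 ≤ 1 → 0 ≤ p.2 → ∀ c d, fderiv ℝ G p (c, d) =
      ∫ x, tr (formPencil η β χ p) (c • β + d • χ) x ∂(vol (formPencil η β χ p)) :=
    fun p h0 h1 h2 c d => by
    have hp := hK p h0 h1 h2
    have htr : Continuous (tr (formPencil η β χ p) (c • β + d • χ)) :=
      (hp.contMDiff_tr (β := c • β + d • χ) (fun x => ((hβH x).smul c).add ((hχ.isPos x).toIsHerm.smul d)) fun a => by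
        rw [inChart_add, inChart_smul, inChart_smul]
        exact ((hβs a).const_smul c).add ((hχ.smooth a).const_smul d)).continuous
    rw [hp.integral_mul_volRatio hη htr]
    simp only [G]
    rw [hS.fderiv_integral_apply]
    congr 1
    ext x
    exact fderiv_volRatio (hp.isPos x) c d
  -- Moving in `s` changes the form by `√-1∂∂̄φ`, whose trace integrates to zero.
  have hconst : ∀ ε, 0 ≤ ε → G (1, ε) = G (0, ε) := fun ε hε => by
    have h1 : ∀ s ∈ Set.Icc (0 : ℝ) 1, HasDerivAt (fun s => G (s, ε)) 0 s := fun s hs => by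
      have h2 := ((hG (s, ε)).comp s (f := fun s => (s, ε)) (hasFDerivAt_prodMk_left s ε)).hasDerivAt
      refine h2.congr_deriv ?_
      have h3 := hG' (s, ε) hs.1 hs.2 hε 1 0
      rw [one_smul, zero_smul, add_zero, (hK (s, ε) hs.1 hs.2 hε).integral_tr_ddbar hφs] at h3
      exact h3
    exact constant_of_has_deriv_right_zero (f := fun s => G (s, ε))
      (fun s hs => (h1 s hs).continuousAt.continuousWithinAt)
      (fun s hs => (h1 s ⟨hs.1, hs.2.le⟩).hasDerivWithinAt) 1 ⟨zero_le_one, le_rfl⟩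
  have hd : ∀ s, HasDerivAt (fun ε => G (s, ε)) (fderiv ℝ G (s, 0) (0, 1)) 0 := fun s =>
    ((hG (s, 0)).comp (0 : ℝ) (f := fun ε => (s, ε)) (hasFDerivAt_prodMk_right s 0)).hasDerivAt
  -- The two volumes are known to agree only for `ε ≥ 0`, so their derivatives at `0` are compared
  -- as one-sided derivatives.
  have h1 : HasDerivWithinAt (fun ε => G (0, ε)) (fderiv ℝ G (1, 0) (0, 1)) (Set.Ici 0) 0 :=
    ((hd 1).hasDerivWithinAt (s := Set.Ici 0)).congr (fun ε hε => (hconst ε hε).symm)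
      (hconst 0 le_rfl).symm
  have h2 := (uniqueDiffWithinAt_Ici (0 : ℝ)).eq_deriv _ h1 (hd 0).hasDerivWithinAt
  rw [hG' (1, 0) zero_le_one le_rfl le_rfl, hG' (0, 0) le_rfl zero_le_one le_rfl] at h2
  have h3 : formPencil η β χ (1, 0) = TwistedKahler.shift η φ := by rw [shift_eq_add]; simp [formPencil, β]
  have h4 : formPencil η β χ (0, 0) = η := by simp [formPencil]
  rw [h3, h4] at h2
  simpa using h2

/-- On a compact manifold, a large multiple of a Kähler form dominates any `(1,1)`-form. -/
theorem IsKahlerForm.exists_dominating {η β : Tensor2 n M} (hη : IsKahlerForm η)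
    (hβ : ∀ a : M, ContDiffOn ℝ ∞ (inChart β a) (chartAt (Cn n) a).target) :
    ∃ C : ℝ, ∀ x v, v ≠ 0 → 0 < C * η x v (J n v) + β x v (J n v) := by
  have hmono : ∀ {C C' : ℝ} {x : M} {v : Cn n}, C ≤ C' → v ≠ 0 → 0 < C * η x v (J n v) + β x v (J n v) →
      0 < C' * η x v (J n v) + β x v (J n v) := fun {_ _ x v} hC hv h => by
    have := mul_le_mul_of_nonneg_right hC (hη.pos x v hv).le
    linarith
  suffices h : ∃ C : ℝ, ∀ x ∈ (Set.univ : Set M), ∀ v, v ≠ 0 →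
      0 < C * η x v (J n v) + β x v (J n v) by
    obtain ⟨C, hC⟩ := h
    exact ⟨C, fun x => hC x trivial⟩
  refine isCompact_univ.induction_on (p := fun s => ∃ C : ℝ, ∀ x ∈ s, ∀ v, v ≠ 0 →
      0 < C * η x v (J n v) + β x v (J n v)) ⟨0, fun x hx => hx.elim⟩
    (fun s t hst ⟨C, hC⟩ => ⟨C, fun x hx => hC x (hst hx)⟩)
    (fun s t ⟨C, hC⟩ ⟨C', hC'⟩ => ⟨max C C', fun x hx v hv => ?_⟩) fun a _ => ?_
  · rcases hx with hx | hx
    · exact hmono (le_max_left _ _) hv (hC x hx v hv)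
    · exact hmono (le_max_right _ _) hv (hC' x hx v hv)
  · let y₀ := chartAt (Cn n) a a
    have hy := (chartAt (Cn n) a).map_source (mem_chart_source _ a)
    have hn := (chartAt (Cn n) a).open_target.mem_nhds hy
    have hcα := ((hη.smooth a).contDiffAt hn).continuousAt
    have hcβ := ((hβ a).contDiffAt hn).continuousAt
    have hp := isPos_inChart hη.isPos hy
    have hS := isCompact_sphere (0 : Cn n) 1
    obtain ⟨C, hC⟩ : ∃ C : ℝ, ∀ v ∈ Metric.sphere (0 : Cn n) 1,
        0 < C * inChart η a y₀ v (J n v) + inChart β a y₀ v (J n v) := by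
      have hne : ∀ v ∈ Metric.sphere (0 : Cn n) 1, v ≠ 0 := fun v hv h0 => by
        simp [h0] at hv
      have hcont : ContinuousOn (fun v => -inChart β a y₀ v (J n v) / inChart η a y₀ v (J n v))
          (Metric.sphere (0 : Cn n) 1) := by
        refine ContinuousOn.div ?_ ?_ fun v hv => (hp.pos v (hne v hv)).ne'
        · exact (by fun_prop : Continuous fun v => -inChart β a y₀ v (J n v)).continuousOn
        · exact (by fun_prop : Continuous fun v => inChart η a y₀ v (J n v)).continuousOn
      obtain ⟨C, hC⟩ := (hS.image_of_continuousOn hcont).bddAbove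
      -- `C` bounds `-β / η` on the unit sphere; adding `1` makes the inequality strict, so that it
      -- persists at nearby points.
      refine ⟨C + 1, fun v hv => ?_⟩
      have h1 := hC ⟨v, hv, rfl⟩
      have h2 := hp.pos v (hne v hv)
      simp only at h1
      rw [div_le_iff₀ h2] at h1
      linarith
    have hev : ∀ᶠ y in 𝓝 y₀, ∀ v ∈ Metric.sphere (0 : Cn n) 1,
        0 < C * inChart η a y v (J n v) + inChart β a y v (J n v) := by
      refine hS.eventually_forall_of_forall_eventually fun v hv => ?_
      have h1 : ContinuousAt (fun q : Cn n × Cn n => C * inChart η a q.1 q.2 (J n q.2) +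
          inChart β a q.1 q.2 (J n q.2)) (y₀, v) := by
        have e1 : ContinuousAt (fun q : Cn n × Cn n => inChart η a q.1) (y₀, v) :=
          ContinuousAt.comp (g := inChart η a) hcα continuousAt_fst
        have e2 : ContinuousAt (fun q : Cn n × Cn n => inChart β a q.1) (y₀, v) :=
          ContinuousAt.comp (g := inChart β a) hcβ continuousAt_fst
        have e3 : ContinuousAt (fun q : Cn n × Cn n => J n q.2) (y₀, v) :=
          ((J n).continuous.comp continuous_snd).continuousAt
        exact (continuousAt_const.mul ((e1.clm_apply continuousAt_snd).clm_apply e3)).add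
          ((e2.clm_apply continuousAt_snd).clm_apply e3)
      exact h1.eventually (lt_mem_nhds (hC v hv))
    have hca := (chartAt (Cn n) a).continuousAt (mem_chart_source _ a)
    have hsrc := (chartAt (Cn n) a).open_source.mem_nhds (mem_chart_source _ a)
    refine ⟨{x | x ∈ (chartAt (Cn n) a).source ∧ ∀ v ∈ Metric.sphere (0 : Cn n) 1,
        0 < C * inChart η a (chartAt (Cn n) a x) v (J n v) +
          inChart β a (chartAt (Cn n) a x) v (J n v)},
      mem_nhdsWithin_of_mem_nhds (Filter.inter_mem hsrc (hca.eventually hev)), C,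
      fun x hx v hv => ?_⟩
    obtain ⟨hxa, hx⟩ := hx
    let w := dchart a x v
    have hw : w ≠ 0 := fun h0 => hv (by
      rw [← dchartSymm_dchart hxa v]
      change dchartSymm a _ w = 0
      rw [h0, map_zero])
    have hnw : 0 < ‖w‖ := norm_pos_iff.2 hw
    -- The condition is homogeneous of degree two in the vector, so the unit sphere suffices.
    have h1 := hx (‖w‖⁻¹ • w) (by simp [norm_smul, hnw.ne'])
    have h2 : ∀ γ : Tensor2 n M, inChart γ a (chartAt (Cn n) a x) w (J n w) = γ x v (J n v) :=
      fun γ => by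
      conv_rhs => rw [← pull_inChart γ hxa]
      rw [pull_apply, dchart_J hxa]
    simp only [map_smul, smul_apply, smul_eq_mul, h2] at h1
    have h3 : 0 < ‖w‖⁻¹ * ‖w‖⁻¹ * (C * η x v (J n v) + β x v (J n v)) := by
      calc _ < _ := h1
        _ = _ := by ring
    exact (mul_pos_iff_of_pos_left (by positivity)).1 h3

/-- Locally `log ρ(α) = log ρ(η) + log (ρ(α) / ρ(η))`, and the last term is a global function. -/
theorem ricci_shift {η : Tensor2 n M} (hη : IsKahlerForm η) {α : Tensor2 n M} (hα : IsKahlerForm α) :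
    ricci α = ricci η - shift 0 (fun x => Real.log (volRatio η α x)) := by
  have hlog : ContMDiff 𝓘(ℝ, Cn n) 𝓘(ℝ, ℝ) ∞ (fun x => Real.log (volRatio η α x)) :=
    contMDiff_of_funInChart fun a => by
      have hy := (chartAt (Cn n) a).map_source (mem_chart_source _ a)
      refine (contDiffAt_funInChart (hα.contMDiff_volRatio hη) hy).log ?_
      have : funInChart (volRatio η α) a (chartAt (Cn n) a a) = volRatio η α a := by
        simp [funInChart, (chartAt (Cn n) a).left_inv (mem_chart_source _ a)]
      rw [this]
      exact (div_pos (hα.isPos a).rho_pos (hη.isPos a).rho_pos).ne'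
  ext1 x
  have hy := (chartAt (Cn n) x).map_source (mem_chart_source _ x)
  have hn := (chartAt (Cn n) x).open_target.mem_nhds hy
  have h1 : (fun z => Real.log (rho (inChart α x z))) =ᶠ[𝓝 (chartAt (Cn n) x x)]
      fun z => Real.log (rho (inChart η x z)) +
        funInChart (fun x => Real.log (volRatio η α x)) x z := by
    filter_upwards [hn] with z hz
    have e1 := (isPos_inChart hα.isPos hz).rho_pos
    have e2 := (isPos_inChart hη.isPos hz).rho_pos
    rw [funInChart, Function.comp_apply, volRatio_symm (fun x => (hα.isPos x).toIsHerm) hη.isPos hz,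
      Real.log_div e1.ne' e2.ne']
    ring
  rw [ricci_eq_locRicci hα, locRicci, h1.ddbarAt_eq,
    ddbarAt_add ((hη.localKahler x).contDiffAt_log_rho hy) (contDiffAt_funInChart hlog hy),
    Pi.sub_apply, ricci_eq_locRicci hη, locRicci, ← inChart_ddbar hlog hy, inChart_self]
  abel

/-- `Ric(η)` is closed but not positive, so `integral_tr_shift` is applied to the Kähler form `C η +
Ric(η)` and to `η`, and the results are subtracted. `Ric(ω_φ)` differs from `Ric(η)` by `√-1∂∂̄` of
a function, whose trace integrates to zero. -/
theorem IsKahlerForm.integral_scal_shift {η : Tensor2 n M} (hη : IsKahlerForm η) {φ : M → ℝ}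
    (hφ : φ ∈ potentials η) :
    ∫ x, scal (TwistedKahler.shift η φ) x ∂(vol (TwistedKahler.shift η φ)) = ∫ x, scal η x ∂(vol η) := by
  have hα := hη.shift hφ
  obtain ⟨C, hC⟩ := hη.exists_dominating (contDiffOn_inChart_ricci hη)
  have hK : IsKahlerForm (C • η + ricci η) :=
    hη.add_of_pos C (contDiffOn_inChart_ricci hη) (isHerm_ricci hη) (fun a y hy u v w => by
      have h1 : inChart (ricci η) a =ᶠ[𝓝 y] fun z => -ddbarAt (fun z =>
          Real.log (rho (inChart η a z))) z :=
        Filter.eventually_of_mem ((chartAt (Cn n) a).open_target.mem_nhds hy) fun z hz =>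
          inChart_ricci hη hz
      have h2 := ddbarAt_closed (chartAt (Cn n) a).open_target (fun _ hz =>
        ((hη.localKahler a).contDiffAt_log_rho hz).contDiffWithinAt) hy u v w
      rw [h1.fderiv_eq, fderiv_fun_neg]
      simp only [neg_apply]
      linarith) hC
  have h1 := hη.integral_tr_shift hK hφ
  have h2 := hη.integral_tr_shift hη hφ
  have hlog : ContMDiff 𝓘(ℝ, Cn n) 𝓘(ℝ, ℝ) ∞ (fun x => Real.log (volRatio η (TwistedKahler.shift η φ) x)) :=
    contMDiff_of_funInChart fun a => by
      have hy := (chartAt (Cn n) a).map_source (mem_chart_source _ a)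
      refine (contDiffAt_funInChart (hα.contMDiff_volRatio hη) hy).log ?_
      have : funInChart (volRatio η (TwistedKahler.shift η φ)) a (chartAt (Cn n) a a) =
          volRatio η (TwistedKahler.shift η φ) a := by
        simp [funInChart, (chartAt (Cn n) a).left_inv (mem_chart_source _ a)]
      rw [this]
      exact (div_pos (hα.isPos a).rho_pos (hη.isPos a).rho_pos).ne'
  have h3 := hα.integral_tr_ddbar hlog
  have hsplit : ∀ {α : Tensor2 n M}, IsKahlerForm α →
      ∫ x, tr α (C • η + ricci η) x ∂(vol α) =
        C * (∫ x, tr α η x ∂(vol α)) + ∫ x, tr α (ricci η) x ∂(vol α) := fun {α} hα => by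
    have c1 : Continuous (tr α η) :=
      (hα.contMDiff_tr (fun x => (hη.isPos x).toIsHerm) hη.smooth).continuous
    have c2 : Continuous (tr α (ricci η)) :=
      (hα.contMDiff_tr (isHerm_ricci hη) (contDiffOn_inChart_ricci hη)).continuous
    simp only [tr_add, tr_smul]
    rw [hα.integral_add (f := fun x => C * tr α η x) (continuous_const.mul c1) c2, integral_const_mul]
  have h4 : ∫ x, scal (TwistedKahler.shift η φ) x ∂(vol (TwistedKahler.shift η φ)) =
      ∫ x, tr (TwistedKahler.shift η φ) (ricci η) x ∂(vol (TwistedKahler.shift η φ)) := by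
    have e1 : ∀ x, tr (TwistedKahler.shift η φ) (ricci η) x = scal (TwistedKahler.shift η φ) x +
        tr (TwistedKahler.shift η φ) (TwistedKahler.shift 0 fun x => Real.log (volRatio η (TwistedKahler.shift η φ) x)) x := fun x => by
      rw [scal, ricci_shift hη hα, ← tr_add, sub_add_cancel]
    simp only [e1]
    rw [hα.integral_add hα.contMDiff_scal.continuous (hα.contMDiff_tr (isHerm_ddbar hlog)
      (contDiffOn_inChart_ddbar hlog)).continuous, h3, add_zero]
  rw [hsplit hα, hsplit hη, h2] at h1
  rw [h4]
  exact add_left_cancel h1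

theorem integral_onSymplectic [Nonempty M] {η χ : Tensor2 n M} (hη : IsKahlerForm η)
    (hχ : IsKahlerForm χ) (t : ℝ) {f : Diff n M} (hf : f ∈ kahlerSpace η) :
    ∫ x, onSymplectic η (fun α x => (1 - t) * tr α χ x - t * scal α x - constC η χ t) f x
      ∂(vol η) = 0 := by
  have hfin := hη.isFiniteMeasure
  have hopen := hη.isOpenPosMeasure
  have hα := hη.pushforward hf
  -- The averages divide by the total volume, so it has to be finite and nonzero.
  have hV : (vol η).real Set.univ ≠ 0 := by
    rw [Measure.real, ENNReal.toReal_ne_zero]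
    exact ⟨(isOpen_univ.measure_pos _ Set.univ_nonempty).ne', measure_ne_top _ _⟩
  have c1 : Continuous (tr (pushforward f η) χ) :=
    (hα.contMDiff_tr (fun x => (hχ.isPos x).toIsHerm) hχ.smooth).continuous
  have c2 : Continuous (scal (pushforward f η)) := hα.contMDiff_scal.continuous
  have e1 : ∫ x, tr (pushforward f η) χ (f x) ∂(vol η) = ∫ x, tr η χ x ∂(vol η) := by
    rw [← integral_vol_pushforward hη.isPos hα.isPos]
    obtain ⟨φ, hφ, h⟩ := hf
    rw [h, hη.integral_tr_shift hχ hφ]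
  have e2 : ∫ x, scal (pushforward f η) (f x) ∂(vol η) = ∫ x, scal η x ∂(vol η) := by
    rw [← integral_vol_pushforward hη.isPos hα.isPos]
    obtain ⟨φ, hφ, h⟩ := hf
    rw [h, hη.integral_scal_shift hφ]
  have i1 : Integrable (fun x => (1 - t) * tr (pushforward f η) χ (f x)) (vol η) :=
    hη.integrable (continuous_const.mul (c1.comp f.continuous))
  have i2 : Integrable (fun x => t * scal (pushforward f η) (f x)) (vol η) :=
    hη.integrable (continuous_const.mul (c2.comp f.continuous))
  have i12 : Integrable (fun x => (1 - t) * tr (pushforward f η) χ (f x) -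
    t * scal (pushforward f η) (f x)) (vol η) := i1.sub i2
  simp only [onSymplectic]
  rw [integral_sub i12 (integrable_const _), integral_sub i1 i2, integral_const_mul,
    integral_const_mul, e1, e2, integral_const, smul_eq_mul, constC, average, average]
  change _ - _ - _ * ((1 - t) * _ - t * ((∫ x, scal η x ∂(vol η)) / _)) = 0
  field_simp
  ring

end MeanValues

/-! ### Exterior derivatives of forms depending on parameters -/

section ParametricForms

open Filter Topology

variable {n : ℕ} {P : Type*} [NormedAddCommGroup P] [NormedSpace ℝ P]

theorem fderiv_clm_comp_apply {G : P → Cn n →L[ℝ] Cn n} {B : P → Cn n →L[ℝ] ℝ} {q : P}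
    (hB : DifferentiableAt ℝ B q) (hG : DifferentiableAt ℝ G q) (u : P) :
    fderiv ℝ (fun r => (B r).comp (G r)) q u =
      (B q).comp (fderiv ℝ G q u) + (fderiv ℝ B q u).comp (G q) := by
  rw [fderiv_clm_comp hB hG]
  rfl

/-- The variation of the pulled-back complex structure at the identity; for the differentials of a
family it is `L_V J`. -/
theorem fderiv_conj_J {D : P → Cn n →L[ℝ] Cn n} {q : P} (hD : ContDiffAt ℝ ∞ D q)
    (hi : D q = ContinuousLinearMap.id ℝ (Cn n)) (u : P) :
    fderiv ℝ (fun r => (D r).inverse.comp ((J n).comp (D r))) q u =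
      (J n).comp (fderiv ℝ D q u) - (fderiv ℝ D q u).comp (J n) := by
  have hinv : (D q).IsInvertible := by
    rw [hi]; exact ⟨ContinuousLinearEquiv.refl ℝ (Cn n), rfl⟩
  have h1 := contDiffAt_inverse_comp hD hinv
  have h2 : HasFDerivAt (fun r => (J n).comp (D r))
      ((ContinuousLinearMap.compL ℝ (Cn n) (Cn n) (Cn n) (J n)).comp (fderiv ℝ D q)) q :=
    (ContinuousLinearMap.compL ℝ (Cn n) (Cn n) (Cn n) (J n)).hasFDerivAt.comp q hD.hasFDerivAt_infty
  rw [(h1.hasFDerivAt_infty.clm_comp h2).fderiv]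
  have h3 := fderiv_inverse hD hinv u
  ext1 v
  simp [h3, hi, sub_eq_add_neg]

/-- The exterior derivative, in the second variable, of a 1-form depending on parameters. -/
def extdSnd (ζ : P × Cn n → Cn n →L[ℝ] ℝ) (q : P × Cn n) : Bil n :=
  extd (fun y => ζ (q.1, y)) q.2

/-- The alternating part of the restriction of a linear map to the second factor. -/
def altSnd : (P × Cn n →L[ℝ] Cn n →L[ℝ] ℝ) →L[ℝ] Bil n :=
  let L := (ContinuousLinearMap.compL ℝ (Cn n) (P × Cn n) (Cn n →L[ℝ] ℝ)).flip
    (ContinuousLinearMap.inr ℝ P (Cn n))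
  L - ((ContinuousLinearMap.flipₗᵢ ℝ (Cn n) (Cn n) ℝ).toContinuousLinearEquiv :
    Bil n →L[ℝ] Bil n).comp L

theorem altSnd_apply (T : P × Cn n →L[ℝ] Cn n →L[ℝ] ℝ) (v w : Cn n) :
    altSnd T v w = T (0, v) w - T (0, w) v := rfl

theorem fderiv_snd {G : Type*} [NormedAddCommGroup G] [NormedSpace ℝ G] {f : P × Cn n → G}
    {q : P × Cn n} (hf : DifferentiableAt ℝ f q) (v : Cn n) :
    fderiv ℝ (fun y => f (q.1, y)) q.2 v = fderiv ℝ f q (0, v) := by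
  have e : HasFDerivAt (fun y => f (q.1, y)) _ q.2 :=
    HasFDerivAt.comp (g := f) q.2 hf.hasFDerivAt (hasFDerivAt_prodMk_right q.1 q.2)
  rw [e.fderiv]
  rfl

theorem fderiv_fst {G : Type*} [NormedAddCommGroup G] [NormedSpace ℝ G] {f : P × Cn n → G}
    {q : P × Cn n} (hf : DifferentiableAt ℝ f q) (u : P) :
    fderiv ℝ (fun p => f (p, q.2)) q.1 u = fderiv ℝ f q (u, 0) := by
  have e : HasFDerivAt (fun p => f (p, q.2)) _ q.1 :=
    HasFDerivAt.comp (g := f) q.1 hf.hasFDerivAt (hasFDerivAt_prodMk_left q.1 q.2)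
  rw [e.fderiv]
  rfl

theorem extdSnd_eq {ζ : P × Cn n → Cn n →L[ℝ] ℝ} {q : P × Cn n} (hζ : DifferentiableAt ℝ ζ q) :
    extdSnd ζ q = altSnd (fderiv ℝ ζ q) := by
  ext v w
  rw [extdSnd, extd_apply, altSnd_apply, fderiv_snd hζ, fderiv_snd hζ]

theorem extdSnd_eventuallyEq {ζ : P × Cn n → Cn n →L[ℝ] ℝ} {q : P × Cn n}
    (hζ : ContDiffAt ℝ ∞ ζ q) : extdSnd ζ =ᶠ[𝓝 q] fun r => altSnd (fderiv ℝ ζ r) := by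
  filter_upwards [(hζ.of_le (m := 1) (by simp)).eventually (by simp)] with r hr
  exact extdSnd_eq (hr.differentiableAt (by simp))

theorem contDiffAt_extdSnd {ζ : P × Cn n → Cn n →L[ℝ] ℝ} {q : P × Cn n}
    (hζ : ContDiffAt ℝ ∞ ζ q) : ContDiffAt ℝ ∞ (extdSnd ζ) q :=
  ((altSnd (n := n) (P := P)).contDiff.contDiffAt.comp q hζ.fderiv_infty).congr_of_eventuallyEq (extdSnd_eventuallyEq hζ)

/-- The exterior derivative commutes with differentiation in the parameters. -/
theorem fderiv_extdSnd {ζ : P × Cn n → Cn n →L[ℝ] ℝ} {q : P × Cn n} (hζ : ContDiffAt ℝ ∞ ζ q)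
    (u : P) : fderiv ℝ (extdSnd ζ) q (u, 0) = extd (fun y => fderiv ℝ ζ (q.1, y) (u, 0)) q.2 := by
  have e : HasFDerivAt (fun r => altSnd (fderiv ℝ ζ r)) (altSnd.comp (fderiv ℝ (fderiv ℝ ζ) q)) q :=
    (altSnd (n := n) (P := P)).hasFDerivAt.comp q hζ.fderiv_infty.hasFDerivAt_infty
  have h1 : ∀ v, fderiv ℝ (fun y => fderiv ℝ ζ (q.1, y) (u, 0)) q.2 v =
      fderiv ℝ (fderiv ℝ ζ) q (u, 0) (0, v) := fun v => by
    rw [fderiv_snd (f := fun r => fderiv ℝ ζ r (u, 0))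
      ((hζ.fderiv_infty.clm_apply contDiffAt_const).differentiableAt (by simp)),
      fderiv_clm_apply_const (hζ.fderiv_infty.differentiableAt (by simp)), hζ.symm_infty]
  rw [(extdSnd_eventuallyEq hζ).fderiv_eq, e.fderiv]
  ext v w
  rw [extd_apply, h1, h1]
  rfl

theorem fderiv_trR_fst {T : P × Cn n → Bil n} {q : P × Cn n} (hT : DifferentiableAt ℝ T q)
    (β : Bil n) (u : P) :
    fderiv ℝ (fun p => trR β (T (p, q.2))) q.1 u = trR β (fderiv ℝ T q (u, 0)) := by
  let L : Bil n →L[ℝ] ℝ := (1 / 2 : ℝ) • trc.comp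
    (ContinuousLinearMap.compL ℝ (Cn n) (Cn n →L[ℝ] ℝ) (Cn n) β.inverse)
  have e : HasFDerivAt (fun r => L (T r)) (L.comp (fderiv ℝ T q)) q :=
    L.hasFDerivAt.comp q hT.hasFDerivAt
  have h := fderiv_fst (f := fun r => L (T r)) e.differentiableAt u
  rw [e.fderiv] at h
  exact h

end ParametricForms

/-! ### First variations of `tr χ` and of the scalar curvature -/

section FamilyTraces

open Filter Topology

variable {n : ℕ} {M : Type*} [TopologicalSpace M] [ChartedSpace (Cn n) M]
  [IsManifold 𝓘(ℂ, Cn n) ∞ M]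
  {P : Type*} [NormedAddCommGroup P] [NormedSpace ℝ P] {F : P → Diff n M} {η : Tensor2 n M}

/-- Pulled back to the source, the metric `F_* η` becomes `η`, so the parameters survive only in the
pull-back of `β`. -/
theorem IsSmoothFamily.tr_eq (hF : IsSmoothFamily F)
    (hFη : ∀ p, IsKahlerForm (pushforward (F p) η)) {β : Tensor2 n M} (hβ : ∀ x, IsHerm (β x))
    {a b : M} {q : P × Cn n} (hq : q ∈ famSet F a b) :
    tr (pushforward (F q.1) η) β (F q.1 ((chartAt (Cn n) a).symm q.2)) =
      trR (inChart η a q.2) (pull (inChart β b (famChart F a b q)) (famD F a b q)) := by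
  have h1 := tr_eq_trR (((hFη q.1).isPos) (F q.1 ((chartAt (Cn n) a).symm q.2))) (hβ _) hq.2
  rw [h1, hF.inChart_eq η hq]
  exact (trR_pull (isPos_inChart (hFη q.1).isPos (famChart_mem_target hq)).isInvertible
    (hF.famD_isInvertible hq)).symm

theorem IsSmoothFamily.pull_inverse_famD (hF : IsSmoothFamily F) (η : Tensor2 n M)
    {a b : M} {q : P × Cn n} (hq : q ∈ famSet F a b) :
    pull (inChart η a q.2) (famD F a b q).inverse =
      inChart (pushforward (F q.1) η) b (famChart F a b q) := by
  rw [hF.inChart_eq η hq, pull_pull, (hF.famD_isInvertible hq).self_comp_inverse, pull_id]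

theorem mem_famSet_one {p : P} (h1 : F p = 1) {a : M} {y : Cn n}
    (hy : y ∈ (chartAt (Cn n) a).target) : (p, y) ∈ famSet F a a :=
  ⟨hy, by rw [h1]; exact (chartAt (Cn n) a).map_target hy⟩

theorem famChart_one {p : P} (h1 : F p = 1) {a : M} {y : Cn n}
    (hy : y ∈ (chartAt (Cn n) a).target) : famChart F a a (p, y) = y := by
  rw [famChart, h1]
  exact (chartAt (Cn n) a).right_inv hy

theorem IsSmoothFamily.famD_one (hF : IsSmoothFamily F) {p : P} (h1 : F p = 1) {a : M} {y : Cn n}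
    (hy : y ∈ (chartAt (Cn n) a).target) :
    famD F a a (p, y) = ContinuousLinearMap.id ℝ (Cn n) := by
  have e : HasFDerivAt (fun z => famChart F a a (p, z)) (famD F a a (p, y)) y :=
    HasFDerivAt.comp (g := famChart F a a) y (hF.contDiffAt (mem_famSet_one h1 hy)).hasFDerivAt_infty
      (hasFDerivAt_prodMk_right p y)
  refine e.unique ((hasFDerivAt_id y).congr_of_eventuallyEq ?_)
  exact Filter.eventually_of_mem ((chartAt (Cn n) a).open_target.mem_nhds hy) fun z hz =>
    famChart_one h1 hz

theorem IsSmoothFamily.fderiv_famChart_one (hF : IsSmoothFamily F) {p : P} (h1 : F p = 1) {a : M}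
    {y : Cn n} (hy : y ∈ (chartAt (Cn n) a).target) (u : P) :
    fderiv ℝ (famChart F a a) (p, y) (u, 0) = fieldInChart (velocity F p u) a y := by
  have h := hF.fieldInChart_velocity (mem_famSet_one h1 hy) u
  rw [famChart_one h1 hy] at h
  exact h.symm

theorem IsSmoothFamily.fderiv_famD_one (hF : IsSmoothFamily F) {p : P} (h1 : F p = 1) {a : M}
    {y : Cn n} (hy : y ∈ (chartAt (Cn n) a).target) (u : P) :
    fderiv ℝ (famD F a a) (p, y) (u, 0) = fderiv ℝ (fieldInChart (velocity F p u) a) y := by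
  have h := hF.fderiv_velocity (mem_famSet_one h1 hy) u
  rw [famChart_one h1 hy, hF.famD_one h1 hy, ContinuousLinearMap.comp_id] at h
  exact h.symm

theorem IsSmoothFamily.smoothParam_tr (hF : IsSmoothFamily F) (hη : IsKahlerForm η)
    (hFη : ∀ p, IsKahlerForm (pushforward (F p) η)) {χ : Tensor2 n M} (hχ : IsKahlerForm χ) :
    SmoothParam n fun p x => tr (pushforward (F p) η) χ (F p x) := fun p a => by
  have hq : (p, chartAt (Cn n) a a) ∈ famSet F a (F p a) :=
    mem_famSet (mem_chart_source _ a) (mem_chart_source _ _)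
  have h1 := (hη.localKahler a).smoothAt hq.1
  have h2 : ContDiffAt ℝ ∞ (fun r : P × Cn n => inChart η a r.2) (p, chartAt (Cn n) a a) :=
    h1.comp (g := inChart η a) _ contDiffAt_snd
  have h3 := contDiffAt_pull (((hχ.localKahler _).smoothAt (famChart_mem_target hq)).comp _
    (hF.contDiffAt hq)) (hF.contDiffAt_famD hq)
  refine (IsPos.contDiffAt_trR (α := fun r : P × Cn n => inChart η a r.2) (isPos_inChart hη.isPos hq.1) h2 h3).congr_of_eventuallyEq ?_
  exact Filter.eventually_of_mem (hF.famSet_mem_nhds hq) fun r hr =>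
    hF.tr_eq hFη (fun x => (hχ.isPos x).toIsHerm) hr

/-- In the source picture the trace is a fixed linear functional of `F^* χ`, whose derivative is
`d(χ(V, ·))` by Cartan's formula. -/
theorem IsSmoothFamily.fderiv_tr (hF : IsSmoothFamily F)
    (hFη : ∀ p, IsKahlerForm (pushforward (F p) η)) {χ : Tensor2 n M} (hχ : IsKahlerForm χ)
    {p : P} (h1 : F p = 1) {a x : M} (ha : x ∈ (chartAt (Cn n) a).source) (u : P) :
    fderiv ℝ (fun r => tr (pushforward (F r) η) χ (F r x)) p u =
      trR (inChart η a (chartAt (Cn n) a x)) (extd (fun y => inChart χ a y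
        (fieldInChart (velocity F p u) a y)) (chartAt (Cn n) a x)) := by
  have hy := (chartAt (Cn n) a).map_source ha
  have hq := mem_famSet_one h1 hy
  have hT := contDiffAt_pull (((hχ.localKahler _).smoothAt (famChart_mem_target hq)).comp _
    (hF.contDiffAt hq)) (hF.contDiffAt_famD hq)
  have e : (fun r => tr (pushforward (F r) η) χ (F r x)) =ᶠ[𝓝 p] fun r =>
      trR (inChart η a (chartAt (Cn n) a x)) (pull (inChart χ a (famChart F a a
        (r, chartAt (Cn n) a x))) (famD F a a (r, chartAt (Cn n) a x))) := by
    have hc : ContinuousAt (fun r : P => (r, chartAt (Cn n) a x)) p :=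
      (Continuous.prodMk_left _).continuousAt
    filter_upwards [hc.preimage_mem_nhds (hF.famSet_mem_nhds hq)] with r hr
    have := hF.tr_eq hFη (fun x => (hχ.isPos x).toIsHerm) hr
    rwa [(chartAt (Cn n) a).left_inv ha] at this
  have h2 := fderiv_trR_fst (hT.differentiableAt (by simp)) (inChart η a (chartAt (Cn n) a x)) u
  rw [e.fderiv_eq]
  refine h2.trans ?_
  congr 1
  refine (hF.fderiv_pull_closed hχ hq u).trans (EventuallyEq.extd_eq ?_)
  refine Filter.eventually_of_mem ((chartAt (Cn n) a).open_target.mem_nhds hy) fun z hz => ?_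
  simp only
  rw [famChart_one h1 hz, hF.famD_one h1 hz, hF.fderiv_famChart_one h1 hz]
  rfl

/-- The logarithm of the volume density of `F_* η`, transported by `F`. -/
def famLog (F : P → Diff n M) (η : Tensor2 n M) (a b : M) (q : P × Cn n) : ℝ :=
  Real.log (rho (inChart (pushforward (F q.1) η) b (famChart F a b q)))

/-- A primitive of the Ricci form of `F_* η`, transported by `F`. -/
def famRicci (F : P → Diff n M) (η : Tensor2 n M) (a b : M) (q : P × Cn n) : Cn n →L[ℝ] ℝ :=
  (1 / 2 : ℝ) • ((fderiv ℝ (famLog F η a b) q).comp (ContinuousLinearMap.inr ℝ P (Cn n))).comp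
    ((famD F a b q).inverse.comp ((J n).comp (famD F a b q)))

theorem IsSmoothFamily.contDiffAt_inChart_pushforward (hF : IsSmoothFamily F) (hη : IsKahlerForm η)
    {a b : M} {q : P × Cn n} (hq : q ∈ famSet F a b) :
    ContDiffAt ℝ ∞ (fun r => pull (inChart η a r.2) (famD F a b r).inverse) q :=
  contDiffAt_pull (((hη.localKahler a).smoothAt hq.1).comp (g := inChart η a) q contDiffAt_snd)
    (contDiffAt_inverse_comp (hF.contDiffAt_famD hq) (hF.famD_isInvertible hq))

theorem IsSmoothFamily.famLog_eventuallyEq (hF : IsSmoothFamily F) (η : Tensor2 n M)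
    {a b : M} {q : P × Cn n} (hq : q ∈ famSet F a b) : famLog F η a b =ᶠ[𝓝 q]
      fun r => Real.log (rho (pull (inChart η a r.2) (famD F a b r).inverse)) :=
  Filter.eventually_of_mem (hF.famSet_mem_nhds hq) fun r hr => by
    simp only [hF.pull_inverse_famD η hr]
    rfl

theorem IsSmoothFamily.contDiffAt_famLog (hF : IsSmoothFamily F) (hη : IsKahlerForm η)
    (hFη : ∀ p, IsKahlerForm (pushforward (F p) η)) {a b : M} {q : P × Cn n}
    (hq : q ∈ famSet F a b) : ContDiffAt ℝ ∞ (famLog F η a b) q := by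
  refine ContDiffAt.congr_of_eventuallyEq ?_ (hF.famLog_eventuallyEq η hq)
  refine (contDiff_rho.contDiffAt.comp q (hF.contDiffAt_inChart_pushforward hη hq)).log ?_
  rw [Function.comp_apply, hF.pull_inverse_famD η hq]
  exact (isPos_inChart (hFη q.1).isPos (famChart_mem_target hq)).rho_pos.ne'

theorem IsSmoothFamily.contDiffAt_famRicci (hF : IsSmoothFamily F) (hη : IsKahlerForm η)
    (hFη : ∀ p, IsKahlerForm (pushforward (F p) η)) {a b : M} {q : P × Cn n}
    (hq : q ∈ famSet F a b) : ContDiffAt ℝ ∞ (famRicci F η a b) q :=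
  ContDiffAt.const_smul (1 / 2 : ℝ) ((((hF.contDiffAt_famLog hη hFη hq).fderiv_infty).clm_comp
    contDiffAt_const).clm_comp ((contDiffAt_inverse_comp (hF.contDiffAt_famD hq)
      (hF.famD_isInvertible hq)).clm_comp (contDiffAt_const.clm_comp (hF.contDiffAt_famD hq))))

/-- In the target the Ricci form is `½ d(dλ ∘ J)` with `λ = log ρ`. Exterior differentiation
commutes with pull-back, and `F^*(dλ ∘ J) = d(λ ∘ F) ∘ ((DF)⁻¹ J DF)`. This isolates the two moving
parts: the transported density and the transported complex structure. -/
theorem IsSmoothFamily.pull_ricci (hF : IsSmoothFamily F) (hη : IsKahlerForm η)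
    (hFη : ∀ p, IsKahlerForm (pushforward (F p) η)) {a b : M} {q : P × Cn n}
    (hq : q ∈ famSet F a b) :
    pull (inChart (ricci (pushforward (F q.1) η)) b (famChart F a b q)) (famD F a b q) =
      extdSnd (famRicci F η a b) q := by
  have hk := (hFη q.1).localKahler b
  let lam : Cn n → ℝ := fun z => Real.log (rho (inChart (pushforward (F q.1) η) b z))
  have hlam : ∀ z ∈ (chartAt (Cn n) b).target, ContDiffAt ℝ ∞ lam z := fun z hz =>
    hk.contDiffAt_log_rho hz
  let g : Cn n → Cn n := fun y => famChart F a b (q.1, y)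
  have hr : Continuous fun y : Cn n => (q.1, y) := Continuous.prodMk_right q.1
  have hg : ∀ y, (q.1, y) ∈ famSet F a b → HasFDerivAt g (famD F a b (q.1, y)) y := fun y hy =>
    HasFDerivAt.comp (g := famChart F a b) y (hF.contDiffAt hy).hasFDerivAt_infty
      (hasFDerivAt_prodMk_right q.1 y)
  have hgs : ContDiffAt ℝ ∞ g q.2 :=
    ContDiffAt.comp (g := famChart F a b) q.2 (hF.contDiffAt hq)
      (contDiffAt_const.prodMk contDiffAt_id)
  have hev : (fun y => famRicci F η a b (q.1, y)) =ᶠ[𝓝 q.2]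
      fun y => (1 / 2 : ℝ) • ((dJ lam (g y)).comp (fderiv ℝ g y)) := by
    filter_upwards [hr.continuousAt.preimage_mem_nhds (hF.famSet_mem_nhds hq)] with y hy
    have e1 : (fderiv ℝ (famLog F η a b) (q.1, y)).comp (ContinuousLinearMap.inr ℝ P (Cn n)) =
        (fderiv ℝ lam (g y)).comp (famD F a b (q.1, y)) := by
      have h1 : HasFDerivAt (fun y => famLog F η a b (q.1, y))
          ((fderiv ℝ (famLog F η a b) (q.1, y)).comp (ContinuousLinearMap.inr ℝ P (Cn n))) y :=
        HasFDerivAt.comp (g := famLog F η a b) y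
          (hF.contDiffAt_famLog hη hFη hy).hasFDerivAt_infty (hasFDerivAt_prodMk_right q.1 y)
      exact h1.unique ((hlam _ (famChart_mem_target hy)).hasFDerivAt_infty.comp (g := lam) y (hg y hy))
    rw [famRicci, e1, (hg y hy).fderiv]
    ext1 v
    simp [dJ, (hF.famD_isInvertible hy).self_apply_inverse]
  have hd : ContDiffAt ℝ ∞ (fun y => (dJ lam (g y)).comp (fderiv ℝ g y)) q.2 :=
    ContDiffAt.clm_comp (ContDiffAt.comp (g := dJ lam) q.2
      (contDiffAt_dJ (hlam _ (famChart_mem_target hq))) hgs) hgs.fderiv_infty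
  rw [extdSnd, hev.extd_eq, extd_const_smul _ (hd.differentiableAt (by simp)), inChart_ricci (hFη q.1) (famChart_mem_target hq),
    locRicci, ddbarAt_eq_extd (hlam _ (famChart_mem_target hq))]
  have h2 := extd_comp hgs (contDiffAt_dJ (hlam _ (famChart_mem_target hq)))
  rw [h2, (hg q.2 hq).fderiv]
  ext v w
  simp only [pull_apply, neg_apply, smul_apply, smul_eq_mul]
  ring_nf
  rfl

theorem IsSmoothFamily.scal_eq (hF : IsSmoothFamily F) (hη : IsKahlerForm η)
    (hFη : ∀ p, IsKahlerForm (pushforward (F p) η)) {a b : M} {q : P × Cn n}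
    (hq : q ∈ famSet F a b) :
    scal (pushforward (F q.1) η) (F q.1 ((chartAt (Cn n) a).symm q.2)) =
      trR (inChart η a q.2) (extdSnd (famRicci F η a b) q) := by
  rw [scal, hF.tr_eq hFη (isHerm_ricci (hFη q.1)) hq, hF.pull_ricci hη hFη hq]

theorem IsSmoothFamily.smoothParam_scal (hF : IsSmoothFamily F) (hη : IsKahlerForm η)
    (hFη : ∀ p, IsKahlerForm (pushforward (F p) η)) :
    SmoothParam n fun p x => scal (pushforward (F p) η) (F p x) := fun p a => by
  have hq : (p, chartAt (Cn n) a a) ∈ famSet F a (F p a) :=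
    mem_famSet (mem_chart_source _ a) (mem_chart_source _ _)
  have h1 := (hη.localKahler a).smoothAt hq.1
  have h2 : ContDiffAt ℝ ∞ (fun r : P × Cn n => inChart η a r.2) (p, chartAt (Cn n) a a) :=
    h1.comp (g := inChart η a) _ contDiffAt_snd
  refine (IsPos.contDiffAt_trR (α := fun r : P × Cn n => inChart η a r.2) (isPos_inChart hη.isPos hq.1) h2
    (contDiffAt_extdSnd (hF.contDiffAt_famRicci hη hFη hq))).congr_of_eventuallyEq ?_
  exact Filter.eventually_of_mem (hF.famSet_mem_nhds hq) fun r hr => hF.scal_eq hη hFη hr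

/-- The form at the moving point is `η` pulled back by `(DF)⁻¹`, whose variation at the identity is
the infinitesimal action of `-DV`. By Jacobi's formula and `trR_lie` the logarithm of the density
changes at the rate `-tr DV`. -/
theorem IsSmoothFamily.fderiv_famLog_one (hF : IsSmoothFamily F) (hη : IsKahlerForm η)
    (hFη : ∀ p, IsKahlerForm (pushforward (F p) η)) {p : P} (h1 : F p = 1) {a : M} {y : Cn n}
    (hy : y ∈ (chartAt (Cn n) a).target) (u : P) :
    fderiv ℝ (famLog F η a a) (p, y) (u, 0) =
      -trc (fderiv ℝ (fieldInChart (velocity F p u) a) y) := by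
  have hq := mem_famSet_one h1 hy
  have hD := hF.contDiffAt_famD hq
  have hi := hF.famD_isInvertible hq
  have hS := hF.contDiffAt_inChart_pushforward hη hq
  have hp : IsPos (pull (inChart η a (p, y).2) (famD F a a (p, y)).inverse) := by
    rw [hF.pull_inverse_famD η hq]
    exact isPos_inChart (hFη p).isPos (famChart_mem_target hq)
  have hval : pull (inChart η a y) (famD F a a (p, y)).inverse = inChart η a y := by
    rw [hF.famD_one h1 hy, ContinuousLinearMap.inverse_id, pull_id]
  have hH : IsHerm (fderiv ℝ (fun r => pull (inChart η a r.2) (famD F a a r).inverse) (p, y)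
      (u, 0)) := isHerm_fderiv (hS.differentiableAt (by simp))
    (Filter.eventually_of_mem (hF.famSet_mem_nhds hq) fun r hr => by
      rw [hF.pull_inverse_famD η hr]
      exact (isPos_inChart (hFη r.1).isPos (famChart_mem_target hr)).toIsHerm) (u, 0)
  have hρ := HasFDerivAt.rho_comp hS.hasFDerivAt_infty hp (u, 0)
  have hρd : DifferentiableAt ℝ (fun r => rho (pull (inChart η a r.2) (famD F a a r).inverse))
      (p, y) := (contDiff_rho.contDiffAt.comp (p, y) hS).differentiableAt (by simp)
  rw [(hF.famLog_eventuallyEq η hq).fderiv_eq, fderiv.log hρd hp.rho_pos.ne', smul_apply, hρ,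
    trAt_eq_trR hp hH, smul_eq_mul, inv_mul_cancel_left₀ hp.rho_pos.ne']
  have h2 := hp.isInvertible
  simp only [hval] at h2 ⊢
  rw [← map_neg]
  refine trR_lie h2 _ fun v w => ?_
  have hα : fderiv ℝ (fun r : P × Cn n => inChart η a r.2) (p, y) (u, 0) = 0 := by
    have e : HasFDerivAt (fun r : P × Cn n => inChart η a r.2) _ (p, y) :=
      HasFDerivAt.comp (g := inChart η a) (p, y)
        ((hη.localKahler a).smoothAt hy).hasFDerivAt_infty hasFDerivAt_snd
    rw [e.fderiv]; simp
  have hQ := fderiv_inverse hD hi (u, 0)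
  rw [hF.famD_one h1 hy, hF.fderiv_famD_one h1 hy, ContinuousLinearMap.inverse_id] at hQ
  have hηs : ContDiffAt ℝ ∞ (fun r : P × Cn n => inChart η a r.2) (p, y) :=
    ((hη.localKahler a).smoothAt hy).comp (g := inChart η a) (p, y) contDiffAt_snd
  rw [fderiv_pull_apply hηs (contDiffAt_inverse_comp hD hi), hα, hQ, hF.famD_one h1 hy,
    ContinuousLinearMap.inverse_id]
  simp

theorem famLog_one {p : P} (h1 : F p = 1) {a : M} {y : Cn n}
    (hy : y ∈ (chartAt (Cn n) a).target) :
    famLog F η a a (p, y) = Real.log (rho (inChart η a y)) := by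
  simp only [famLog]
  rw [famChart_one h1 hy, h1, pushforward_one]

/-- The first variation of the Ricci form. -/
theorem IsSmoothFamily.fderiv_famRicci_one (hF : IsSmoothFamily F) (hη : IsKahlerForm η)
    (hFη : ∀ p, IsKahlerForm (pushforward (F p) η)) {p : P} (h1 : F p = 1) {a : M} {y : Cn n}
    (hy : y ∈ (chartAt (Cn n) a).target) (u : P) :
    fderiv ℝ (famRicci F η a a) (p, y) (u, 0) = (1 / 2 : ℝ) •
      ((fderiv ℝ (fun z => Real.log (rho (inChart η a z))) y).comp
        (locLieJ (fieldInChart (velocity F p u) a) y) -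
      (fderiv ℝ (fun z => trc (fderiv ℝ (fieldInChart (velocity F p u) a) z)) y).comp (J n)) := by
  have hq := mem_famSet_one h1 hy
  have hn := (chartAt (Cn n) a).open_target.mem_nhds hy
  have hD := hF.contDiffAt_famD hq
  have hμ := hF.contDiffAt_famLog hη hFη hq
  have hG : ContDiffAt ℝ ∞ (fun r => (famD F a a r).inverse.comp ((J n).comp (famD F a a r)))
      (p, y) := (contDiffAt_inverse_comp hD (hF.famD_isInvertible hq)).clm_comp
    (contDiffAt_const.clm_comp hD)
  have hB : ContDiffAt ℝ ∞ (fun r => (fderiv ℝ (famLog F η a a) r).comp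
      (ContinuousLinearMap.inr ℝ P (Cn n))) (p, y) := hμ.fderiv_infty.clm_comp contDiffAt_const
  have hB0 : (fderiv ℝ (famLog F η a a) (p, y)).comp (ContinuousLinearMap.inr ℝ P (Cn n)) =
      fderiv ℝ (fun z => Real.log (rho (inChart η a z))) y := by
    have e : (fun z => famLog F η a a (p, z)) =ᶠ[𝓝 y] fun z => Real.log (rho (inChart η a z)) :=
      Filter.eventually_of_mem hn fun z hz => famLog_one h1 hz
    rw [← e.fderiv_eq]
    ext1 v
    exact (fderiv_snd (hμ.differentiableAt (by simp)) v).symm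
  -- Derivatives in the parameter and in space commute, so this is the differential of the function
  -- found in `fderiv_famLog_one`.
  have hB1 : fderiv ℝ (fun r => (fderiv ℝ (famLog F η a a) r).comp
      (ContinuousLinearMap.inr ℝ P (Cn n))) (p, y) (u, 0) =
      -fderiv ℝ (fun z => trc (fderiv ℝ (fieldInChart (velocity F p u) a) z)) y := by
    have e : (fun z => fderiv ℝ (famLog F η a a) (p, z) (u, 0)) =ᶠ[𝓝 y]
        fun z => -trc (fderiv ℝ (fieldInChart (velocity F p u) a) z) :=
      Filter.eventually_of_mem hn fun z hz => hF.fderiv_famLog_one hη hFη h1 hz u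
    rw [← fderiv_fun_neg, ← e.fderiv_eq]
    ext1 v
    rw [← fderiv_clm_apply_const (hB.differentiableAt (by simp))]
    have e2 := fderiv_snd (f := fun r => fderiv ℝ (famLog F η a a) r (u, 0)) (q := (p, y))
      ((hμ.fderiv_infty.clm_apply contDiffAt_const).differentiableAt (by simp)) v
    refine Eq.trans ?_ e2.symm
    rw [fderiv_clm_apply_const (hμ.fderiv_infty.differentiableAt (by simp)), hμ.symm_infty]
    exact fderiv_clm_apply_const (hμ.fderiv_infty.differentiableAt (by simp)) (u, (0 : Cn n)) (0, v)
  have e : famRicci F η a a = fun r => (1 / 2 : ℝ) • ((fderiv ℝ (famLog F η a a) r).comp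
      (ContinuousLinearMap.inr ℝ P (Cn n))).comp
      ((famD F a a r).inverse.comp ((J n).comp (famD F a a r))) := rfl
  rw [e, fderiv_fun_const_smul ((hB.clm_comp hG).differentiableAt (by simp)), smul_apply,
    fderiv_clm_comp_apply (hB.differentiableAt (by simp)) (hG.differentiableAt (by simp)), hB0, hB1,
    fderiv_conj_J hD (hF.famD_one h1 hy), hF.fderiv_famD_one h1 hy, hF.famD_one h1 hy,
    ContinuousLinearMap.inverse_id]
  congr 1

theorem IsSmoothFamily.fderiv_scal (hF : IsSmoothFamily F) (hη : IsKahlerForm η)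
    (hFη : ∀ p, IsKahlerForm (pushforward (F p) η))
    {p : P} (h1 : F p = 1) {a x : M} (ha : x ∈ (chartAt (Cn n) a).source) (u : P) :
    fderiv ℝ (fun r => scal (pushforward (F r) η) (F r x)) p u =
      trR (inChart η a (chartAt (Cn n) a x)) (extd (fun y => (1 / 2 : ℝ) •
      ((fderiv ℝ (fun z => Real.log (rho (inChart η a z))) y).comp
        (locLieJ (fieldInChart (velocity F p u) a) y) -
      (fderiv ℝ (fun z => trc (fderiv ℝ (fieldInChart (velocity F p u) a) z)) y).comp (J n)))
        (chartAt (Cn n) a x)) := by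
  have hy := (chartAt (Cn n) a).map_source ha
  have hq := mem_famSet_one h1 hy
  have hζ := hF.contDiffAt_famRicci hη hFη hq
  have e : (fun r => scal (pushforward (F r) η) (F r x)) =ᶠ[𝓝 p] fun r =>
      trR (inChart η a (chartAt (Cn n) a x))
        (extdSnd (famRicci F η a a) (r, chartAt (Cn n) a x)) := by
    have hc : ContinuousAt (fun r : P => (r, chartAt (Cn n) a x)) p :=
      (Continuous.prodMk_left _).continuousAt
    filter_upwards [hc.preimage_mem_nhds (hF.famSet_mem_nhds hq)] with r hr
    have := hF.scal_eq hη hFη hr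
    rwa [(chartAt (Cn n) a).left_inv ha] at this
  have h2 := fderiv_trR_fst ((contDiffAt_extdSnd hζ).differentiableAt (by simp))
    (inChart η a (chartAt (Cn n) a x)) u
  rw [e.fderiv_eq]
  refine h2.trans ?_
  rw [fderiv_extdSnd hζ]
  congr 1
  refine EventuallyEq.extd_eq ?_
  exact Filter.eventually_of_mem ((chartAt (Cn n) a).open_target.mem_nhds hy) fun z hz =>
    hF.fderiv_famRicci_one hη hFη h1 hz u

end FamilyTraces

/-! ### The moment map identity -/

section MomentMap

open Filter Topology

variable {n : ℕ} {M : Type*} [TopologicalSpace M] [ChartedSpace (Cn n) M]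
  [IsManifold 𝓘(ℂ, Cn n) ∞ M] [CompactSpace M] [T2Space M] [MeasurableSpace M] [BorelSpace M]
  {P : Type*} [NormedAddCommGroup P] [NormedSpace ℝ P] {F : P → Diff n M} {η : Tensor2 n M}

/-- The first variation of the trace of a Kähler form, paired with a function. -/
theorem IsSmoothFamily.integral_fderiv_tr_mul (hF : IsSmoothFamily F) (hη : IsKahlerForm η)
    (hFη : ∀ p, IsKahlerForm (pushforward (F p) η)) {χ : Tensor2 n M} (hχ : IsKahlerForm χ)
    {p : P} (h1 : F p = 1) (u : P) {h : M → ℝ} (hh : ContMDiff 𝓘(ℝ, Cn n) 𝓘(ℝ, ℝ) ∞ h) :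
    ∫ x, fderiv ℝ (fun r => tr (pushforward (F r) η) χ (F r x)) p u * h x ∂(vol η) =
      ∫ x, χ x (velocity F p u x) (hamField η h x) ∂(vol η) := by
  have hV := hF.isSmoothField_velocity p u
  have hk : Continuous fun x => fderiv ℝ (fun r => tr (pushforward (F r) η) χ (F r x)) p u :=
    ((hF.smoothParam_tr hη hFη hχ).continuous_fderiv p).clm_apply continuous_const
  have hg : ∀ {h : M → ℝ}, ContMDiff 𝓘(ℝ, Cn n) 𝓘(ℝ, ℝ) ∞ h →
      Continuous fun x => χ x (velocity F p u x) (hamField η h x) := fun hh =>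
    (contMDiff_apply hχ hV (hη.isSmoothField_hamField hh)).continuous
  refine contMDiff_induction (n := n) (p := fun h =>
    ∫ x, fderiv ℝ (fun r => tr (pushforward (F r) η) χ (F r x)) p u * h x ∂(vol η) =
      ∫ x, χ x (velocity F p u x) (hamField η h x) ∂(vol η))
    (U := fun x : M => (chartAt (Cn n) x).source) (fun x => (chartAt (Cn n) x).open_source)
    (fun x => mem_chart_source _ x) (fun a h hh hs => ?_) (fun h k hh hk' e1 e2 => ?_) ?_ hh
  · refine hη.integral_mul_eq_of_extd hh hs (fun x hx => ?_) hk (hg hh)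
      (fun x hx => hF.fderiv_tr hFη hχ h1 (hs hx) u) (fun x hx => apply_eq_inChart χ _ _ (hs hx))
      fun x hx => by rw [hamField_eq_zero hη.isPos hx, map_zero]
    have hy := (chartAt (Cn n) a).map_source (hs hx)
    exact ((hχ.localKahler a).smoothAt hy).clm_apply (hV.contDiffAt hy)
  · simp only [hamField_add hη.isPos hh hk', map_add, Pi.add_apply, mul_add]
    rw [hη.integral_add
      (f := fun x => fderiv ℝ (fun r => tr (pushforward (F r) η) χ (F r x)) p u * h x)
      (g := fun x => fderiv ℝ (fun r => tr (pushforward (F r) η) χ (F r x)) p u * k x)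
      (hk.mul hh.continuous) (hk.mul hk'.continuous),
      hη.integral_add (hg hh) (hg hk'), e1, e2]
  · have e1 : ∀ x, hamField η (0 : M → ℝ) x = 0 := fun x => hamField_const hη.isPos 0 x
    simp [e1]

/-- The first variation of the scalar curvature, paired with a function. -/
theorem IsSmoothFamily.integral_fderiv_scal_mul (hF : IsSmoothFamily F) (hη : IsKahlerForm η)
    (hFη : ∀ p, IsKahlerForm (pushforward (F p) η))
    {p : P} (h1 : F p = 1) (u : P) {h : M → ℝ} (hh : ContMDiff 𝓘(ℝ, Cn n) 𝓘(ℝ, ℝ) ∞ h) :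
    ∫ x, fderiv ℝ (fun r => scal (pushforward (F r) η) (F r x)) p u * h x ∂(vol η) =
      ∫ x, 1 / 4 * lieTrace (hamField η h) (velocity F p u) x ∂(vol η) := by
  have hV := hF.isSmoothField_velocity p u
  have hk : Continuous fun x => fderiv ℝ (fun r => scal (pushforward (F r) η) (F r x)) p u :=
    ((hF.smoothParam_scal hη hFη).continuous_fderiv p).clm_apply continuous_const
  have hg : ∀ {h : M → ℝ}, ContMDiff 𝓘(ℝ, Cn n) 𝓘(ℝ, ℝ) ∞ h →
      Continuous fun x => 1 / 4 * lieTrace (hamField η h) (velocity F p u) x := fun hh =>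
    continuous_const.mul (contMDiff_lieTrace (hη.isSmoothField_hamField hh) hV).continuous
  refine contMDiff_induction (n := n) (p := fun h =>
    ∫ x, fderiv ℝ (fun r => scal (pushforward (F r) η) (F r x)) p u * h x ∂(vol η) =
      ∫ x, 1 / 4 * lieTrace (hamField η h) (velocity F p u) x ∂(vol η))
    (U := fun x : M => (chartAt (Cn n) x).source) (fun x => (chartAt (Cn n) x).open_source)
    (fun x => mem_chart_source _ x) (fun a h hh hs => ?_) (fun h k hh hk' e1 e2 => ?_) ?_ hh
  · let H : Cn n → ℝ := chartExt h a
    let W : Cn n → Cn n := fieldInChart (velocity F p u) a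
    have hloc := hη.localKahler a
    have hH : ContDiff ℝ ∞ H := contDiff_chartExt hh hs
    have hHc : HasCompactSupport H := hasCompactSupport_chartExt hs
    have hHt : tsupport H ⊆ (chartAt (Cn n) a).target := tsupport_chartExt_subset_target hs
    have hW : ∀ y ∈ (chartAt (Cn n) a).target, ContDiffAt ℝ ∞ W y := fun y hy => hV.contDiffAt hy
    let ζ : Cn n → Cn n →L[ℝ] ℝ := fun y => (1 / 2 : ℝ) •
      ((fderiv ℝ (fun z => Real.log (rho (inChart η a z))) y).comp (locLieJ W y) -
        (fderiv ℝ (fun z => trc (fderiv ℝ W z)) y).comp (J n))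
    have hζ : ∀ y ∈ (chartAt (Cn n) a).target, ContDiffAt ℝ ∞ ζ y := fun y hy =>
      ContDiffAt.const_smul (1 / 2 : ℝ) ((((hloc.contDiffAt_log_rho hy).fderiv_infty).clm_comp
        (contDiffAt_locLieJ (hW y hy))).sub (((trc.contDiff.contDiffAt.comp y
          (hW y hy).fderiv_infty).fderiv_infty).clm_comp contDiffAt_const))
    have hX : ∀ y ∈ (chartAt (Cn n) a).target, fieldInChart (hamField η h) a =ᶠ[𝓝 y]
        locHam (inChart η a) H := fun y hy => by
      filter_upwards [(chartAt (Cn n) a).open_target.mem_nhds hy] with z hz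
      rw [fieldInChart_hamField hη.isPos hh hz, locHam, locHam,
        (chartExt_eventuallyEq h hz).fderiv_eq]
    have hX0 : ∀ y ∉ tsupport H, locHam (inChart η a) H =ᶠ[𝓝 y] fun _ => 0 := fun y hy => by
      filter_upwards [(isClosed_tsupport H).isOpen_compl.mem_nhds hy] with z hz
      rw [locHam, fderiv_of_notMem_tsupport ℝ hz, map_zero]
    have hleft : ∫ x, fderiv ℝ (fun r => scal (pushforward (F r) η) (F r x)) p u * h x ∂(vol η) =
        ∫ y, rho (inChart η a y) * (H y * trR (inChart η a y) (extd ζ y)) :=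
      hη.integral_eq_integral (hk.mul hh.continuous)
        (fun x hx => by
          rw [image_eq_zero_of_notMem_tsupport fun hx' => hx (hs hx'), mul_zero])
        (fun x hx => by
          rw [hF.fderiv_scal hη hFη h1 hx, mul_comm]
          simp only [H, chartExt_chart h hx]
          rfl)
        (fun y hy => by
          simp only [H, chartExt, Set.indicator_of_notMem hy, zero_mul])
    have hright : ∫ x, 1 / 4 * lieTrace (hamField η h) (velocity F p u) x ∂(vol η) =
        ∫ y, rho (inChart η a y) * (1 / 4 * trc ((J n).comp
          ((locLieJ (locHam (inChart η a) H) y).comp (locLieJ W y)))) :=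
      hη.integral_eq_integral (hg hh)
        (fun x hx => by
          rw [lieTrace, lieJ_hamField_eq_zero hη.isPos fun hx' => hx (hs hx')]
          simp)
        (fun x hx => by
          rw [lieTrace_eq_inChart (hη.isSmoothField_hamField hh) hV hx, locLieJ, locLieJ,
            ← (hX _ ((chartAt (Cn n) a).map_source hx)).fderiv_eq]
          rfl)
        (fun y hy => by
          rw [locLieJ, (hX0 y fun h' => hy (hHt h')).fderiv_eq]
          simp)
    have hvar := hloc.integral_variation hH hHc hHt fun y hy => hW y (hHt hy)
    have e1 : ∀ y, rho (inChart η a y) * ζ y (locHam (inChart η a) H y) = 1 / 2 *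
        (rho (inChart η a y) * (fderiv ℝ (fun z => Real.log (rho (inChart η a z))) y
          (locLieJ W y (locHam (inChart η a) H y)) -
        fderiv ℝ (fun z => trc (fderiv ℝ W z)) y (J n (locHam (inChart η a) H y)))) := fun y => by
      simp only [ζ, smul_apply, sub_apply, ContinuousLinearMap.comp_apply, smul_eq_mul]
      ring
    -- `trc_comm_J` turns `tr(J L_X J L_W J)` into `-2 tr(L_W J · DX)`, the quantity left by the
    -- second integration by parts. The factors `½` and `¼` match through this `-2`.
    have e2 : ∀ y, rho (inChart η a y) * (1 / 4 * trc ((J n).comp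
        ((locLieJ (locHam (inChart η a) H) y).comp (locLieJ W y)))) = -(1 / 2) *
        (rho (inChart η a y) *
          trc ((locLieJ W y).comp (fderiv ℝ (locHam (inChart η a) H) y))) := fun y => by
      rw [locLieJ, trc_comm_J (A := locLieJ W y) (antiJ_comm _)]
      ring
    rw [hleft, hright, hloc.integral_mul_trR_extd hH hHc hHt fun y hy => hζ y (hHt hy)]
    simp only [e1, e2]
    rw [integral_const_mul, integral_const_mul, hvar]
    ring
  · have e3 : ∀ x, 1 / 4 * lieTrace (hamField η (h + k)) (velocity F p u) x =
        1 / 4 * lieTrace (hamField η h) (velocity F p u) x +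
        1 / 4 * lieTrace (hamField η k) (velocity F p u) x := fun x => by
      have e4 : hamField η (h + k) = hamField η h + hamField η k :=
        funext fun x => hamField_add hη.isPos hh hk' x
      rw [e4, lieTrace, lieJ_add (hη.isSmoothField_hamField hh) (hη.isSmoothField_hamField hk'),
        ContinuousLinearMap.add_comp, ContinuousLinearMap.comp_add, map_add, mul_add]
      rfl
    simp only [e3, Pi.add_apply, mul_add]
    rw [hη.integral_add
      (f := fun x => fderiv ℝ (fun r => scal (pushforward (F r) η) (F r x)) p u * h x)
      (g := fun x => fderiv ℝ (fun r => scal (pushforward (F r) η) (F r x)) p u * k x)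
      (hk.mul hh.continuous) (hk.mul hk'.continuous),
      hη.integral_add (hg hh) (hg hk'), e1, e2]
  · have e3 : ∀ x, lieJ (hamField η (0 : M → ℝ)) x = 0 := fun x =>
      lieJ_eq_zero (Filter.Eventually.of_forall fun x => hamField_const hη.isPos 0 x)
    simp [lieTrace, e3]

/-- The moment map property, at the identity. -/
theorem IsSmoothFamily.hasDerivAt_integral_one {F : ℝ → Diff n M} (hF : IsSmoothFamily F)
    (hη : IsKahlerForm η) (hFη : ∀ s, IsKahlerForm (pushforward (F s) η)) {χ : Tensor2 n M}
    (hχ : IsKahlerForm χ) (t c : ℝ) {s : ℝ} (h1 : F s = 1) {h : M → ℝ}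
    (hh : ContMDiff 𝓘(ℝ, Cn n) 𝓘(ℝ, ℝ) ∞ h) :
    HasDerivAt (fun r => ∫ x, ((1 - t) * tr (pushforward (F r) η) χ (F r x) -
      t * scal (pushforward (F r) η) (F r x) - c) * h x ∂(vol η))
      (∫ x, formDensity χ t (-hamField η h) (velocity F s 1) x ∂(vol η)) s := by
  have hfin := hη.isFiniteMeasure
  have hV := hF.isSmoothField_velocity s 1
  have hX := hη.isSmoothField_hamField hh
  have hs : ∀ a : M, ContDiffAt ℝ ∞ (funInChart h a) (chartAt (Cn n) a a) := fun a =>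
    contDiffAt_funInChart hh ((chartAt (Cn n) a).map_source (mem_chart_source _ a))
  have hT := hF.smoothParam_tr hη hFη hχ
  have hR := hF.smoothParam_scal hη hFη
  have key : ∀ {K : ℝ → M → ℝ}, SmoothParam n K → HasDerivAt (fun r => ∫ x, K r x * h x ∂(vol η))
      (∫ x, fderiv ℝ (fun r => K r x) s 1 * h x ∂(vol η)) s := fun {K} hK => by
    have e1 := ((hK.mul_const hs).hasFDerivAt_integral (μ := vol η) s).differentiableAt.hasFDerivAt
    have e2 := e1.hasDerivAt
    rw [(hK.mul_const hs).fderiv_integral_apply] at e2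
    convert e2 using 3 with x
    simp [mul_comm]
  have d1 := key hT
  have d2 := key hR
  rw [hF.integral_fderiv_tr_mul hη hFη hχ h1 1 hh] at d1
  rw [hF.integral_fderiv_scal_mul hη hFη h1 1 hh] at d2
  -- The constant contributes a term independent of the parameter, so its value plays no role in the
  -- derivative.
  have d3 := ((d1.const_mul (1 - t)).sub (d2.const_mul t)).sub_const (c * ∫ x, h x ∂(vol η))
  have hc := contMDiff_apply hχ hV hX
  have hl := contMDiff_lieTrace hX hV
  refine (d3.congr_of_eventuallyEq (Filter.Eventually.of_forall fun r => ?_)).congr_deriv ?_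
  · have c1 : Continuous fun x => tr (pushforward (F r) η) χ (F r x) := hT.continuous r
    have c2 : Continuous fun x => scal (pushforward (F r) η) (F r x) := hR.continuous r
    have i1 : Integrable (fun x => (1 - t) * (tr (pushforward (F r) η) χ (F r x) * h x)) (vol η) :=
      hη.integrable (continuous_const.mul (c1.mul hh.continuous))
    have i2 : Integrable (fun x => t * (scal (pushforward (F r) η) (F r x) * h x)) (vol η) :=
      hη.integrable (continuous_const.mul (c2.mul hh.continuous))
    have i3 : Integrable (fun x => c * h x) (vol η) :=
      hη.integrable (continuous_const.mul hh.continuous)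
    have i12 : Integrable (fun x => (1 - t) * (tr (pushforward (F r) η) χ (F r x) * h x) -
      t * (scal (pushforward (F r) η) (F r x) * h x)) (vol η) := i1.sub i2
    simp only [Pi.sub_apply]
    rw [← integral_const_mul, ← integral_const_mul, ← integral_const_mul, ← integral_sub i1 i2,
      ← integral_sub i12 i3]
    congr 1
    ext x
    ring
  · have i1 : Integrable (fun x => (1 - t) * χ x (velocity F s 1 x) (hamField η h x)) (vol η) :=
      hη.integrable (continuous_const.mul hc.continuous)
    have i2 : Integrable (fun x => t * (1 / 4 * lieTrace (hamField η h) (velocity F s 1) x))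
      (vol η) := hη.integrable (continuous_const.mul (continuous_const.mul hl.continuous))
    rw [← integral_const_mul, ← integral_const_mul, ← integral_sub i1 i2]
    congr 1
    ext x
    have e1 := (hχ.isPos x).toIsHerm.antisymm (hamField η h x) (velocity F s 1 x)
    have e2 : lieTrace (-hamField η h) (velocity F s 1) x =
        -lieTrace (hamField η h) (velocity F s 1) x := by
      simp [lieTrace, lieJ_neg]
    rw [formDensity, e2, Pi.neg_apply, map_neg, neg_apply, e1]
    ring

theorem IsSmoothFamily.mul_right (hF : IsSmoothFamily F) (g : Diff n M) :
    IsSmoothFamily fun p => F p * g :=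
  ContMDiff.comp (g := fun q : P × M => F q.1 q.2) (f := fun q : P × M => (q.1, g q.2)) hF
    (contMDiff_fst.prodMk (g.contMDiff.comp contMDiff_snd))

/-- The identity case holds for every Kähler form, so it is applied to `(F_s)_* η`, the family `F_r
F_s⁻¹` and the function `h ∘ F_s⁻¹`. This family is the identity at `r = s`, has the same velocity,
and pushes `(F_s)_* η` to `(F_r)_* η`. -/
theorem IsSmoothFamily.hasDerivAt_integral {F : ℝ → Diff n M} (hF : IsSmoothFamily F)
    (hη : IsKahlerForm η) (hFη : ∀ s, IsKahlerForm (pushforward (F s) η)) {χ : Tensor2 n M}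
    (hχ : IsKahlerForm χ) (t c : ℝ) (s : ℝ) {h : M → ℝ}
    (hh : ContMDiff 𝓘(ℝ, Cn n) 𝓘(ℝ, ℝ) ∞ h) :
    HasDerivAt (fun r => ∫ x, onSymplectic η
        (fun α x => (1 - t) * tr α χ x - t * scal α x - c) (F r) x * h x ∂(vol η))
      (twistedForm η χ t (F s) (infAction η h (F s)) (velocity F s 1)) s := by
  have hα := hFη s
  have hl : ContMDiff 𝓘(ℝ, Cn n) 𝓘(ℝ, ℝ) ∞ (h ∘ (F s).symm) := hh.comp (F s).symm.contMDiff
  have hpush : ∀ r, pushforward (F r * (F s)⁻¹) (pushforward (F s) η) = pushforward (F r) η :=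
    fun r => by rw [← pushforward_mul, inv_mul_cancel_right]
  have hd := (hF.mul_right (F s)⁻¹).hasDerivAt_integral_one hα
    (fun r => by rw [hpush]; exact hFη r) hχ t c (s := s) (mul_inv_cancel _) hl
  rw [velocity_mul_right] at hd
  rw [twistedForm_eq hχ t hα (isTangent_infAction hη hα hh).1 (hF.isSmoothField_velocity s 1),
    infAction_eq hη hα hh]
  refine hd.congr_of_eventuallyEq (Filter.Eventually.of_forall fun r => ?_)
  simp only
  rw [integral_vol_pushforward hη.isPos hα.isPos]
  congr 1
  ext x
  have e1 : (F r * (F s)⁻¹) (F s x) = F r x := by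
    rw [mul_apply, inv_apply, Diffeomorph.symm_apply_apply]
  simp only [hpush, e1, Function.comp_apply, Diffeomorph.symm_apply_apply, onSymplectic]

theorem isMomentMap_twistedForm [Nonempty M] (hη : IsKahlerForm η) {χ : Tensor2 n M}
    (hχ : IsKahlerForm χ) (t : ℝ) :
    IsMomentMap η (twistedForm η χ t)
      (fun α x => (1 - t) * tr α χ x - t * scal α x - constC η χ t) where
  stable g hg f hf := mul_inv_mem_kahlerSpace hη hg hf
  velocity_tangent k F hF hFη p u := hF.isTangent (fun p => hη.pushforward (hFη p)) p u
  infinitesimal f hf h hh := by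
    refine ⟨fun x => hamField_spec (hη.isPos x) h, isTangent_infAction hη (hη.pushforward hf) hh,
      fun G hG hGm h0 hv => ?_⟩
    ext1 x
    rw [velocity_mul_inv hG h0 f x, hv]
    rfl
  form := isInvariantClosedForm_twistedForm hη hχ t
  smooth f hf := by
    have hα := hη.pushforward hf
    have h1 : ContMDiff 𝓘(ℝ, Cn n) 𝓘(ℝ, ℝ) ∞ (fun x => (1 - t) * tr (pushforward f η) χ x -
        t * scal (pushforward f η) x - constC η χ t) :=
      ((contMDiff_const.mul (hα.contMDiff_tr (fun x => (hχ.isPos x).toIsHerm) hχ.smooth)).sub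
        (contMDiff_const.mul hα.contMDiff_scal)).sub contMDiff_const
    exact h1.comp f.contMDiff
  mean_zero f hf := integral_onSymplectic hη hχ t hf
  equivariant g hg f hf x := by
    simp only [onSymplectic]
    rw [pushforward_mul_inv hη hg]
    rfl
  moment h hh F hF hFη s :=
    hF.hasDerivAt_integral hη (fun s => hη.pushforward (hFη s)) hχ t _ s hh

end MomentMap

end TwistedKahler

end

/-! ### The theorem -/

open TwistedKahler in
theorem proposition1p5 {n : ℕ} {M : Type*} [TopologicalSpace M] [T2Space M] [CompactSpace M]
    [ConnectedSpace M] [ChartedSpace (Cn n) M] [IsManifold 𝓘(ℂ, Cn n) ∞ M]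
    [MeasurableSpace M] [BorelSpace M]
    (ω₀ χ : Tensor2 n M) (hω₀ : IsKahlerForm ω₀) (hχ : IsKahlerForm χ)
    (t : ℝ) (ht : t ∈ Set.Icc (0 : ℝ) 1) :
    IsMomentMap ω₀ (twistedForm ω₀ χ t)
      (fun α x => (1 - t) * tr α χ x - t * scal α x - constC ω₀ χ t) ∧
    ∀ f ∈ kahlerSpace ω₀, ∀ V : Field n M, IsTangent ω₀ f V →
      IsTangent ω₀ f (mulI V) ∧
      0 ≤ twistedForm ω₀ χ t f V (mulI V) ∧
      (twistedForm ω₀ χ t f V (mulI V) = 0 ↔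
        (t < 1 → V = 0) ∧ (t = 1 → ∀ x, lieJ V x = 0)) := by
  exact ⟨isMomentMap_twistedForm hω₀ hχ t, fun f hf V hV => twistedForm_mulI hω₀ hχ ht hf hV⟩
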